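/- Let $p$ be an odd prime and let $\mathcal G$ be a one-dimensional pro-$p$ group, i.e. a pro-$p$ group with a continuous surjection $\mathcal G\to\Gamma\cong\mathbb Z_p$ with finite kernel $H$. Let $S$ be the set of subquotients $U=W/C$ with $W\le\mathcal G$ open and $C\trianglelefteq W$, $C\subseteq H$, and let $S^{\rm ab}$ be the set of abelian $U\in S$. An inclusion $V\subseteq U$ in $S$ means $V=W'/C$, $U=W/C$ with $W'\le W$; a surjection $U\twoheadrightarrow V$ in $S$ means $U=W/C$, $V=W/C'$ with $C\le C'$. Let $B(U)$ be the $p$-adic completion of $\Lambda(U)_{(p)}$, the localisation of the Iwasawa algebra $\Lambda(U)=\mathbb Z_p[[U]]$ inverting $\Lambda(Z)\setminus p\Lambda(Z)$ for all central subgroups $Z\cong\mathbb Z_p$ of $U$. Put $TB(U)=B(U)/[B(U),B(U)]$ (additive commutators). Let $R(U)$ be the group of virtual $\overline{\mathbb Q}_p$-characters of $U$ with open kernel. For $u\in U$ let $\bar u$ denote its image in $\Gamma$. For a one-dimensional character $\varphi$ (with open kernel), $\mathrm{Det}(\cdot)(\varphi)$ is the ring homomorphism $B(U)\to B_{\overline{\mathbb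 Z}_p}(\Gamma)=\overline{\mathbb Z}_p\otimes_{\mathbb Z_p} B(\Gamma)$ induced by $u\mapsto\varphi(u)\bar u$. For $\chi\in R(U)$, $\mathrm{Tr}(\cdot)(\chi):TB(U)[\frac1p]\to \overline{\mathbb Q}_p\otimes_{\mathbb Z_p} B(\Gamma)$ is induced by $u\mapsto\chi(u)\bar u$. Let $\widetilde\Phi_B$ be the set of tuples $(\lambda_U)\in\prod_{U\in S^{\rm ab}}B(U)^\times$ such that: (RW1) $\mathrm{pr}^U_V\lambda_U=\lambda_V$ for all surjections $U\twoheadrightarrow V$ and $N^U_V\lambda_U=\lambda_V$ for all inclusions $V\subseteq U$ in $S^{\rm ab}$, where $\mathrm{pr}^U_V:B(U)\to B(V)$ is induced by the projection and $N^U_V$ is the norm of the free $B(V)$-algebra $B(U)$; (RW2) for all $U\in S$ the tuple $(\lambda_{V^{\rm ab}})_{V\subseteq U}$ is invariant under conjugation by $U$; (RW3) for all $U\in S$ and all abelian normal open subgroups $A\trianglelefteq U$, $\sum_{A\subseteq V\subseteq U}\mu_{U/A}(V/A)\,\mathrm{ver}^V_A(\lambda_{V^{\rm ab}})\in\sigma^U_A(B(A))$,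 where $\mu_{U/A}$ is the Möbius function of the subgroup lattice of $U/A$, $\mathrm{ver}^V_A$ is induced by the transfer $V^{\rm ab}\to A$ and $\sigma^U_A(b)=\sum_{u\in U/A}ubu^{-1}$; (RW4) for all $U\in S$, $\Xi_U(\rho)=\prod_V\mathrm{Det}(\lambda_{V^{\rm ab}})(\chi_V)^{n_V}$ whenever $\rho=\sum_V n_V\,\mathrm{Ind}_V^U\chi_V$ in $R(U)$ is a finite sum with subgroups $V\subseteq U$, one-dimensional characters $\chi_V$ of $V$ and $n_V\in\mathbb Z$. Here $\Xi_U:R(U)\to B_{\overline{\mathbb Z}_p}(\Gamma)^\times$ is defined by explicit (Boltje) Brauer induction: if $\rho\in R(U)$ is inflated from a finite quotient $U/N$ and $a_{U/N}(\rho)=\sum\alpha_{(V,\varphi)}(V,\varphi)$ is its canonical induction formula, the sum being over conjugacy classes of pairs of a subgroup $V\le U/N$ and a one-dimensional character $\varphi$ of $V$, then $\Xi_U(\rho)=\prod\mathrm{Det}(\lambda_{\tilde V^{\rm ab}})(\tilde\varphi)^{\alpha_{(V,\varphi)}}$, where $\tilde V\subseteq U$ is the preimage of $V$ and $\tilde\varphi$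 the inflation of $\varphi$. Let $\Psi$ be the coefficient-linear endomorphism of $\overline{\mathbb Z}_p\otimes B(\Gamma)$ (and of $\overline{\mathbb Q}_p\otimes B(\Gamma)$) with $\gamma\mapsto\gamma^p$, let $(\psi_p\chi)(u)=\chi(u^p)$ and $\mathbf L_U(f)(\chi)=\frac1p\log\frac{f(\chi)^p}{\Psi f(\psi_p\chi)}$. Put $t_U=\mathrm{Tr}^{-1}(\mathbf L_U(\Xi_U))\in TB(U)[\frac1p]$. For $V\subseteq U$ the modified trace is $\widetilde{\mathrm{Tr}}{}^U_V=\mathrm{Tr}_V^{-1}\circ\mathrm{Res}\circ\mathrm{Tr}_U$, where $(\mathrm{Res} f)(\chi)=f(\mathrm{Ind}\chi)+\sum_{r\ge1}p^{-r}\Psi^r f(\psi_p^{r-1}\chi'')$ and $\chi''=\psi_p(\mathrm{Ind}\chi)-\mathrm{Ind}(\psi_p\chi)$. Then for every $(\lambda_U)\in\widetilde\Phi_B$: 1. for every surjection $U\twoheadrightarrow V$ in $S$, $\mathrm{pr}^U_V(\Xi_U)=\Xi_V$, i.e. $\Xi_U(\mathrm{infl}\,\rho)=\Xi_V(\rho)$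 for all $\rho\in R(V)$; 2. for every inclusion $V\subseteq U$ in $S$, $N^U_V(\Xi_U)=\Xi_V$, i.e. $\Xi_U(\mathrm{Ind}_V^U\rho)=\Xi_V(\rho)$ for all $\rho\in R(V)$; 3. for every $U\in S$ the element $t_U$ is well defined: it is the unique $t\in TB(U)[\frac1p]$ with $\mathrm{Tr}(t)(\rho)=\mathbf L_U(\Xi_U)(\rho)$ for all $\rho\in R(U)$; 4. for every surjection $U\twoheadrightarrow V$ in $S$, $\mathrm{pr}^U_V(t_U)=t_V$; 5. for every inclusion $V\subseteq U$ in $S$, $\widetilde{\mathrm{Tr}}{}^U_V(t_U)=t_V$ (and $\widetilde{\mathrm{Tr}}{}^U_V(t_U)$ is well defined: its trace is $\mathrm{Res}(\mathrm{Tr}_U(t_U))$ on $R(V)$). -/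

import Mathlib

open scoped TensorProduct

noncomputable section
namespace RW

/-- The group `Γ ≅ ℤ_p`, written multiplicatively. -/
abbrev Gam (p : ℕ) [Fact p.Prime] : Type := Multiplicative ℤ_[p]

section Iwasawa

variable (p : ℕ) [Fact p.Prime]

/-- The homomorphism `U/N → V/M` induced by `f : U → V` with `f(N) ⊆ M`. -/
def quotMap {U V : Type*} [Group U] [TopologicalSpace U] [Group V] [TopologicalSpace V]
    (f : U →* V) (N : OpenNormalSubgroup U) (M : OpenNormalSubgroup V)
    (h : ∀ u ∈ N.toSubgroup, f u ∈ M.toSubgroup) : U ⧸ N.toSubgroup →* V ⧸ M.toSubgroup :=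
  QuotientGroup.map N.toSubgroup M.toSubgroup f h

theorem quotMap_mk {U V : Type*} [Group U] [TopologicalSpace U] [Group V] [TopologicalSpace V]
    (f : U →* V) (N : OpenNormalSubgroup U) (M : OpenNormalSubgroup V)
    (h : ∀ u ∈ N.toSubgroup, f u ∈ M.toSubgroup) (u : U) :
    quotMap f N M h (QuotientGroup.mk u) = QuotientGroup.mk (f u) := rfl

theorem quotMap_comp {U V W : Type*} [Group U] [TopologicalSpace U] [Group V] [TopologicalSpace V]
    [Group W] [TopologicalSpace W] (f : U →* V) (g : V →* W) (N : OpenNormalSubgroup U)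
    (M : OpenNormalSubgroup V) (K : OpenNormalSubgroup W) (h : ∀ u ∈ N.toSubgroup, f u ∈ M.toSubgroup)
    (h' : ∀ u ∈ M.toSubgroup, g u ∈ K.toSubgroup) :
    (quotMap g M K h').comp (quotMap f N M h) =
      quotMap (g.comp f) N K (fun u hu => h' _ (h u hu)) :=
  MonoidHom.ext fun u => QuotientGroup.induction_on u fun _ => rfl

/-- The Iwasawa algebra `Λ(U) = lim ℤ_p[U/N]`, the limit being over the open normal subgroups
`N` of `U`. -/
def Lam (U : Type*) [Group U] [TopologicalSpace U] :
    Subring (∀ N : OpenNormalSubgroup U, MonoidAlgebra ℤ_[p] (U ⧸ N.toSubgroup)) where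
  carrier := {x | ∀ (N M : OpenNormalSubgroup U) (h : ∀ u ∈ N.toSubgroup, u ∈ M.toSubgroup),
    MonoidAlgebra.mapDomainRingHom ℤ_[p] (quotMap (MonoidHom.id U) N M h) (x N) = x M}
  mul_mem' hx hy N M h := by
    rw [Pi.mul_apply, map_mul, hx N M h, hy N M h, Pi.mul_apply]
  one_mem' N M h := by rw [Pi.one_apply, map_one, Pi.one_apply]
  add_mem' hx hy N M h := by
    rw [Pi.add_apply, map_add, hx N M h, hy N M h, Pi.add_apply]
  zero_mem' N M h := by rw [Pi.zero_apply, map_zero, Pi.zero_apply]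
  neg_mem' hx N M h := by rw [Pi.neg_apply, map_neg, hx N M h, Pi.neg_apply]

variable {p}
variable {U V W : Type*} [Group U] [TopologicalSpace U] [Group V] [TopologicalSpace V]
  [Group W] [TopologicalSpace W]

/-- The preimage of an open normal subgroup. -/
def comapON (f : U →* V) (hf : Continuous f) (M : OpenNormalSubgroup V) : OpenNormalSubgroup U where
  toOpenSubgroup := OpenSubgroup.comap f hf M.toOpenSubgroup
  isNormal' := Subgroup.Normal.comap M.isNormal' f

theorem mem_comapON (f : U →* V) (hf : Continuous f) (M : OpenNormalSubgroup V) (u : U) :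
    u ∈ (comapON f hf M).toSubgroup ↔ f u ∈ M.toSubgroup := Iff.rfl

variable (p) in
/-- The homomorphism `Λ(U) → Λ(V)` induced by `f : U → V`. -/
def Lam.map (f : U →* V) (hf : Continuous f) : Lam p U →+* Lam p V where
  toFun x := ⟨fun M => MonoidAlgebra.mapDomainRingHom ℤ_[p]
      (quotMap f (comapON f hf M) M fun u => (mem_comapON f hf M u).1) (x.1 (comapON f hf M)), by
    intro N M h
    have e := x.2 (comapON f hf N) (comapON f hf M)
      (fun u hu => (mem_comapON f hf M u).2 (h _ ((mem_comapON f hf N u).1 hu)))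
    beta_reduce
    rw [← e, ← RingHom.comp_apply, ← RingHom.comp_apply, ← MonoidAlgebra.mapDomainRingHom_comp,
      ← MonoidAlgebra.mapDomainRingHom_comp, quotMap_comp, quotMap_comp]
    rfl⟩
  map_one' := by ext1; funext M; exact map_one _
  map_mul' x y := by ext1; funext M; exact map_mul _ _ _
  map_zero' := by ext1; funext M; exact map_zero _
  map_add' x y := by ext1; funext M; exact map_add _ _ _

theorem Lam.map_comp (f : U →* V) (hf : Continuous f) (g : V →* W) (hg : Continuous g)
    (x : Lam p U) :
    Lam.map p g hg (Lam.map p f hf x) = Lam.map p (g.comp f) (hg.comp hf) x := by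
  ext1; funext M
  change MonoidAlgebra.mapDomainRingHom ℤ_[p] _ (MonoidAlgebra.mapDomainRingHom ℤ_[p] _ _) = _
  rw [← RingHom.comp_apply, ← MonoidAlgebra.mapDomainRingHom_comp, quotMap_comp]
  rfl

theorem mapDomain_comm {G H : Type*} [Group G] [Group H] (f : G →* H)
    (hf : ∀ g h, f g * h = h * f g) (x : MonoidAlgebra ℤ_[p] G) (y : MonoidAlgebra ℤ_[p] H) :
    MonoidAlgebra.mapDomainRingHom ℤ_[p] f x * y = y * MonoidAlgebra.mapDomainRingHom ℤ_[p] f x := by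
  induction x using MonoidAlgebra.induction_linear with
  | zero => simp
  | add a b ha hb => rw [map_add, add_mul, mul_add, ha, hb]
  | single g r =>
    induction y using MonoidAlgebra.induction_linear with
    | zero => simp
    | add a b ha hb => rw [mul_add, add_mul, ha, hb]
    | single h s => simp [MonoidAlgebra.single_mul_single, hf, mul_comm]

theorem Lam.map_comm (f : U →* V) (hf : Continuous f) (hc : ∀ u v, f u * v = v * f u)
    (x : Lam p U) (y : Lam p V) : Lam.map p f hf x * y = y * Lam.map p f hf x := by
  ext1; funext M
  refine mapDomain_comm _ ?_ _ _
  intro g h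
  induction g using QuotientGroup.induction_on with | H g => ?_
  induction h using QuotientGroup.induction_on with | H h => ?_
  exact congrArg (QuotientGroup.mk' M.toSubgroup) (hc g h)

variable (p U) in
/-- The elements of `Λ(Z) ∖ pΛ(Z)`, for the central subgroups `Z ≅ ℤ_p` of `U`. -/
def canonSet : Set (Lam p U) :=
  {x | ∃ (z : Gam p →* U) (hz : Continuous z) (s : Lam p (Gam p)),
    Function.Injective z ∧ (∀ g u, z g * u = u * z g) ∧ (¬ ∃ y, s = (p : Lam p (Gam p)) * y) ∧
      x = Lam.map p z hz s}

variable (p U) in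
/-- The multiplicative subset of central elements of `Λ(U)` generated by the sets
`Λ(Z) ∖ pΛ(Z)`, for central subgroups `Z ≅ ℤ_p` of `U`. -/
def canonS : Submonoid (Lam p U) := Submonoid.closure (canonSet p U)

theorem canonS_comm (s : Lam p U) (hs : s ∈ canonS p U) (y : Lam p U) : s * y = y * s := by
  induction hs using Submonoid.closure_induction with
  | mem x hx =>
    obtain ⟨z, hz, s, -, hc, -, rfl⟩ := hx
    exact Lam.map_comm z hz hc s y
  | one => rw [one_mul, mul_one]
  | mul a b _ _ ha hb => rw [mul_assoc, hb, ← mul_assoc, ha, mul_assoc]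

instance canonS_ore : OreLocalization.OreSet (canonS p U) where
  ore_right_cancel r₁ r₂ s h := ⟨s, by rw [canonS_comm _ s.2, canonS_comm _ s.2, h]⟩
  oreNum r _ := r
  oreDenom _ s := s
  ore_eq r s := canonS_comm _ s.2 r

variable (p U) in
/-- The localisation `Λ(U)_(p)`, in which all elements of `Λ(Z) ∖ pΛ(Z)`, for central subgroups
`Z ≅ ℤ_p` of `U`, are inverted. For one-dimensional pro-`p` groups this is the localisation of
`Λ(U)` at the canonical Ore set. -/
def LamS : Type _ := OreLocalization (canonS p U) (Lam p U)

instance : Ring (LamS p U) := inferInstanceAs (Ring (OreLocalization (canonS p U) (Lam p U)))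

variable (p U) in
/-- The canonical map `Λ(U) → Λ(U)_(p)`. -/
def LamS.of : Lam p U →+* LamS p U := OreLocalization.numeratorRingHom

theorem LamS.isUnit_of (s : Lam p U) (hs : s ∈ canonS p U) : IsUnit (LamS.of p U s) :=
  OreLocalization.numerator_isUnit (⟨s, hs⟩ : canonS p U)

/-- The universal property of `Λ(U)_(p)`. -/
def LamS.lift {T : Type*} [Ring T] (f : Lam p U →+* T) (hf : ∀ s ∈ canonSet p U, IsUnit (f s)) :
    LamS p U →+* T :=
  OreLocalization.universalHom f
    (IsUnit.liftRight ((f : Lam p U →* T).comp (canonS p U).subtype) (by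
      rintro ⟨s, hs⟩
      induction hs using Submonoid.closure_induction with
      | mem x hx => exact hf x hx
      | one => change IsUnit (f 1); rw [map_one]; exact isUnit_one
      | mul a b _ _ ha hb => change IsUnit (f (a * b)); rw [map_mul]; exact ha.mul hb))
    (fun _ => rfl)

theorem LamS.lift_of {T : Type*} [Ring T] (f : Lam p U →+* T) (hf : ∀ s ∈ canonSet p U, IsUnit (f s))
    (x : Lam p U) : LamS.lift f hf (LamS.of p U x) = f x :=
  OreLocalization.universalHom_commutes _ _ _

theorem LamS.hom_ext {T : Type*} [Ring T] {f g : LamS p U →+* T}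
    (h : ∀ x, f (LamS.of p U x) = g (LamS.of p U x)) : f = g := by
  have hf : ∀ s ∈ canonSet p U, IsUnit ((g.comp (LamS.of p U)) s) := fun s hs =>
    (LamS.isUnit_of s (Submonoid.subset_closure hs)).map g
  have e1 := OreLocalization.universalHom_unique (g.comp (LamS.of p U))
    (IsUnit.liftRight (((g.comp (LamS.of p U) : Lam p U →+* T) : Lam p U →* T).comp
      (canonS p U).subtype) (fun s => (LamS.isUnit_of s.1 s.2).map g)) (fun _ => rfl)
  exact (e1 f h).trans (e1 g fun _ => rfl).symm


section Completion

variable (p) (A A' : Type*) [Ring A] [Ring A']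

/-- The ideal `pⁿA`. -/
def pId (n : ℕ) : Ideal A := Ideal.span {(p : A) ^ n}

variable {A} in
theorem mem_pId {n : ℕ} {x : A} : x ∈ pId p A n ↔ ∃ y, y * (p : A) ^ n = x :=
  Ideal.mem_span_singleton'

instance pId_twoSided (n : ℕ) : (pId p A n).IsTwoSided where
  mul_mem_of_left {a} b ha := by
    obtain ⟨y, rfl⟩ := (mem_pId p).1 ha
    exact (mem_pId p).2 ⟨y * b, by rw [mul_assoc, mul_assoc, ← Nat.cast_pow, Nat.cast_comm]⟩

variable {A} in
theorem pId_le {m n : ℕ} (h : m ≤ n) : pId p A n ≤ pId p A m := fun x hx => by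
  obtain ⟨y, rfl⟩ := (mem_pId p).1 hx
  exact (mem_pId p).2 ⟨y * (p : A) ^ (n - m), by rw [mul_assoc, ← pow_add, Nat.sub_add_cancel h]⟩

/-- The `p`-adic completion `lim_n A / pⁿA`. -/
def PComp : Subring (∀ n : ℕ, A ⧸ pId p A n) where
  carrier := {x | ∀ (m n : ℕ) (h : m ≤ n), Ideal.Quotient.factor (pId_le p h) (x n) = x m}
  mul_mem' hx hy m n h := by rw [Pi.mul_apply, map_mul, hx m n h, hy m n h, Pi.mul_apply]
  one_mem' m n h := by rw [Pi.one_apply, map_one, Pi.one_apply]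
  add_mem' hx hy m n h := by rw [Pi.add_apply, map_add, hx m n h, hy m n h, Pi.add_apply]
  zero_mem' m n h := by rw [Pi.zero_apply, map_zero, Pi.zero_apply]
  neg_mem' hx m n h := by rw [Pi.neg_apply, map_neg, hx m n h, Pi.neg_apply]

variable {A A'}

/-- The canonical map `A → lim_n A / pⁿA`. -/
def PComp.of : A →+* PComp p A where
  toFun x := ⟨fun n => Ideal.Quotient.mk (pId p A n) x, fun _ _ _ => rfl⟩
  map_one' := rfl
  map_mul' _ _ := rfl
  map_zero' := rfl
  map_add' _ _ := rfl

theorem map_pId (f : A →+* A') (n : ℕ) (x : A) (hx : x ∈ pId p A n) : f x ∈ pId p A' n := by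
  obtain ⟨y, rfl⟩ := (mem_pId p).1 hx
  exact (mem_pId p).2 ⟨f y, by rw [map_mul, map_pow, map_natCast]⟩

/-- The homomorphism `A / pⁿA → A' / pⁿA'` induced by a ring homomorphism. -/
def pQuotMap (f : A →+* A') (n : ℕ) : A ⧸ pId p A n →+* A' ⧸ pId p A' n :=
  Ideal.Quotient.lift (pId p A n) ((Ideal.Quotient.mk (pId p A' n)).comp f) fun x hx =>
    Ideal.Quotient.eq_zero_iff_mem.2 (map_pId p f n x hx)

/-- Functoriality of the `p`-adic completion. -/
def PComp.map (f : A →+* A') : PComp p A →+* PComp p A' where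
  toFun x := ⟨fun n => pQuotMap p f n (x.1 n), by
    intro m n h
    beta_reduce
    rw [← x.2 m n h]
    obtain ⟨y, hy⟩ := Ideal.Quotient.mk_surjective (x.1 n)
    rw [← hy]
    rfl⟩
  map_one' := by ext1; funext n; exact map_one _
  map_mul' x y := by ext1; funext n; exact map_mul _ _ _
  map_zero' := by ext1; funext n; exact map_zero _
  map_add' x y := by ext1; funext n; exact map_add _ _ _

end Completion

variable (p U) in
/-- The ring `B(U)`, the `p`-adic completion of `Λ(U)_(p)`. -/
def B : Type _ := PComp p (LamS p U)

instance : Ring (B p U) := inferInstanceAs (Ring (PComp p (LamS p U)))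

theorem Lam.mul_comm_of (hU : ∀ a b : U, a * b = b * a) (x y : Lam p U) : x * y = y * x := by
  ext1; funext M
  have h := mapDomain_comm (p := p) (MonoidHom.id (U ⧸ M.toSubgroup)) (fun g h => by
    induction g using QuotientGroup.induction_on with | H g => ?_
    induction h using QuotientGroup.induction_on with | H h => ?_
    exact congrArg (QuotientGroup.mk' M.toSubgroup) (hU g h)) (x.1 M) (y.1 M)
  rwa [MonoidAlgebra.mapDomainRingHom_id] at h

theorem LamS.mul_comm_of (hU : ∀ a b : U, a * b = b * a) (x y : LamS p U) : x * y = y * x := by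
  induction x using OreLocalization.ind with | _ a s
  induction y using OreLocalization.ind with | _ b t
  have e := OreLocalization.oreDiv_mul_char a b s t a t (canonS_comm _ t.2 a)
  have e' := OreLocalization.oreDiv_mul_char b a t s b s (canonS_comm _ s.2 b)
  refine e.trans (Eq.trans ?_ e'.symm)
  rw [Lam.mul_comm_of hU a b]
  congr 1
  exact Subtype.ext (canonS_comm _ t.2 _)

theorem B.mul_comm_of (hU : ∀ a b : U, a * b = b * a) (x y : B p U) : x * y = y * x := by
  refine Subtype.ext (funext fun n => ?_)
  change x.1 n * y.1 n = y.1 n * x.1 n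
  obtain ⟨a, ha⟩ := Ideal.Quotient.mk_surjective (x.1 n)
  obtain ⟨b, hb⟩ := Ideal.Quotient.mk_surjective (y.1 n)
  rw [← ha, ← hb, ← map_mul, ← map_mul, LamS.mul_comm_of hU]

/-- `B(U)` as a commutative ring, for abelian `U`. -/
abbrev B.commRing (hU : ∀ a b : U, a * b = b * a) : CommRing (B p U) :=
  { (inferInstance : Ring (B p U)) with mul_comm := B.mul_comm_of hU }

/-- The homomorphisms for which functoriality of `B(U)` is used: continuous, with finite kernel,
and mapping the centre to the centre. -/
structure Adm (p : ℕ) (f : U →* V) : Prop where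
  cont : Continuous f
  fin : Finite f.ker
  central : ∀ u, (∀ u', u * u' = u' * u) → ∀ v, f u * v = v * f u

theorem gam_torsionFree (g : Gam p) (n : ℕ) (hn : n ≠ 0) (h : g ^ n = 1) : g = 1 := by
  have h1 : n • Multiplicative.toAdd g = 0 := congrArg Multiplicative.toAdd h
  rw [nsmul_eq_mul, mul_eq_zero] at h1
  exact congrArg Multiplicative.ofAdd (h1.resolve_left (Nat.cast_ne_zero.2 hn))

theorem injective_comp (f : U →* V) (hf : Finite f.ker) (z : Gam p →* U)
    (hz : Function.Injective z) : Function.Injective (f.comp z) := by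
  rw [injective_iff_map_eq_one]
  intro g hg
  have hk : ∀ n : ℕ, z (g ^ n) ∈ f.ker := fun n => by
    rw [MonoidHom.mem_ker, map_pow, map_pow]
    exact (congrArg (· ^ n) hg).trans (one_pow n)
  obtain ⟨a, b, hab, h⟩ := Finite.exists_ne_map_eq_of_infinite
    (fun n : ℕ => (⟨z (g ^ n), hk n⟩ : f.ker))
  have h1 : g ^ a = g ^ b := hz (Subtype.ext_iff.1 h)
  wlog hlt : a < b generalizing a b
  · exact this b a hab.symm h.symm h1.symm (lt_of_le_of_ne (not_lt.1 hlt) hab.symm)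
  refine gam_torsionFree g (b - a) (by omega) ?_
  rw [pow_sub _ hlt.le, ← h1, mul_inv_cancel]

theorem Adm.map_canonSet {f : U →* V} (hf : Adm p f) (x : Lam p U) (hx : x ∈ canonSet p U) :
    Lam.map p f hf.cont x ∈ canonSet p V := by
  obtain ⟨z, hz, s, hi, hc, hs, rfl⟩ := hx
  exact ⟨f.comp z, hf.cont.comp hz, s, injective_comp f hf.fin z hi,
    fun g v => hf.central (z g) (hc g) v, hs, Lam.map_comp _ _ _ _ _⟩

/-- The homomorphism `Λ(U)_(p) → Λ(V)_(p)` induced by `f : U → V`. -/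
def LamS.map (f : U →* V) (hf : Adm p f) : LamS p U →+* LamS p V :=
  LamS.lift ((LamS.of p V).comp (Lam.map p f hf.cont)) fun s hs =>
    LamS.isUnit_of _ (Submonoid.subset_closure (hf.map_canonSet s hs))

/-- The homomorphism `B(U) → B(V)` induced by `f : U → V`. -/
def B.map (f : U →* V) (hf : Adm p f) : B p U →+* B p V := PComp.map p (LamS.map f hf)

section Twist

/-- Assembling compatible ring homomorphisms `f i : X → Q i [F]` into `X → R[F]`, where `R` is a
limit of the `Q i`. -/
def assemble {ι X R F : Type*} [Ring X] [Ring R] [Group F] {Q : ι → Type*} [∀ i, Ring (Q i)]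
    (e : ∀ i, R →+* Q i) (he : ∀ a b, (∀ i, e i a = e i b) → a = b)
    (f : ∀ i, X →+* MonoidAlgebra (Q i) F) (g : X → F →₀ R)
    (hg : ∀ x c i, e i (g x c) = (f i x).coeff c) : X →+* MonoidAlgebra R F :=
  have key : ∀ a b : MonoidAlgebra R F,
      (∀ i, MonoidAlgebra.mapRingHom F (e i) a = MonoidAlgebra.mapRingHom F (e i) b) → a = b := by
    intro a b h
    ext c
    refine he _ _ fun i => ?_
    rw [← MonoidAlgebra.coeff_mapRingHom, ← MonoidAlgebra.coeff_mapRingHom, h]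
  have hm : ∀ x i, MonoidAlgebra.mapRingHom F (e i) (MonoidAlgebra.ofCoeff (g x)) = f i x := by
    intro x i
    ext c
    rw [MonoidAlgebra.coeff_mapRingHom, ← hg]
  { toFun := fun x => MonoidAlgebra.ofCoeff (g x)
    map_one' := key _ _ fun i => by rw [hm, map_one, map_one]
    map_mul' := fun x y => key _ _ fun i => by rw [hm, map_mul, map_mul, hm, hm]
    map_zero' := key _ _ fun i => by rw [hm, map_zero, map_zero]
    map_add' := fun x y => key _ _ fun i => by rw [hm, map_add, map_add, hm, hm] }

theorem Lam.dvd_of (x : Lam p U) (h : ∀ N, ∃ y, x.1 N = (p : MonoidAlgebra ℤ_[p] (U ⧸ N.toSubgroup)) * y) :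
    ∃ y : Lam p U, x = (p : Lam p U) * y := by
  have hinj : ∀ (N : OpenNormalSubgroup U) (a b : MonoidAlgebra ℤ_[p] (U ⧸ N.toSubgroup)),
      (p : MonoidAlgebra ℤ_[p] (U ⧸ N.toSubgroup)) * a = (p : MonoidAlgebra ℤ_[p] (U ⧸ N.toSubgroup)) * b → a = b := by
    intro N a b hab
    rw [← nsmul_eq_mul, ← nsmul_eq_mul] at hab
    ext c
    have h1 := DFunLike.congr_fun (congrArg MonoidAlgebra.coeff hab) c
    rw [MonoidAlgebra.coeff_smul, MonoidAlgebra.coeff_smul, Finsupp.smul_apply, Finsupp.smul_apply,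
      nsmul_eq_mul, nsmul_eq_mul] at h1
    exact mul_left_cancel₀ (Nat.cast_ne_zero.2 (Fact.out : p.Prime).ne_zero) h1
  choose y hy using h
  refine ⟨⟨y, fun N M hNM => hinj M _ _ ?_⟩, ?_⟩
  · rw [← hy, ← x.2 N M hNM, hy N, map_mul, map_natCast]
  · ext1; funext N
    exact hy N

theorem frob_fin {G : Type*} [CommGroup G] (x : MonoidAlgebra ℤ_[p] G) :
    ∃ y, x ^ p - MonoidAlgebra.mapDomainRingHom ℤ_[p] (powMonoidHom p) x =
      (p : MonoidAlgebra ℤ_[p] G) * y := by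
  induction x using MonoidAlgebra.induction_linear with
  | zero => exact ⟨0, by simp [(Fact.out : p.Prime).ne_zero]⟩
  | add a b ha hb =>
    obtain ⟨y, hy⟩ := ha
    obtain ⟨y', hy'⟩ := hb
    obtain ⟨r, hr⟩ := exists_add_pow_prime_eq (Fact.out : p.Prime) a b
    exact ⟨y + y' + a * b * r, by rw [hr, map_add]; linear_combination hy + hy'⟩
  | single g r =>
    have h : r ^ p - r ∈ Ideal.span {(p : ℤ_[p])} := by
      rw [← PadicInt.maximalIdeal_eq_span_p, ← PadicInt.ker_toZMod, RingHom.mem_ker, map_sub,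
        map_pow, ZMod.pow_card, sub_self]
    obtain ⟨c, hc⟩ := Ideal.mem_span_singleton'.1 h
    refine ⟨MonoidAlgebra.single (g ^ p) c, ?_⟩
    rw [← nsmul_eq_mul]
    simp only [MonoidAlgebra.single_pow, MonoidAlgebra.mapDomainRingHom_apply,
      MonoidAlgebra.mapDomain_single, powMonoidHom_apply, ← MonoidAlgebra.single_sub,
      MonoidAlgebra.smul_single]
    rw [← hc, nsmul_eq_mul, mul_comm]


theorem continuous_powHom (n : ℕ) : Continuous (powMonoidHom n : Gam p →* Gam p) :=
  continuous_pow n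

theorem mem_inf {N N' : OpenNormalSubgroup U} {u : U} (h : u ∈ N.toSubgroup)
    (h' : u ∈ N'.toSubgroup) : u ∈ (N ⊓ N').toSubgroup := ⟨h, h'⟩

theorem mem_inf_left {N N' : OpenNormalSubgroup U} {u : U} (h : u ∈ (N ⊓ N').toSubgroup) :
    u ∈ N.toSubgroup := h.1

theorem mem_inf_right {N N' : OpenNormalSubgroup U} {u : U} (h : u ∈ (N ⊓ N').toSubgroup) :
    u ∈ N'.toSubgroup := h.2

theorem frob_Lam (s : Lam p (Gam p)) (k : ℕ) : ∃ y,
    s ^ p ^ k = Lam.map p (powMonoidHom (p ^ k)) (continuous_powHom _) s + (p : Lam p (Gam p)) * y := by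
  have hc := Lam.mul_comm_of (p := p) (U := Gam p) mul_comm
  letI : CommRing (Lam p (Gam p)) :=
    { (inferInstance : Ring (Lam p (Gam p))) with mul_comm := hc }
  have h1 : ∀ s : Lam p (Gam p), ∃ y,
      s ^ p = Lam.map p (powMonoidHom p) (continuous_powHom _) s + (p : Lam p (Gam p)) * y := by
    intro s
    obtain ⟨y, hy⟩ := Lam.dvd_of (s ^ p - Lam.map p (powMonoidHom p) (continuous_powHom _) s) (by
      intro N
      obtain ⟨y, hy⟩ := frob_fin (p := p) (s.1 N)
      refine ⟨y, hy ▸ ?_⟩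
      have e := s.2 N (comapON (powMonoidHom p) (continuous_powHom p) N)
        (fun u hu => (mem_comapON _ _ _ _).2 (pow_mem hu p))
      change (s.1 N) ^ p - MonoidAlgebra.mapDomainRingHom ℤ_[p] _ (s.1 _) = _
      rw [← e, ← RingHom.comp_apply, ← MonoidAlgebra.mapDomainRingHom_comp, quotMap_comp]
      rfl)
    exact ⟨y, by rw [← hy]; abel⟩
  induction k with
  | zero =>
    refine ⟨0, ?_⟩
    have e0 : s ^ p ^ 0 = s := by rw [pow_zero, pow_one]
    rw [mul_zero, add_zero, e0]
    ext1; funext N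
    have e := s.2 N (comapON (powMonoidHom (p ^ 0)) (continuous_powHom _) N)
        (fun u hu => (mem_comapON _ _ _ _).2 (pow_mem hu _))
    have e' := s.2 N N (fun _ hu => hu)
    refine e'.symm.trans ?_
    change _ = MonoidAlgebra.mapDomainRingHom ℤ_[p] _ (s.1 _)
    rw [← e, ← RingHom.comp_apply, ← MonoidAlgebra.mapDomainRingHom_comp, quotMap_comp]
    congr 2
    refine MonoidHom.ext fun u => QuotientGroup.induction_on u fun u => ?_
    have e1 : u ^ p ^ 0 = u := by rw [pow_zero, pow_one]
    exact congrArg (QuotientGroup.mk' N.toSubgroup) e1.symm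
  | succ k ih =>
    obtain ⟨y, hy⟩ := ih
    obtain ⟨y', hy'⟩ := h1 (Lam.map p (powMonoidHom (p ^ k)) (continuous_powHom _) s)
    obtain ⟨r, hr⟩ := sub_dvd_pow_sub_pow (Lam.map p (powMonoidHom (p ^ k)) (continuous_powHom _) s +
      (p : Lam p (Gam p)) * y) (Lam.map p (powMonoidHom (p ^ k)) (continuous_powHom _) s) p
    refine ⟨y' + y * r, ?_⟩
    have e : Lam.map p (powMonoidHom (p ^ (k + 1))) (continuous_powHom _) s =
        Lam.map p (powMonoidHom p) (continuous_powHom _)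
          (Lam.map p (powMonoidHom (p ^ k)) (continuous_powHom _) s) := by
      rw [Lam.map_comp]
      congr 2
      refine MonoidHom.ext fun g => ?_
      exact (congrArg (g ^ ·) (pow_succ p k)).trans (pow_mul g (p ^ k) p)
    rw [pow_succ p k, pow_mul, hy, ← pow_succ, e]
    rw [add_sub_cancel_left] at hr
    linear_combination hr + hy'

theorem exists_pow_mem (z : Gam p →* U) (hz : Continuous z) (N : OpenNormalSubgroup U) :
    ∃ k : ℕ, ∀ g, z (g ^ p ^ k) ∈ N.toSubgroup := by
  have ho : IsOpen ((comapON z hz N : OpenNormalSubgroup (Gam p)) : Set (Gam p)) :=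
    (comapON z hz N).isOpen'
  have ho' : IsOpen (Multiplicative.ofAdd ⁻¹' ((comapON z hz N : OpenNormalSubgroup (Gam p)) : Set (Gam p))
      : Set ℤ_[p]) := ho.preimage continuous_ofAdd
  obtain ⟨ε, hε, h⟩ := Metric.isOpen_iff.1 ho' 0 (one_mem (comapON z hz N).toSubgroup)
  obtain ⟨k, hk⟩ := PadicInt.exists_pow_neg_lt p hε
  refine ⟨k, fun g => ?_⟩
  have h2 : (p : ℤ_[p]) ^ k * Multiplicative.toAdd g ∈ Metric.ball (0 : ℤ_[p]) ε := by
    rw [mem_ball_zero_iff, norm_mul, PadicInt.norm_p_pow]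
    refine lt_of_le_of_lt (mul_le_of_le_one_right (by positivity) (PadicInt.norm_le_one _)) hk
  have h3 := h h2
  have h4 : g ^ p ^ k = Multiplicative.ofAdd ((p : ℤ_[p]) ^ k * Multiplicative.toAdd g) := by
    rw [← Nat.cast_pow, ← nsmul_eq_mul]
    rfl
  rw [h4]
  exact h3

/-- A group `U` with a continuous homomorphism to `Γ` that has finite kernel. -/
structure OneDim (p : ℕ) [Fact p.Prime] (U : Type*) [Group U] [TopologicalSpace U] where
  /-- the projection to `Γ` -/
  proj : U →* Gam p
  cont : Continuous proj
  fin : Finite proj.ker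

theorem OneDim.adm (D : OneDim p U) : Adm p D.proj := ⟨D.cont, D.fin, fun _ _ _ => mul_comm _ _⟩

variable (D : OneDim p U) (N : OpenNormalSubgroup U)

/-- The homomorphism `u ↦ ū · [uN]` at the finite level `M`. -/
def twistChar (M : OpenNormalSubgroup (Gam p)) :
    U ⧸ (N ⊓ comapON D.proj D.cont M).toSubgroup →*
      MonoidAlgebra (MonoidAlgebra ℤ_[p] (Gam p ⧸ M.toSubgroup)) (U ⧸ N.toSubgroup) where
  toFun u := MonoidAlgebra.single (quotMap (MonoidHom.id U) _ N (fun _ h => mem_inf_left h) u)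
    (MonoidAlgebra.single (quotMap D.proj _ M (fun u h => (mem_comapON D.proj D.cont M u).1 (mem_inf_right h)) u) 1)
  map_one' := by rw [map_one, map_one]; rfl
  map_mul' u v := by rw [map_mul, map_mul]; simp [MonoidAlgebra.single_mul_single]

theorem twistChar_mk (M : OpenNormalSubgroup (Gam p)) (g : U) :
    twistChar D N M (QuotientGroup.mk g) = MonoidAlgebra.single (QuotientGroup.mk g)
      (MonoidAlgebra.single (QuotientGroup.mk (D.proj g)) (1 : ℤ_[p])) := rfl

/-- The homomorphism `Λ(U) → ℤ_p[Γ/M][U/N]` with `u ↦ ū · [uN]`. -/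
def twistLevel (M : OpenNormalSubgroup (Gam p)) : Lam p U →+*
    MonoidAlgebra (MonoidAlgebra ℤ_[p] (Gam p ⧸ M.toSubgroup)) (U ⧸ N.toSubgroup) :=
  ((MonoidAlgebra.lift ℤ_[p] _ _ (twistChar D N M)).toRingHom).comp
    ((Pi.evalRingHom _ (N ⊓ comapON D.proj D.cont M)).comp (Lam p U).subtype)

theorem twistLevel_compat (M M' : OpenNormalSubgroup (Gam p))
    (h : ∀ u ∈ M.toSubgroup, u ∈ M'.toSubgroup) (x : Lam p U) :
    MonoidAlgebra.mapRingHom _ (MonoidAlgebra.mapDomainRingHom ℤ_[p]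
      (quotMap (MonoidHom.id _) M M' h)) (twistLevel D N M x) = twistLevel D N M' x := by
  have e := x.2 (N ⊓ comapON D.proj D.cont M) (N ⊓ comapON D.proj D.cont M')
    (fun u hu => mem_inf (mem_inf_left hu) ((mem_comapON D.proj D.cont M' u).2
      (h _ ((mem_comapON D.proj D.cont M u).1 (mem_inf_right hu)))))
  change _ = MonoidAlgebra.lift ℤ_[p] _ _ (twistChar D N M') (x.1 _)
  rw [← e]
  change MonoidAlgebra.mapRingHom _ _ (MonoidAlgebra.lift ℤ_[p] _ _ (twistChar D N M) (x.1 _)) = _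
  induction x.1 (N ⊓ comapON D.proj D.cont M) using MonoidAlgebra.induction_linear with
  | zero => simp only [map_zero]
  | add a b ha hb => simp only [map_add, ha, hb]
  | single g r =>
    induction g using QuotientGroup.induction_on with | H g => ?_
    rw [MonoidAlgebra.lift_single, MonoidAlgebra.mapDomainRingHom_apply,
      MonoidAlgebra.mapDomain_single, MonoidAlgebra.lift_single, quotMap_mk, twistChar_mk,
      twistChar_mk]
    ext c c'
    simp
    rw [quotMap_mk]
    rfl

/-- The homomorphism `Λ(U) → Λ(Γ)[U/N]` with `u ↦ ū · [uN]`. -/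
def Lam.twist [Finite (U ⧸ N.toSubgroup)] :
    Lam p U →+* MonoidAlgebra (Lam p (Gam p)) (U ⧸ N.toSubgroup) :=
  assemble (Q := fun M : OpenNormalSubgroup (Gam p) => MonoidAlgebra ℤ_[p] (Gam p ⧸ M.toSubgroup))
    (fun M => (Pi.evalRingHom _ M).comp (Lam p (Gam p)).subtype)
    (fun _ _ h => Subtype.ext (funext h))
    (twistLevel D N)
    (fun x => Finsupp.equivFunOnFinite.symm fun c => ⟨fun M => (twistLevel D N M x).coeff c, by
      intro M M' h
      beta_reduce
      rw [← twistLevel_compat D N M M' h x, MonoidAlgebra.coeff_mapRingHom]⟩)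
    (fun _ _ _ => rfl)

theorem Lam.twist_spec [Finite (U ⧸ N.toSubgroup)] (x : Lam p U) (c : U ⧸ N.toSubgroup)
    (M : OpenNormalSubgroup (Gam p)) :
    ((Lam.twist D N x).coeff c).1 M = (twistLevel D N M x).coeff c := rfl

theorem Lam.twist_map [Finite (U ⧸ N.toSubgroup)] (w : Gam p →* U) (hw : Continuous w)
    (h : ∀ g, w g ∈ N.toSubgroup) (s : Lam p (Gam p)) :
    Lam.twist D N (Lam.map p w hw s) =
      MonoidAlgebra.single 1 (Lam.map p (D.proj.comp w) (D.cont.comp hw) s) := by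
  refine MonoidAlgebra.ext (Finsupp.ext fun c => Subtype.ext (funext fun M => ?_))
  rw [Lam.twist_spec]
  have e := s.2 (comapON (D.proj.comp w) (D.cont.comp hw) M)
    (comapON w hw (N ⊓ comapON D.proj D.cont M)) (fun g hg => (mem_comapON w hw _ g).2 (mem_inf (h g)
      ((mem_comapON D.proj D.cont M _).2 ((mem_comapON (D.proj.comp w) (D.cont.comp hw) M g).1 hg))))
  have e2 : ((MonoidAlgebra.single (1 : U ⧸ N.toSubgroup)
      (Lam.map p (D.proj.comp w) (D.cont.comp hw) s)).coeff c).1 M =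
      (MonoidAlgebra.single (1 : U ⧸ N.toSubgroup)
        ((Lam.map p (D.proj.comp w) (D.cont.comp hw) s).1 M)).coeff c := by
    classical
    rw [MonoidAlgebra.coeff_single, MonoidAlgebra.coeff_single, Finsupp.single_apply,
      Finsupp.single_apply]
    split_ifs <;> rfl
  rw [e2]
  congr 2
  change MonoidAlgebra.lift ℤ_[p] _ _ (twistChar D N M)
    (MonoidAlgebra.mapDomainRingHom ℤ_[p] _ (s.1 _)) =
    MonoidAlgebra.single 1 (MonoidAlgebra.mapDomainRingHom ℤ_[p] _ (s.1 _))
  rw [← e]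
  induction s.1 (comapON (D.proj.comp w) (D.cont.comp hw) M) using
    MonoidAlgebra.induction_linear with
  | zero => simp only [map_zero, MonoidAlgebra.single_zero]
  | add a b ha hb => simp only [map_add, ha, hb, MonoidAlgebra.single_add]
  | single g r =>
    induction g using QuotientGroup.induction_on with | H g => ?_
    simp only [MonoidAlgebra.mapDomainRingHom_apply, MonoidAlgebra.mapDomain_single]
    rw [MonoidAlgebra.lift_single, quotMap_mk, quotMap_mk, quotMap_mk, twistChar_mk,
      MonoidHom.id_apply, (QuotientGroup.eq_one_iff (w g)).2 (h g)]
    simp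

end Twist

end Iwasawa

section Iwasawa

variable {p : ℕ} [Fact p.Prime]
variable {U V W : Type*} [Group U] [TopologicalSpace U] [Group V] [TopologicalSpace V]
  [Group W] [TopologicalSpace W]

section Twist
variable (D : OneDim p U) (N : OpenNormalSubgroup U)

/-- `Lam.twist` with coefficients in `Λ(Γ)_(p) / pⁿ`. -/
def twistAux [Finite (U ⧸ N.toSubgroup)] (n : ℕ) :
    Lam p U →+* MonoidAlgebra (LamS p (Gam p) ⧸ pId p (LamS p (Gam p)) n) (U ⧸ N.toSubgroup) :=
  (MonoidAlgebra.mapRingHom _ ((Ideal.Quotient.mk (pId p (LamS p (Gam p)) n)).comp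
    (LamS.of p (Gam p)))).comp (Lam.twist D N)

theorem twistAux_pow_eq_zero (n : ℕ) :
    (p : MonoidAlgebra (LamS p (Gam p) ⧸ pId p (LamS p (Gam p)) n) (U ⧸ N.toSubgroup)) ^ n = 0 := by
  have h : (p : LamS p (Gam p) ⧸ pId p (LamS p (Gam p)) n) ^ n = 0 := by
    rw [← map_natCast (Ideal.Quotient.mk (pId p (LamS p (Gam p)) n)), ← map_pow]
    exact Ideal.Quotient.eq_zero_iff_mem.2 ((mem_pId p).2 ⟨1, one_mul _⟩)
  rw [← map_natCast (MonoidAlgebra.singleOneRingHom :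
    (LamS p (Gam p) ⧸ pId p (LamS p (Gam p)) n) →+* MonoidAlgebra _ (U ⧸ N.toSubgroup)), ← map_pow,
    h, map_zero]

theorem twistAux_isUnit [Finite (U ⧸ N.toSubgroup)] (n : ℕ) (x : Lam p U)
    (hx : x ∈ canonSet p U) : IsUnit (twistAux D N n x) := by
  obtain ⟨z, hz, s, hi, hc, hs, rfl⟩ := hx
  obtain ⟨k, hk⟩ := exists_pow_mem z hz N
  obtain ⟨y, hy⟩ := frob_Lam s k
  rw [← isUnit_pow_iff (pow_ne_zero k (Fact.out : p.Prime).ne_zero), ← map_pow, ← map_pow, hy,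
    map_add, map_add, Lam.map_comp, map_mul, map_mul, map_natCast, map_natCast]
  have hcw : Continuous (z.comp (powMonoidHom (p ^ k))) := hz.comp (continuous_powHom _)
  have hu : IsUnit (twistAux D N n (Lam.map p (z.comp (powMonoidHom (p ^ k))) hcw s)) := by
    change IsUnit (MonoidAlgebra.mapRingHom _ _ (Lam.twist D N _))
    rw [Lam.twist_map D N _ _ hk]
    rw [MonoidAlgebra.mapRingHom_single]
    refine IsUnit.map (MonoidAlgebra.singleOneRingHom) (IsUnit.map (Ideal.Quotient.mk _) ?_)
    refine LamS.isUnit_of _ (Submonoid.subset_closure ⟨_, D.cont.comp hcw, s, ?_,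
      fun _ _ => mul_comm _ _, hs, rfl⟩)
    refine injective_comp D.proj D.fin _ (hi.comp ?_)
    refine (injective_iff_map_eq_one (powMonoidHom (p ^ k) : Gam p →* Gam p)).2 fun g hg => ?_
    exact gam_torsionFree g _ (pow_ne_zero k (Fact.out : p.Prime).ne_zero) hg
  have hcy : Commute (twistAux D N n (Lam.map p z hz y))
      (twistAux D N n (Lam.map p (z.comp (powMonoidHom (p ^ k))) hcw s)) :=
    Commute.map (Lam.map_comm z hz hc y _ : Commute (Lam.map p z hz y) _) _
  refine IsNilpotent.isUnit_add_left_of_commute ⟨n, ?_⟩ hu ((Nat.cast_commute _ _).mul_left hcy)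
  rw [(Nat.cast_commute _ _).mul_pow, twistAux_pow_eq_zero, zero_mul]

/-- Level `n` of `B.twist`. -/
def B.twistLevel [Finite (U ⧸ N.toSubgroup)] (n : ℕ) :
    (LamS p U ⧸ pId p (LamS p U) n) →+*
      MonoidAlgebra (LamS p (Gam p) ⧸ pId p (LamS p (Gam p)) n) (U ⧸ N.toSubgroup) :=
  Ideal.Quotient.lift _ (LamS.lift (twistAux D N n) (twistAux_isUnit D N n)) fun x hx => by
    obtain ⟨y, rfl⟩ := (mem_pId p).1 hx
    rw [map_mul, map_pow, map_natCast, twistAux_pow_eq_zero, mul_zero]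

theorem B.twistLevel_compat [Finite (U ⧸ N.toSubgroup)] (m n : ℕ) (h : m ≤ n)
    (x : LamS p U ⧸ pId p (LamS p U) n) :
    MonoidAlgebra.mapRingHom _ (Ideal.Quotient.factor (pId_le p h)) (B.twistLevel D N n x) =
      B.twistLevel D N m (Ideal.Quotient.factor (pId_le p h) x) := by
  obtain ⟨x, rfl⟩ := Ideal.Quotient.mk_surjective x
  change ((MonoidAlgebra.mapRingHom _ (Ideal.Quotient.factor (pId_le p h))).comp
    (LamS.lift (twistAux D N n) (twistAux_isUnit D N n))) x =
    LamS.lift (twistAux D N m) (twistAux_isUnit D N m) x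
  congr 1
  refine LamS.hom_ext fun x => ?_
  rw [RingHom.comp_apply, LamS.lift_of, LamS.lift_of]
  refine MonoidAlgebra.ext (Finsupp.ext fun c => ?_)
  change _ = (MonoidAlgebra.mapRingHom _ _ _).coeff c
  rw [MonoidAlgebra.coeff_mapRingHom, MonoidAlgebra.coeff_mapRingHom]
  change Ideal.Quotient.factor (pId_le p h) ((MonoidAlgebra.mapRingHom _ _ _).coeff c) = _
  rw [MonoidAlgebra.coeff_mapRingHom]
  rfl

/-- The ring homomorphism `B(U) → B(Γ)[U/N]` with `u ↦ ū · [uN]`, where `ū` is the image of `u`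
in `Γ`. -/
def B.twist [Finite (U ⧸ N.toSubgroup)] :
    B p U →+* MonoidAlgebra (B p (Gam p)) (U ⧸ N.toSubgroup) :=
  assemble (Q := fun n : ℕ => LamS p (Gam p) ⧸ pId p (LamS p (Gam p)) n)
    (fun n => (Pi.evalRingHom _ n).comp (PComp p (LamS p (Gam p))).subtype)
    (fun _ _ h => Subtype.ext (funext h))
    (fun n => (B.twistLevel D N n).comp
      ((Pi.evalRingHom _ n).comp (PComp p (LamS p U)).subtype))
    (fun x => Finsupp.equivFunOnFinite.symm fun c =>
      ⟨fun n => (B.twistLevel D N n (x.1 n)).coeff c, by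
        intro m n h
        beta_reduce
        rw [← x.2 m n h, ← B.twistLevel_compat D N m n h, MonoidAlgebra.coeff_mapRingHom]⟩)
    (fun _ _ _ => rfl)

end Twist
section Coefficients

/-- The embedding `ℤ_p → Λ(U)`. -/
def Lam.const : ℤ_[p] →+* Lam p U where
  toFun r := ⟨fun _ => MonoidAlgebra.singleOneRingHom r, fun N M h => by
    change MonoidAlgebra.mapDomainRingHom ℤ_[p] _ (MonoidAlgebra.single 1 r) =
      MonoidAlgebra.single 1 r
    rw [MonoidAlgebra.mapDomainRingHom_apply, MonoidAlgebra.mapDomain_single, map_one]⟩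
  map_one' := by ext1; funext N; exact map_one _
  map_mul' x y := by ext1; funext N; exact map_mul _ _ _
  map_zero' := by ext1; funext N; exact map_zero _
  map_add' x y := by ext1; funext N; exact map_add _ _ _

instance : CommRing (B p (Gam p)) := B.commRing mul_comm

instance : Algebra ℤ_[p] (B p (Gam p)) :=
  RingHom.toAlgebra ((PComp.of p).comp ((LamS.of p (Gam p)).comp Lam.const))

variable (p) in
theorem pow_adm : Adm p (powMonoidHom p : Gam p →* Gam p) where
  cont := continuous_powHom p
  fin := by
    have h : (powMonoidHom p : Gam p →* Gam p).ker = ⊥ := (MonoidHom.ker_eq_bot_iff _).2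
      ((injective_iff_map_eq_one _).2 fun g hg =>
        gam_torsionFree g p (Fact.out : p.Prime).ne_zero hg)
    rw [h]
    infer_instance
  central _ _ _ := mul_comm _ _

variable (p) in
/-- The endomorphism of `B(Γ)` with `γ ↦ γᵖ`. -/
def frobB : B p (Gam p) →ₐ[ℤ_[p]] B p (Gam p) :=
  { B.map (powMonoidHom p) (pow_adm p) with
    commutes' := fun r => by
      refine Subtype.ext (funext fun n => ?_)
      change Ideal.Quotient.mk _ (LamS.map _ (pow_adm p) (LamS.of p (Gam p) (Lam.const r))) =
        Ideal.Quotient.mk _ (LamS.of p (Gam p) (Lam.const r))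
      congr 1
      refine (LamS.lift_of _ _ _).trans ?_
      change LamS.of p (Gam p) (Lam.map p _ _ (Lam.const r)) = _
      congr 1
      refine Subtype.ext (funext fun M => ?_)
      change MonoidAlgebra.mapDomainRingHom ℤ_[p] _ (MonoidAlgebra.single 1 r) =
        MonoidAlgebra.single 1 r
      rw [MonoidAlgebra.mapDomainRingHom_apply, MonoidAlgebra.mapDomain_single, map_one] }

variable (p) in
/-- An algebraic closure of `ℚ_p`. -/
abbrev QBar : Type := AlgebraicClosure ℚ_[p]

variable (p) in
/-- The ring of integers of the algebraic closure of `ℚ_p`. -/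
abbrev ZBar : Subalgebra ℤ_[p] (QBar p) := integralClosure ℤ_[p] (QBar p)

variable (p) in
/-- `B(Γ)` with coefficients in the integers of the algebraic closure of `ℚ_p`. -/
abbrev BZ : Type _ := ZBar p ⊗[ℤ_[p]] B p (Gam p)

variable (p) in
/-- `B(Γ)` with coefficients in the algebraic closure of `ℚ_p`, that is, `BZ p` with `p`
inverted. -/
abbrev BQ : Type _ := QBar p ⊗[ℤ_[p]] B p (Gam p)

variable (p) in
/-- The canonical map from `BZ p` to `BZ p` with `p` inverted. -/
def toBQ : BZ p →ₐ[ℤ_[p]] BQ p :=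
  Algebra.TensorProduct.map (ZBar p).val (AlgHom.id ℤ_[p] (B p (Gam p)))

variable (p) in
/-- The endomorphism `Ψ`, with `γ ↦ γᵖ` for `γ ∈ Γ`, linear over the coefficients. -/
def PsiZ : BZ p →ₐ[ℤ_[p]] BZ p := Algebra.TensorProduct.map (AlgHom.id ℤ_[p] (ZBar p)) (frobB p)

variable (p) in
/-- The endomorphism `Ψ` after inverting `p`. -/
def PsiQ : BQ p →ₐ[ℤ_[p]] BQ p := Algebra.TensorProduct.map (AlgHom.id ℤ_[p] (QBar p)) (frobB p)

/-- The series `∑ (-1)ᵏ (x - 1)ᵏ⁺¹ / (k + 1)` converges `p`-adically to `y`. -/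
def IsPLog (x : BZ p) (y : BQ p) : Prop :=
  ∀ n : ℕ, ∃ m₀ : ℕ, ∀ m ≥ m₀, ∃ w : BZ p,
    y - ∑ k ∈ Finset.range m, ((-1 : QBar p) ^ k / (k + 1 : QBar p)) • toBQ p ((x - 1) ^ (k + 1)) =
      toBQ p ((p : BZ p) ^ n * w)

open Classical in
/-- The `p`-adic logarithm, where its series converges. -/
def plog (x : BZ p) : BQ p := if h : ∃ y, IsPLog x y then h.choose else 0

end Coefficients

section Characters

/-- One-dimensional characters with open kernel. -/
structure Chr (p : ℕ) [Fact p.Prime] (U : Type*) [Group U] [TopologicalSpace U] where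
  toHom : U →* (ZBar p)ˣ
  isOpen_ker : IsOpen (toHom.ker : Set U)

/-- The kernel of a character. -/
def Chr.kerON (φ : Chr p U) : OpenNormalSubgroup U where
  toSubgroup := φ.toHom.ker
  isOpen' := φ.isOpen_ker
  isNormal' := inferInstanceAs φ.toHom.ker.Normal

/-- A one-dimensional character as a function. -/
def Chr.toFun (φ : Chr p U) (u : U) : QBar p := ((φ.toHom u : ZBar p) : QBar p)

/-- Inflation or restriction of a one-dimensional character. -/
def Chr.comp (φ : Chr p V) (f : U →* V) (hf : Continuous f) : Chr p U where
  toHom := φ.toHom.comp f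
  isOpen_ker := φ.isOpen_ker.preimage hf

/-- `Det(·)(φ)` for a one-dimensional character `φ`: the ring homomorphism with
`u ↦ φ(u) ū`, where `ū` is the image of `u` in `Γ`. -/
def detChr [IsTopologicalGroup U] [CompactSpace U] (D : OneDim p U) (φ : Chr p U) :
    B p U →+* BZ p :=
  (MonoidAlgebra.liftNCRingHom
    (Algebra.TensorProduct.includeRight : B p (Gam p) →ₐ[ℤ_[p]] BZ p).toRingHom
    (((Algebra.TensorProduct.includeLeftRingHom : ZBar p →+* BZ p) : ZBar p →* BZ p).comp
      ((Units.coeHom (ZBar p)).comp (QuotientGroup.kerLift φ.toHom)))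
    (fun _ _ => Commute.all _ _)).comp (B.twist D φ.kerON)

variable (p U) in
/-- The ring `R(U)` of virtual characters: the group generated by the characters of the
representations of `U` with open kernel. -/
def virtChar : AddSubgroup (U → QBar p) :=
  AddSubgroup.closure {χ | ∃ (n : ℕ) (ρ : U →* Matrix (Fin n) (Fin n) (QBar p)),
    IsOpen {u | ρ u = 1} ∧ χ = fun u => (ρ u).trace}

/-- Locally constant class functions. -/
structure IsClassFn (χ : U → QBar p) : Prop where
  conj : ∀ u v, χ (u * v) = χ (v * u)
  smooth : ∃ (N : OpenNormalSubgroup U) (χ' : U ⧸ N.toSubgroup → QBar p), ∀ u : U, χ u = χ' u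

/-- The Adams operation `(ψ_p χ)(u) = χ(uᵖ)`. -/
def adams (χ : U → QBar p) : U → QBar p := fun u => χ (u ^ p)

/-- Induction of class functions along an injective homomorphism `i : V → U`. -/
def indFun (i : V →* U) (f : V → QBar p) : U → QBar p := fun g =>
  ∑ᶠ q : U ⧸ i.range, Function.extend i f 0 (q.out⁻¹ * g * q.out)

end Characters

section Trace

variable (p U) in
/-- The additive subgroup `[B(U), B(U)]` generated by the additive commutators. -/
def commSub : AddSubgroup (B p U) := AddSubgroup.closure {x | ∃ a b : B p U, x = a * b - b * a}

variable (p U) in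
/-- `TB(U) = B(U)/[B(U), B(U)]`. -/
abbrev TB : Type _ := B p U ⧸ commSub p U

variable (p U) in
/-- `TB(U)[1/p]`. -/
abbrev TBp : Type _ := LocalizedModule (Submonoid.powers (p : ℤ)) (TB p U)

/-- The homomorphism `TB(U)[1/p] → TB(V)[1/p]` induced by `f : B(U) → B(V)`. -/
def TBp.map (f : B p U →+* B p V) : TBp p U →+ TBp p V :=
  (LocalizedModule.map (Submonoid.powers (p : ℤ))
    (QuotientAddGroup.map (commSub p U) (commSub p V) f.toAddMonoidHom (by
      refine (AddSubgroup.closure_le _).2 ?_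
      rintro _ ⟨a, b, rfl⟩
      refine AddSubgroup.subset_closure ⟨f a, f b, ?_⟩
      simp)).toIntLinearMap).toAddMonoidHom

/-- The linear map `B(Γ)[F] → Q̄_p ⊗ B(Γ)` with `g ↦ χ(g)`. -/
def trFin {F : Type*} [Group F] (χ : F → QBar p) : MonoidAlgebra (B p (Gam p)) F →+ BQ p :=
  MonoidAlgebra.liftNC
    ((Algebra.TensorProduct.includeRight : B p (Gam p) →ₐ[ℤ_[p]] BQ p) : B p (Gam p) →+ BQ p)
    (fun c => χ c ⊗ₜ[ℤ_[p]] (1 : B p (Gam p)))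

theorem trFin_comm {F : Type*} [Group F] (χ : F → QBar p) (hχ : ∀ u v, χ (u * v) = χ (v * u))
    (x y : MonoidAlgebra (B p (Gam p)) F) : trFin χ (x * y) = trFin χ (y * x) := by
  induction x using MonoidAlgebra.induction_linear with
  | zero => simp
  | add a b ha hb => rw [add_mul, mul_add, map_add, map_add, ha, hb]
  | single g r =>
    induction y using MonoidAlgebra.induction_linear with
    | zero => simp
    | add a b ha hb => rw [add_mul, mul_add, map_add, map_add, ha, hb]
    | single h s => simp [MonoidAlgebra.single_mul_single, trFin, hχ, mul_comm r s]

variable [IsTopologicalGroup U] [CompactSpace U]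

/-- The map `t ↦ Tr(t)(χ)` on `TB(U)`, induced by `u ↦ χ(u) ū`. -/
def trB (D : OneDim p U) {χ : U → QBar p} (h : IsClassFn χ) : TB p U →+ BQ p :=
  QuotientAddGroup.lift (commSub p U)
    ((trFin h.smooth.choose_spec.choose).comp (B.twist D h.smooth.choose).toAddMonoidHom) (by
      have hc : ∀ u v, h.smooth.choose_spec.choose (u * v) =
          h.smooth.choose_spec.choose (v * u) := by
        intro u v
        induction u using QuotientGroup.induction_on with | H u => ?_
        induction v using QuotientGroup.induction_on with | H v => ?_
        rw [← QuotientGroup.mk_mul, ← QuotientGroup.mk_mul, ← h.smooth.choose_spec.choose_spec,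
          ← h.smooth.choose_spec.choose_spec, h.conj]
      refine (AddSubgroup.closure_le _).2 ?_
      rintro _ ⟨a, b, rfl⟩
      change trFin _ (B.twist D _ (a * b - b * a)) = 0
      rw [map_sub, map_mul, map_mul, map_sub, trFin_comm _ hc, sub_self])

theorem isUnit_end_BQ (x : Submonoid.powers (p : ℤ)) :
    IsUnit (algebraMap ℤ (Module.End ℤ (BQ p)) x) := by
  obtain ⟨_, k, rfl⟩ := x
  have h0 : ((p : QBar p) ^ k) ≠ 0 := pow_ne_zero _ (Nat.cast_ne_zero.2 (Fact.out : p.Prime).ne_zero)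
  have h1 : ∀ x : BQ p, ((p : ℤ) ^ k) • x = ((p : QBar p) ^ k) • x := fun x => by
    rw [← Int.cast_smul_eq_zsmul (QBar p)]
    push_cast
    rfl
  rw [Module.End.isUnit_iff]
  constructor
  · intro a b hab
    have h2 : ((p : ℤ) ^ k) • a = ((p : ℤ) ^ k) • b := hab
    rw [h1, h1] at h2
    exact smul_right_injective _ h0 h2
  · intro b
    refine ⟨((p : QBar p) ^ k)⁻¹ • b, ?_⟩
    exact (h1 _).trans (smul_inv_smul₀ h0 b)

open Classical in
/-- The trace `Tr(t)(χ)`, induced by `u ↦ χ(u) ū`, where `ū` is the image of `u` in `Γ`. -/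
def Tr (D : OneDim p U) (t : TBp p U) (χ : U → QBar p) : BQ p :=
  if h : IsClassFn χ then
    LocalizedModule.lift (Submonoid.powers (p : ℤ)) (trB D h).toIntLinearMap isUnit_end_BQ t
  else 0

open Classical in
/-- `Tr⁻¹(f)`, for a function `f` on `R(U)`. -/
def TrInv (D : OneDim p U) (f : (U → QBar p) → BQ p) : TBp p U :=
  if h : ∃ t, ∀ χ ∈ virtChar p U, Tr D t χ = f χ then h.choose else 0

/-- The logarithm `L(f)(χ) = (1/p) log (f(χ)ᵖ / Ψ(f(ψ_p χ)))`. -/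
def LogHom (f : (U → QBar p) → (BZ p)ˣ) (χ : U → QBar p) : BQ p :=
  (p : QBar p)⁻¹ • plog ((f χ ^ p * (Units.map (PsiZ p : BZ p →* BZ p) (f (adams χ)))⁻¹ : (BZ p)ˣ) : BZ p)

/-- The map `Res` with `(Res f)(χ) = f(ind χ) + ∑_{r ≥ 1} p⁻ʳ Ψʳ (f(ψ_pʳ⁻¹ χ''))`, where
`χ'' = ψ_p(ind χ) - ind(ψ_p χ)`. -/
def resHom (i : V →* U) (f : (U → QBar p) → BQ p) (χ : V → QBar p) : BQ p :=
  f (indFun i χ) + ∑ᶠ r : ℕ, ((p : QBar p) ^ (r + 1))⁻¹ •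
    (PsiQ p)^[r + 1] (f (adams^[r] (adams (indFun i χ) - indFun i (adams χ))))

/-- The modified trace `Tr_V⁻¹ ∘ Res ∘ Tr_U`, the map for which the logarithms `𝕃 = Tr⁻¹ L Det`
of `U` and `V` are compatible with the norm map. -/
def modTr [IsTopologicalGroup V] [CompactSpace V] (D : OneDim p U) (E : OneDim p V) (i : V →* U)
    (t : TBp p U) : TBp p V := TrInv E (resHom i (Tr D t))

end Trace
section Norm

/-- The norm map `B(U) → B(V)` of the free `B(V)`-algebra `B(U)`, for abelian `U` and an open
subgroup `V` with inclusion `f : V → U`. -/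
def normB (hU : ∀ a b : U, a * b = b * a) (hV : ∀ a b : V, a * b = b * a) (f : V →* U)
    (hf : Adm p f) : B p U →* B p V :=
  letI : CommRing (B p V) := B.commRing hV
  letI : Algebra (B p V) (B p U) := RingHom.toAlgebra' (B.map f hf) fun _ _ => B.mul_comm_of hU _ _
  Algebra.norm (B p V)

end Norm

section Brauer

/-- Pairs `(V, φ)` of a subgroup `V` of `G` and a one-dimensional character `φ` of `V`. -/
@[ext] structure MPair (p : ℕ) [Fact p.Prime] (G : Type*) [Group G] where
  V : Subgroup G
  φ : V →* (ZBar p)ˣ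

variable {G : Type*} [Group G]

instance : PartialOrder (MPair p G) where
  le a b := ∃ h : a.V ≤ b.V, ∀ v : a.V, b.φ (Subgroup.inclusion h v) = a.φ v
  le_refl a := ⟨le_rfl, fun _ => rfl⟩
  le_trans a b c := by
    rintro ⟨h, e⟩ ⟨h', e'⟩
    exact ⟨h.trans h', fun v => by rw [← e, ← e']; rfl⟩
  le_antisymm a b := by
    rintro ⟨h, e⟩ ⟨h', -⟩
    obtain ⟨V, φ⟩ := a
    obtain ⟨V', φ'⟩ := b
    obtain rfl : V = V' := le_antisymm h h'
    congr 1
    exact MonoidHom.ext fun v => (e v).symm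

theorem MPair.finite_Icc [Finite G] (a b : MPair p G) : (Set.Icc a b).Finite := by
  refine Set.Finite.of_injOn (f := MPair.V) (t := Set.univ) (fun _ _ => trivial) ?_ Set.finite_univ
  rintro ⟨V, φ⟩ ⟨-, h, e⟩ ⟨V', φ'⟩ ⟨-, h', e'⟩ hV
  obtain rfl : V = V' := hV
  congr 1
  exact MonoidHom.ext fun v => (e v).symm.trans (e' v)

open Classical in
/-- The Möbius function of the partially ordered set of pairs `(V, φ)`. -/
def moebiusPair [Finite G] (a b : MPair p G) : ℤ :=
  letI : LocallyFiniteOrder (MPair p G) := LocallyFiniteOrder.ofFiniteIcc MPair.finite_Icc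
  IncidenceAlgebra.mu ℤ a b

open Classical in
/-- The Möbius function `μ_G(V)` of the subgroup lattice of a finite group, with
`μ_G(1) = 1` and `μ_G(V) = -∑_{V' ⊊ V} μ_G(V')` for `V ≠ 1`. -/
def moebiusGrp [Finite G] (V : Subgroup G) : ℤ :=
  letI : LocallyFiniteOrder (Subgroup G) :=
    LocallyFiniteOrder.ofFiniteIcc fun _ _ => Set.toFinite _
  IncidenceAlgebra.mu ℤ ⊥ V

variable (p G) in
/-- Conjugacy of pairs: `(V', φ') = (gVg⁻¹, φ(g⁻¹ · g))` for some `g`. -/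
def conjPair : Setoid (MPair p G) where
  r a b := ∃ g : G, ∃ h : ∀ v, v ∈ a.V ↔ g * v * g⁻¹ ∈ b.V,
    ∀ v : a.V, b.φ ⟨g * v * g⁻¹, (h v).1 v.2⟩ = a.φ v
  iseqv :=
    { refl := fun a => ⟨1, fun v => by simp, fun v => by congr 1; ext; simp⟩
      symm := by
        rintro a b ⟨g, h, e⟩
        refine ⟨g⁻¹, fun v => ?_, fun v => ?_⟩
        · rw [h]
          simp [mul_assoc]
        · rw [← e]
          congr 1
          ext
          simp [mul_assoc]
      trans := by
        rintro a b c ⟨g, h, e⟩ ⟨g', h', e'⟩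
        refine ⟨g' * g, fun v => ?_, fun v => ?_⟩
        · rw [h, h']
          simp [mul_assoc]
        · rw [← e, ← e']
          congr 1
          ext
          simp [mul_assoc] }

/-- The Schur inner product `⟨φ, Res_V ρ⟩`. -/
def schurInner (a : MPair p G) (ρ : G → QBar p) : QBar p :=
  (Nat.card a.V : QBar p)⁻¹ *
    ∑ᶠ v : a.V, (((a.φ v)⁻¹ : (ZBar p)ˣ) : ZBar p) * ρ v

/-- The (rational) coefficient of the class `c` in explicit Brauer induction,
`|V|/|G| · ∑ μ_{(V',φ'),(V'',φ'')} ⟨φ'', Res ρ⟩`, the sum being over all `(V',φ') ∈ c` and all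
`(V'',φ'') ⊇ (V',φ')`. -/
def brauerSum [Finite G] (ρ : G → QBar p) (c : Quotient (conjPair p G)) : QBar p :=
  (Nat.card c.out.V : QBar p) / Nat.card G *
    ∑ᶠ x : {x : MPair p G × MPair p G // Quotient.mk (conjPair p G) x.1 = c ∧ x.1 ≤ x.2},
      (moebiusPair x.1.1 x.1.2 : QBar p) * schurInner x.1.2 ρ

open Classical in
/-- The integer `α_c(ρ)` in `a_G(ρ) = ∑_c α_c(ρ) c`. -/
def brauerCoeff [Finite G] (ρ : G → QBar p) (c : Quotient (conjPair p G)) : ℤ :=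
  if h : ∃ n : ℤ, (n : QBar p) = brauerSum ρ c then h.choose else 0

end Brauer

section Subquotients

variable {G : Type*} [Group G] [TopologicalSpace G] {P : OneDim p G}

/-- The one-dimensional subquotients `W/C` of `G`: `W` is an open subgroup and `C` is a normal
subgroup of `W` contained in `H = ker(G → Γ)`. -/
structure SubQ (P : OneDim p G) where
  W : Subgroup G
  C : Subgroup G
  isOpen : IsOpen (W : Set G)
  le : C ≤ W
  leH : C ≤ P.proj.ker
  normal : (C.subgroupOf W).Normal

namespace SubQ

instance (S : SubQ P) : (S.C.subgroupOf S.W).Normal := S.normal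

/-- The group `W/C`. -/
abbrev Grp (S : SubQ P) : Type _ := S.W ⧸ S.C.subgroupOf S.W

variable [IsTopologicalGroup G] [CompactSpace G]

instance (S : SubQ P) : CompactSpace S.W :=
  isCompact_iff_compactSpace.1 (S.W.isClosed_of_isOpen S.isOpen).isCompact

theorem conj_mem (S : SubQ P) {w c : G} (hw : w ∈ S.W) (hc : c ∈ S.C) : w * c * w⁻¹ ∈ S.C :=
  S.normal.conj_mem ⟨c, S.le hc⟩ hc ⟨w, hw⟩

/-- The projection `W/C → Γ`. -/
def proj (S : SubQ P) : S.Grp →* Gam p :=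
  QuotientGroup.lift _ (P.proj.comp S.W.subtype) fun _ hc => S.leH hc

/-- The projection `W/C → Γ` has finite kernel. -/
def oneDim (S : SubQ P) : OneDim p S.Grp where
  proj := S.proj
  cont := (P.cont.comp continuous_subtype_val).quotient_lift _
  fin := by
    have := P.fin
    refine Finite.of_surjective
      (fun x : {x : P.proj.ker // (x : G) ∈ S.W} =>
        (⟨QuotientGroup.mk ⟨x.1.1, x.2⟩, x.1.2⟩ : S.proj.ker)) ?_
    rintro ⟨x, hx⟩
    induction x using QuotientGroup.induction_on with | H x => ?_
    exact ⟨⟨⟨x.1, hx⟩, x.2⟩, rfl⟩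

/-- `W/C` is abelian. -/
def IsAb (S : SubQ P) : Prop := ∀ a b : S.Grp, a * b = b * a

/-- The natural homomorphism `W/C → W'/C'` for `W ≤ W'` and `C ≤ C'`. -/
def hom {S T : SubQ P} (hW : S.W ≤ T.W) (hC : S.C ≤ T.C) : S.Grp →* T.Grp :=
  QuotientGroup.map _ _ (Subgroup.inclusion hW) fun _ hc => hC hc

theorem continuous_hom {S T : SubQ P} (hW : S.W ≤ T.W) (hC : S.C ≤ T.C) :
    Continuous (hom hW hC) :=
  (continuous_quotient_mk'.comp (continuous_inclusion hW)).quotient_lift _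

theorem adm_of_proj {S T : SubQ P} (f : S.Grp →* T.Grp) (hf : Continuous f)
    (hp : ∀ u, f u = 1 → S.proj u = 1)
    (hc : T.IsAb ∨ Function.Surjective f) : Adm p f where
  cont := hf
  fin := by
    have : Finite S.proj.ker := S.oneDim.fin
    exact Finite.of_injective (fun x : f.ker => (⟨x.1, hp _ x.2⟩ : S.proj.ker))
      fun x y h => Subtype.ext (congrArg (fun z : S.proj.ker => z.1) h)
  central u hu v := by
    rcases hc with hc | hc
    · exact hc _ _
    · obtain ⟨v, rfl⟩ := hc v
      rw [← map_mul, hu, map_mul]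

theorem proj_hom {S T : SubQ P} (hW : S.W ≤ T.W) (hC : S.C ≤ T.C) (u : S.Grp) :
    T.proj (hom hW hC u) = S.proj u := by
  induction u using QuotientGroup.induction_on with | H u => ?_
  rfl

theorem adm_of_ab {S T : SubQ P} (hW : S.W ≤ T.W) (hC : S.C ≤ T.C) (hT : T.IsAb) :
    Adm p (hom hW hC) :=
  adm_of_proj _ (continuous_hom hW hC) (fun u hu => by rw [← proj_hom hW hC, hu, map_one])
    (Or.inl hT)

theorem adm_of_eq {S T : SubQ P} (hW : S.W = T.W) (hC : S.C ≤ T.C) :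
    Adm p (hom hW.le hC) :=
  adm_of_proj _ (continuous_hom hW.le hC) (fun u hu => by rw [← proj_hom hW.le hC, hu, map_one])
    (Or.inr fun v => by
      induction v using QuotientGroup.induction_on with | H v => ?_
      exact ⟨QuotientGroup.mk ⟨v.1, hW.ge v.2⟩, rfl⟩)

/-- The abelianisation `W/(C·[W,W])` of `W/C`. -/
def ab (S : SubQ P) : SubQ P where
  W := S.W
  C := S.C ⊔ ⁅S.W, S.W⁆
  isOpen := S.isOpen
  le := sup_le S.le (Subgroup.commutator_le.2 fun a ha b hb =>
    mul_mem (mul_mem (mul_mem ha hb) (inv_mem ha)) (inv_mem hb))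
  leH := sup_le S.leH (by
    rw [Subgroup.commutator_le]
    intro a _ b _
    rw [MonoidHom.mem_ker, map_commutatorElement, commutatorElement_eq_one_iff_mul_comm, mul_comm])
  normal := ⟨by
    rintro ⟨c, hcW⟩ hc ⟨w, hw⟩
    have h : w * c * w⁻¹ * c⁻¹ ∈ S.C ⊔ ⁅S.W, S.W⁆ :=
      Subgroup.mem_sup_right (Subgroup.commutator_mem_commutator hw hcW)
    have h2 := mul_mem h (show c ∈ S.C ⊔ ⁅S.W, S.W⁆ from hc)
    rw [inv_mul_cancel_right] at h2
    exact h2⟩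


theorem ab_isAb (S : SubQ P) : S.ab.IsAb := by
  intro a b
  induction a using QuotientGroup.induction_on with | H a => ?_
  induction b using QuotientGroup.induction_on with | H b => ?_
  rw [← QuotientGroup.mk_mul, ← QuotientGroup.mk_mul, QuotientGroup.eq]
  have h := Subgroup.commutator_mem_commutator (inv_mem b.2) (inv_mem a.2)
  refine Subgroup.mem_sup_right (S := S.C) ?_
  have h2 : ((a : G) * (b : G))⁻¹ * ((b : G) * (a : G)) =
      (b : G)⁻¹ * (a : G)⁻¹ * (b : G)⁻¹⁻¹ * (a : G)⁻¹⁻¹ := by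
    simp [mul_assoc]
  change ((a : G) * (b : G))⁻¹ * ((b : G) * (a : G)) ∈ ⁅S.W, S.W⁆
  rw [h2]
  exact h

theorem ab_le {S T : SubQ P} (hW : S.W ≤ T.W) (hC : S.C ≤ T.C) : S.ab.C ≤ T.ab.C :=
  sup_le_sup hC (Subgroup.commutator_mono hW hW)

theorem le_ab (S : SubQ P) : S.C ≤ S.ab.C := le_sup_left

theorem eq_one_of_mem_ab {S : SubQ P} {A : Type*} [CommGroup A] (f : S.W →* A)
    (hf : ∀ c (h : c ∈ S.C), f ⟨c, S.le h⟩ = 1) (x : S.W) (hx : (x : G) ∈ S.ab.C) : f x = 1 := by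
  have h : S.ab.C ≤ f.ker.map S.W.subtype := by
    refine sup_le (fun c hc => (?_ : c ∈ f.ker.map S.W.subtype))
      (?_ : ⁅S.W, S.W⁆ ≤ f.ker.map S.W.subtype)
    · exact ⟨⟨c, S.le hc⟩, hf c hc, rfl⟩
    rw [Subgroup.commutator_le]
    intro a ha b hb
    refine ⟨(⟨a, ha⟩ : S.W) * ⟨b, hb⟩ * (⟨a, ha⟩ : S.W)⁻¹ * (⟨b, hb⟩ : S.W)⁻¹, ?_, rfl⟩
    change f _ = 1
    rw [map_mul, map_mul, map_mul, map_inv, map_inv, mul_inv_cancel_comm, mul_inv_cancel]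
  obtain ⟨y, hy, hyx⟩ := h hx
  rw [← Subtype.ext hyx]
  exact hy

/-- A homomorphism from `W` to an abelian group that is trivial on `C` descends to the
abelianisation of `W/C`. -/
def liftAb (S : SubQ P) {A : Type*} [CommGroup A] (f : S.W →* A)
    (hf : ∀ c (h : c ∈ S.C), f ⟨c, S.le h⟩ = 1) : S.ab.Grp →* A :=
  QuotientGroup.lift (S.ab.C.subgroupOf S.ab.W) (show S.ab.W →* A from f) fun x hx =>
    eq_one_of_mem_ab f hf x hx

section Preimage

variable (S : SubQ P) (N : OpenNormalSubgroup S.Grp)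

/-- `W → (W/C)/N`. -/
def toQuot : S.W →* S.Grp ⧸ N.toSubgroup :=
  (QuotientGroup.mk' N.toSubgroup).comp (QuotientGroup.mk' (S.C.subgroupOf S.W))

theorem isOpen_toQuot (V : Set (S.Grp ⧸ N.toSubgroup)) : IsOpen (S.toQuot N ⁻¹' V) := by
  have h : IsOpen ((QuotientGroup.mk' N.toSubgroup) ⁻¹' V) := by
    have : DiscreteTopology (S.Grp ⧸ N.toSubgroup) :=
      QuotientGroup.discreteTopology N.isOpen'
    exact (isOpen_discrete V).preimage continuous_quotient_mk'
  exact h.preimage continuous_quotient_mk'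

/-- The preimage in `W/C` of a subgroup `V` of `(W/C)/N`. -/
def pre (V : Subgroup (S.Grp ⧸ N.toSubgroup)) : SubQ P where
  W := (V.comap (S.toQuot N)).map S.W.subtype
  C := S.C
  isOpen := S.isOpen.isOpenMap_subtype_val _ (S.isOpen_toQuot N V)
  le c hc := ⟨⟨c, S.le hc⟩, by
    have h : S.toQuot N ⟨c, S.le hc⟩ = 1 := by
      have h' : QuotientGroup.mk' (S.C.subgroupOf S.W) ⟨c, S.le hc⟩ = 1 :=
        (QuotientGroup.eq_one_iff _).2 hc
      rw [toQuot, MonoidHom.comp_apply, h', map_one]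
    change S.toQuot N ⟨c, S.le hc⟩ ∈ V
    rw [h]
    exact one_mem V, rfl⟩
  leH := S.leH
  normal := ⟨by
    rintro c hc ⟨w, hw⟩
    obtain ⟨w, -, rfl⟩ := hw
    exact S.conj_mem w.2 hc⟩

theorem pre_le (V : Subgroup (S.Grp ⧸ N.toSubgroup)) : (S.pre N V).W ≤ S.W :=
  Subgroup.map_subtype_le _

theorem toQuot_mem (V : Subgroup (S.Grp ⧸ N.toSubgroup)) (w : (S.pre N V).W) :
    S.toQuot N ⟨w, S.pre_le N V w.2⟩ ∈ V := by
  obtain ⟨_, w, hw, rfl⟩ := w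
  exact hw

/-- The projection of the preimage of `V` to `V`. -/
def preHom (V : Subgroup (S.Grp ⧸ N.toSubgroup)) : (S.pre N V).W →* V where
  toFun w := ⟨S.toQuot N ⟨w, S.pre_le N V w.2⟩, S.toQuot_mem N V w⟩
  map_one' := Subtype.ext (map_one (S.toQuot N))
  map_mul' w w' := Subtype.ext (map_mul (S.toQuot N) ⟨w, S.pre_le N V w.2⟩ ⟨w', S.pre_le N V w'.2⟩)

/-- The inflation of a one-dimensional character `φ` of `V ≤ (W/C)/N` to the preimage of `V` in
`W/C`, as a character of the abelianisation of this preimage. -/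
def preChr (x : MPair p (S.Grp ⧸ N.toSubgroup)) : Chr p (S.pre N x.V).ab.Grp where
  toHom := (S.pre N x.V).liftAb (x.φ.comp (S.preHom N x.V)) fun c hc => by
    have h : S.preHom N x.V ⟨c, (S.pre N x.V).le hc⟩ = 1 := Subtype.ext (by
      have h' : QuotientGroup.mk' (S.C.subgroupOf S.W) ⟨c, S.le hc⟩ = 1 :=
        (QuotientGroup.eq_one_iff _).2 hc
      change QuotientGroup.mk' N.toSubgroup (QuotientGroup.mk' (S.C.subgroupOf S.W) ⟨c, S.le hc⟩) = 1
      rw [h', map_one])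
    rw [MonoidHom.comp_apply, h, map_one]
  isOpen_ker := by
    refine (QuotientGroup.isQuotientMap_mk _).isOpen_preimage.1 ?_
    have h : IsOpen {w : (S.pre N x.V).W |
        S.toQuot N ⟨w, S.pre_le N x.V w.2⟩ ∈ Subtype.val '' {v : x.V | x.φ v = 1}} :=
      (S.isOpen_toQuot N (Subtype.val '' {v : x.V | x.φ v = 1})).preimage
        (continuous_inclusion (S.pre_le N x.V))
    have h2 : {w : (S.pre N x.V).W | x.φ (S.preHom N x.V w) = 1} =
        Set.inclusion (S.pre_le N x.V) ⁻¹' (S.toQuot N ⁻¹' (Subtype.val '' {v | x.φ v = 1})) := by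
      ext w
      constructor
      · exact fun hw => ⟨S.preHom N x.V w, hw, rfl⟩
      · rintro ⟨v, hv, hvw⟩
        have : S.preHom N x.V w = v := Subtype.ext hvw.symm
        change x.φ _ = 1
        rw [this]
        exact hv
    have h3 : IsOpen {w : (S.pre N x.V).W | x.φ (S.preHom N x.V w) = 1} := h2 ▸ h
    exact h3

end Preimage

section Conj

/-- The subquotient `gWg⁻¹/gCg⁻¹`. -/
def conj (S : SubQ P) (g : G) : SubQ P where
  W := S.W.comap (MulAut.conj g⁻¹).toMonoidHom
  C := S.C.comap (MulAut.conj g⁻¹).toMonoidHom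
  isOpen := S.isOpen.preimage (by
    change Continuous fun x => g⁻¹ * x * g⁻¹⁻¹
    fun_prop)
  le := Subgroup.comap_mono S.le
  leH c hc := by
    have h : P.proj (g⁻¹ * c * g⁻¹⁻¹) = 1 := S.leH hc
    rw [inv_inv, map_mul, map_mul, mul_right_comm, ← map_mul, inv_mul_cancel, map_one,
      one_mul] at h
    exact h
  normal := ⟨by
    rintro c hc w
    have h := S.conj_mem (show (MulAut.conj g⁻¹).toMonoidHom w.1 ∈ S.W from w.2)
      (show (MulAut.conj g⁻¹).toMonoidHom c.1 ∈ S.C from hc)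
    rw [← map_inv, ← map_mul, ← map_mul] at h
    exact h⟩

theorem conj_mem_conj (S : SubQ P) (g : G) {w : G} (hw : w ∈ S.W) :
    g * w * g⁻¹ ∈ (S.conj g).W := by
  change g⁻¹ * (g * w * g⁻¹) * g⁻¹⁻¹ ∈ S.W
  simpa [mul_assoc] using hw

/-- Conjugation `W/C → gWg⁻¹/gCg⁻¹`. -/
def conjHom (S : SubQ P) (g : G) : S.Grp →* (S.conj g).Grp :=
  QuotientGroup.map _ _
    (MonoidHom.mk' (fun w : S.W => (⟨g * w * g⁻¹, S.conj_mem_conj g w.2⟩ : (S.conj g).W))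
      fun a b => Subtype.ext (by simp [mul_assoc])) fun c hc => by
    change g⁻¹ * (g * c * g⁻¹) * g⁻¹⁻¹ ∈ S.C
    have : (c : G) ∈ S.C := hc
    simpa [mul_assoc] using this

theorem proj_conjHom (S : SubQ P) (g : G) (u : S.Grp) :
    (S.conj g).proj (S.conjHom g u) = S.proj u := by
  induction u using QuotientGroup.induction_on with | H u => ?_
  change P.proj (g * u * g⁻¹) = P.proj u
  rw [map_mul, map_mul, map_inv, mul_right_comm, mul_inv_cancel, one_mul]

theorem conj_isAb {S : SubQ P} (h : S.IsAb) (g : G) : (S.conj g).IsAb := by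
  have hs : Function.Surjective (S.conjHom g) := by
    intro v
    induction v using QuotientGroup.induction_on with | H v => ?_
    refine ⟨QuotientGroup.mk ⟨g⁻¹ * v * g⁻¹⁻¹, v.2⟩, ?_⟩
    refine congrArg QuotientGroup.mk (Subtype.ext ?_)
    change g * (g⁻¹ * v * g⁻¹⁻¹) * g⁻¹ = v
    simp [mul_assoc]
  intro a b
  obtain ⟨a, rfl⟩ := hs a
  obtain ⟨b, rfl⟩ := hs b
  rw [← map_mul, h a b, map_mul]

theorem adm_conjHom {S : SubQ P} (h : S.IsAb) (g : G) : Adm p (S.conjHom g) :=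
  adm_of_proj _ (by
    refine Continuous.quotient_lift (continuous_quotient_mk'.comp ?_) _
    exact Continuous.subtype_mk (by fun_prop) _)
    (fun u hu => by rw [← proj_conjHom S g, hu, map_one]) (Or.inl (conj_isAb h g))

end Conj

section Transfer

variable {S A : SubQ P}

theorem finiteIndex (S A : SubQ P) : (A.W.subgroupOf S.W).FiniteIndex := by
  have h : Finite (S.W ⧸ A.W.subgroupOf S.W) :=
    Subgroup.quotient_finite_of_isOpen _ (A.isOpen.preimage continuous_subtype_val)
  exact Subgroup.finiteIndex_of_finite_quotient

/-- The transfer `W → A` for a normal abelian subgroup `A` of `W/C`. -/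
def verAux (S A : SubQ P) (hA : A.IsAb) : S.W →* A.Grp :=
  letI : CommGroup A.Grp := { (inferInstance : Group A.Grp) with mul_comm := hA }
  haveI := finiteIndex S A
  MonoidHom.transfer (H := A.W.subgroupOf S.W) (A := A.Grp)
    ((QuotientGroup.mk' (A.C.subgroupOf A.W)).comp (MonoidHom.mk' (M := A.W.subgroupOf S.W)
      (fun x => (⟨x.1, x.2⟩ : A.W)) fun _ _ => rfl))

theorem conj_inv_mem (hn : (A.W.subgroupOf S.W).Normal) {a : S.W}
    (ha : a ∈ A.W.subgroupOf S.W) (t : S.W) : ((t⁻¹ * a * t : S.W) : G) ∈ A.W := by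
  have := hn.conj_mem a ha t⁻¹
  rw [inv_inv] at this
  exact this

theorem verAux_apply (hA : A.IsAb) (hn : (A.W.subgroupOf S.W).Normal) :
    ∃ t : S.W ⧸ A.W.subgroupOf S.W → S.W, ∀ (a : S.W) (ha : a ∈ A.W.subgroupOf S.W),
      letI : CommGroup A.Grp := { (inferInstance : Group A.Grp) with mul_comm := hA }
      verAux S A hA a = ∏ᶠ q, (QuotientGroup.mk (⟨((t q)⁻¹ * a * t q : S.W), conj_inv_mem hn ha (t q)⟩ : A.W) : A.Grp) := by
  letI : CommGroup A.Grp := { (inferInstance : Group A.Grp) with mul_comm := hA }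
  haveI := finiteIndex S A
  let T : (A.W.subgroupOf S.W).LeftTransversal := default
  refine ⟨fun q => T.2.leftQuotientEquiv q, fun a ha => ?_⟩
  refine (MonoidHom.transfer_def _ T a).trans ?_
  letI := (A.W.subgroupOf S.W).fintypeQuotientOfFiniteIndex
  refine Eq.trans ?_ (finprod_eq_prod_of_fintype _).symm
  unfold Subgroup.leftTransversals.diff
  refine Finset.prod_congr rfl fun q _ => ?_
  refine congrArg QuotientGroup.mk (Subtype.ext ?_)
  have h : ((a • T).2.leftQuotientEquiv q : S.W) = a * T.2.leftQuotientEquiv q := by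
    have : a⁻¹ • q = q := by
      induction q using QuotientGroup.induction_on with | H q => ?_
      change (QuotientGroup.mk (a⁻¹ * q) : S.W ⧸ A.W.subgroupOf S.W) = QuotientGroup.mk q
      rw [QuotientGroup.eq]
      simpa [mul_assoc] using hn.conj_mem a ha q⁻¹
    conv_lhs => rw [Subgroup.smul_apply_eq_smul_apply_inv_smul, this]
    rfl
  have h2 : (T.2.leftQuotientEquiv q : S.W)⁻¹ * ((a • T).2.leftQuotientEquiv q : S.W) =
      (T.2.leftQuotientEquiv q : S.W)⁻¹ * a * (T.2.leftQuotientEquiv q : S.W) := by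
    rw [h, mul_assoc]
  have h3 := congrArg (fun x : S.W => (x : G)) h2
  exact h3

theorem verAux_eq_one (hA : A.IsAb) (hn : (A.W.subgroupOf S.W).Normal) (hC : S.C = A.C)
    (c : G) (hc : c ∈ S.C) : verAux S A hA ⟨c, S.le hc⟩ = 1 := by
  letI : CommGroup A.Grp := { (inferInstance : Group A.Grp) with mul_comm := hA }
  obtain ⟨t, ht⟩ := verAux_apply hA hn
  rw [ht _ (A.le (hC ▸ hc))]
  refine finprod_eq_one_of_forall_eq_one fun q => ?_
  refine (QuotientGroup.eq_one_iff _).2 ?_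
  have := S.conj_mem (inv_mem (t q).2) hc
  rw [inv_inv, hC] at this
  exact this

theorem continuous_verAux (hA : A.IsAb) (hn : (A.W.subgroupOf S.W).Normal) :
    Continuous (verAux S A hA) := by
  letI : CommGroup A.Grp := { (inferInstance : Group A.Grp) with mul_comm := hA }
  have hf := finiteIndex S A
  obtain ⟨t, ht⟩ := verAux_apply hA hn
  refine continuous_of_continuousAt_one _ ?_
  have ho : IsOpen (A.W.subgroupOf S.W : Set S.W) := A.isOpen.preimage continuous_subtype_val
  have h : Continuous fun a : A.W.subgroupOf S.W => verAux S A hA a.1 := by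
    simp_rw [fun a : A.W.subgroupOf S.W => ht a.1 a.2]
    letI := (A.W.subgroupOf S.W).fintypeQuotientOfFiniteIndex
    simp_rw [finprod_eq_prod_of_fintype]
    refine continuous_finsetProd _ fun q _ => continuous_quotient_mk'.comp ?_
    exact Continuous.subtype_mk (by fun_prop) _
  exact (ho.isOpenEmbedding_subtypeVal.continuousAt_iff (x := ⟨1, one_mem _⟩)).1 h.continuousAt

theorem proj_eq_one_of_verAux (hA : A.IsAb) (hn : (A.W.subgroupOf S.W).Normal) (u : S.W)
    (hu : verAux S A hA u = 1) : P.proj u = 1 := by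
  letI : CommGroup A.Grp := { (inferInstance : Group A.Grp) with mul_comm := hA }
  have hf := finiteIndex S A
  obtain ⟨t, ht⟩ := verAux_apply hA hn
  have hk : u ^ (A.W.subgroupOf S.W).index ∈ A.W.subgroupOf S.W := Subgroup.pow_index_mem _ u
  have h1 : verAux S A hA (u ^ (A.W.subgroupOf S.W).index) = 1 := by rw [map_pow, hu, one_pow]
  letI := (A.W.subgroupOf S.W).fintypeQuotientOfFiniteIndex
  rw [ht _ hk, finprod_eq_prod_of_fintype] at h1
  have h2 := congrArg A.proj h1
  rw [map_prod, map_one] at h2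
  have h3 : ∀ q, A.proj (QuotientGroup.mk (⟨((t q)⁻¹ * u ^ (A.W.subgroupOf S.W).index * t q : S.W),
      conj_inv_mem hn hk (t q)⟩ : A.W) : A.Grp) = P.proj u ^ (A.W.subgroupOf S.W).index := by
    intro q
    change P.proj ((t q : G)⁻¹ * (u : G) ^ _ * (t q : G)) = _
    rw [map_mul, map_mul, mul_right_comm, ← map_mul, inv_mul_cancel, map_one, one_mul, map_pow]
  rw [Finset.prod_congr rfl fun q _ => h3 q, Finset.prod_const, ← pow_mul] at h2
  refine gam_torsionFree _ _ (mul_ne_zero hf.index_ne_zero ?_) h2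
  exact Finset.card_ne_zero.2 ⟨QuotientGroup.mk 1, Finset.mem_univ _⟩

/-- The transfer `(W/C)ᵃᵇ → A` for a normal abelian open subgroup `A` of `W/C`. -/
def ver (hA : A.IsAb) (hn : (A.W.subgroupOf S.W).Normal) (hC : S.C = A.C) : S.ab.Grp →* A.Grp :=
  letI : CommGroup A.Grp := { (inferInstance : Group A.Grp) with mul_comm := hA }
  S.liftAb (verAux S A hA) (verAux_eq_one hA hn hC)

theorem adm_ver (hA : A.IsAb) (hn : (A.W.subgroupOf S.W).Normal) (hC : S.C = A.C) :
    Adm p (ver hA hn hC) :=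
  adm_of_proj _ ((continuous_verAux hA hn).quotient_lift _) (fun u hu => by
    induction u using QuotientGroup.induction_on with | H u => ?_
    exact proj_eq_one_of_verAux hA hn u hu) (Or.inl hA)

/-- Conjugation by `u ∈ W` on a normal subgroup `A` of `W/C`. -/
def conjNormal (hn : (A.W.subgroupOf S.W).Normal) (hC : S.C = A.C) (hW : A.W ≤ S.W) (u : S.W) :
    A.Grp →* A.Grp :=
  QuotientGroup.map _ _
    (MonoidHom.mk' (fun w : A.W =>
      (⟨u * w * (u : G)⁻¹, hn.conj_mem ⟨w, hW w.2⟩ w.2 u⟩ : A.W))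
      fun a b => Subtype.ext (by simp [mul_assoc])) fun c hc => by
    have h : (c : G) ∈ S.C := hC ▸ hc
    have h2 := S.conj_mem u.2 h
    rw [hC] at h2
    exact h2

theorem adm_conjNormal (hn : (A.W.subgroupOf S.W).Normal) (hC : S.C = A.C) (hW : A.W ≤ S.W)
    (hA : A.IsAb) (u : S.W) : Adm p (conjNormal hn hC hW u) :=
  adm_of_proj _ (by
    refine Continuous.quotient_lift (continuous_quotient_mk'.comp ?_) _
    exact Continuous.subtype_mk (by fun_prop) _)
    (fun w hw => by
      have h : A.proj (conjNormal hn hC hW u w) = A.proj w := by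
        induction w using QuotientGroup.induction_on with | H w => ?_
        change P.proj (u * w * (u : G)⁻¹) = P.proj w
        rw [map_mul, map_mul, map_inv, mul_right_comm, mul_inv_cancel, one_mul]
      rw [← h, hw, map_one]) (Or.inl hA)

/-- The map `σ : B(A) → B(A)`, `b ↦ ∑_{u ∈ U/A} u b u⁻¹`. -/
def sigma (hn : (A.W.subgroupOf S.W).Normal) (hC : S.C = A.C) (hW : A.W ≤ S.W)
    (hA : A.IsAb) (b : B p A.Grp) : B p A.Grp :=
  ∑ᶠ q : S.W ⧸ A.W.subgroupOf S.W,
    B.map (conjNormal hn hC hW q.out) (adm_conjNormal hn hC hW hA q.out) b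

end Transfer

end SubQ
end Subquotients
section Tuples

variable {G : Type*} [Group G] [TopologicalSpace G] [IsTopologicalGroup G] [CompactSpace G]
  {P : OneDim p G}

namespace SubQ

/-- The inclusion `V ⊆ U` of subquotients: `V = W'/C` and `U = W/C` with `W' ≤ W`. -/
structure Incl (V U : SubQ P) : Prop where
  W : V.W ≤ U.W
  C : V.C = U.C

/-- The surjection `U ↠ V` of subquotients: `U = W/C` and `V = W/C'` with `C ≤ C'`. -/
structure Surj (U V : SubQ P) : Prop where
  W : U.W = V.W
  C : U.C ≤ V.C

/-- The inclusion homomorphism `V → U`. -/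
def Incl.hom {V U : SubQ P} (h : Incl V U) : V.Grp →* U.Grp := SubQ.hom h.W h.C.le

/-- The projection homomorphism `U → V`. -/
def Surj.hom {U V : SubQ P} (h : Surj U V) : U.Grp →* V.Grp := SubQ.hom h.W.le h.C

theorem normal_of_incl {U V A : SubQ P} (hn : (A.W.subgroupOf U.W).Normal) (hV : Incl V U) :
    (A.W.subgroupOf V.W).Normal :=
  ⟨fun n hn' g => hn.conj_mem ⟨n, hV.W n.2⟩ hn' ⟨g, hV.W g.2⟩⟩

/-- The value `μ_{U/A}(V/A)` of the Möbius function for `A ⊆ V ⊆ U`. -/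
def moebius {U A : SubQ P} (hn : (A.W.subgroupOf U.W).Normal) (V : SubQ P) : ℤ :=
  haveI := hn
  haveI : Finite (U.W ⧸ A.W.subgroupOf U.W) :=
    Subgroup.quotient_finite_of_isOpen _ (A.isOpen.preimage continuous_subtype_val)
  moebiusGrp ((V.W.subgroupOf U.W).map (QuotientGroup.mk' (A.W.subgroupOf U.W)))

instance finite_quot (U : SubQ P) (N : OpenNormalSubgroup U.Grp) :
    Finite (U.Grp ⧸ N.toSubgroup) :=
  Subgroup.quotient_finite_of_isOpen _ N.isOpen'

/-- A one-dimensional character of `Vᵃᵇ`, viewed as a character of `V`. -/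
def chrFun (V : SubQ P) (φ : Chr p V.ab.Grp) : V.Grp → QBar p :=
  fun v => φ.toFun (SubQ.hom (S := V) (T := V.ab) le_rfl V.le_ab v)

end SubQ

/-- The product `∏_U B(U)ˣ` over all abelian one-dimensional subquotients `U` of `G`. -/
abbrev Tuple (P : OneDim p G) : Type _ := ∀ U : SubQ P, U.IsAb → (B p U.Grp)ˣ

/-- The element `λ_{Vᵃᵇ}` for a one-dimensional subquotient `V`. -/
def Tuple.atAb (l : Tuple P) (V : SubQ P) : (B p V.ab.Grp)ˣ := l V.ab V.ab_isAb

/-- The value `Det_{Vᵃᵇ}(λ_{Vᵃᵇ})(φ)` at a one-dimensional character `φ`. -/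
def Tuple.det (l : Tuple P) (V : SubQ P) (φ : Chr p V.ab.Grp) : (BZ p)ˣ :=
  Units.map (detChr V.ab.oneDim φ : B p V.ab.Grp →* BZ p) (l.atAb V)

open Classical in
/-- The element `Ξ_U`: if `ρ` is inflated from `ρ'` on a finite quotient `U/N`, with
`a_{U/N}(ρ') = ∑ α_c (V, φ)`, the sum being over representatives `(V, φ)` of the conjugacy
classes `c`, then `Ξ_U(ρ) = ∏ Det(λ_{V'ᵃᵇ})(φ')^{α_c}`, where `V'` and `φ'` are the preimage of `V`
in `U` and the inflation of `φ` to `V'`. -/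
def Tuple.Xi (l : Tuple P) (U : SubQ P) (ρ : U.Grp → QBar p) : (BZ p)ˣ :=
  if h : ∃ (N : OpenNormalSubgroup U.Grp) (ρ' : U.Grp ⧸ N.toSubgroup → QBar p), ∀ u : U.Grp,
      ρ u = ρ' u then
    ∏ᶠ c : Quotient (conjPair p (U.Grp ⧸ h.choose.toSubgroup)),
      l.det (U.pre h.choose c.out.V) (U.preChr h.choose c.out) ^
        brauerCoeff h.choose_spec.choose c
  else 1

/-- The element `t_U = Tr⁻¹(L_U(Ξ_U))`. -/
def Tuple.t (l : Tuple P) (U : SubQ P) : TBp p U.Grp := TrInv U.oneDim (LogHom (l.Xi U))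

/-- The group `Φ̃_B` of tuples `(λ_U)` satisfying the conditions (RW1)-(RW4). -/
structure Tuple.MemPhi (l : Tuple P) : Prop where
  /-- `pr(λ_U) = λ_V` for every surjection `U ↠ V` of abelian subquotients. -/
  rw1_pr : ∀ (U V : SubQ P) (hU : U.IsAb) (hV : V.IsAb) (h : SubQ.Surj U V),
    B.map h.hom (SubQ.adm_of_eq h.W h.C) (l U hU : B p U.Grp) = l V hV
  /-- `N(λ_U) = λ_V` for every inclusion `V ⊆ U` of abelian subquotients. -/
  rw1_norm : ∀ (U V : SubQ P) (hU : U.IsAb) (hV : V.IsAb) (h : SubQ.Incl V U),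
    normB hU hV h.hom (SubQ.adm_of_ab h.W h.C.le hU) (l U hU : B p U.Grp) = l V hV
  /-- `(λ_{Vᵃᵇ})_{V ⊆ U}` is invariant under conjugation by `U`. -/
  rw2 : ∀ (U V : SubQ P), SubQ.Incl V U → ∀ g ∈ U.W,
    B.map (V.ab.conjHom g) (SubQ.adm_conjHom V.ab_isAb g) (l.atAb V : B p V.ab.Grp) =
      l (V.ab.conj g) (SubQ.conj_isAb V.ab_isAb g)
  /-- The Möbius-Wall congruence. -/
  rw3 : ∀ (U A : SubQ P) (hA : A.IsAb) (h : SubQ.Incl A U) (hn : (A.W.subgroupOf U.W).Normal),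
    ∃ b : B p A.Grp,
      ∑ᶠ V : {V : SubQ P // SubQ.Incl A V ∧ SubQ.Incl V U}, SubQ.moebius hn V.1 •
        B.map (SubQ.ver hA (SubQ.normal_of_incl hn V.2.2) V.2.1.C.symm)
          (SubQ.adm_ver hA (SubQ.normal_of_incl hn V.2.2) V.2.1.C.symm)
          (l.atAb V.1 : B p V.1.ab.Grp) =
      SubQ.sigma hn h.C.symm h.W hA b
  /-- The value of `Ξ_U` at `ρ = ∑ n_V Ind χ_V` is `∏ Det(λ_{Vᵃᵇ})(χ_V)^{n_V}`. -/
  rw4 : ∀ (U : SubQ P) (m : ℕ) (V : Fin m → SubQ P) (h : ∀ i, SubQ.Incl (V i) U)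
    (φ : ∀ i, Chr p (V i).ab.Grp) (n : Fin m → ℤ) (ρ : U.Grp → QBar p), ρ ∈ virtChar p U.Grp →
    ρ = ∑ i, n i • indFun (h i).hom ((V i).chrFun (φ i)) →
    l.Xi U ρ = ∏ i, l.det (V i) (φ i) ^ n i

end Tuples

end Iwasawa

end RW

end

/-! Everything rests on Blichfeldt's theorem. A representation of U with open kernel factors through
a finite p-group, so its character is an integral combination of characters induced from
one-dimensional ones (`trace_mem_monSpan`, `SubQ.virtChar_le_indSpan`). Condition (RW4) therefore
computes Ξ_U on all of R(U) and makes it a homomorphism (`Tuple.MemPhi.Xi_add`). Induction is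
transitive, so the same product computes Ξ_U(Ind ρ) and Ξ_V(ρ) (`Tuple.MemPhi.Xi_ind`). Inflation
commutes with induction and λ is compatible with projections, which gives the first claim
(`Tuple.MemPhi.Xi_surj`).

Existence of t_U. For abelian E the element μ = λ^p / φ(λ), where φ is induced by u ↦ u^p, is
congruent to 1 modulo p. Its logarithm is p·c with c in B(E), and the traces of c are the values of
L (`Tuple.MemPhi.exists_log_ab`). For general U an open central subgroup z(Γ) is chosen, with finite
quotient F. Artin's argument, with integral coefficients, writes the constant function 1 on F
through indicators of subgroups of cyclic groups (`one_mem_cycSpan`). Averaging over conjugation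
turns this into |F|·ρ = ∑ a_V |V| Ind Res ρ, where the preimages of the V in U are abelian. Hence
|F|·L is the trace of a sum of elements carried over from abelian subgroups, and |F| is a power of
p, invertible in TB(U)[1/p] (`Tuple.MemPhi.exists_isLogTrace`). Logarithms are handled as limits of
(x^(p^k) - 1)/p^k, for which roots and products are easy; `IsPLog'.isPLog` passes to the defining
series.

Uniqueness of t_U. B(U) is spanned over z(B(Γ)) by representatives of F
(`CenSec.combine_surjective`), and γ ↦ γ^p is injective on B(Γ) (`B.pow_injective`), so B(U) embeds
into B(Γ)[F] (`CenSec.twist_injective`). If all traces of x vanish, Fourier inversion on cyclic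
subgroups of F kills the sum of the conjugates of x, which is |F|·x modulo commutators
(`SubQ.Tr_eq_zero`).

Given uniqueness, the last two claims only need a comparison of traces. For projections this is
immediate. For inclusions, the correction terms of Res are the telescoping expansion of the
logarithm of ΨΞ_U(χ''). It is a finite sum, because χ'' vanishes at 1 and is killed by a power of
ψ_p (`Tuple.IsLogTrace.res`). -/

noncomputable section
namespace RW

/-! ### The p-adic completion is complete, separated and free of p-torsion. -/

section PCompLemmas

variable {p : ℕ} [Fact p.Prime] {A : Type*} [Ring A]

theorem pow_mem_pId (n : ℕ) (y : A) : y * (p : A) ^ n ∈ pId p A n := (mem_pId p).2 ⟨y, rfl⟩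

theorem pow_mem_pId' (n : ℕ) (y : A) : (p : A) ^ n * y ∈ pId p A n :=
  (mem_pId p).2 ⟨y, by rw [← Nat.cast_pow, Nat.cast_comm]⟩

theorem PComp.coe_pow_eq_zero (y : PComp p A) (n : ℕ) : ((y * (p : PComp p A) ^ n).1 n) = 0 := by
  change y.1 n * (Ideal.Quotient.mk (pId p A n) ((p : A)) ^ n) = 0
  rw [← map_pow, Ideal.Quotient.eq_zero_iff_mem.2 ((mem_pId p).2 ⟨1, one_mul _⟩), mul_zero]

/-- The quotient by pⁿ is built as a series: for lifts a_k of the components, a_n lies in pⁿA and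
successive differences a_(n+k+1) - a_(n+k) are divisible by p^(n+k). So each a_(n+k) is pⁿ times a
partial sum, and the partial sums form a compatible sequence. -/
theorem PComp.mem_pId_iff (x : PComp p A) (n : ℕ) : x ∈ pId p (PComp p A) n ↔ x.1 n = 0 := by
  constructor
  · intro h
    obtain ⟨y, rfl⟩ := (mem_pId p).1 h
    exact PComp.coe_pow_eq_zero y n
  · intro h
    choose a ha using fun k => Ideal.Quotient.mk_surjective (I := pId p A k) (x.1 k)
    have h0 : a n ∈ pId p A n := by
      rw [← Ideal.Quotient.eq_zero_iff_mem, ha, h]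
    obtain ⟨c, hc⟩ := (mem_pId p).1 h0
    have h1 : ∀ k, a (n + (k + 1)) - a (n + k) ∈ pId p A (n + k) := by
      intro k
      rw [← Ideal.Quotient.eq_zero_iff_mem, map_sub, ha, sub_eq_zero,
        ← x.2 (n + k) (n + (k + 1)) (by omega), ← ha (n + (k + 1))]
      rfl
    choose d hd using fun k => (mem_pId p).1 (h1 k)
    have h2 : ∀ k, a (n + k) = (c + ∑ j ∈ Finset.range k, d j * (p : A) ^ j) * (p : A) ^ n := by
      intro k
      induction k with
      | zero => simpa using hc.symm
      | succ k ih =>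
        have e : a (n + (k + 1)) = d k * (p : A) ^ (n + k) + a (n + k) := by rw [hd]; abel
        rw [e, ih, Finset.sum_range_succ]
        simp only [add_mul, mul_assoc, ← pow_add, add_comm k n]
        abel
    refine (mem_pId p).2 ⟨⟨fun k => Ideal.Quotient.mk _ (c + ∑ j ∈ Finset.range k, d j * (p : A) ^ j),
      ?_⟩, ?_⟩
    · intro m k hmk
      change Ideal.Quotient.mk _ _ = Ideal.Quotient.mk _ _
      rw [← sub_eq_zero, ← map_sub, Ideal.Quotient.eq_zero_iff_mem, add_sub_add_left_eq_sub,
        ← Finset.sum_Ico_eq_sub _ hmk]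
      refine Ideal.sum_mem _ fun j hj => pId_le p (Finset.mem_Ico.1 hj).1 (pow_mem_pId j _)
    · refine Subtype.ext (funext fun k => ?_)
      change Ideal.Quotient.mk _ _ * (Ideal.Quotient.mk (pId p A k) ((p : A)) ^ n) = x.1 k
      rw [← map_pow, ← map_mul, ← h2, ← x.2 k (n + k) (by omega), ← ha (n + k)]
      rfl

theorem PComp.exists_of (x : PComp p A) (n : ℕ) : ∃ a, x - PComp.of p a ∈ pId p (PComp p A) n := by
  obtain ⟨a, ha⟩ := Ideal.Quotient.mk_surjective (I := pId p A n) (x.1 n)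
  refine ⟨a, (PComp.mem_pId_iff _ _).2 ?_⟩
  change x.1 n - Ideal.Quotient.mk _ a = 0
  rw [ha, sub_self]

theorem PComp.eq_zero (x : PComp p A) (h : ∀ n, x ∈ pId p (PComp p A) n) : x = 0 :=
  Subtype.ext (funext fun n => (PComp.mem_pId_iff x n).1 (h n))

theorem PComp.exists_lim (x : ℕ → PComp p A) (hx : ∀ n, x (n + 1) - x n ∈ pId p (PComp p A) n) :
    ∃ y : PComp p A, ∀ n, y - x n ∈ pId p (PComp p A) n := by
  have h1 : ∀ m k, x (m + k) - x m ∈ pId p (PComp p A) m := by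
    intro m k
    induction k with
    | zero => simp
    | succ k ih =>
      have := Ideal.add_mem _ (pId_le p (Nat.le_add_right m k) (hx (m + k))) ih
      rwa [sub_add_sub_cancel] at this
  refine ⟨⟨fun n => (x n).1 n, ?_⟩, fun n => (PComp.mem_pId_iff _ _).2 ?_⟩
  · intro m n h
    rw [(x n).2 m n h]
    obtain ⟨k, rfl⟩ := Nat.exists_eq_add_of_le h
    exact sub_eq_zero.1 ((PComp.mem_pId_iff _ _).1 (h1 m k))
  · exact sub_self _

/-- Multiplication by p is not injective at a finite level, but a·p in p^(n+1)A forces a in pⁿA.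
Level n+1 of x·p thus controls level n of x. -/
theorem PComp.torsionFree (hA : ∀ a : A, a * (p : A) = 0 → a = 0) (x : PComp p A)
    (hx : x * (p : PComp p A) = 0) : x = 0 := by
  refine Subtype.ext (funext fun n => ?_)
  obtain ⟨a, ha⟩ := Ideal.Quotient.mk_surjective (I := pId p A (n + 1)) (x.1 (n + 1))
  have h1 : x.1 (n + 1) * Ideal.Quotient.mk (pId p A (n + 1)) (p : A) = 0 :=
    congrFun (congrArg Subtype.val hx) (n + 1)
  rw [← ha, ← map_mul, Ideal.Quotient.eq_zero_iff_mem] at h1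
  obtain ⟨y, hy⟩ := (mem_pId p).1 h1
  have h2 : a = y * (p : A) ^ n := by
    refine sub_eq_zero.1 (hA _ ?_)
    rw [sub_mul, mul_assoc, ← pow_succ, hy, sub_self]
  rw [← x.2 n (n + 1) (by omega), ← ha]
  change Ideal.Quotient.mk _ a = 0
  rw [Ideal.Quotient.eq_zero_iff_mem, h2]
  exact pow_mem_pId n y

end PCompLemmas

/-! ### Functoriality of B(U), group elements, and the twist B(U) → B(Γ)[U/N]. -/

section BLemmas

variable {p : ℕ} [Fact p.Prime]
variable {U V W : Type*} [Group U] [TopologicalSpace U] [Group V] [TopologicalSpace V]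
  [Group W] [TopologicalSpace W]

theorem B.eq_zero (x : B p U) (h : ∀ n, x ∈ pId p (B p U) n) : x = 0 := PComp.eq_zero x h

/-- The canonical map `Λ(U)_(p) → B(U)`. -/
def B.ofS : LamS p U →+* B p U := PComp.of p

/-- The canonical map `Λ(U) → B(U)`. -/
def B.of : Lam p U →+* B p U := B.ofS.comp (LamS.of p U)

theorem B.exists_of (x : B p U) (n : ℕ) :
    ∃ a : LamS p U, x - B.ofS a ∈ pId p (B p U) n := PComp.exists_of x n

/-- Homomorphisms from `B(U)` to a `p`-adically separated ring are determined on `Λ(U)`. -/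
theorem B.hom_ext {X : Type*} [Ring X] (hX : ∀ x : X, (∀ n, x ∈ pId p X n) → x = 0)
    {f g : B p U →+* X} (h : ∀ x, f (B.of x) = g (B.of x)) : f = g := by
  have h1 : f.comp B.ofS = g.comp B.ofS :=
    LamS.hom_ext h
  refine RingHom.ext fun x => sub_eq_zero.1 (hX _ fun n => ?_)
  obtain ⟨a, ha⟩ := B.exists_of x n
  have h2 : f (B.ofS a) = g (B.ofS a) := RingHom.congr_fun h1 a
  have h3 := Ideal.sub_mem _ (map_pId p f n _ ha) (map_pId p g n _ ha)
  rw [map_sub, map_sub, h2, sub_sub_sub_cancel_right] at h3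
  exact h3

theorem B.map_of (f : U →* V) (hf : Adm p f) (x : Lam p U) :
    B.map f hf (B.of x) = B.of (Lam.map p f hf.cont x) := by
  refine Subtype.ext (funext fun n => ?_)
  exact congrArg (Ideal.Quotient.mk _) (LamS.lift_of _ _ x)

theorem B.map_map (f : U →* V) (hf : Adm p f) (g : V →* W) (hg : Adm p g) (h : Adm p (g.comp f))
    (x : B p U) : B.map g hg (B.map f hf x) = B.map (g.comp f) h x := by
  have : (B.map g hg).comp (B.map f hf) = B.map (g.comp f) h := by
    refine B.hom_ext B.eq_zero fun x => ?_
    rw [RingHom.comp_apply, B.map_of, B.map_of, B.map_of, Lam.map_comp]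
  exact RingHom.congr_fun this x

theorem Lam.map_id (x : Lam p U) : Lam.map p (MonoidHom.id U) continuous_id x = x := by
  refine Subtype.ext (funext fun N => ?_)
  exact x.2 (comapON (MonoidHom.id U) continuous_id N) N fun _ h => h

theorem B.map_id (h : Adm p (MonoidHom.id U)) (x : B p U) : B.map (MonoidHom.id U) h x = x := by
  have : B.map (MonoidHom.id U) h = RingHom.id (B p U) := by
    refine B.hom_ext B.eq_zero fun x => ?_
    rw [B.map_of, Lam.map_id]; rfl
  exact RingHom.congr_fun this x

variable (p) in
/-- A group element as an element of `Λ(U)`. -/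
def Lam.grp : U →* Lam p U where
  toFun u := ⟨fun N => MonoidAlgebra.single (QuotientGroup.mk u) 1, fun N M h => by
    rw [MonoidAlgebra.mapDomainRingHom_apply, MonoidAlgebra.mapDomain_single, quotMap_mk]; rfl⟩
  map_one' := rfl
  map_mul' u v := by
    refine Subtype.ext (funext fun N => ?_)
    change (MonoidAlgebra.single (QuotientGroup.mk (u * v)) 1 :
      MonoidAlgebra ℤ_[p] (U ⧸ N.toSubgroup)) =
      MonoidAlgebra.single (QuotientGroup.mk u) 1 * MonoidAlgebra.single (QuotientGroup.mk v) 1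
    rw [MonoidAlgebra.single_mul_single, one_mul]; rfl

theorem Lam.map_grp (f : U →* V) (hf : Continuous f) (u : U) :
    Lam.map p f hf (Lam.grp p u) = Lam.grp p (f u) := by
  refine Subtype.ext (funext fun N => ?_)
  change MonoidAlgebra.mapDomainRingHom ℤ_[p] _ (MonoidAlgebra.single _ _) =
    MonoidAlgebra.single _ _
  rw [MonoidAlgebra.mapDomainRingHom_apply, MonoidAlgebra.mapDomain_single, quotMap_mk]

variable (p) in
/-- A group element as an element of `B(U)`. -/
def B.grp : U →* B p U := ((B.of : Lam p U →+* B p U) : Lam p U →* B p U).comp (Lam.grp p)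

theorem B.isUnit_grp (u : U) : IsUnit (B.grp p u) := (Group.isUnit u).map (B.grp p)

theorem MonoidAlgebra_pSep {F : Type*} [Monoid F] {R : Type*} [Ring R]
    (hR : ∀ x : R, (∀ n, x ∈ pId p R n) → x = 0) (x : MonoidAlgebra R F)
    (hx : ∀ n, x ∈ pId p (MonoidAlgebra R F) n) : x = 0 := by
  ext c
  refine hR _ fun n => ?_
  obtain ⟨y, rfl⟩ := (mem_pId p).1 (hx n)
  refine (mem_pId p).2 ⟨y.coeff c, ?_⟩
  rw [← Nat.cast_pow, ← Nat.cast_pow, ← Nat.cast_comm, ← Nat.cast_comm, ← nsmul_eq_mul, ← nsmul_eq_mul, MonoidAlgebra.coeff_smul]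
  rfl

section TwistLemmas

variable (D : OneDim p U) (N : OpenNormalSubgroup U) [Finite (U ⧸ N.toSubgroup)]

/-- Together with `B.hom_ext` this reduces identities between twist homomorphisms on B(U) to
identities on Λ(U), which can be checked on group elements at finite levels. -/
theorem B.twist_of (x : Lam p U) :
    B.twist D N (B.of x) = MonoidAlgebra.mapRingHom _ (B.of : Lam p (Gam p) →+* B p (Gam p)) (Lam.twist D N x) := by
  refine MonoidAlgebra.ext (Finsupp.ext fun c => Subtype.ext (funext fun n => ?_))
  rw [MonoidAlgebra.coeff_mapRingHom]
  change (B.twistLevel D N n (Ideal.Quotient.mk _ (LamS.of p U x))).coeff c =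
    Ideal.Quotient.mk _ (LamS.of p (Gam p) ((Lam.twist D N x).coeff c))
  change (LamS.lift (twistAux D N n) (twistAux_isUnit D N n) (LamS.of p U x)).coeff c = _
  rw [LamS.lift_of]
  change (MonoidAlgebra.mapRingHom _ _ _).coeff c = _
  rw [MonoidAlgebra.coeff_mapRingHom]
  rfl

theorem Lam.twist_grp (u : U) : Lam.twist D N (Lam.grp p u) =
    MonoidAlgebra.single (QuotientGroup.mk u) (Lam.grp p (D.proj u)) := by
  classical
  refine MonoidAlgebra.ext (Finsupp.ext fun c => Subtype.ext (funext fun M => ?_))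
  rw [Lam.twist_spec]
  change (MonoidAlgebra.lift ℤ_[p] _ _ (twistChar D N M) (MonoidAlgebra.single _ _)).coeff c = _
  rw [MonoidAlgebra.lift_single, twistChar_mk, one_smul, MonoidAlgebra.coeff_single,
    MonoidAlgebra.coeff_single, Finsupp.single_apply, Finsupp.single_apply]
  split_ifs <;> rfl

theorem B.twist_grp (u : U) : B.twist D N (B.grp p u) =
    MonoidAlgebra.single (QuotientGroup.mk u) (B.grp p (D.proj u)) := by
  change B.twist D N (B.of _) = _
  rw [B.twist_of, Lam.twist_grp, MonoidAlgebra.mapRingHom_single]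
  rfl

end TwistLemmas

section Naturality

variable (D : OneDim p U) (E : OneDim p V) (N : OpenNormalSubgroup U) (M : OpenNormalSubgroup V)
  [Finite (U ⧸ N.toSubgroup)] [Finite (V ⧸ M.toSubgroup)]

/-- Both sides send u to the class of f(u) with coefficient the image of u in Γ. The hypothesis `hp`
says that the two projections to Γ agree, so coefficients are unchanged and only the group index
moves. -/
theorem Lam.twist_map_nat (f : U →* V) (hf : Continuous f) (hp : ∀ u, E.proj (f u) = D.proj u)
    (h : ∀ u ∈ N.toSubgroup, f u ∈ M.toSubgroup) (x : Lam p U) :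
    Lam.twist E M (Lam.map p f hf x) =
      MonoidAlgebra.mapDomainRingHom _ (quotMap f N M h) (Lam.twist D N x) := by
  classical
  refine MonoidAlgebra.ext (Finsupp.ext fun c => Subtype.ext (funext fun L => ?_))
  rw [Lam.twist_spec]
  -- evaluation at `L`
  have e1 : ((MonoidAlgebra.mapDomainRingHom _ (quotMap f N M h) (Lam.twist D N x)).coeff c).1 L =
      (MonoidAlgebra.mapDomainRingHom _ (quotMap f N M h) (twistLevel D N L x)).coeff c := by
    have e2 : twistLevel D N L x = MonoidAlgebra.mapRingHom _
        ((Pi.evalRingHom _ L).comp (Lam p (Gam p)).subtype) (Lam.twist D N x) := by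
      refine MonoidAlgebra.ext (Finsupp.ext fun c => ?_)
      rw [MonoidAlgebra.coeff_mapRingHom]
      rfl
    rw [e2]
    generalize Lam.twist D N x = y
    induction y using MonoidAlgebra.induction_linear with
    | zero => simp
    | add a b ha hb =>
      simp only [map_add, MonoidAlgebra.coeff_add, Finsupp.add_apply] at ha hb ⊢
      rw [← ha, ← hb]; rfl
    | single g r =>
      simp only [MonoidAlgebra.mapDomainRingHom_apply, MonoidAlgebra.mapDomain_single,
        MonoidAlgebra.mapRingHom_single, MonoidAlgebra.coeff_single, Finsupp.single_apply]
      split_ifs <;> rfl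
  rw [e1]
  congr 2
  have e := x.2 (N ⊓ comapON D.proj D.cont L) (comapON f hf (M ⊓ comapON E.proj E.cont L))
    (fun u hu => (mem_comapON f hf _ u).2 (mem_inf (h u (mem_inf_left hu))
      ((mem_comapON E.proj E.cont L _).2 ((hp u).symm ▸
        (mem_comapON D.proj D.cont L u).1 (mem_inf_right hu)))))
  change MonoidAlgebra.lift ℤ_[p] _ _ (twistChar E M L)
    (MonoidAlgebra.mapDomainRingHom ℤ_[p] _ (x.1 _)) =
    MonoidAlgebra.mapDomainRingHom _ _ (MonoidAlgebra.lift ℤ_[p] _ _ (twistChar D N L) (x.1 _))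
  rw [← e]
  generalize x.1 (N ⊓ comapON D.proj D.cont L) = y
  induction y using MonoidAlgebra.induction_linear with
  | zero => simp only [map_zero]
  | add a b ha hb => simp only [map_add, ha, hb]
  | single g r =>
    induction g using QuotientGroup.induction_on with | H g => ?_
    simp only [MonoidAlgebra.mapDomainRingHom_apply, MonoidAlgebra.mapDomain_single]
    rw [MonoidAlgebra.lift_single, MonoidAlgebra.lift_single, quotMap_mk, quotMap_mk, twistChar_mk,
      twistChar_mk, MonoidHom.id_apply, hp]
    simp only [MonoidAlgebra.smul_single, MonoidAlgebra.mapDomain_single, quotMap_mk]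

theorem B.twist_map (f : U →* V) (hf : Adm p f) (hp : ∀ u, E.proj (f u) = D.proj u)
    (h : ∀ u ∈ N.toSubgroup, f u ∈ M.toSubgroup) (x : B p U) :
    B.twist E M (B.map f hf x) =
      MonoidAlgebra.mapDomainRingHom _ (quotMap f N M h) (B.twist D N x) := by
  have : (B.twist E M).comp (B.map f hf) =
      (MonoidAlgebra.mapDomainRingHom _ (quotMap f N M h)).comp (B.twist D N) := by
    refine B.hom_ext (MonoidAlgebra_pSep B.eq_zero) fun x => ?_
    rw [RingHom.comp_apply, RingHom.comp_apply, B.map_of, B.twist_of, B.twist_of,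
      Lam.twist_map_nat D E N M f hf.cont hp h]
    generalize Lam.twist D N x = y
    induction y using MonoidAlgebra.induction_linear with
    | zero => simp only [map_zero]
    | add a b ha hb => simp only [map_add, ha, hb]
    | single g r =>
      simp only [MonoidAlgebra.mapDomainRingHom_apply, MonoidAlgebra.mapDomain_single,
        MonoidAlgebra.mapRingHom_single]
  exact RingHom.congr_fun this x

end Naturality

end BLemmas

/-! ### Traces on TB(U)[1/p]: independence of choices, additivity, naturality. -/

section TraceLemmas

variable {p : ℕ} [Fact p.Prime]

section Fin

variable {F F' : Type*} [Group F] [Group F']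

theorem trFin_single (χ : F → QBar p) (c : F) (r : B p (Gam p)) :
    trFin χ (MonoidAlgebra.single c r) = χ c ⊗ₜ[ℤ_[p]] r := by
  simp [trFin]

theorem trFin_mapDomain (f : F →* F') (χ : F' → QBar p) (y : MonoidAlgebra (B p (Gam p)) F) :
    trFin χ (MonoidAlgebra.mapDomainRingHom _ f y) = trFin (fun c => χ (f c)) y := by
  induction y using MonoidAlgebra.induction_linear with
  | zero => simp only [map_zero]
  | add a b ha hb => simp only [map_add, ha, hb]
  | single c r =>
    rw [MonoidAlgebra.mapDomainRingHom_apply, MonoidAlgebra.mapDomain_single, trFin_single,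
      trFin_single]

theorem trFin_mul_single (χ : F → QBar p) (y : MonoidAlgebra (B p (Gam p)) F) (c : F)
    (r : B p (Gam p)) : trFin χ (y * MonoidAlgebra.single c r) =
      trFin (fun d => χ (d * c)) y * ((1 : QBar p) ⊗ₜ[ℤ_[p]] r) := by
  induction y using MonoidAlgebra.induction_linear with
  | zero => simp only [map_zero, zero_mul]
  | add a b ha hb => simp only [add_mul, map_add, ha, hb]
  | single d s =>
    rw [MonoidAlgebra.single_mul_single, trFin_single, trFin_single,
      Algebra.TensorProduct.tmul_mul_tmul, mul_one]

theorem trFin_add (χ χ' : F → QBar p) (y : MonoidAlgebra (B p (Gam p)) F) :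
    trFin (fun c => χ c + χ' c) y = trFin χ y + trFin χ' y := by
  induction y using MonoidAlgebra.induction_linear with
  | zero => simp only [map_zero, add_zero]
  | add a b ha hb => simp only [map_add, ha, hb]; abel
  | single d s => simp only [trFin_single, TensorProduct.add_tmul]

end Fin

variable {U V : Type*} [Group U] [TopologicalSpace U] [Group V] [TopologicalSpace V]

variable (p U) in
/-- The canonical map `B(U) → TB(U)[1/p]`. -/
def TBp.of : B p U →+ TBp p U :=
  ((LocalizedModule.mkLinearMap (Submonoid.powers (p : ℤ)) (TB p U)).toAddMonoidHom).comp
    (QuotientAddGroup.mk' (commSub p U))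

/-- The element `pᵏ` of the monoid of powers of `p`. -/
def powS (p : ℕ) (k : ℕ) : Submonoid.powers (p : ℤ) := ⟨(p : ℤ) ^ k, k, rfl⟩

theorem powS_smul {M : Type*} [AddCommGroup M] (k : ℕ) (m : M) : powS p k • m = p ^ k • m := by
  change ((p : ℤ) ^ k) • m = _
  rw [← Nat.cast_pow, natCast_zsmul]

/-- `m ↦ m / s` as a homomorphism. -/
def TBp.mkHom (s : Submonoid.powers (p : ℤ)) : TB p U →+ TBp p U :=
  AddMonoidHom.mk' (fun m => LocalizedModule.mk m s) fun _ _ => by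
    rw [LocalizedModule.mk_add_mk]
    exact (LocalizedModule.mk_cancel_common_left s s _).symm.trans
      (congrArg (LocalizedModule.mk · (s * s)) (zsmul_add _ _ (s : ℤ)))

theorem TBp.nsmul_mk (n : ℕ) (m : TB p U) (s : Submonoid.powers (p : ℤ)) :
    n • (LocalizedModule.mk m s : TBp p U) = LocalizedModule.mk (n • m) s :=
  (map_nsmul (TBp.mkHom s) n m).symm

theorem TBp.smul_injective (k : ℕ) {s t : TBp p U} (h : p ^ k • s = p ^ k • t) : s = t := by
  rw [← sub_eq_zero, ← nsmul_sub] at h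
  rw [← sub_eq_zero]
  generalize s - t = x at h
  induction x using LocalizedModule.induction_on with | _ m s
  rw [TBp.nsmul_mk, ← LocalizedModule.zero_mk s, LocalizedModule.mk_eq] at h
  obtain ⟨⟨_, j, rfl⟩, hu⟩ := h
  rw [← LocalizedModule.zero_mk s, LocalizedModule.mk_eq]
  refine ⟨⟨(p : ℤ) ^ j, j, rfl⟩ * powS p k, ?_⟩
  rw [smul_zero, smul_zero] at hu ⊢
  rw [mul_smul, smul_comm _ s m, powS_smul]
  exact hu

theorem TBp.exists_smul (k : ℕ) (t : TBp p U) : ∃ s, p ^ k • s = t := by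
  induction t using LocalizedModule.induction_on with | _ m s
  refine ⟨LocalizedModule.mk m (powS p k * s), ?_⟩
  rw [TBp.nsmul_mk]
  refine Eq.trans ?_ (LocalizedModule.mk_cancel_common_left (powS p k) s m)
  rw [powS_smul]

theorem TBp.exists_of (t : TBp p U) : ∃ (k : ℕ) (x : B p U), p ^ k • t = TBp.of p U x := by
  induction t using LocalizedModule.induction_on with | _ m s
  obtain ⟨_, k, rfl⟩ := s
  obtain ⟨x, rfl⟩ := QuotientAddGroup.mk_surjective m
  refine ⟨k, x, ?_⟩
  rw [TBp.nsmul_mk]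
  refine Eq.trans ?_ (LocalizedModule.mk_cancel (powS p k) _)
  rw [powS_smul]
  rfl

theorem TBp.of_eq_zero {x : B p U} (h : x ∈ commSub p U) : TBp.of p U x = 0 := by
  have : (QuotientAddGroup.mk' (commSub p U)) x = 0 := (QuotientAddGroup.eq_zero_iff x).2 h
  rw [TBp.of, AddMonoidHom.comp_apply, this, map_zero]

theorem TBp.of_mul_comm (x y : B p U) : TBp.of p U (x * y) = TBp.of p U (y * x) := by
  rw [← sub_eq_zero, ← map_sub]
  exact TBp.of_eq_zero (AddSubgroup.subset_closure ⟨x, y, rfl⟩)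

theorem TBp.map_of (f : B p U →+* B p V) (x : B p U) :
    TBp.map f (TBp.of p U x) = TBp.of p V (f x) := by
  change LocalizedModule.map (Submonoid.powers (p : ℤ)) _ (LocalizedModule.mkLinearMap _ _ _) = _
  rw [LocalizedModule.mkLinearMap_apply, LocalizedModule.map_mk]
  rfl

theorem BQ_smul_injective (k : ℕ) {s t : BQ p} (h : p ^ k • s = p ^ k • t) : s = t := by
  refine ((Module.End.isUnit_iff _).1 (isUnit_end_BQ (p := p) ⟨(p : ℤ) ^ k, k, rfl⟩)).1 ?_
  change ((p : ℤ) ^ k) • s = ((p : ℤ) ^ k) • t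
  rw [← Nat.cast_pow, natCast_zsmul, natCast_zsmul, h]

variable [IsTopologicalGroup U] [CompactSpace U] [IsTopologicalGroup V] [CompactSpace V]

instance OpenNormalSubgroup.finite_quot (N : OpenNormalSubgroup U) : Finite (U ⧸ N.toSubgroup) :=
  Subgroup.quotient_finite_of_isOpen _ N.isOpen'

variable (D : OneDim p U) (E : OneDim p V)

theorem twist_id {N N' : OpenNormalSubgroup U} (h : ∀ u ∈ N.toSubgroup, u ∈ N'.toSubgroup)
    (x : B p U) : B.twist D N' x =
      MonoidAlgebra.mapDomainRingHom _ (quotMap (MonoidHom.id U) N N' h) (B.twist D N x) := by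
  have ha : Adm p (MonoidHom.id U) := ⟨continuous_id, by
    have : (MonoidHom.id U).ker = ⊥ := (MonoidHom.ker_eq_bot_iff _).2 fun _ _ h => h
    rw [this]; infer_instance, fun u hu v => hu v⟩
  have := B.twist_map D D N N' (MonoidHom.id U) ha (fun _ => rfl) h x
  rwa [B.map_id] at this

/-- `trB` evaluates a class function at a chosen level. Any two levels can be compared at the
intersection N ⊓ N', so the choice does not matter. -/
theorem trFin_twist_eq {χ : U → QBar p} {N N' : OpenNormalSubgroup U}
    {χ₁ : U ⧸ N.toSubgroup → QBar p} {χ₂ : U ⧸ N'.toSubgroup → QBar p} (h₁ : ∀ u : U, χ u = χ₁ u)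
    (h₂ : ∀ u : U, χ u = χ₂ u) (x : B p U) :
    trFin χ₁ (B.twist D N x) = trFin χ₂ (B.twist D N' x) := by
  rw [twist_id D (N := N ⊓ N') (N' := N) (fun u hu => mem_inf_left hu),
    twist_id D (N := N ⊓ N') (N' := N') (fun u hu => mem_inf_right hu), trFin_mapDomain,
    trFin_mapDomain]
  congr 1
  refine congrArg trFin (funext fun c => ?_)
  induction c using QuotientGroup.induction_on with | H u => ?_
  rw [quotMap_mk, quotMap_mk, MonoidHom.id_apply, ← h₁, ← h₂]

theorem Tr_of {χ : U → QBar p} (h : IsClassFn χ) {N : OpenNormalSubgroup U}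
    {χ₁ : U ⧸ N.toSubgroup → QBar p} (h₁ : ∀ u : U, χ u = χ₁ u) (x : B p U) :
    Tr D (TBp.of p U x) χ = trFin χ₁ (B.twist D N x) := by
  rw [Tr, dif_pos h]
  change LocalizedModule.lift (Submonoid.powers (p : ℤ)) (trB D h).toIntLinearMap isUnit_end_BQ
    (LocalizedModule.mkLinearMap _ _ _) = _
  rw [LocalizedModule.mkLinearMap_apply, LocalizedModule.lift_mk_one]
  change trFin h.smooth.choose_spec.choose (B.twist D h.smooth.choose x) = _
  exact trFin_twist_eq D h.smooth.choose_spec.choose_spec h₁ x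

theorem Tr_add (s t : TBp p U) (χ : U → QBar p) : Tr D (s + t) χ = Tr D s χ + Tr D t χ := by
  unfold Tr
  split_ifs
  · rw [map_add]
  · rw [add_zero]

/-- `Tr(·)(χ)` as a homomorphism. -/
def TrHom (χ : U → QBar p) : TBp p U →+ BQ p := AddMonoidHom.mk' (fun t => Tr D t χ) fun s t => Tr_add D s t χ

theorem TrHom_apply (χ : U → QBar p) (t : TBp p U) : TrHom D χ t = Tr D t χ := rfl

theorem IsClassFn.add {χ χ' : U → QBar p} (h : IsClassFn χ) (h' : IsClassFn χ') :
    IsClassFn (χ + χ') := by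
  refine ⟨fun u v => by rw [Pi.add_apply, Pi.add_apply, h.conj, h'.conj], ?_⟩
  obtain ⟨N, f, hf⟩ := h.smooth
  obtain ⟨N', f', hf'⟩ := h'.smooth
  refine ⟨N ⊓ N', fun c => f (quotMap (MonoidHom.id U) (N ⊓ N') N (fun u hu => mem_inf_left hu) c) +
    f' (quotMap (MonoidHom.id U) (N ⊓ N') N' (fun u hu => mem_inf_right hu) c), fun u => ?_⟩
  beta_reduce
  rw [quotMap_mk, quotMap_mk, Pi.add_apply, hf, hf']; rfl

theorem IsClassFn.neg {χ : U → QBar p} (h : IsClassFn χ) : IsClassFn (-χ) := by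
  refine ⟨fun u v => by rw [Pi.neg_apply, Pi.neg_apply, h.conj], ?_⟩
  obtain ⟨N, f, hf⟩ := h.smooth
  exact ⟨N, fun c => - f c, fun u => by rw [Pi.neg_apply, hf]⟩

theorem IsClassFn.zero : IsClassFn (0 : U → QBar p) := by
  refine ⟨fun u v => rfl, { toOpenSubgroup := ⊤, isNormal' := inferInstanceAs (⊤ : Subgroup U).Normal }, 0, fun u => rfl⟩

theorem IsClassFn.comp {χ : V → QBar p} (h : IsClassFn χ) (f : U →* V) (hf : Continuous f) :
    IsClassFn (χ ∘ f) := by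
  refine ⟨fun u v => by simp only [Function.comp_apply, map_mul, h.conj], ?_⟩
  obtain ⟨N, g, hg⟩ := h.smooth
  refine ⟨comapON f hf N, fun c => g (quotMap f _ N (fun u => (mem_comapON f hf N u).1) c),
    fun u => ?_⟩
  beta_reduce
  rw [quotMap_mk, Function.comp_apply, hg]

theorem Tr_add_right (t : TBp p U) {χ χ' : U → QBar p} (h : IsClassFn χ) (h' : IsClassFn χ') :
    Tr D t (χ + χ') = Tr D t χ + Tr D t χ' := by
  obtain ⟨k, x, hx⟩ := TBp.exists_of t
  refine BQ_smul_injective k ?_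
  rw [smul_add, ← TrHom_apply, ← TrHom_apply, ← TrHom_apply, ← map_nsmul, ← map_nsmul, ← map_nsmul, hx]
  simp only [TrHom_apply]
  obtain ⟨N, f, hf⟩ := h.smooth
  obtain ⟨N', f', hf'⟩ := h'.smooth
  obtain ⟨g, e1⟩ : ∃ g : U ⧸ (N ⊓ N').toSubgroup → QBar p, ∀ u : U, χ u = g u :=
    ⟨fun c => f (quotMap (MonoidHom.id U) (N ⊓ N') N (fun u hu => mem_inf_left hu) c), fun u => by beta_reduce; rw [quotMap_mk, hf]; rfl⟩
  obtain ⟨g', e2⟩ : ∃ g : U ⧸ (N ⊓ N').toSubgroup → QBar p, ∀ u : U, χ' u = g u :=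
    ⟨fun c => f' (quotMap (MonoidHom.id U) (N ⊓ N') N' (fun u hu => mem_inf_right hu) c), fun u => by beta_reduce; rw [quotMap_mk, hf']; rfl⟩
  rw [Tr_of D h e1, Tr_of D h' e2, ← trFin_add]
  exact Tr_of D (h.add h') (fun u => by rw [Pi.add_apply, e1, e2]) x

theorem Tr_zero_right (t : TBp p U) : Tr D t 0 = 0 := by
  have := Tr_add_right D t (IsClassFn.zero (p := p)) IsClassFn.zero
  rwa [add_zero, left_eq_add] at this

theorem Tr_neg_right (t : TBp p U) {χ : U → QBar p} (h : IsClassFn χ) : Tr D t (-χ) = - Tr D t χ := by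
  have := Tr_add_right D t h h.neg
  rw [add_neg_cancel, Tr_zero_right] at this
  exact (neg_eq_of_add_eq_zero_right this.symm).symm

theorem Tr_map (f : U →* V) (hf : Adm p f) (hp : ∀ u, E.proj (f u) = D.proj u) (t : TBp p U)
    {χ : V → QBar p} (h : IsClassFn χ) : Tr E (TBp.map (B.map f hf) t) χ = Tr D t (χ ∘ f) := by
  obtain ⟨k, x, hx⟩ := TBp.exists_of t
  refine BQ_smul_injective k ?_
  rw [← TrHom_apply, ← TrHom_apply, ← map_nsmul, ← map_nsmul, ← map_nsmul, hx, TBp.map_of]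
  obtain ⟨N, g, hg⟩ := h.smooth
  rw [TrHom_apply, TrHom_apply, Tr_of E h hg, B.twist_map D E (comapON f hf.cont N) N f hf hp
    fun u => (mem_comapON f hf.cont N u).1, trFin_mapDomain]
  refine (Tr_of D (h.comp f hf.cont) (fun u => ?_) x).symm
  rw [quotMap_mk, Function.comp_apply, hg]

theorem Chr.isClassFn (φ : Chr p U) : IsClassFn φ.toFun := by
  refine ⟨fun u v => by rw [Chr.toFun, Chr.toFun, map_mul, map_mul, mul_comm], φ.kerON,
    fun c => ((QuotientGroup.kerLift φ.toHom c : ZBar p) : QBar p), fun u => rfl⟩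

theorem toBQ_tmul (a : ZBar p) (b : B p (Gam p)) :
    toBQ p (a ⊗ₜ[ℤ_[p]] b) = (a : QBar p) ⊗ₜ[ℤ_[p]] b := rfl

/-- Both sides are induced by u ↦ φ(u)ū. This is the bridge that turns logarithms of determinants
into traces. -/
theorem Tr_of_chr (φ : Chr p U) (x : B p U) :
    Tr D (TBp.of p U x) φ.toFun = toBQ p (detChr D φ x) := by
  rw [Tr_of D φ.isClassFn (N := φ.kerON)
    (χ₁ := fun c => ((QuotientGroup.kerLift φ.toHom c : ZBar p) : QBar p)) (fun u => rfl)]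
  change _ = toBQ p (MonoidAlgebra.liftNCRingHom _ _ (fun _ _ => Commute.all _ _) (B.twist D φ.kerON x))
  generalize B.twist D φ.kerON x = y
  induction y using MonoidAlgebra.induction_linear with
  | zero => simp only [map_zero]
  | add a b ha hb => simp only [map_add, ha, hb]
  | single c r =>
    rw [trFin_single]
    change _ = toBQ p (MonoidAlgebra.liftNC _ _ _)
    rw [MonoidAlgebra.liftNC_single]
    change _ = toBQ p (((1 : ZBar p) ⊗ₜ[ℤ_[p]] r) * ((QuotientGroup.kerLift φ.toHom c : ZBar p) ⊗ₜ[ℤ_[p]] 1))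
    rw [Algebra.TensorProduct.tmul_mul_tmul, one_mul, mul_one, toBQ_tmul]

/-- Restriction of the projection along a homomorphism with finite kernel. -/
def OneDim.comp (D : OneDim p V) (f : U →* V) (hf : Continuous f) (hk : Finite f.ker) : OneDim p U where
  proj := D.proj.comp f
  cont := D.cont.comp hf
  fin := by
    have := D.fin
    have := hk
    have e : (D.proj.comp f).ker = D.proj.ker.comap f := rfl
    rw [e]
    refine Set.Finite.preimage' (f := f) (s := (D.proj.ker : Set V)) (Set.toFinite _) ?_
    intro v hv
    by_cases hx : ∃ u, f u = v
    · obtain ⟨u, rfl⟩ := hx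
      refine ((Set.toFinite (f.ker : Set U)).image (fun k => u * k)).subset fun w hw => ?_
      refine ⟨u⁻¹ * w, ?_, mul_inv_cancel_left u w⟩
      change f (u⁻¹ * w) = 1
      rw [map_mul, map_inv, show f w = f u from hw, inv_mul_cancel]
    · convert Set.finite_empty
      refine Set.eq_empty_of_forall_notMem fun w hw => hx ⟨w, hw⟩

/-- Elements f(b)·v, with f a central section and v a coset representative, span B of the group.
This formula for one summand is what allows traces on two different groups to be compared term by
term. -/
theorem Tr_of_map_mul_grp (f : U →* V) (hf : Adm p f) (b : B p U) (v : V)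
    {χ : V → QBar p} (h : IsClassFn χ) (h' : IsClassFn fun u => χ (f u * v)) :
    Tr E (TBp.of p V (B.map f hf b * B.grp p v)) χ =
      Tr (E.comp f hf.cont hf.fin) (TBp.of p U b) (fun u => χ (f u * v)) *
        ((1 : QBar p) ⊗ₜ[ℤ_[p]] B.grp p (E.proj v)) := by
  obtain ⟨N, g, hg⟩ := h.smooth
  rw [Tr_of E h hg, map_mul, B.twist_grp, trFin_mul_single,
    B.twist_map (E.comp f hf.cont hf.fin) E (comapON f hf.cont N) N f hf (fun _ => rfl)
      fun u => (mem_comapON f hf.cont N u).1, trFin_mapDomain]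
  congr 1
  refine (Tr_of _ h' (fun u => ?_) b).symm
  rw [quotMap_mk, hg]
  rfl

theorem detChr_map (f : U →* V) (hf : Adm p f) (hp : ∀ u, E.proj (f u) = D.proj u) (φ : Chr p V)
    (x : B p U) : detChr E φ (B.map f hf x) = detChr D (φ.comp f hf.cont) x := by
  change MonoidAlgebra.liftNCRingHom _ _ (fun _ _ => Commute.all _ _) (B.twist E φ.kerON _) =
    MonoidAlgebra.liftNCRingHom _ _ (fun _ _ => Commute.all _ _) (B.twist D (φ.comp f hf.cont).kerON x)
  rw [B.twist_map D E (φ.comp f hf.cont).kerON φ.kerON f hf hp fun u hu => hu]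
  generalize B.twist D (φ.comp f hf.cont).kerON x = y
  induction y using MonoidAlgebra.induction_linear with
  | zero => simp only [map_zero]
  | add a b ha hb => simp only [map_add, ha, hb]
  | single c r =>
    induction c using QuotientGroup.induction_on with | H u => ?_
    rw [MonoidAlgebra.mapDomainRingHom_apply, MonoidAlgebra.mapDomain_single]
    change MonoidAlgebra.liftNC _ _ _ = MonoidAlgebra.liftNC _ _ _
    rw [MonoidAlgebra.liftNC_single, MonoidAlgebra.liftNC_single]
    rfl

end TraceLemmas

/-! ### B(U) as a finitely generated module over the image of B(Γ) under a central section. -/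

section Decomposition

variable {p : ℕ} [Fact p.Prime]

/-- In additive notation the set is p^k ℤ_p, a closed ball, and closed balls of positive radius are
open in an ultrametric space. -/
theorem isOpen_powRange (k : ℕ) : IsOpen (Set.range fun g : Gam p => g ^ p ^ k) := by
  have h : (Set.range fun g : Gam p => g ^ p ^ k) =
      Multiplicative.toAdd ⁻¹' Metric.closedBall (0 : ℤ_[p]) ((p : ℝ) ^ (-k : ℤ)) := by
    ext g
    rw [Set.mem_preimage, mem_closedBall_zero_iff, PadicInt.norm_le_pow_iff_mem_span_pow,
      Ideal.mem_span_singleton']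
    constructor
    · rintro ⟨h, rfl⟩
      refine ⟨Multiplicative.toAdd h, ?_⟩
      change _ = p ^ k • Multiplicative.toAdd h
      rw [nsmul_eq_mul, Nat.cast_pow, mul_comm]
    · rintro ⟨a, ha⟩
      refine ⟨Multiplicative.ofAdd a, ?_⟩
      refine Multiplicative.toAdd.injective ?_
      change p ^ k • a = _
      rw [nsmul_eq_mul, Nat.cast_pow, mul_comm, ha]
  rw [h]
  exact (IsUltrametricDist.isOpen_closedBall _ (by
    have := (Fact.out : p.Prime).pos
    positivity)).preimage continuous_toAdd

variable {U V : Type*} [Group U] [TopologicalSpace U] [Group V] [TopologicalSpace V]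

/-- A central open subgroup of `U` isomorphic to `Γ`, on which the projection to `Γ` is
`γ ↦ γ ^ p ^ j`. -/
structure CenSec (D : OneDim p U) where
  z : Gam p →* U
  cont : Continuous z
  central : ∀ g u, z g * u = u * z g
  isOpen_range : IsOpen (Set.range z)
  j : ℕ
  proj_z : ∀ g, D.proj (z g) = g ^ p ^ j

namespace CenSec

variable {D : OneDim p U} (Z : CenSec D)

theorem injective : Function.Injective Z.z := by
  refine (injective_iff_map_eq_one _).2 fun g hg => ?_
  refine gam_torsionFree g (p ^ Z.j) (pow_ne_zero _ (Fact.out : p.Prime).ne_zero) ?_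
  rw [← Z.proj_z, hg, map_one]

theorem adm : Adm p Z.z where
  cont := Z.cont
  fin := by rw [(MonoidHom.ker_eq_bot_iff _).2 Z.injective]; infer_instance
  central g _ u := Z.central g u

variable [IsTopologicalGroup U] [CompactSpace U]

/-- The image of an open subgroup of `Γ`. -/
def img (M : OpenNormalSubgroup (Gam p)) : OpenNormalSubgroup U where
  toSubgroup := M.toSubgroup.map Z.z
  isOpen' := by
    -- On z(Γ) the projection is the injective map γ ↦ γ^(p^j), so z(M) is cut out inside z(Γ) by
    -- its image M^(p^j) in Γ.
    have e : (M.toSubgroup.map Z.z : Set U) =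
        Set.range Z.z ∩ D.proj ⁻¹' ((M.toSubgroup.map (powMonoidHom (p ^ Z.j)) : Subgroup (Gam p)) : Set (Gam p)) := by
      ext u
      constructor
      · rintro ⟨g, hg, rfl⟩
        exact ⟨⟨g, rfl⟩, g, hg, (Z.proj_z g).symm⟩
      · rintro ⟨⟨g, rfl⟩, h, hh, hg⟩
        refine ⟨g, ?_, rfl⟩
        have : h = g := by
          rw [Z.proj_z] at hg
          have h1 : (h / g) ^ p ^ Z.j = 1 := by
            rw [div_pow, div_eq_one]; exact hg
          exact div_eq_one.1 (gam_torsionFree _ _ (pow_ne_zero _ (Fact.out : p.Prime).ne_zero) h1)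
        exact this ▸ hh
    change IsOpen (M.toSubgroup.map Z.z : Set U)
    rw [e]
    refine Z.isOpen_range.inter (IsOpen.preimage D.cont ?_)
    -- M contains Γ^(p^k), so M^(p^j) contains the open set Γ^(p^(k+j)).
    obtain ⟨k, hk⟩ := exists_pow_mem (MonoidHom.id (Gam p)) continuous_id M
    refine Subgroup.isOpen_of_mem_nhds _ (g := 1) (Filter.mem_of_superset
      ((isOpen_powRange (k + Z.j)).mem_nhds ⟨1, one_pow _⟩) ?_)
    rintro _ ⟨g, rfl⟩
    refine ⟨g ^ p ^ k, hk g, ?_⟩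
    change (g ^ p ^ k) ^ p ^ Z.j = _
    rw [← pow_mul, ← pow_add]
  isNormal' := ⟨by
    rintro _ ⟨g, hg, rfl⟩ u
    refine ⟨g, hg, ?_⟩
    rw [← Z.central, mul_inv_cancel_right]⟩

theorem mem_img {M : OpenNormalSubgroup (Gam p)} {u : U} :
    u ∈ (Z.img M).toSubgroup ↔ ∃ g ∈ M.toSubgroup, Z.z g = u := Iff.rfl

theorem z_mem_img {M : OpenNormalSubgroup (Gam p)} {g : Gam p} :
    Z.z g ∈ (Z.img M).toSubgroup ↔ g ∈ M.toSubgroup :=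
  ⟨fun ⟨_, hh, e⟩ => Z.injective e ▸ hh, fun h => ⟨g, h, rfl⟩⟩

/-- The open subgroup `z(Γ)`. -/
def top : OpenNormalSubgroup U := Z.img { toOpenSubgroup := ⊤, isNormal' := inferInstanceAs (⊤ : Subgroup (Gam p)).Normal }

theorem mem_top {u : U} : u ∈ Z.top.toSubgroup ↔ ∃ g, Z.z g = u :=
  ⟨fun ⟨g, _, e⟩ => ⟨g, e⟩, fun ⟨g, e⟩ => ⟨g, trivial, e⟩⟩

/-- The inverse of `z` on `z(Γ)`. -/
def inv (u : U) : Gam p := Function.invFun Z.z u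

theorem inv_z (g : Gam p) : Z.inv (Z.z g) = g := Function.leftInverse_invFun Z.injective g

theorem z_inv {u : U} (h : u ∈ Z.top.toSubgroup) : Z.z (Z.inv u) = u := by
  obtain ⟨g, rfl⟩ := Z.mem_top.1 h
  rw [inv_z]

theorem exists_out (u : U) : ∃ g, u = Z.z g * (QuotientGroup.mk u : U ⧸ Z.top.toSubgroup).out := by
  have h : (QuotientGroup.mk u : U ⧸ Z.top.toSubgroup) =
      QuotientGroup.mk (QuotientGroup.mk u : U ⧸ Z.top.toSubgroup).out := (Quotient.out_eq' _).symm
  obtain ⟨g, hg⟩ := Z.mem_top.1 (QuotientGroup.eq.1 h)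
  refine ⟨g⁻¹, ?_⟩
  rw [map_inv, eq_inv_mul_iff_mul_eq, Z.central, hg, mul_inv_cancel_left]

open Classical in
/-- The map `U/z(M) → ℤ_p[Γ/M]` that is `z(g)c ↦ g` on the coset of `c` and zero elsewhere. -/
def coordFun (c : U ⧸ Z.top.toSubgroup) (M : OpenNormalSubgroup (Gam p)) :
    U ⧸ (Z.img M).toSubgroup → MonoidAlgebra ℤ_[p] (Gam p ⧸ M.toSubgroup) :=
  Quotient.lift (fun u : U => if QuotientGroup.mk u = c then
    MonoidAlgebra.single (QuotientGroup.mk (Z.inv (u * c.out⁻¹))) 1 else 0) (by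
      intro u v huv
      obtain ⟨m, hm, e⟩ := (Z.mem_img).1 (QuotientGroup.leftRel_apply.1 huv)
      have hv : v = Z.z m * u := by rw [Z.central, e, mul_inv_cancel_left]
      have hc : (QuotientGroup.mk v : U ⧸ Z.top.toSubgroup) = QuotientGroup.mk u :=
        (QuotientGroup.eq.2 (Z.mem_top.2 ⟨m, e⟩)).symm
      beta_reduce
      rw [hc]
      split_ifs with h
      · obtain ⟨g, hg⟩ := Z.exists_out u
        rw [h] at hg
        have e1 : u * c.out⁻¹ = Z.z g := by
          conv_lhs => rw [hg]
          rw [mul_inv_cancel_right]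
        rw [hv, mul_assoc, e1, ← map_mul, Z.inv_z, Z.inv_z]
        congr 1
        refine QuotientGroup.eq.2 ?_
        rw [mul_comm m g, inv_mul_cancel_left]
        exact hm
      · rfl)

theorem coordFun_mk (M : OpenNormalSubgroup (Gam p)) (c : U ⧸ Z.top.toSubgroup) (g : Gam p) :
    Z.coordFun c M (QuotientGroup.mk (Z.z g * c.out)) =
      MonoidAlgebra.single (QuotientGroup.mk g) 1 := by
  have h : (QuotientGroup.mk (Z.z g * c.out) : U ⧸ Z.top.toSubgroup) = c := by
    conv_rhs => rw [← Quotient.out_eq' c]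
    refine QuotientGroup.eq.2 (Z.mem_top.2 ⟨g⁻¹, ?_⟩)
    rw [mul_inv_rev, mul_assoc, ← map_inv, Z.central, inv_mul_cancel_left]
  refine (if_pos h).trans ?_
  rw [mul_inv_cancel_right, Z.inv_z]

theorem coordFun_mk_of_ne (M : OpenNormalSubgroup (Gam p)) (c : U ⧸ Z.top.toSubgroup) (u : U)
    (h : QuotientGroup.mk u ≠ c) : Z.coordFun c M (QuotientGroup.mk u) = 0 := if_neg h

/-- The `ℤ_p`-linear extension of `coordFun`. -/
def coordLin (c : U ⧸ Z.top.toSubgroup) (M : OpenNormalSubgroup (Gam p)) :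
    MonoidAlgebra ℤ_[p] (U ⧸ (Z.img M).toSubgroup) →+ MonoidAlgebra ℤ_[p] (Gam p ⧸ M.toSubgroup) :=
  MonoidAlgebra.liftNC (MonoidAlgebra.singleOneRingHom : ℤ_[p] →+* _).toAddMonoidHom (Z.coordFun c M)

theorem coordLin_single (c : U ⧸ Z.top.toSubgroup) (M : OpenNormalSubgroup (Gam p)) (u : U) (r : ℤ_[p]) :
    Z.coordLin c M (MonoidAlgebra.single (QuotientGroup.mk u) r) =
      MonoidAlgebra.single 1 r * Z.coordFun c M (QuotientGroup.mk u) := MonoidAlgebra.liftNC_single _ _ _ _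

theorem img_mono {M M' : OpenNormalSubgroup (Gam p)} (h : ∀ u ∈ M.toSubgroup, u ∈ M'.toSubgroup) :
    ∀ u ∈ (Z.img M).toSubgroup, u ∈ (Z.img M').toSubgroup := fun _ ⟨g, hg, e⟩ => ⟨g, h g hg, e⟩

/-- The coordinate of an element of `Λ(U)` at the coset `c`. -/
def coord (c : U ⧸ Z.top.toSubgroup) (x : Lam p U) : Lam p (Gam p) :=
  ⟨fun M => Z.coordLin c M (x.1 (Z.img M)), fun M M' h => by
    beta_reduce
    rw [← x.2 (Z.img M) (Z.img M') (Z.img_mono h)]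
    generalize x.1 (Z.img M) = y
    induction y using MonoidAlgebra.induction_linear with
    | zero => simp only [map_zero]
    | add a b ha hb => simp only [map_add, ha, hb]
    | single u r =>
      induction u using QuotientGroup.induction_on with | H u => ?_
      rw [MonoidAlgebra.mapDomainRingHom_apply ℤ_[p] (quotMap (MonoidHom.id U) _ _ (Z.img_mono h)),
        MonoidAlgebra.mapDomain_single, quotMap_mk, MonoidHom.id_apply, coordLin_single,
        coordLin_single]
      by_cases hu : QuotientGroup.mk u = c
      · obtain ⟨g, hg⟩ := Z.exists_out u
        rw [hu] at hg
        rw [hg, coordFun_mk, coordFun_mk, map_mul]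
        simp only [MonoidAlgebra.mapDomainRingHom_apply, MonoidAlgebra.mapDomain_single, map_one,
          quotMap_mk, MonoidHom.id_apply]
      · rw [coordFun_mk_of_ne _ _ _ _ hu, coordFun_mk_of_ne _ _ _ _ hu, mul_zero, mul_zero, map_zero]⟩

instance : Fintype (U ⧸ Z.top.toSubgroup) := Fintype.ofFinite _

/-- At level N both sides are computed from the finer level z(z⁻¹N), where the coordinates live. On
a single group element u only the summand of the coset of u survives, and it reads u = z(g)·c. -/
theorem sum_coord (x : Lam p U) :
    x = ∑ c : U ⧸ Z.top.toSubgroup, Lam.map p Z.z Z.cont (Z.coord c x) * Lam.grp p c.out := by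
  refine Subtype.ext (funext fun N => ?_)
  have e0 : ∀ f : U ⧸ Z.top.toSubgroup → Lam p U, (∑ c, f c).1 N = ∑ c, (f c).1 N := fun f =>
    map_sum ((Pi.evalRingHom _ N).comp (Lam p U).subtype) f Finset.univ
  rw [e0]
  have hN : ∀ u ∈ (Z.img (comapON Z.z Z.cont N)).toSubgroup, u ∈ N.toSubgroup := by
    rintro _ ⟨g, hg, rfl⟩
    exact hg
  have e1 : ∀ c : U ⧸ Z.top.toSubgroup, (Lam.map p Z.z Z.cont (Z.coord c x) * Lam.grp p c.out).1 N =
      MonoidAlgebra.mapDomainRingHom ℤ_[p] (quotMap Z.z (comapON Z.z Z.cont N) N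
        fun u => (mem_comapON Z.z Z.cont N u).1)
        (Z.coordLin c (comapON Z.z Z.cont N) (x.1 (Z.img (comapON Z.z Z.cont N)))) *
        MonoidAlgebra.single (QuotientGroup.mk c.out) 1 := fun c => rfl
  simp_rw [e1]
  rw [← x.2 (Z.img (comapON Z.z Z.cont N)) N hN]
  generalize x.1 (Z.img (comapON Z.z Z.cont N)) = y
  induction y using MonoidAlgebra.induction_linear with
  | zero => simp only [map_zero, zero_mul, Finset.sum_const_zero]
  | add a b ha hb => simp only [map_add, ha, hb, add_mul, Finset.sum_add_distrib]
  | single u r =>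
    induction u using QuotientGroup.induction_on with | H u => ?_
    rw [MonoidAlgebra.mapDomainRingHom_apply ℤ_[p] (quotMap (MonoidHom.id U) _ _ hN),
        MonoidAlgebra.mapDomain_single, quotMap_mk, MonoidHom.id_apply,
        Finset.sum_eq_single (QuotientGroup.mk u : U ⧸ Z.top.toSubgroup)]
    · obtain ⟨g, hg⟩ := Z.exists_out u
      rw [coordLin_single]
      generalize (QuotientGroup.mk u : U ⧸ Z.top.toSubgroup) = c at hg
      rw [hg, coordFun_mk, map_mul]
      simp only [MonoidAlgebra.mapDomainRingHom_apply, MonoidAlgebra.mapDomain_single, map_one,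
          quotMap_mk, MonoidAlgebra.single_mul_single, mul_one, one_mul]
      rfl
    · intro c _ hc
      rw [coordLin_single, coordFun_mk_of_ne _ _ _ _ hc.symm, mul_zero, map_zero, zero_mul]
    · exact fun h => absurd (Finset.mem_univ _) h

/-- Monomials `z(r)u` modulo `p`. -/
def monomials : Submonoid (LamS p U ⧸ pId p (LamS p U) 1) where
  carrier := {x | ∃ (r : LamS p (Gam p)) (u : U),
    x = Ideal.Quotient.mk _ (LamS.map Z.z Z.adm r * LamS.of p U (Lam.grp p u))}
  one_mem' := ⟨1, 1, by rw [map_one, map_one, map_one, one_mul, map_one]⟩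
  mul_mem' := by
    rintro _ _ ⟨r, u, rfl⟩ ⟨r', u', rfl⟩
    refine ⟨r * r', u * u', ?_⟩
    -- Conjugation by u fixes z(Λ(Γ)) pointwise. Since it is a ring automorphism, the universal
    -- property extends this to the localisation.
    have hc : LamS.of p U (Lam.grp p u) * LamS.map Z.z Z.adm r' =
        LamS.map Z.z Z.adm r' * LamS.of p U (Lam.grp p u) := by
      have hc' : (MulSemiringAction.toRingHom (ConjAct (LamS p U)ˣ) (LamS p U)
          (ConjAct.toConjAct (((Group.isUnit u).map (Lam.grp p)).map (LamS.of p U)).unit)).comp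
          (LamS.map Z.z Z.adm) = LamS.map Z.z Z.adm := by
        refine LamS.hom_ext fun x => ?_
        have e : LamS.map Z.z Z.adm (LamS.of p _ x) = LamS.of p U (Lam.map p Z.z Z.cont x) := LamS.lift_of _ _ x
        rw [RingHom.comp_apply, e, MulSemiringAction.toRingHom_apply, ConjAct.units_smul_def,
          ConjAct.ofConjAct_toConjAct, Units.mul_inv_eq_iff_eq_mul, IsUnit.unit_spec, ← map_mul, ← map_mul,
          Lam.map_comm Z.z Z.cont Z.central]
      have := RingHom.congr_fun hc' r'
      rwa [RingHom.comp_apply, MulSemiringAction.toRingHom_apply, ConjAct.units_smul_def,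
          ConjAct.ofConjAct_toConjAct, Units.mul_inv_eq_iff_eq_mul, IsUnit.unit_spec] at this
    rw [← map_mul, map_mul (LamS.map _ _), map_mul (Lam.grp p), map_mul (LamS.of p U), mul_assoc, ← mul_assoc (LamS.of p U _),
      hc]
    simp only [mul_assoc]

/-- The localisation inverts elements coming from every central copy of ℤ_p, not just from z(Γ). A
p-power of any such copy lies in the open subgroup z(Γ), so it factors through z. -/
theorem exists_factor (z' : Gam p →* U) (hz : Continuous z') : ∃ (k : ℕ) (w : Gam p →* Gam p),
    Continuous w ∧ ∀ g, Z.z (w g) = z' (g ^ p ^ k) := by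
  obtain ⟨k, hk⟩ := exists_pow_mem z' hz Z.top
  refine ⟨k, MonoidHom.mk' (fun g => Z.inv (z' (g ^ p ^ k))) fun a b => Z.injective ?_, ?_,
    fun g => Z.z_inv (hk g)⟩
  · rw [map_mul, Z.z_inv (hk _), Z.z_inv (hk _), Z.z_inv (hk _), mul_pow, map_mul]
  · refine continuous_of_continuousAt_one _ ?_
    rw [ContinuousAt, map_one]
    intro O hO
    obtain ⟨O', hO', ho, h1⟩ := mem_nhds_iff.1 hO
    obtain ⟨M, hM⟩ := ProfiniteGrp.exist_openNormalSubgroup_sub_open_nhds_of_one ho h1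
    refine Filter.mem_map.2 (Filter.mem_of_superset (((Z.img M).isOpen'.preimage (hz.comp (continuous_pow (p ^ k)))).mem_nhds
      (x := 1) ?_) ?_)
    · change z' (1 ^ p ^ k) ∈ (Z.img M).toSubgroup
      rw [one_pow, map_one]
      exact one_mem _
    · intro g hg
      have hg : z' (g ^ p ^ k) ∈ (Z.img M).toSubgroup := hg
      rw [← Z.z_inv (hk g), Z.z_mem_img] at hg
      exact hO' (hM hg)

/-- The point is that no new denominators are needed modulo p. For s in Λ(Γ) ∖ p and another central
z', the Frobenius congruence gives z'(s)^(p^k) ≡ z(w(s)), which is a unit already in the image of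
Λ(Γ)_(p). So the subring spanned by monomials contains all required inverses, and the universal
property of the localisation maps into it. -/
theorem mk_mem_closure (a : LamS p U) :
    Ideal.Quotient.mk (pId p (LamS p U) 1) a ∈ Subring.closure (Z.monomials : Set _) := by
  set S := Subring.closure (Z.monomials : Set (LamS p U ⧸ pId p (LamS p U) 1))
  have hz : ∀ r, Ideal.Quotient.mk (pId p (LamS p U) 1) (LamS.map Z.z Z.adm r) ∈ S := fun r =>
    Subring.subset_closure ⟨r, 1, by rw [map_one, map_one, mul_one]⟩
  have hzof : ∀ x, LamS.map Z.z Z.adm (LamS.of p _ x) = LamS.of p U (Lam.map p Z.z Z.cont x) :=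
    fun x => LamS.lift_of _ _ x
  have h1 : ∀ x, Ideal.Quotient.mk (pId p (LamS p U) 1) (LamS.of p U x) ∈ S := by
    intro x
    rw [Z.sum_coord x, map_sum, map_sum]
    refine Subring.sum_mem _ fun c _ => Subring.subset_closure ⟨LamS.of p _ (Z.coord c x), c.out, ?_⟩
    rw [hzof, map_mul]
  let f : Lam p U →+* S := ((Ideal.Quotient.mk (pId p (LamS p U) 1)).comp (LamS.of p U)).codRestrict S h1
  have hf : ∀ s ∈ canonSet p U, IsUnit (f s) := by
    rintro _ ⟨z', hz', s, hi, hc, hs, rfl⟩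
    obtain ⟨k, w, hw, hwz⟩ := Z.exists_factor z' hz'
    obtain ⟨y, hy⟩ := frob_Lam s k
    rw [← isUnit_pow_iff (pow_ne_zero k (Fact.out : p.Prime).ne_zero)]
    have hu : IsUnit (LamS.of p (Gam p) (Lam.map p w hw s)) := by
      refine LamS.isUnit_of _ (Submonoid.subset_closure ⟨w, hw, s, ?_, fun _ _ => mul_comm _ _, hs, rfl⟩)
      refine (injective_iff_map_eq_one w).2 fun g hg => ?_
      refine gam_torsionFree g _ (pow_ne_zero k (Fact.out : p.Prime).ne_zero) (hi ?_)
      rw [← hwz, hg, map_one, map_one]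
    have hu' := hu.map (((Ideal.Quotient.mk (pId p (LamS p U) 1)).comp (LamS.map Z.z Z.adm)).codRestrict S hz)
    convert hu' using 1
    refine Subtype.ext ?_
    change (Ideal.Quotient.mk (pId p (LamS p U) 1) (LamS.of p U (Lam.map p z' hz' s))) ^ p ^ k =
      Ideal.Quotient.mk (pId p (LamS p U) 1) (LamS.map Z.z Z.adm (LamS.of p (Gam p) (Lam.map p w hw s)))
    rw [← map_pow, ← map_pow, ← map_pow, hy, hzof, Lam.map_comp, map_add, Lam.map_comp, map_mul,
      map_natCast, map_add, map_mul, map_natCast, map_add]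
    have e0 : (Ideal.Quotient.mk (pId p (LamS p U) 1)) ((p : LamS p U) * LamS.of p U (Lam.map p z' hz' y)) = 0 := by
      refine Ideal.Quotient.eq_zero_iff_mem.2 ?_
      have := pow_mem_pId' (p := p) 1 (LamS.of p U (Lam.map p z' hz' y))
      rwa [pow_one] at this
    have e1 : Z.z.comp w = z'.comp (powMonoidHom (p ^ k)) := MonoidHom.ext hwz
    rw [e0, add_zero]
    simp only [e1]
  -- The lift to the subring followed by the inclusion agrees with reduction modulo p on Λ(U), hence
  -- everywhere. Thus the reduction takes values in the subring.
  have h2 : (S.subtype.comp (LamS.lift f hf)) = Ideal.Quotient.mk (pId p (LamS p U) 1) := by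
    refine LamS.hom_ext fun x => ?_
    rw [RingHom.comp_apply, LamS.lift_of]
    rfl
  rw [← h2]
  exact (LamS.lift f hf a).2

theorem exists_coord_mod (a : LamS p U) : ∃ r : U ⧸ Z.top.toSubgroup → LamS p (Gam p),
    a - ∑ c, LamS.map Z.z Z.adm (r c) * LamS.of p U (Lam.grp p c.out) ∈ pId p (LamS p U) 1 := by
  have hzof : ∀ x, LamS.map Z.z Z.adm (LamS.of p _ x) = LamS.of p U (Lam.map p Z.z Z.cont x) :=
    fun x => LamS.lift_of _ _ x
  suffices h : ∃ r : U ⧸ Z.top.toSubgroup → LamS p (Gam p), Ideal.Quotient.mk (pId p (LamS p U) 1) a =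
      Ideal.Quotient.mk (pId p (LamS p U) 1) (∑ c, LamS.map Z.z Z.adm (r c) * LamS.of p U (Lam.grp p c.out)) by
    obtain ⟨r, hr⟩ := h
    exact ⟨r, Ideal.Quotient.eq.1 hr⟩
  have h := Z.mk_mem_closure a
  generalize Ideal.Quotient.mk (pId p (LamS p U) 1) a = x at h
  rw [Subring.mem_closure_iff, Submonoid.closure_eq] at h
  classical
  induction h using AddSubgroup.closure_induction with
  | mem x hx =>
    obtain ⟨r, u, rfl⟩ := hx
    obtain ⟨g, hg⟩ := Z.exists_out u
    refine ⟨Pi.single (QuotientGroup.mk u) (r * LamS.of p _ (Lam.grp p g)), ?_⟩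
    rw [Finset.sum_eq_single (QuotientGroup.mk u : U ⧸ Z.top.toSubgroup)]
    · rw [Pi.single_eq_same, map_mul (LamS.map _ _), hzof, Lam.map_grp, mul_assoc, ← map_mul (LamS.of p U), ← map_mul (Lam.grp p), ← hg]
    · intro c _ hc
      rw [Pi.single_eq_of_ne hc, map_zero, zero_mul]
    · exact fun h => absurd (Finset.mem_univ _) h
  | zero => exact ⟨0, by simp⟩
  | add x y _ _ hx hy =>
    obtain ⟨r, rfl⟩ := hx
    obtain ⟨s, rfl⟩ := hy
    refine ⟨r + s, ?_⟩
    rw [← map_add, ← Finset.sum_add_distrib]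
    simp only [Pi.add_apply, map_add, add_mul]
  | neg x _ hx =>
    obtain ⟨r, rfl⟩ := hx
    refine ⟨-r, ?_⟩
    rw [← map_neg, ← Finset.sum_neg_distrib]
    simp only [Pi.neg_apply, map_neg, neg_mul]

/-- `∑_c z(b_c) c`. -/
def combine : (U ⧸ Z.top.toSubgroup → B p (Gam p)) →+ B p U where
  toFun b := ∑ c, B.map Z.z Z.adm (b c) * B.grp p c.out
  map_zero' := by simp
  map_add' b b' := by simp only [Pi.add_apply, map_add, add_mul, Finset.sum_add_distrib]

theorem combine_apply (b : U ⧸ Z.top.toSubgroup → B p (Gam p)) :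
    Z.combine b = ∑ c, B.map Z.z Z.adm (b c) * B.grp p c.out := rfl

theorem combine_mul_pow (b : U ⧸ Z.top.toSubgroup → B p (Gam p)) (n : ℕ) :
    Z.combine (fun c => b c * (p : B p (Gam p)) ^ n) = Z.combine b * (p : B p U) ^ n := by
  simp only [combine_apply, Finset.sum_mul, map_mul, map_pow, map_natCast, mul_assoc]
  refine Finset.sum_congr rfl fun c _ => ?_
  rw [← Nat.cast_pow, Nat.cast_comm]

theorem exists_combine_mod (x : B p U) : ∃ (b : U ⧸ Z.top.toSubgroup → B p (Gam p)) (y : B p U),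
    x = Z.combine b + y * (p : B p U) := by
  obtain ⟨a, ha⟩ := B.exists_of x 1
  obtain ⟨r, hr⟩ := Z.exists_coord_mod a
  have h1 := map_pId p (B.ofS : LamS p U →+* B p U) 1 _ hr
  have h2 := Ideal.add_mem _ ha h1
  rw [map_sub, sub_add_sub_cancel] at h2
  obtain ⟨y, hy⟩ := (mem_pId p).1 h2
  refine ⟨fun c => B.ofS (r c), y, ?_⟩
  rw [pow_one] at hy
  rw [hy]
  have : Z.combine (fun c => B.ofS (r c)) = B.ofS (∑ c, LamS.map Z.z Z.adm (r c) * LamS.of p U (Lam.grp p c.out)) := by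
    rw [map_sum, combine_apply]
    refine Finset.sum_congr rfl fun c _ => ?_
    rw [map_mul]
    rfl
  rw [this, add_sub_cancel]

/-- Surjectivity modulo p is lifted by successive approximation: x = combine(b₀) + p·x₁, then x₁ is
treated in the same way. The coefficients converge because B(Γ) is complete, and B(U) is separated.
-/
theorem combine_surjective : Function.Surjective Z.combine := by
  intro x
  choose b q h using Z.exists_combine_mod
  let X : ℕ → B p U := fun n => q^[n] x
  let bs : ℕ → (U ⧸ Z.top.toSubgroup → B p (Gam p)) := fun n c =>
    ∑ k ∈ Finset.range n, b (X k) c * (p : B p (Gam p)) ^ k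
  have hX : ∀ n, x = Z.combine (bs n) + X n * (p : B p U) ^ n := by
    intro n
    induction n with
    | zero =>
      have : bs 0 = 0 := by funext c; simp [bs]
      rw [this, map_zero, pow_zero, mul_one, zero_add]
      rfl
    | succ n ih =>
      have e : bs (n + 1) = bs n + fun c => b (X n) c * (p : B p (Gam p)) ^ n := by
        funext c
        exact Finset.sum_range_succ _ _
      have e2 : X (n + 1) = q (X n) := Function.iterate_succ_apply' q n x
      rw [e, map_add, combine_mul_pow, e2, add_assoc, pow_succ', ← mul_assoc, ← add_mul, ← h (X n), ← ih]
  have hl : ∀ c, ∃ y : B p (Gam p), ∀ n, y - bs n c ∈ pId p (B p (Gam p)) n := fun c =>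
    PComp.exists_lim (fun n => bs n c) fun n => by
      have : bs (n + 1) c - bs n c = b (X n) c * (p : B p (Gam p)) ^ n := by
        change (∑ k ∈ Finset.range (n + 1), _) - (∑ k ∈ Finset.range n, _) = _
        rw [Finset.sum_range_succ, add_sub_cancel_left]
      exact this ▸ pow_mem_pId n _
  choose y hy using hl
  refine ⟨y, sub_eq_zero.1 (B.eq_zero _ fun n => ?_)⟩
  choose d hd using fun c => (mem_pId p).1 (hy c n)
  have : y = bs n + fun c => d c * (p : B p (Gam p)) ^ n := by
    funext c
    rw [Pi.add_apply, hd, add_sub_cancel]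
  rw [this, map_add, combine_mul_pow, hX n, add_sub_add_left_eq_sub, ← sub_mul]
  exact pow_mem_pId n _

end CenSec

end Decomposition

/-! ### The Frobenius congruence, injectivity of γ ↦ γ^p on B(Γ), and flatness over ℤ_p. -/

section Frobenius

variable {p : ℕ} [Fact p.Prime]
variable {U : Type*} [Group U] [TopologicalSpace U] [IsTopologicalGroup U]

theorem Lam.nsmul_eq_zero (x : Lam p U) (h : x * (p : Lam p U) = 0) : x = 0 := by
  refine Subtype.ext (funext fun N => ?_)
  have h1 : x.1 N * (p : MonoidAlgebra ℤ_[p] (U ⧸ N.toSubgroup)) = 0 :=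
    congrFun (congrArg Subtype.val h) N
  rw [← Nat.cast_comm, ← nsmul_eq_mul] at h1
  ext c
  have h2 := DFunLike.congr_fun (congrArg MonoidAlgebra.coeff h1) c
  rw [MonoidAlgebra.coeff_smul, Finsupp.smul_apply, nsmul_eq_mul] at h2
  exact (mul_eq_zero.1 h2).resolve_left (Nat.cast_ne_zero.2 (Fact.out : p.Prime).ne_zero)

theorem LamS.exists_of (x : LamS p U) : ∃ (s : Lam p U) (a : Lam p U), s ∈ canonS p U ∧
    LamS.of p U s * x = LamS.of p U a := by
  induction x using OreLocalization.ind with | _ a s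
  refine ⟨s, a, s.2, ?_⟩
  exact (OreLocalization.mul_cancel (R := Lam p U) (S := canonS p U) (r := a) (s := s) (t := 1) : _)

theorem LamS.of_eq_zero (x : Lam p U) (h : LamS.of p U x = 0) : ∃ s ∈ canonS p U, s * x = 0 := by
  have h1 : (x /ₒ (1 : canonS p U) : OreLocalization (canonS p U) (Lam p U)) = 0 /ₒ 1 := by
    rw [OreLocalization.zero_oreDiv]
    exact h
  obtain ⟨u, v, h2, h3⟩ := OreLocalization.oreDiv_eq_iff.1 h1
  refine ⟨v, ?_, ?_⟩
  · have : (u : Lam p U) = v := by simpa using h3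
    exact this ▸ u.2
  · rw [smul_zero] at h2
    exact h2.symm

/-- Torsion-freeness descends from Λ(U) by clearing denominators, which are central. -/
theorem LamS.nsmul_eq_zero (x : LamS p U) (h : x * (p : LamS p U) = 0) : x = 0 := by
  obtain ⟨s, a, hs, e⟩ := LamS.exists_of x
  have h1 : LamS.of p U (a * (p : Lam p U)) = 0 := by
    rw [map_mul, map_natCast, ← e, mul_assoc, h, mul_zero]
  obtain ⟨t, ht, h2⟩ := LamS.of_eq_zero _ h1
  rw [← mul_assoc] at h2
  have h3 := Lam.nsmul_eq_zero _ h2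
  have h4 : LamS.of p U t * LamS.of p U a = 0 := by rw [← map_mul, h3, map_zero]
  rw [(LamS.isUnit_of t ht).mul_right_eq_zero, ← e, (LamS.isUnit_of s hs).mul_right_eq_zero] at h4
  exact h4

theorem B.nsmul_eq_zero (x : B p U) (h : x * (p : B p U) = 0) : x = 0 :=
  PComp.torsionFree LamS.nsmul_eq_zero x h

/-- The `n`-th power map of an abelian group. -/
def powHom (hU : ∀ a b : U, a * b = b * a) (n : ℕ) : U →* U :=
  MonoidHom.mk' (fun u => u ^ n) fun a b => Commute.mul_pow (hU a b) n

theorem Lam.frob (hU : ∀ a b : U, a * b = b * a) (s : Lam p U) : ∃ y,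
    s ^ p = Lam.map p (powHom hU p) (continuous_pow p) s + (p : Lam p U) * y := by
  letI : CommGroup U := { (inferInstance : Group U) with mul_comm := hU }
  obtain ⟨y, hy⟩ := Lam.dvd_of (s ^ p - Lam.map p (powHom hU p) (continuous_pow p) s) (by
      intro N
      obtain ⟨y, hy⟩ := frob_fin (p := p) (G := U ⧸ N.toSubgroup) (s.1 N)
      refine ⟨y, hy ▸ ?_⟩
      have e := s.2 N (comapON (powHom hU p) (continuous_pow p) N)
        (fun u hu => (mem_comapON _ _ _ _).2 (pow_mem hu p))
      change (s.1 N) ^ p - MonoidAlgebra.mapDomainRingHom ℤ_[p] _ (s.1 _) = _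
      rw [← e, ← RingHom.comp_apply, ← MonoidAlgebra.mapDomainRingHom_comp, quotMap_comp]
      rfl)
  exact ⟨y, by rw [← hy]; abel⟩

/-- Modulo p, x ↦ x^p is a ring homomorphism, as is the map induced by u ↦ u^p. Two homomorphisms
out of a localisation need only be compared on Λ(U). -/
theorem LamS.frob (hU : ∀ a b : U, a * b = b * a) (ha : Adm p (powHom hU p)) (x : LamS p U) :
    x ^ p - LamS.map (powHom hU p) ha x ∈ pId p (LamS p U) 1 := by
  have hp0 : ∀ r : LamS p U, Ideal.Quotient.mk (pId p (LamS p U) 1) ((p : LamS p U) * r) = 0 := by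
    intro r
    refine Ideal.Quotient.eq_zero_iff_mem.2 ?_
    have := pow_mem_pId' (p := p) 1 r
    rwa [pow_one] at this
  have hc : ∀ a b : LamS p U, Commute a b := LamS.mul_comm_of hU
  let f : LamS p U →+* LamS p U ⧸ pId p (LamS p U) 1 :=
    { toFun := fun x => Ideal.Quotient.mk _ (x ^ p)
      map_one' := by rw [one_pow, map_one]
      map_mul' := fun x y => by rw [(hc x y).mul_pow, map_mul]
      map_zero' := by rw [zero_pow (Fact.out : p.Prime).ne_zero, map_zero]
      map_add' := fun x y => by
        obtain ⟨r, hr⟩ := (hc x y).exists_add_pow_prime_eq (Fact.out : p.Prime)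
        rw [hr, mul_assoc, mul_assoc, map_add, map_add, hp0, add_zero] }
  have h : f = (Ideal.Quotient.mk _).comp (LamS.map (powHom hU p) ha) := by
    refine LamS.hom_ext fun x => ?_
    obtain ⟨y, hy⟩ := Lam.frob hU x
    have e : LamS.map (powHom hU p) ha (LamS.of p U x) =
      LamS.of p U (Lam.map p (powHom hU p) (continuous_pow p) x) := LamS.lift_of _ _ x
    change Ideal.Quotient.mk _ (LamS.of p U x ^ p) = Ideal.Quotient.mk _ (LamS.map _ _ _)
    rw [e, ← map_pow, hy, map_add, map_mul, map_natCast, map_add, hp0, add_zero]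
  exact Ideal.Quotient.eq.1 (RingHom.congr_fun h x)

theorem B.frob (hU : ∀ a b : U, a * b = b * a) (ha : Adm p (powHom hU p)) (x : B p U) :
    x ^ p - B.map (powHom hU p) ha x ∈ pId p (B p U) 1 := by
  refine (PComp.mem_pId_iff _ 1).2 ?_
  obtain ⟨a, h⟩ := Ideal.Quotient.mk_surjective (I := pId p (LamS p U) 1) (x.1 1)
  change (x.1 1) ^ p - pQuotMap p (LamS.map _ ha) 1 (x.1 1) = 0
  rw [← h]
  exact Ideal.Quotient.eq_zero_iff_mem.2 (LamS.frob hU ha a)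

theorem dvd_of_mapDomain {F F' : Type*} [Group F] [Finite F] [Group F'] (f : F →* F')
    (hf : Function.Injective f) (x : MonoidAlgebra ℤ_[p] F)
    (h : ∃ y, MonoidAlgebra.mapDomainRingHom ℤ_[p] f x = (p : MonoidAlgebra ℤ_[p] F') * y) :
    ∃ y, x = (p : MonoidAlgebra ℤ_[p] F) * y := by
  obtain ⟨y, hy⟩ := h
  refine ⟨MonoidAlgebra.ofCoeff (Finsupp.equivFunOnFinite.symm fun c => y.coeff (f c)), ?_⟩
  rw [← nsmul_eq_mul] at hy ⊢
  ext c
  have h1 := DFunLike.congr_fun (congrArg MonoidAlgebra.coeff hy) (f c)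
  have h2 : (MonoidAlgebra.mapDomainRingHom ℤ_[p] f x).coeff (f c) = x.coeff c :=
    Finsupp.mapDomain_apply hf _ _
  rw [h2] at h1
  rw [h1]
  rfl

/-- The subgroup `Γᵖ` of `Γ` as a central section. -/
def powSec (p : ℕ) [Fact p.Prime] : CenSec (⟨MonoidHom.id _, continuous_id, by
    rw [(MonoidHom.ker_eq_bot_iff _).2 fun _ _ h => h]; infer_instance⟩ : OneDim p (Gam p)) where
  z := powMonoidHom p
  cont := continuous_powHom p
  central _ _ := mul_comm _ _
  isOpen_range := by
    have := isOpen_powRange (p := p) 1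
    simp only [pow_one] at this
    exact this
  j := 1
  proj_z g := by rw [pow_one]; rfl

/-- The p-th power map Γ/z⁻¹(z(N)) → Γ/z(N), with z(γ) = γ^p, is injective, so divisibility by p can
be read off the coefficients at that level and then pushed down to N. -/
theorem Lam.dvd_of_frob (a : Lam p (Gam p))
    (h : ∃ y, Lam.map p (powMonoidHom p) (continuous_powHom p) a = (p : Lam p (Gam p)) * y) :
    ∃ y, a = (p : Lam p (Gam p)) * y := by
  refine Lam.dvd_of _ fun N => ?_
  let Z := powSec p
  have hle : ∀ u ∈ (comapON Z.z Z.cont (Z.img N)).toSubgroup, u ∈ N.toSubgroup := fun u hu =>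
    Z.z_mem_img.1 hu
  obtain ⟨y, hy⟩ := h
  have h1 : ∃ y, a.1 (comapON Z.z Z.cont (Z.img N)) = (p : MonoidAlgebra ℤ_[p] _) * y := by
    refine dvd_of_mapDomain (quotMap Z.z (comapON Z.z Z.cont (Z.img N)) (Z.img N)
      fun u => (mem_comapON Z.z Z.cont _ u).1) ?_ _ ⟨y.1 (Z.img N), ?_⟩
    · refine (injective_iff_map_eq_one _).2 fun u hu => ?_
      induction u using QuotientGroup.induction_on with | H u => ?_
      rw [quotMap_mk, QuotientGroup.eq_one_iff] at hu
      exact (QuotientGroup.eq_one_iff _).2 hu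
    · exact congrFun (congrArg Subtype.val hy) (Z.img N)
  obtain ⟨y', hy'⟩ := h1
  rw [← a.2 _ N hle, hy', map_mul, map_natCast]
  exact ⟨_, rfl⟩

theorem mem_pId_one {A : Type*} [Ring A] {x : A} : x ∈ pId p A 1 ↔ ∃ y, x = (p : A) * y := by
  rw [mem_pId]
  simp only [pow_one, ← Nat.cast_comm]
  exact ⟨fun ⟨y, h⟩ => ⟨y, h.symm⟩, fun ⟨y, h⟩ => ⟨y, h.symm⟩⟩

theorem sub_eq_zero_of_scale {R : Type*} [Ring R] (hR : ∀ a b : R, a * b = b * a) {s t x a y b q : R} {n : ℕ}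
    (e : s * x = a) (e' : t * y = b) (h : x ^ n = q * y) : t * a ^ n - q * (s ^ n * b) = 0 := by
  letI : CommRing R := { (inferInstance : Ring R) with mul_comm := hR }
  rw [← e, ← e', mul_pow, h]
  ring

theorem pow_eq_of_scale {R : Type*} [Ring R] (hR : ∀ a b : R, a * b = b * a) {r t a q c : R} {n : ℕ}
    (hn : n ≠ 0) (h : r * (t * a ^ n - q * c) = 0) :
    (r * t * a) ^ n = q * ((r * t) ^ (n - 1) * (r * c)) := by
  letI : CommRing R := { (inferInstance : Ring R) with mul_comm := hR }
  obtain ⟨m, rfl⟩ := Nat.exists_eq_succ_of_ne_zero hn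
  rw [Nat.succ_sub_one, mul_pow, pow_succ (r * t)]
  linear_combination (r * t) ^ m * h

/-- After clearing denominators, a nilpotent class modulo p gives a in Λ(Γ) with a^p divisible by p.
Frobenius replaces a^p by the image of a under γ ↦ γ^p, which is injective modulo p. -/
theorem LamS.reduced (x : LamS p (Gam p)) (h : x ^ p ∈ pId p (LamS p (Gam p)) 1) :
    x ∈ pId p (LamS p (Gam p)) 1 := by
  have hc : ∀ a b : LamS p (Gam p), Commute a b := LamS.mul_comm_of mul_comm
  have hc' : ∀ a b : Lam p (Gam p), Commute a b := Lam.mul_comm_of mul_comm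
  obtain ⟨s, a, hs, e⟩ := LamS.exists_of x
  obtain ⟨y, hy⟩ := mem_pId_one.1 h
  obtain ⟨t, b, ht, e'⟩ := LamS.exists_of y
  have h1 : LamS.of p _ (t * a ^ p - (p : Lam p (Gam p)) * (s ^ p * b)) = 0 := by
    rw [map_sub, map_mul, map_mul, map_mul, map_natCast, map_pow, map_pow]
    exact sub_eq_zero_of_scale (LamS.mul_comm_of mul_comm) e e' hy
  obtain ⟨r, hr, h2⟩ := LamS.of_eq_zero _ h1
  have h3 : ∃ y, r * t * a = (p : Lam p (Gam p)) * y := by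
    refine Lam.dvd_of_frob _ ?_
    obtain ⟨y', hy'⟩ := Lam.frob mul_comm (r * t * a)
    have e1 : (r * t * a) ^ p = (p : Lam p (Gam p)) * ((r * t) ^ (p - 1) * (r * (s ^ p * b))) :=
      pow_eq_of_scale (Lam.mul_comm_of mul_comm) (Fact.out : p.Prime).ne_zero h2
    refine ⟨(r * t) ^ (p - 1) * (r * (s ^ p * b)) - y', ?_⟩
    rw [mul_sub, ← e1, hy', add_sub_cancel_right]
    rfl
  obtain ⟨y', hy'⟩ := h3
  have hu : IsUnit (LamS.of p _ (r * t * s)) := LamS.isUnit_of _ (mul_mem (mul_mem hr ht) hs)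
  have h4 : LamS.of p _ (r * t * s) * x = (p : LamS p (Gam p)) * LamS.of p _ y' := by
    rw [map_mul, mul_assoc, e, ← map_mul, hy', map_mul, map_natCast]
  obtain ⟨v, hv⟩ := hu
  refine mem_pId_one.2 ⟨(↑v⁻¹ : LamS p (Gam p)) * LamS.of p _ y', ?_⟩
  rw [← hv] at h4
  rw [← mul_assoc, (Nat.cast_commute p _).eq, mul_assoc, ← h4, Units.inv_mul_cancel_left]

theorem B.reduced (x : B p (Gam p)) (h : x ^ p ∈ pId p (B p (Gam p)) 1) : x ∈ pId p (B p (Gam p)) 1 := by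
  refine (PComp.mem_pId_iff _ 1).2 ?_
  have h := (PComp.mem_pId_iff _ 1).1 h
  obtain ⟨a, ha⟩ := Ideal.Quotient.mk_surjective (I := pId p (LamS p (Gam p)) 1) (x.1 1)
  have h : (x.1 1) ^ p = 0 := h
  rw [← ha, ← map_pow, Ideal.Quotient.eq_zero_iff_mem] at h
  change x.1 1 = 0
  rw [← ha]
  exact Ideal.Quotient.eq_zero_iff_mem.2 (LamS.reduced a h)

/-- If φ(x) = 0 then x^p ≡ φ(x) = 0 modulo p, so x = p·w by reducedness, and φ(w) = 0 since B(Γ) has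
no p-torsion. Repeating this puts x in every pⁿB(Γ). -/
theorem B.pow_injective (x : B p (Gam p)) (h : B.map (powMonoidHom p) (pow_adm p) x = 0) : x = 0 := by
  refine B.eq_zero x fun n => ?_
  -- The induction must carry along that the quotient by pⁿ is again in the kernel.
  suffices H : ∃ y, y * (p : B p (Gam p)) ^ n = x ∧ B.map (powMonoidHom p) (pow_adm p) y = 0 by
    obtain ⟨y, hy, -⟩ := H
    exact (mem_pId p).2 ⟨y, hy⟩
  induction n with
  | zero => exact ⟨x, by rw [pow_zero, mul_one], h⟩
  | succ n ih =>
    obtain ⟨y, hy, h0⟩ := ih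
    have h1 := B.frob (p := p) mul_comm (pow_adm p) y
    have h2 : B.map (powHom mul_comm p) (pow_adm p) y = 0 := h0
    rw [h2, sub_zero] at h1
    obtain ⟨w, hw⟩ := (mem_pId p).1 (B.reduced y h1)
    rw [pow_one] at hw
    refine ⟨w, by rw [pow_succ', ← mul_assoc, hw, hy], B.nsmul_eq_zero _ ?_⟩
    rw [← h0, ← hw, map_mul, map_natCast]

theorem B.pow_pow_injective (j : ℕ) (f : Gam p →* Gam p) (hf : Adm p f) (h : ∀ g, f g = g ^ p ^ j)
    (x : B p (Gam p)) (hx : B.map f hf x = 0) : x = 0 := by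
  induction j generalizing f with
  | zero =>
    obtain rfl : f = MonoidHom.id _ := MonoidHom.ext fun g => by rw [h, pow_zero, pow_one]; rfl
    rwa [B.map_id] at hx
  | succ j ih =>
    have hj' : Adm p (powMonoidHom (p ^ j) : Gam p →* Gam p) := by
      refine ⟨continuous_pow _, ?_, fun _ _ _ => mul_comm _ _⟩
      rw [(MonoidHom.ker_eq_bot_iff _).2 ((injective_iff_map_eq_one _).2 fun g hg =>
        gam_torsionFree g _ (pow_ne_zero _ (Fact.out : p.Prime).ne_zero) hg)]
      infer_instance
    refine ih _ hj' (fun _ => rfl) (B.pow_injective _ ?_)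
    obtain rfl : f = (powMonoidHom p).comp (powMonoidHom (p ^ j)) := MonoidHom.ext fun g => by
      rw [h, pow_succ, pow_mul]; rfl
    rw [← hx]
    exact B.map_map _ hj' _ (pow_adm p) hf x

instance : Module.IsTorsionFree ℤ_[p] (B p (Gam p)) := by
  refine Module.IsTorsionFree.of_smul_eq_zero fun r b h => ?_
  by_cases hr : r = 0
  · exact Or.inl hr
  refine Or.inr ?_
  rw [PadicInt.unitCoeff_spec hr, mul_smul] at h
  have h1 := (PadicInt.unitCoeff hr).isUnit.smul_eq_zero.1 h
  have h2 : ∀ n (b : B p (Gam p)), ((p : ℤ_[p]) ^ n) • b = 0 → b = 0 := by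
    intro n
    induction n with
    | zero => intro b hb; simpa using hb
    | succ n ih =>
      intro b hb
      rw [pow_succ, mul_smul] at hb
      have hb := ih _ hb
      rw [Nat.cast_smul_eq_nsmul, nsmul_eq_mul, mul_comm] at hb
      exact B.nsmul_eq_zero _ hb
  exact h2 _ _ h1

instance : Module.Flat ℤ_[p] (B p (Gam p)) :=
  IsDedekindDomain.flat_iff_torsion_eq_bot.2 (Submodule.isTorsionFree_iff_torsion_eq_bot.1 inferInstance)

theorem includeRight_BQ_injective :
    Function.Injective (fun b : B p (Gam p) => (1 : QBar p) ⊗ₜ[ℤ_[p]] b) :=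
  Algebra.TensorProduct.includeRight_injective (R := ℤ_[p]) (A := QBar p) (B := B p (Gam p))
    (by
      rw [IsScalarTower.algebraMap_eq ℤ_[p] ℚ_[p] (QBar p)]
      exact (algebraMap ℚ_[p] (QBar p)).injective.comp (IsFractionRing.injective ℤ_[p] ℚ_[p]))

end Frobenius

/-! ### The integral lattice ℤ̄_p ⊗ B(Γ) in ℚ̄_p ⊗ B(Γ) is p-adically separated. -/

section Lattice

variable {p : ℕ} [Fact p.Prime]

theorem algebraMap_QBar_injective : Function.Injective (algebraMap ℤ_[p] (QBar p)) := by
  rw [IsScalarTower.algebraMap_eq ℤ_[p] ℚ_[p] (QBar p)]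
  exact (algebraMap ℚ_[p] (QBar p)).injective.comp (IsFractionRing.injective ℤ_[p] ℚ_[p])

instance : Module.IsTorsionFree ℤ_[p] (QBar p) := by
  refine Module.IsTorsionFree.of_smul_eq_zero fun r b h => ?_
  rw [Algebra.smul_def, mul_eq_zero] at h
  exact h.imp_left fun h => algebraMap_QBar_injective (h.trans (map_zero _).symm)

/-- The integers of an intermediate field `K`, as a submodule of the integers of `QBar p`. -/
def intOf (K : IntermediateField ℚ_[p] (QBar p)) : Submodule ℤ_[p] (ZBar p) :=
  (K.toSubalgebra.toSubmodule.restrictScalars ℤ_[p]).comap (ZBar p).val.toLinearMap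

theorem mem_intOf {K : IntermediateField ℚ_[p] (QBar p)} {z : ZBar p} : z ∈ intOf K ↔ (z : QBar p) ∈ K :=
  Iff.rfl

instance (K : IntermediateField ℚ_[p] (QBar p)) [FiniteDimensional ℚ_[p] K] :
    Module.Finite ℤ_[p] (intOf K) := by
  have h : Module.Finite ℤ_[p] (integralClosure ℤ_[p] K) := IsIntegralClosure.finite ℤ_[p] ℚ_[p] K _
  let f : integralClosure ℤ_[p] K →ₗ[ℤ_[p]] intOf K :=
    { toFun := fun x => ⟨⟨((x : K) : QBar p), x.2.map (K.val.restrictScalars ℤ_[p])⟩, (x : K).2⟩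
      map_add' := fun _ _ => rfl
      map_smul' := fun _ _ => rfl }
  refine Module.Finite.of_surjective f ?_
  rintro ⟨⟨x, hx⟩, hK⟩
  refine ⟨⟨⟨x, hK⟩, ?_⟩, rfl⟩
  have : IsIntegral ℤ_[p] (K.val.restrictScalars ℤ_[p] ⟨x, hK⟩) := hx
  exact (isIntegral_algHom_iff (K.val.restrictScalars ℤ_[p]) K.val.injective).1 this

instance (K : IntermediateField ℚ_[p] (QBar p)) [FiniteDimensional ℚ_[p] K] :
    Module.Free ℤ_[p] (intOf K) := Module.free_of_finite_type_torsion_free'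

/-- An integer z with r·z in K and r ≠ 0 lies in K, because K is a field. So the quotient is
torsion-free, and torsion-free modules over a Dedekind domain are flat. -/
instance (K : IntermediateField ℚ_[p] (QBar p)) : Module.Flat ℤ_[p] (ZBar p ⧸ intOf K) := by
  refine IsDedekindDomain.flat_iff_torsion_eq_bot.2 (Submodule.isTorsionFree_iff_torsion_eq_bot.1 ?_)
  refine Module.IsTorsionFree.of_smul_eq_zero fun r b h => ?_
  obtain ⟨b, rfl⟩ := Submodule.Quotient.mk_surjective _ b
  by_cases hr : r = 0
  · exact Or.inl hr
  refine Or.inr ((Submodule.Quotient.mk_eq_zero _).2 (mem_intOf.2 ?_))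
  rw [← Submodule.Quotient.mk_smul, Submodule.Quotient.mk_eq_zero, mem_intOf] at h
  have h2 : algebraMap ℤ_[p] (QBar p) r ∈ K := by
    rw [IsScalarTower.algebraMap_apply ℤ_[p] ℚ_[p] (QBar p)]
    exact K.algebraMap_mem _
  have h3 : ((r • b : ZBar p) : QBar p) = algebraMap ℤ_[p] (QBar p) r * b := Algebra.smul_def _ _
  rw [h3] at h
  have h4 := K.mul_mem (K.inv_mem h2) h
  rwa [inv_mul_cancel_left₀] at h4
  exact (map_ne_zero_iff _ algebraMap_QBar_injective).2 hr

/-- The map `O_K ⊗ B(Γ) → Z̄_p ⊗ B(Γ)`. -/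
def intMap (K : IntermediateField ℚ_[p] (QBar p)) : intOf K ⊗[ℤ_[p]] B p (Gam p) →ₗ[ℤ_[p]] BZ p :=
  LinearMap.rTensor _ (intOf K).subtype

theorem toBQ_injective : Function.Injective (toBQ p) := by
  have h := Module.Flat.rTensor_preserves_injective_linearMap (M := B p (Gam p))
    (ZBar p).val.toLinearMap Subtype.val_injective
  exact h

theorem intMap_injective (K : IntermediateField ℚ_[p] (QBar p)) : Function.Injective (intMap K) :=
  Module.Flat.rTensor_preserves_injective_linearMap _ Subtype.val_injective

/-- Divisibility by r in the big lattice already holds over O_K: the obstruction lies in (ℤ̄_p/O_K)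
⊗ B(Γ), which has no torsion. -/
theorem intMap_saturated (K : IntermediateField ℚ_[p] (QBar p)) (x : intOf K ⊗[ℤ_[p]] B p (Gam p))
    (r : ℤ_[p]) (hr : r ≠ 0) (w : BZ p) (h : intMap K x = r • w) : ∃ y, x = r • y := by
  have hex : Function.Exact (intMap K) (LinearMap.rTensor (B p (Gam p)) (intOf K).mkQ) :=
    rTensor_exact _ (LinearMap.exact_subtype_mkQ _) (Submodule.mkQ_surjective _)
  have h1 : LinearMap.rTensor (B p (Gam p)) (intOf K).mkQ (r • w) = 0 := by
    rw [← h]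
    exact (hex _).2 ⟨x, rfl⟩
  rw [map_smul, smul_eq_zero] at h1
  obtain ⟨y, hy⟩ := (hex w).1 (h1.resolve_left hr)
  refine ⟨y, intMap_injective K ?_⟩
  rw [h, map_smul, hy]

/-- A tensor involves finitely many algebraic coefficients. They generate a finite extension and
have a common denominator in ℤ_p. -/
theorem exists_intMap (x : BQ p) : ∃ (K : IntermediateField ℚ_[p] (QBar p)) (r : ℤ_[p])
    (y : intOf K ⊗[ℤ_[p]] B p (Gam p)), FiniteDimensional ℚ_[p] K ∧ r ≠ 0 ∧ r • x = toBQ p (intMap K y) := by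
  have mono : ∀ {K K' : IntermediateField ℚ_[p] (QBar p)} (h : K ≤ K') (y : intOf K ⊗[ℤ_[p]] B p (Gam p)),
      ∃ y', intMap K' y' = intMap K y := by
    intro K K' h y
    have hle : intOf K ≤ intOf K' := fun _ hz => h hz
    refine ⟨LinearMap.rTensor _ (Submodule.inclusion hle) y, ?_⟩
    change (LinearMap.rTensor _ (intOf K').subtype) _ = _
    rw [← LinearMap.rTensor_comp_apply]
    rfl
  induction x using TensorProduct.induction_on with
  | zero => exact ⟨⊥, 1, 0, inferInstance, one_ne_zero, by rw [smul_zero, map_zero, map_zero]⟩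
  | tmul q b =>
    have hq : IsAlgebraic ℤ_[p] q := by
      have : IsAlgebraic ℚ_[p] q := Algebra.IsAlgebraic.isAlgebraic q
      exact (IsFractionRing.isAlgebraic_iff ℤ_[p] ℚ_[p] (QBar p)).2 this
    obtain ⟨r, hr, h⟩ := hq.exists_integral_multiple
    have hi : IsIntegral ℚ_[p] q := Algebra.IsIntegral.isIntegral q
    refine ⟨IntermediateField.adjoin ℚ_[p] {q}, r, (⟨⟨r • q, h⟩, ?_⟩ : intOf _) ⊗ₜ b,
      IntermediateField.adjoin.finiteDimensional hi, hr, ?_⟩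
    · rw [mem_intOf]
      change r • q ∈ _
      rw [Algebra.smul_def, IsScalarTower.algebraMap_apply ℤ_[p] ℚ_[p] (QBar p)]
      exact mul_mem (IntermediateField.algebraMap_mem _ _) (IntermediateField.mem_adjoin_simple_self _ _)
    · rw [TensorProduct.smul_tmul']
      rfl
  | add x x' hx hx' =>
    obtain ⟨K, r, y, hK, hr, h⟩ := hx
    obtain ⟨K', r', y', hK', hr', h'⟩ := hx'
    obtain ⟨z, hz⟩ := mono (le_sup_left : K ≤ K ⊔ K') y
    obtain ⟨z', hz'⟩ := mono (le_sup_right : K' ≤ K ⊔ K') y'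
    refine ⟨K ⊔ K', r * r', r' • z + r • z', IntermediateField.finiteDimensional_sup K K',
      mul_ne_zero hr hr', ?_⟩
    rw [map_add, map_add, map_smul, map_smul, map_smul, map_smul, hz, hz', ← h, ← h', smul_add, mul_smul,
      mul_smul, smul_comm r r']

theorem smul_eq_mul_B (b : B p (Gam p)) (n : ℕ) : ((p : ℤ_[p]) ^ n) • b = b * (p : B p (Gam p)) ^ n := by
  rw [Algebra.smul_def, map_pow, map_natCast, mul_comm]

/-- The subgroup `pⁿ (Z̄_p ⊗ B(Γ))` of `Q̄_p ⊗ B(Γ)`. -/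
def pLat (p : ℕ) [Fact p.Prime] (n : ℕ) : AddSubgroup (BQ p) :=
  ((toBQ p : BZ p →+ BQ p).comp (AddMonoidHom.mulLeft ((p : BZ p) ^ n))).range

theorem mem_pLat {n : ℕ} {x : BQ p} : x ∈ pLat p n ↔ ∃ w, x = toBQ p ((p : BZ p) ^ n * w) :=
  ⟨fun ⟨w, h⟩ => ⟨w, h.symm⟩, fun ⟨w, h⟩ => ⟨w, h.symm⟩⟩

/-- ℤ̄_p has infinite rank over ℤ_p, so separatedness is not formal. Up to a scalar the element
comes from a finite extension K, its divisibility by pⁿ persists over O_K by saturation, and O_K ⊗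
B(Γ) is a finite sum of copies of the separated ring B(Γ). This is what makes p-adic limits, hence
logarithms, unique. -/
theorem eq_zero_of_mem_pLat (x : BQ p) (h : ∀ n, x ∈ pLat p n) : x = 0 := by
  obtain ⟨K, r, y, hK, hr, hy⟩ := exists_intMap x
  have key : ∀ n, ∃ z, y = ((p : ℤ_[p]) ^ n) • z := by
    intro n
    obtain ⟨w, hw⟩ := mem_pLat.1 (h n)
    refine intMap_saturated K y _ (pow_ne_zero _ (Nat.cast_ne_zero.2 (Fact.out : p.Prime).ne_zero))
      (r • w) (toBQ_injective ?_)
    rw [← hy, hw, ← map_smul]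
    congr 1
    have e : ((p : ℤ_[p]) ^ n) • (r • w) = (p : BZ p) ^ n * (r • w) := by
      refine (Algebra.smul_def (A := BZ p) ((p : ℤ_[p]) ^ n) (r • w)).trans ?_
      rw [map_pow, map_natCast]
    exact (mul_smul_comm (β := BZ p) r ((p : BZ p) ^ n) w).symm.trans e.symm
  classical
  let b := Module.Free.chooseBasis ℤ_[p] (intOf K)
  let e : intOf K ⊗[ℤ_[p]] B p (Gam p) ≃ₗ[ℤ_[p]] (Module.Free.ChooseBasisIndex ℤ_[p] (intOf K) →₀ B p (Gam p)) :=
    (TensorProduct.congr b.repr (LinearEquiv.refl _ _)).trans (TensorProduct.finsuppScalarLeft ℤ_[p] (B p (Gam p)) _)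
  have hy0 : e y = 0 := by
    ext i
    refine B.eq_zero _ fun n => ?_
    obtain ⟨z, hz⟩ := key n
    refine (mem_pId p).2 ⟨e z i, ?_⟩
    have e1 : e (((p : ℤ_[p]) ^ n) • z) = ((p : ℤ_[p]) ^ n) • e z := e.toLinearMap.map_smul _ z
    rw [hz, e1, Finsupp.smul_apply, smul_eq_mul_B]
  have hy1 : y = 0 := e.injective (hy0.trans e.toLinearMap.map_zero.symm)
  rw [hy1, map_zero, map_zero, ← IsScalarTower.algebraMap_smul (QBar p),
    smul_eq_zero] at hy
  exact hy.resolve_left ((map_ne_zero_iff _ algebraMap_QBar_injective).2 hr)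

end Lattice

/-! ### The p-adic logarithm as the limit of (x^(p^k) - 1)/p^k, and its comparison with the series.
-/

section Log

variable {p : ℕ} [Fact p.Prime]

theorem pLat_le {m n : ℕ} (h : m ≤ n) : pLat p n ≤ pLat p m := fun x hx => by
  obtain ⟨w, rfl⟩ := mem_pLat.1 hx
  exact mem_pLat.2 ⟨(p : BZ p) ^ (n - m) * w, by rw [← mul_assoc, ← pow_add, Nat.add_sub_cancel' h]⟩

theorem toBQ_mem_pLat (a : BZ p) : toBQ p a ∈ pLat p 0 := mem_pLat.2 ⟨a, by rw [pow_zero, one_mul]⟩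

theorem toBQ_mul_mem {n : ℕ} (a : BZ p) {x : BQ p} (h : x ∈ pLat p n) : toBQ p a * x ∈ pLat p n := by
  obtain ⟨w, rfl⟩ := mem_pLat.1 h
  exact mem_pLat.2 ⟨a * w, by rw [← map_mul, mul_left_comm]⟩

theorem mul_mem_pLat {m n : ℕ} {x y : BQ p} (hx : x ∈ pLat p m) (hy : y ∈ pLat p n) : x * y ∈ pLat p (m + n) := by
  obtain ⟨w, rfl⟩ := mem_pLat.1 hx
  obtain ⟨w', rfl⟩ := mem_pLat.1 hy
  exact mem_pLat.2 ⟨w * w', by rw [← map_mul, pow_add]; ring_nf⟩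

theorem natCast_smul_toBQ (k : ℕ) (a : BZ p) : (k : QBar p) • toBQ p a = toBQ p ((k : BZ p) * a) := by
  rw [Nat.cast_smul_eq_nsmul, ← map_nsmul, nsmul_eq_mul]

theorem pow_smul_mem {n : ℕ} (s : ℕ) {x : BQ p} (h : x ∈ pLat p n) : ((p : QBar p) ^ s) • x ∈ pLat p (n + s) := by
  obtain ⟨w, rfl⟩ := mem_pLat.1 h
  refine mem_pLat.2 ⟨w, ?_⟩
  rw [← Nat.cast_pow, natCast_smul_toBQ, Nat.cast_pow, ← mul_assoc, ← pow_add, add_comm]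

theorem pow_ne_zero_QBar (s : ℕ) : (p : QBar p) ^ s ≠ 0 :=
  pow_ne_zero _ (Nat.cast_ne_zero.2 (Fact.out : p.Prime).ne_zero)

theorem inv_pow_smul_mem {n s : ℕ} {x : BQ p} (h : x ∈ pLat p (n + s)) : ((p : QBar p) ^ s)⁻¹ • x ∈ pLat p n := by
  obtain ⟨w, rfl⟩ := mem_pLat.1 h
  refine mem_pLat.2 ⟨w, ?_⟩
  have h1 := natCast_smul_toBQ (p ^ s) ((p : BZ p) ^ n * w)
  rw [Nat.cast_pow, Nat.cast_pow] at h1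
  rw [add_comm, pow_add, mul_assoc, ← h1, inv_smul_smul₀ (pow_ne_zero_QBar s)]

theorem exists_dvd_pow (k s : ℕ) (hk : k ≠ 0) (h : k.factorization p ≤ s) :
    ∃ c : ℤ_[p], (k : ℤ_[p]) * c = (p : ℤ_[p]) ^ s := by
  have hu : IsUnit ((k / p ^ k.factorization p : ℕ) : ℤ_[p]) := by
    rw [PadicInt.isUnit_iff, PadicInt.norm_natCast_eq_one_iff]
    exact Nat.coprime_ordCompl Fact.out hk
  obtain ⟨v, hv⟩ := hu
  refine ⟨(↑v⁻¹ : ℤ_[p]) * (p : ℤ_[p]) ^ (s - k.factorization p), ?_⟩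
  have e : (k : ℤ_[p]) = (p : ℤ_[p]) ^ k.factorization p * v := by
    rw [hv, ← Nat.cast_pow, ← Nat.cast_mul, Nat.ordProj_mul_ordCompl_eq_self]
  rw [e, mul_assoc, Units.mul_inv_cancel_left, ← pow_add, Nat.add_sub_cancel' h]

theorem inv_smul_mem {n s : ℕ} (k : ℕ) (hk : k ≠ 0) (h : k.factorization p ≤ s) {x : BQ p}
    (hx : x ∈ pLat p (n + s)) : (k : QBar p)⁻¹ • x ∈ pLat p n := by
  obtain ⟨w, rfl⟩ := mem_pLat.1 hx
  obtain ⟨c, hc⟩ := exists_dvd_pow k s hk h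
  have e : (p : BZ p) ^ (n + s) * w = (k : BZ p) * ((p : BZ p) ^ n * (algebraMap ℤ_[p] (BZ p) c * w)) := by
    have : (p : BZ p) ^ s = (k : BZ p) * algebraMap ℤ_[p] (BZ p) c := by
      rw [← map_natCast (algebraMap ℤ_[p] (BZ p)) k, ← map_mul, hc, map_pow, map_natCast]
    rw [pow_add, this]
    ring
  refine mem_pLat.2 ⟨algebraMap ℤ_[p] (BZ p) c * w, ?_⟩
  rw [e, ← natCast_smul_toBQ, inv_smul_smul₀ (Nat.cast_ne_zero.2 hk)]

theorem exists_pow_smul_mem (x : BQ p) : ∃ s, ((p : QBar p) ^ s) • x ∈ pLat p 0 := by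
  obtain ⟨K, r, y, -, hr, h⟩ := exists_intMap x
  refine ⟨r.valuation, ?_⟩
  have e : (p : QBar p) ^ r.valuation • x = toBQ p (((PadicInt.unitCoeff hr)⁻¹ : ℤ_[p]ˣ) • intMap K y) := by
    rw [Units.smul_def, map_smul, ← h, smul_smul]
    rw [(Units.inv_mul_eq_iff_eq_mul _).2 (PadicInt.unitCoeff_spec hr)]
    have h2 := IsScalarTower.algebraMap_smul (QBar p) ((p : ℤ_[p]) ^ r.valuation) x
    rw [map_pow, map_natCast] at h2
    exact h2
  rw [e]
  exact toBQ_mem_pLat _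

/-- `(x ^ pᵏ - 1) / pᵏ` converges `p`-adically to `z`. -/
def IsPLog' (x : BZ p) (z : BQ p) : Prop :=
  ∀ n : ℕ, ∃ k₀ : ℕ, ∀ k ≥ k₀, z - ((p : QBar p) ^ k)⁻¹ • toBQ p (x ^ p ^ k - 1) ∈ pLat p n

theorem IsPLog'.bounded {x : BZ p} {z : BQ p} (h : IsPLog' x z) :
    ∃ s k₀, ∀ k ≥ k₀, ((p : QBar p) ^ s) • (((p : QBar p) ^ k)⁻¹ • toBQ p (x ^ p ^ k - 1)) ∈ pLat p 0 := by
  obtain ⟨s, hs⟩ := exists_pow_smul_mem z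
  obtain ⟨k₀, hk⟩ := h 0
  refine ⟨s, k₀, fun k hk0 => ?_⟩
  have h1 := sub_mem hs (pow_smul_mem s (hk k hk0) |> pLat_le (Nat.zero_le _))
  rwa [← smul_sub, sub_sub_cancel] at h1

/-- With q = p^k, both (x^q - 1)/q and (y^q - 1)/q stay bounded, so the product (x^q - 1)(y^q - 1)/q
is q times something bounded. This is the error term in the additivity of the logarithm. -/
theorem IsPLog'.mul_small {x y : BZ p} {z z' : BQ p} (h : IsPLog' x z) (h' : IsPLog' y z') (n : ℕ) :
    ∃ k₀, ∀ k ≥ k₀, ∀ c : BZ p,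
      ((p : QBar p) ^ k)⁻¹ • toBQ p (c * ((x ^ p ^ k - 1) * (y ^ p ^ k - 1))) ∈ pLat p n := by
  obtain ⟨s, k₀, hs⟩ := h.bounded
  obtain ⟨s', k₀', hs'⟩ := h'.bounded
  -- The factor p^k has to absorb the bounds p^s and p^s' and still leave pⁿ.
  refine ⟨k₀ + k₀' + (n + (s + s')), fun k hk c => ?_⟩
  have h1 := mul_mem_pLat (hs k (by omega)) (hs' k (by omega))
  have h2 := pow_smul_mem k (toBQ_mul_mem c h1)
  have h3 := inv_pow_smul_mem (n := n) (s := s + s') (pLat_le (by omega) h2)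
  convert h3 using 1
  simp only [map_mul, smul_mul_assoc, mul_smul_comm, smul_smul]
  congr 1
  have := pow_ne_zero_QBar (p := p)
  field_simp [this]
  ring

variable (p) in
/-- The group of pairs `(x, z)` such that `z` is the logarithm of `x`. -/
def plogSub : Subgroup ((BZ p)ˣ × Multiplicative (BQ p)) where
  carrier := {a | IsPLog' (a.1 : BZ p) a.2.toAdd}
  one_mem' n := ⟨0, fun k _ => by
    have e : (((1 : (BZ p)ˣ × Multiplicative (BQ p)).1 : BZ p)) = 1 := rfl
    have e' : (1 : (BZ p)ˣ × Multiplicative (BQ p)).2.toAdd = 0 := rfl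
    rw [e, e', one_pow, sub_self, map_zero, smul_zero, sub_zero]
    exact zero_mem _⟩
  mul_mem' := by
    rintro ⟨x, z⟩ ⟨y, z'⟩ h h' n
    obtain ⟨k₁, h₁⟩ := h n
    obtain ⟨k₂, h₂⟩ := h' n
    obtain ⟨k₃, h₃⟩ := IsPLog'.mul_small h h' n
    refine ⟨k₁ + k₂ + k₃, fun k hk => ?_⟩
    convert sub_mem (add_mem (h₁ k (by omega)) (h₂ k (by omega))) (h₃ k (by omega) 1) using 1
    have e : (((x, z) * (y, z') : (BZ p)ˣ × Multiplicative (BQ p)).1 : BZ p) ^ p ^ k - 1 =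
      ((x : BZ p) ^ p ^ k - 1) + ((y : BZ p) ^ p ^ k - 1) +
        1 * (((x : BZ p) ^ p ^ k - 1) * ((y : BZ p) ^ p ^ k - 1)) := by
      rw [Prod.fst_mul, Units.val_mul, mul_pow]
      ring
    have e' : ((x, z) * (y, z') : (BZ p)ˣ × Multiplicative (BQ p)).2.toAdd = z.toAdd + z'.toAdd := rfl
    rw [e, e', map_add, map_add, smul_add, smul_add]
    abel
  inv_mem' := by
    rintro ⟨x, z⟩ h n
    obtain ⟨k₁, h₁⟩ := h n
    obtain ⟨k₃, h₃⟩ := IsPLog'.mul_small h h n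
    refine ⟨k₁ + k₃, fun k hk => ?_⟩
    convert neg_mem (add_mem (h₁ k (by omega)) (h₃ k (by omega) (((x⁻¹ : (BZ p)ˣ) : BZ p) ^ p ^ k))) using 1
    -- The identity 1/a - 1 = -(a - 1) + a⁻¹(a - 1)², with a = x^(p^k); the square is negligible.
    have e : (((x, z)⁻¹ : (BZ p)ˣ × Multiplicative (BQ p)).1 : BZ p) ^ p ^ k - 1 =
      -((x : BZ p) ^ p ^ k - 1) +
        ((x⁻¹ : (BZ p)ˣ) : BZ p) ^ p ^ k * (((x : BZ p) ^ p ^ k - 1) * ((x : BZ p) ^ p ^ k - 1)) := by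
      have e1 : ((x⁻¹ : (BZ p)ˣ) : BZ p) ^ p ^ k * (x : BZ p) ^ p ^ k = 1 := by
        rw [← mul_pow, Units.inv_mul, one_pow]
      change ((x⁻¹ : (BZ p)ˣ) : BZ p) ^ p ^ k - 1 = _
      linear_combination (2 - (x : BZ p) ^ p ^ k) * e1
    have e' : ((x, z)⁻¹ : (BZ p)ˣ × Multiplicative (BQ p)).2.toAdd = - z.toAdd := rfl
    rw [e, e', map_add, map_neg, smul_add, smul_neg]
    abel

/-- Replacing x^(p^s) by x shifts the index k by s. The limit form therefore passes to roots without
any congruence condition on x, which the series would need. -/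
theorem IsPLog'.root {x : BZ p} {z : BQ p} (s : ℕ) (h : IsPLog' (x ^ p ^ s) z) :
    IsPLog' x (((p : QBar p) ^ s)⁻¹ • z) := by
  intro n
  obtain ⟨k₀, hk⟩ := h (n + s)
  refine ⟨k₀ + s, fun k hk0 => ?_⟩
  obtain ⟨k, rfl⟩ := Nat.exists_eq_add_of_le' (show s ≤ k by omega)
  convert inv_pow_smul_mem (hk k (by omega)) using 1
  rw [smul_sub, smul_smul, ← mul_inv, ← pow_add, ← pow_mul, ← pow_add, add_comm s k]

/-- The valuation of j is at most logarithmic in j. Small valuations are handled by a bound linear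
in L₀, large ones by 2^v ≤ p^v ≤ j together with L/2^L → 0. -/
theorem exists_log_bound (N n : ℕ) : ∃ m₀, ∀ j ≥ m₀, N * (n + j.factorization p) ≤ j := by
  have h1 : Filter.Tendsto (fun L : ℕ => (L : ℝ) ^ 1 / (2 : ℝ) ^ L) Filter.atTop (nhds 0) :=
    tendsto_pow_const_div_const_pow_of_one_lt 1 (by norm_num)
  have h2 := h1.eventually (gt_mem_nhds (show (0 : ℝ) < 1 / (2 * (N + 1)) by positivity))
  obtain ⟨L₀, hL⟩ := Filter.eventually_atTop.1 h2
  refine ⟨2 ^ L₀ + 2 * N * n + N * L₀ + 1, fun j hj => ?_⟩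
  by_cases hf : j.factorization p ≤ L₀
  · have h3 : N * j.factorization p ≤ N * L₀ := Nat.mul_le_mul_left _ hf
    have h4 : 2 * N * n = N * n + N * n := by ring
    have h5 : 0 < 2 ^ L₀ := by positivity
    rw [mul_add]
    omega
  · have h3 := hL (j.factorization p) (by omega)
    rw [pow_one, div_lt_div_iff₀ (by positivity) (by positivity), one_mul] at h3
    have h4 : j.factorization p * (2 * (N + 1)) < 2 ^ j.factorization p := by exact_mod_cast h3
    have h5 : 2 ^ j.factorization p ≤ j :=
      (Nat.pow_le_pow_left (Fact.out : p.Prime).two_le _).trans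
        (Nat.ordProj_le p (by rintro rfl; exact hf (by simp)))
    have h6 : j.factorization p * (2 * (N + 1)) = 2 * (N * j.factorization p) + 2 * j.factorization p := by ring
    have h7 : 2 * N * n = 2 * (N * n) := by ring
    rw [mul_add]
    have h8 : 0 < 2 ^ L₀ := by positivity
    omega

/-- The binomial coefficient of P - 1 is a polynomial in P with denominator i!, and its value at P =
0 is (-1)^i. So it approaches the sign of the logarithm series when P is a high power of p. -/
theorem choose_congr (P i : ℕ) (hi : i < P) :
    ∃ c : ℤ, (i.factorial : ℤ) * (((P - 1).choose i : ℤ) - (-1) ^ i) = P * c := by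
  induction i with
  | zero => exact ⟨0, by simp⟩
  | succ i ih =>
    obtain ⟨c, hc⟩ := ih (by omega)
    obtain ⟨Q, rfl⟩ := Nat.exists_eq_succ_of_ne_zero (show P ≠ 0 by omega)
    rw [Nat.succ_sub_one] at hc ⊢
    have h1 : (((Q + 1) * Q.choose i : ℕ) : ℤ) = ((Q.choose i + Q.choose (i + 1)) * (i + 1) : ℕ) := by
      rw [← Nat.choose_succ_succ]
      exact congrArg _ (Nat.add_one_mul_choose_eq Q i)
    push_cast at h1
    refine ⟨i.factorial * Q.choose i - (i + 1) * c, ?_⟩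
    rw [Nat.factorial_succ, pow_succ]
    push_cast at hc ⊢
    linear_combination (-(i.factorial : ℤ)) * h1 - (i + 1 : ℤ) * hc

/-- With u = x - 1 and P = p^k, (x^P - 1)/P = ∑ C(P-1, j)/(j+1) · u^(j+1). For j < m the
coefficients tend to (-1)^j/(j+1) as k grows. For j ≥ m the power u^(j+1) contains enough factors
u^N = p·w to beat the denominator j+1. -/
theorem IsPLog'.isPLog {x : BZ p} {z : BQ p} (h : IsPLog' x z) (N : ℕ) (w : BZ p)
    (hw : (x - 1) ^ N = (p : BZ p) * w) : IsPLog x z := by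
  intro n
  suffices H : ∃ m₀, ∀ m ≥ m₀, z - ∑ k ∈ Finset.range m, ((-1 : QBar p) ^ k / (k + 1 : QBar p)) •
      toBQ p ((x - 1) ^ (k + 1)) ∈ pLat p n by
    obtain ⟨m₀, H⟩ := H
    exact ⟨m₀, fun m hm => mem_pLat.1 (H m hm)⟩
  obtain ⟨m₀, hm₀⟩ := exists_log_bound (p := p) N n
  refine ⟨m₀, fun m hm => ?_⟩
  obtain ⟨k₀, hk₀⟩ := h n
  -- The summand m! dominates the valuations of all the denominators (j+1)! with j < m, and also
  -- ensures m ≤ P.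
  set k := k₀ + n + m.factorial with hk
  set P := p ^ k with hP
  have hPk : k < P := Nat.lt_pow_self (Fact.out : p.Prime).one_lt
  have hmP : m ≤ P := by have := Nat.self_le_factorial m; omega
  set u := x - 1 with hu
  have hx : x = u + 1 := by rw [hu, sub_add_cancel]
  have e1 : ((p : QBar p) ^ k)⁻¹ • toBQ p (x ^ P - 1) = ∑ j ∈ Finset.range P,
      (((P - 1).choose j : QBar p) / (j + 1 : QBar p)) • toBQ p (u ^ (j + 1)) := by
    rw [hx, add_pow, Finset.sum_range_succ']
    simp only [one_pow, mul_one, pow_zero, Nat.choose_zero_right, Nat.cast_one, add_sub_cancel_right]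
    rw [map_sum, Finset.smul_sum]
    refine Finset.sum_congr rfl fun j hj => ?_
    rw [mul_comm, ← natCast_smul_toBQ, smul_smul]
    congr 1
    have h2 := Nat.add_one_mul_choose_eq (P - 1) j
    rw [Nat.sub_add_cancel (by omega)] at h2
    have h3 : (P : QBar p) * (P - 1).choose j = P.choose (j + 1) * (j + 1) := by exact_mod_cast h2
    have h4 : (P : QBar p) ≠ 0 := Nat.cast_ne_zero.2 (by omega)
    have h5 : (j + 1 : QBar p) ≠ 0 := Nat.cast_add_one_ne_zero j
    rw [← Nat.cast_pow, ← hP, eq_div_iff h5, mul_assoc, ← h3, inv_mul_cancel_left₀ h4]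
  have e2 : ∑ j ∈ Finset.range P, (((P - 1).choose j : QBar p) / (j + 1 : QBar p)) • toBQ p (u ^ (j + 1)) =
      ∑ j ∈ Finset.range m, (((P - 1).choose j : QBar p) / (j + 1 : QBar p)) • toBQ p (u ^ (j + 1)) +
      ∑ j ∈ Finset.Ico m P, (((P - 1).choose j : QBar p) / (j + 1 : QBar p)) • toBQ p (u ^ (j + 1)) := by
    rw [Finset.sum_range_add_sum_Ico _ hmP]
  have e3 : z - ∑ j ∈ Finset.range m, ((-1 : QBar p) ^ j / (j + 1 : QBar p)) • toBQ p (u ^ (j + 1)) =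
      (z - ((p : QBar p) ^ k)⁻¹ • toBQ p (x ^ P - 1)) +
      ∑ j ∈ Finset.range m, ((((P - 1).choose j : QBar p) - (-1) ^ j) / (j + 1 : QBar p)) • toBQ p (u ^ (j + 1)) +
      ∑ j ∈ Finset.Ico m P, (((P - 1).choose j : QBar p) / (j + 1 : QBar p)) • toBQ p (u ^ (j + 1)) := by
    simp only [sub_div, sub_smul, Finset.sum_sub_distrib]
    rw [e1, e2]
    abel
  rw [e3]
  refine add_mem (add_mem (hk₀ k (by omega)) (sum_mem fun j hj => ?_)) (sum_mem fun j hj => ?_)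
  · have hj := Finset.mem_range.1 hj
    obtain ⟨c, hc⟩ := choose_congr P j (by omega)
    have e4 : ((((P - 1).choose j : QBar p) - (-1) ^ j) / (j + 1 : QBar p)) • toBQ p (u ^ (j + 1)) =
        (((j + 1).factorial : ℕ) : QBar p)⁻¹ • toBQ p ((p : BZ p) ^ k * (c * u ^ (j + 1))) := by
      have e5 : toBQ p ((p : BZ p) ^ k * (c * u ^ (j + 1))) = ((P : QBar p) * (c : QBar p)) • toBQ p (u ^ (j + 1)) := by
        rw [← Nat.cast_pow, ← natCast_smul_toBQ, mul_smul, Int.cast_smul_eq_zsmul, ← map_zsmul, zsmul_eq_mul]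
      have hc' : (j.factorial : QBar p) * (((P - 1).choose j : QBar p) - (-1) ^ j) = P * c := by exact_mod_cast hc
      rw [e5, smul_smul, ← hc']
      congr 1
      have h5 : (j + 1 : QBar p) ≠ 0 := Nat.cast_add_one_ne_zero j
      have h6 : (j.factorial : QBar p) ≠ 0 := Nat.cast_ne_zero.2 j.factorial_ne_zero
      rw [Nat.factorial_succ]
      push_cast
      field_simp
    rw [e4]
    refine inv_smul_mem (s := m.factorial) _ (Nat.factorial_ne_zero _) ?_ ?_
    · exact (Nat.factorization_lt p (Nat.factorial_ne_zero _)).le.trans (Nat.factorial_le (by omega))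
    · exact pLat_le (by omega) (mem_pLat.2 ⟨_, rfl⟩)
  · have hj := Finset.mem_Ico.1 hj
    have h1 := hm₀ (j + 1) (by omega)
    obtain ⟨d, hd⟩ := Nat.exists_eq_add_of_le h1
    -- By the choice of m₀ there are n + v_p(j+1) blocks u^N inside u^(j+1). The last v_p(j+1)
    -- factors p cancel the denominator, the other n remain.
    have e4 : (((P - 1).choose j : QBar p) / (j + 1 : QBar p)) • toBQ p (u ^ (j + 1)) =
        (((j + 1 : ℕ)) : QBar p)⁻¹ • toBQ p ((p : BZ p) ^ (n + (j + 1).factorization p) *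
          (w ^ (n + (j + 1).factorization p) * u ^ d * (P - 1).choose j)) := by
      have e5 : u ^ (j + 1) = (p : BZ p) ^ (n + (j + 1).factorization p) *
          (w ^ (n + (j + 1).factorization p) * u ^ d) := by
        conv_lhs => rw [hd]
        rw [pow_add, pow_mul, hw, mul_pow, mul_assoc]
      rw [← mul_assoc, ← e5, mul_comm, ← natCast_smul_toBQ, smul_smul, Nat.cast_add_one, div_eq_inv_mul]
    rw [e4]
    exact inv_smul_mem (s := (j + 1).factorization p) _ (Nat.succ_ne_zero _) le_rfl (mem_pLat.2 ⟨_, rfl⟩)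

theorem IsPLog.plog_eq {x : BZ p} {z : BQ p} (h : IsPLog x z) : plog x = z := by
  have hex : ∃ y, IsPLog x y := ⟨z, h⟩
  rw [plog, dif_pos hex, ← sub_eq_zero]
  refine eq_zero_of_mem_pLat _ fun n => ?_
  obtain ⟨m, hm⟩ := hex.choose_spec n
  obtain ⟨m', hm'⟩ := h n
  obtain ⟨w, hw⟩ := hm (m + m') (by omega)
  obtain ⟨w', hw'⟩ := hm' (m + m') (by omega)
  have h1 := sub_mem (mem_pLat.2 ⟨w, hw⟩) (mem_pLat.2 ⟨w', hw'⟩)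
  rwa [sub_sub_sub_cancel_right] at h1

/-- Expansion to second order: the quadratic term carries p^(2k+2), so the coefficient c changes
only modulo p^k while the exponent of p rises by one. -/
theorem one_add_pow_step {R : Type*} [CommRing R] (k : ℕ) (c : R) :
    ∃ d, (1 + (p : R) ^ (k + 1) * c) ^ p = 1 + (p : R) ^ (k + 2) * (c + d * (p : R) ^ k) := by
  obtain ⟨r, hr⟩ := Polynomial.powAddExpansion (1 : R) ((p : R) ^ (k + 1) * c) p
  refine ⟨r * c ^ 2, ?_⟩
  rw [hr, one_pow, one_pow]
  ring

theorem B.exists_lim {E : Type*} [Group E] [TopologicalSpace E] (x : ℕ → B p E)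
    (hx : ∀ n, x (n + 1) - x n ∈ pId p (B p E) n) : ∃ y, ∀ n, y - x n ∈ pId p (B p E) n :=
  PComp.exists_lim (A := LamS p E) x hx

/-- Writing μ^(p^k) = 1 + p^(k+1)·c_k, the c_k form a Cauchy sequence with limit c, and (μ^(p^k) -
1)/p^k = p·c_k tends to p·c. The same c serves every f at once, so the logarithms of all
determinants of μ come from one element of B(E). -/
theorem exists_log {E : Type*} [Group E] [TopologicalSpace E] (hE : ∀ a b : E, a * b = b * a) (μ : B p E)
    (h : μ - 1 ∈ pId p (B p E) 1) :
    ∃ c : B p E, ∀ f : B p E →+* BZ p, IsPLog' (f μ) ((p : QBar p) • toBQ p (f c)) := by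
  letI : CommRing (B p E) := B.commRing hE
  have step : ∀ (k : ℕ) (c : {c : B p E // μ ^ p ^ k = 1 + (p : B p E) ^ (k + 1) * c}),
      ∃ c' : {c : B p E // μ ^ p ^ (k + 1) = 1 + (p : B p E) ^ (k + 1 + 1) * c},
        (c' : B p E) - c ∈ pId p (B p E) k := by
    intro k c
    obtain ⟨d, hd⟩ := one_add_pow_step (p := p) k c.1
    refine ⟨⟨c.1 + d * (p : B p E) ^ k, ?_⟩, ?_⟩
    · rw [pow_succ, pow_mul]
      exact (congrArg (· ^ p) c.2).trans hd
    · rw [add_sub_cancel_left]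
      exact (mem_pId p).2 ⟨d, rfl⟩
  choose nxt hnxt using step
  obtain ⟨c₀, hc₀⟩ := (mem_pId p).1 h
  let c : ∀ k, {c : B p E // μ ^ p ^ k = 1 + (p : B p E) ^ (k + 1) * c} := fun k =>
    Nat.rec ⟨c₀, by
      change μ ^ p ^ 0 = 1 + (p : B p E) ^ 1 * c₀
      rw [pow_zero, pow_one, B.mul_comm_of hE _ c₀, hc₀, add_sub_cancel]⟩ (fun k c => nxt k c) k
  obtain ⟨y, hy⟩ := B.exists_lim (fun k => (c k).1) fun k => hnxt k (c k)
  refine ⟨y, fun f n => ⟨n, fun k hk => ?_⟩⟩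
  have hck := (c k).2
  obtain ⟨d, hd⟩ := (mem_pId p).1 (hy k)
  beta_reduce at hd
  generalize (c k).1 = e at hck hd
  have e1 : f μ ^ p ^ k - 1 = (p : BZ p) ^ (k + 1) * f e := by
    rw [← map_pow, hck, map_add, map_one, map_mul, map_pow, map_natCast, add_sub_cancel_left]
  have h1 := natCast_smul_toBQ (p ^ k) ((p : BZ p) * f e)
  rw [Nat.cast_pow, Nat.cast_pow, ← mul_assoc, ← pow_succ] at h1
  have e2 : ((p : QBar p) ^ k)⁻¹ • toBQ p (f μ ^ p ^ k - 1) = (p : QBar p) • toBQ p (f e) := by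
    rw [e1, ← h1, inv_smul_smul₀ (pow_ne_zero_QBar k), natCast_smul_toBQ]
  rw [e2, ← smul_sub, ← map_sub, ← map_sub, natCast_smul_toBQ]
  have e3 : f (y - e) = f d * (p : BZ p) ^ k := by
    rw [← map_natCast f, ← map_pow, ← map_mul, hd]
  rw [e3]
  exact pLat_le hk (mem_pLat.2 ⟨(p : BZ p) * f d, by ring_nf⟩)

end Log

/-! ### Induced class functions: transversals, transitivity, inflation. -/

section Induction

variable {p : ℕ} [Fact p.Prime]
variable {U V W : Type*} [Group U] [Group V] [Group W]

theorem extend_conj (i : V →* U) (hi : Function.Injective i) (f : V → QBar p)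
    (hf : ∀ u v, f (u * v) = f (v * u)) (v : V) (x : U) :
    Function.extend i f 0 ((i v)⁻¹ * x * i v) = Function.extend i f 0 x := by
  by_cases h : ∃ w, i w = x
  · obtain ⟨w, rfl⟩ := h
    rw [← map_inv, ← map_mul, ← map_mul, hi.extend_apply, hi.extend_apply, mul_assoc, hf,
      mul_assoc, mul_inv_cancel, mul_one]
  · rw [Function.extend_apply' _ _ _ h, Function.extend_apply']
    · rfl
    · rintro ⟨w, hw⟩
      refine h ⟨v * w * v⁻¹, ?_⟩
      rw [map_mul, map_mul, hw, map_inv]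
      group

/-- Changing a representative by an element of V conjugates the argument inside V, where f is a
class function. So any transversal may replace the chosen one. -/
theorem indFun_eq (i : V →* U) (hi : Function.Injective i) (f : V → QBar p)
    (hf : ∀ u v, f (u * v) = f (v * u)) {ι : Type*} (r : ι → U)
    (hr : ∀ x y, (r x)⁻¹ * r y ∈ i.range → x = y) (hr' : ∀ u, ∃ x, (r x)⁻¹ * u ∈ i.range) (g : U) :
    indFun i f g = ∑ᶠ x, Function.extend i f 0 ((r x)⁻¹ * g * r x) := by
  refine (finsum_eq_of_bijective (fun x => (r x : U ⧸ i.range)) ⟨fun x y h => hr x y ?_, fun q => ?_⟩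
    fun x => ?_).symm
  · exact QuotientGroup.eq.1 h
  · induction q using QuotientGroup.induction_on with | H u => ?_
    obtain ⟨x, hx⟩ := hr' u
    exact ⟨x, QuotientGroup.eq.2 hx⟩
  · have h : (r x)⁻¹ * (r x : U ⧸ i.range).out ∈ i.range :=
      QuotientGroup.eq.1 (QuotientGroup.out_eq' _).symm
    obtain ⟨v, hv⟩ := h
    have e : (r x : U ⧸ i.range).out = r x * i v := by rw [hv, mul_inv_cancel_left]
    rw [e, ← extend_conj i hi f hf v ((r x)⁻¹ * g * r x)]
    congr 1
    group

theorem out_inv_mul_mem {K : Subgroup U} (u : U) : (u : U ⧸ K).out⁻¹ * u ∈ K :=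
  QuotientGroup.eq.1 (QuotientGroup.out_eq' _)

theorem eq_of_out_inv_mul_mem {K : Subgroup U} {x y : U ⧸ K} (h : x.out⁻¹ * y.out ∈ K) : x = y := by
  have := QuotientGroup.eq.2 h
  rwa [QuotientGroup.out_eq', QuotientGroup.out_eq'] at this

theorem extend_add' (i : V →* U) (hi : Function.Injective i) (f f' : V → QBar p) (x : U) :
    Function.extend i (f + f') 0 x = Function.extend i f 0 x + Function.extend i f' 0 x := by
  by_cases h : ∃ w, i w = x
  · obtain ⟨w, rfl⟩ := h
    simp only [hi.extend_apply, Pi.add_apply]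
  · simp only [Function.extend_apply' _ _ _ h, Pi.zero_apply, add_zero]

theorem indFun_add (i : V →* U) (hi : Function.Injective i) [Finite (U ⧸ i.range)] (f f' : V → QBar p) :
    indFun i (f + f') = indFun i f + indFun i f' := by
  funext g
  rw [Pi.add_apply, indFun, indFun, indFun, ← finsum_add_distrib (Set.toFinite _) (Set.toFinite _)]
  exact finsum_congr fun q => extend_add' i hi f f' _

/-- Induction as an additive map. -/
def indHom (i : V →* U) (hi : Function.Injective i) [Finite (U ⧸ i.range)] :
    (V → QBar p) →+ (U → QBar p) := AddMonoidHom.mk' (indFun i) (indFun_add i hi)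

theorem indFun_comp (i : V →* U) (hi : Function.Injective i) (j : W →* V) (hj : Function.Injective j)
    [Finite (U ⧸ i.range)] [Finite (V ⧸ j.range)] (f : W → QBar p)
    (hf : ∀ u v, f (u * v) = f (v * u)) : indFun i (indFun j f) = indFun (i.comp j) f := by
  funext g
  have := Fintype.ofFinite (U ⧸ i.range)
  have := Fintype.ofFinite (V ⧸ j.range)
  -- Products of representatives of U/V and V/W form a transversal of U/W.
  rw [indFun_eq (i.comp j) (hi.comp hj) f hf
    (fun x : (U ⧸ i.range) × (V ⧸ j.range) => x.1.out * i x.2.out), finsum_eq_sum_of_fintype,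
    Fintype.sum_prod_type, indFun, finsum_eq_sum_of_fintype]
  · refine Finset.sum_congr rfl fun q _ => ?_
    by_cases h : ∃ v, i v = q.out⁻¹ * g * q.out
    · obtain ⟨v, hv⟩ := h
      rw [← hv, hi.extend_apply, indFun, finsum_eq_sum_of_fintype]
      refine Finset.sum_congr rfl fun s _ => ?_
      have e : (q.out * i s.out)⁻¹ * g * (q.out * i s.out) = i (s.out⁻¹ * v * s.out) := by
        rw [map_mul, map_mul, hv, map_inv]
        group
      rw [e]
      by_cases h' : ∃ w, j w = s.out⁻¹ * v * s.out
      · obtain ⟨w, hw⟩ := h'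
        rw [← hw, hj.extend_apply]
        exact ((hi.comp hj).extend_apply f 0 w).symm
      · rw [Function.extend_apply' _ _ _ h', Function.extend_apply']
        · rfl
        · rintro ⟨w, hw⟩
          exact h' ⟨w, hi hw⟩
    · rw [Function.extend_apply' _ _ _ h]
      refine (Finset.sum_eq_zero fun s _ => ?_).symm
      rw [Function.extend_apply']
      · rfl
      · rintro ⟨w, hw⟩
        refine h ⟨s.out * j w * s.out⁻¹, ?_⟩
        have hw : i (j w) = (q.out * i s.out)⁻¹ * g * (q.out * i s.out) := hw
        rw [map_mul, map_mul, hw, map_inv]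
        group
  · rintro ⟨q, s⟩ ⟨q', s'⟩ ⟨w, hw⟩
    have hw : i (j w) = (q.out * i s.out)⁻¹ * (q'.out * i s'.out) := hw
    obtain rfl : q = q' := eq_of_out_inv_mul_mem ⟨s.out * j w * s'.out⁻¹, by
      rw [map_mul, map_mul, hw, map_inv]; group⟩
    obtain rfl : s = s' := eq_of_out_inv_mul_mem ⟨w, hi (by
      rw [hw, map_mul, map_inv]; group)⟩
    rfl
  · intro u
    obtain ⟨v, hv⟩ := out_inv_mul_mem (K := i.range) u
    obtain ⟨w, hw⟩ := out_inv_mul_mem (K := j.range) v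
    refine ⟨((u : U ⧸ i.range), (v : V ⧸ j.range)), w, ?_⟩
    change i (j w) = _
    rw [hw, map_mul, hv, map_inv]
    group

/-- The image of i is the full preimage of the image of i', so a transversal upstairs maps to a
transversal downstairs and the two sums match term by term. -/
theorem indFun_inflate {U' V' : Type*} [Group U'] [Group V'] (i : V →* U) (hi : Function.Injective i)
    (i' : V' →* U') (hi' : Function.Injective i') (f : U →* U') (hf : Function.Surjective f) (f' : V →* V')
    (h : ∀ v, i' (f' v) = f (i v)) (h' : ∀ u, f u ∈ i'.range → u ∈ i.range) (χ : V' → QBar p)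
    (hχ : ∀ u v, χ (u * v) = χ (v * u)) (u : U) : indFun i (χ ∘ f') u = indFun i' χ (f u) := by
  rw [indFun_eq i' hi' χ hχ (fun q : U ⧸ i.range => f q.out), indFun]
  · refine finsum_congr fun q => ?_
    rw [← map_inv, ← map_mul, ← map_mul]
    by_cases hx : ∃ v, i v = q.out⁻¹ * u * q.out
    · obtain ⟨v, hv⟩ := hx
      rw [← hv, hi.extend_apply, ← h, hi'.extend_apply]
      rfl
    · rw [Function.extend_apply' _ _ _ hx, Function.extend_apply']
      · rfl
      · rintro hv
        exact hx (h' _ hv)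
  · intro x y hxy
    rw [← map_inv, ← map_mul] at hxy
    exact eq_of_out_inv_mul_mem (h' _ hxy)
  · intro u
    obtain ⟨u, rfl⟩ := hf u
    obtain ⟨v, hv⟩ := out_inv_mul_mem (K := i.range) u
    refine ⟨(u : U ⧸ i.range), f' v, ?_⟩
    rw [h, hv, map_mul, map_inv]

theorem card_smul_indFun [Finite U] (K : Subgroup U) (f : K → QBar p)
    (hf : ∀ u v, f (u * v) = f (v * u)) (g : U) :
    (Nat.card K : QBar p) * indFun K.subtype f g =
      ∑ᶠ u : U, Function.extend K.subtype f 0 (u⁻¹ * g * u) := by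
  have := Fintype.ofFinite (U ⧸ K)
  have := Fintype.ofFinite K
  rw [indFun_eq K.subtype K.subtype_injective f hf (fun q : U ⧸ K => q.out)
    (fun x y h => eq_of_out_inv_mul_mem (by obtain ⟨v, hv⟩ := h; rw [← hv]; exact v.2))
    (fun u => ⟨u, ⟨_, out_inv_mul_mem u⟩, rfl⟩)]
  rw [← finsum_comp_equiv (Subgroup.groupEquivQuotientProdSubgroup (s := K)).symm,
    finsum_eq_sum_of_fintype, finsum_eq_sum_of_fintype, Fintype.sum_prod_type, Finset.mul_sum]
  refine Finset.sum_congr rfl fun q _ => ?_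
  have h : ∀ v : K, Function.extend K.subtype f 0
      ((Subgroup.groupEquivQuotientProdSubgroup.symm (q, v))⁻¹ * g *
        Subgroup.groupEquivQuotientProdSubgroup.symm (q, v)) =
      Function.extend K.subtype f 0 (q.out⁻¹ * g * q.out) := by
    intro v
    have e : ∃ v' : K, Subgroup.groupEquivQuotientProdSubgroup.symm (q, v) = q.out * K.subtype v' := by
      have h1 : ((Subgroup.groupEquivQuotientProdSubgroup (s := K)).symm (q, v) : U ⧸ K) = q := by
        have := congrArg Prod.fst ((Subgroup.groupEquivQuotientProdSubgroup (s := K)).apply_symm_apply (q, v))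
        exact this
      have h2 := out_inv_mul_mem (K := K) ((Subgroup.groupEquivQuotientProdSubgroup (s := K)).symm (q, v))
      rw [h1] at h2
      exact ⟨⟨_, h2⟩, by simp⟩
    obtain ⟨v', e⟩ := e
    rw [e, ← extend_conj K.subtype K.subtype_injective f hf v' (q.out⁻¹ * g * q.out)]
    congr 1
    group
  rw [Finset.sum_congr rfl fun v _ => h v, Finset.sum_const, Finset.card_univ, nsmul_eq_mul,
    Nat.card_eq_fintype_card]

end Induction

/-! ### Linear characters of finite groups and eigenspace projections. -/

section Characters

variable {p : ℕ} [Fact p.Prime]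

/-- Roots of unity are integral, so those of ℚ̄_p already lie in its ring of integers. -/
instance (n : ℕ) [NeZero n] : HasEnoughRootsOfUnity (ZBar p) n where
  prim := by
    obtain ⟨ζ, hζ⟩ := HasEnoughRootsOfUnity.exists_primitiveRoot (QBar p) n
    have hi : IsIntegral ℤ_[p] ζ := by
      refine ⟨Polynomial.X ^ n - 1, Polynomial.monic_X_pow_sub_C 1 (NeZero.ne n), ?_⟩
      simp [hζ.pow_eq_one]
    exact ⟨⟨ζ, hi⟩, hζ.of_map_of_injective (f := (ZBar p).val) Subtype.val_injective⟩
  cyc := rootsOfUnity.isCyclic _ _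

/-- The value of a linear character. -/
def chVal {A : Type*} [Group A] (w : A →* (ZBar p)ˣ) (a : A) : QBar p := ((w a : ZBar p) : QBar p)

section

variable {A : Type*} [Group A]

theorem chVal_one (w : A →* (ZBar p)ˣ) : chVal w 1 = 1 := by rw [chVal, map_one]; rfl

theorem chVal_mul (w : A →* (ZBar p)ˣ) (a b : A) : chVal w (a * b) = chVal w a * chVal w b := by
  rw [chVal, map_mul]; rfl

theorem chVal_inv_mul (w : A →* (ZBar p)ˣ) (a : A) : chVal w a⁻¹ * chVal w a = 1 := by
  rw [← chVal_mul, inv_mul_cancel, chVal_one]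

theorem chVal_ne_zero (w : A →* (ZBar p)ˣ) (a : A) : chVal w a ≠ 0 := by
  intro h
  have := chVal_inv_mul w a
  rw [h, mul_zero] at this
  exact zero_ne_one this

theorem chVal_comm (w : A →* (ZBar p)ˣ) (a b : A) : chVal w (a * b) = chVal w (b * a) := by
  rw [chVal_mul, chVal_mul, mul_comm]

theorem chVal_injective {a : A} {w w' : A →* (ZBar p)ˣ} (h : chVal w a = chVal w' a) : w a = w' a :=
  Units.ext (Subtype.ext h)

variable [Finite A]

instance : NeZero (Monoid.exponent A) := ⟨Monoid.exponent_ne_zero_of_finite⟩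

instance : Fintype (A →* (ZBar p)ˣ) := Fintype.ofFinite _

theorem sum_char_apply [Fintype A] (w w' : A →* (ZBar p)ˣ) (h : w ≠ w') :
    ∑ a, chVal w a⁻¹ * chVal w' a = 0 := by
  obtain ⟨b, hb⟩ := DFunLike.ne_iff.1 h
  have h1 : ∑ a, chVal w a⁻¹ * chVal w' a =
      (chVal w b⁻¹ * chVal w' b) * ∑ a, chVal w a⁻¹ * chVal w' a := by
    rw [Finset.mul_sum, ← Equiv.sum_comp (Equiv.mulRight b)]
    refine Finset.sum_congr rfl fun a _ => ?_
    rw [Equiv.coe_mulRight, mul_inv_rev, chVal_mul, chVal_mul]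
    ring
  have h2 : chVal w b⁻¹ * chVal w' b ≠ 1 := by
    intro h3
    rw [← chVal_inv_mul w b] at h3
    exact hb (chVal_injective (mul_left_cancel₀ (chVal_ne_zero w b⁻¹) h3)).symm
  have h3 : (chVal w b⁻¹ * chVal w' b - 1) * ∑ a, chVal w a⁻¹ * chVal w' a = 0 := by
    rw [sub_mul, one_mul, ← h1, sub_self]
  exact (mul_eq_zero.1 h3).resolve_left (sub_ne_zero.2 h2)

theorem exists_char_ne_one (hA : ∀ a b : A, a * b = b * a) (a : A) (ha : a ≠ 1) :
    ∃ w : A →* (ZBar p)ˣ, w a ≠ 1 := by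
  letI : CommGroup A := { (inferInstance : Group A) with mul_comm := hA }
  exact CommGroup.exists_apply_ne_one_of_hasEnoughRootsOfUnity A (ZBar p) ha

theorem card_char (hA : ∀ a b : A, a * b = b * a) : Nat.card (A →* (ZBar p)ˣ) = Nat.card A := by
  letI : CommGroup A := { (inferInstance : Group A) with mul_comm := hA }
  exact CommGroup.card_monoidHom_of_hasEnoughRootsOfUnity A (ZBar p)

theorem sum_char (hA : ∀ a b : A, a * b = b * a) (a : A) (ha : a ≠ 1) :
    ∑ w : A →* (ZBar p)ˣ, chVal w a = 0 := by
  obtain ⟨v, hv⟩ := exists_char_ne_one (p := p) hA a ha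
  have h1 : ∑ w : A →* (ZBar p)ˣ, chVal w a = chVal v a * ∑ w : A →* (ZBar p)ˣ, chVal w a := by
    rw [Finset.mul_sum, ← Equiv.sum_comp (Equiv.mulLeft v)]
    rfl
  have h2 : chVal v a ≠ 1 := fun h => hv (Units.ext (Subtype.ext h))
  have h3 : (chVal v a - 1) * ∑ w : A →* (ZBar p)ˣ, chVal w a = 0 := by
    rw [sub_mul, one_mul, ← h1, sub_self]
  exact (mul_eq_zero.1 h3).resolve_left (sub_ne_zero.2 h2)

/-- The projection to the `w`-eigenspace of a representation. -/
def eigProj {n : ℕ} (ρ : A →* Matrix (Fin n) (Fin n) (QBar p)) (w : A →* (ZBar p)ˣ) :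
    Matrix (Fin n) (Fin n) (QBar p) :=
  haveI := Fintype.ofFinite A
  (Nat.card A : QBar p)⁻¹ • ∑ a, chVal w a⁻¹ • ρ a

variable {n : ℕ} (ρ : A →* Matrix (Fin n) (Fin n) (QBar p))

theorem sum_eigProj (hA : ∀ a b : A, a * b = b * a) : ∑ w, eigProj ρ w = 1 := by
  classical
  letI := Fintype.ofFinite A
  simp only [eigProj]
  rw [← Finset.smul_sum, Finset.sum_comm]
  simp only [← Finset.sum_smul]
  rw [Finset.sum_eq_single 1]
  · have h : ∑ w : A →* (ZBar p)ˣ, chVal w (1 : A)⁻¹ = (Nat.card A : QBar p) := by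
      rw [inv_one, Finset.sum_congr rfl fun w _ => chVal_one w, Finset.sum_const, Finset.card_univ, nsmul_one,
        ← Nat.card_eq_fintype_card, card_char hA]
    rw [h, map_one, inv_smul_smul₀ (Nat.cast_ne_zero.2 Nat.card_pos.ne')]
  · intro a _ ha
    rw [sum_char hA _ (inv_ne_one.2 ha), zero_smul]
  · exact fun h => (h (Finset.mem_univ _)).elim

theorem mul_eigProj (w : A →* (ZBar p)ˣ) (b : A) : ρ b * eigProj ρ w = chVal w b • eigProj ρ w := by
  letI := Fintype.ofFinite A
  simp only [eigProj]
  rw [mul_smul_comm, smul_comm (chVal w b), Finset.mul_sum]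
  congr 1
  rw [Finset.smul_sum, ← Equiv.sum_comp (Equiv.mulLeft b⁻¹)]
  refine Finset.sum_congr rfl fun a _ => ?_
  rw [Equiv.coe_mulLeft, mul_inv_rev, inv_inv, chVal_mul, mul_smul_comm, ← map_mul, mul_inv_cancel_left,
    smul_smul, mul_comm]

/-- Orthogonality of linear characters: A acts on the image of the second projection through w', so
the first one becomes the scalar average of w⁻¹w', which is 1 or 0. -/
theorem eigProj_mul (w w' : A →* (ZBar p)ˣ) [Decidable (w = w')] :
    eigProj ρ w * eigProj ρ w' = if w = w' then eigProj ρ w else 0 := by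
  letI := Fintype.ofFinite A
  have h : eigProj ρ w * eigProj ρ w' =
      ((Nat.card A : QBar p)⁻¹ * ∑ a, chVal w a⁻¹ * chVal w' a) • eigProj ρ w' := by
    conv_lhs => rw [eigProj]
    rw [smul_mul_assoc, Finset.sum_mul, mul_smul, Finset.sum_smul]
    congr 1
    refine Finset.sum_congr rfl fun a _ => ?_
    rw [smul_mul_assoc, mul_eigProj, smul_smul]
  rw [h]
  split_ifs with e
  · subst e
    rw [Finset.sum_congr rfl fun a _ => chVal_inv_mul w a, Finset.sum_const, Finset.card_univ, nsmul_one,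
      ← Nat.card_eq_fintype_card, inv_mul_cancel₀ (Nat.cast_ne_zero.2 Nat.card_pos.ne'), one_smul]
  · rw [sum_char_apply w w' e, mul_zero, zero_smul]

end

theorem Matrix_exists_factor {n : ℕ} {K : Type*} [Field K] (e : Matrix (Fin n) (Fin n) K) (he : e * e = e) :
    ∃ (m : ℕ) (A : Matrix (Fin n) (Fin m) K) (C : Matrix (Fin m) (Fin n) K), A * C = e ∧ C * A = 1 := by
  let L := Matrix.toLin' e
  let b := Module.finBasis K (LinearMap.range L)
  let f : (Fin (Module.finrank K (LinearMap.range L)) → K) →ₗ[K] (Fin n → K) :=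
    (LinearMap.range L).subtype ∘ₗ b.equivFun.symm.toLinearMap
  let g : (Fin n → K) →ₗ[K] (Fin (Module.finrank K (LinearMap.range L)) → K) :=
    b.equivFun.toLinearMap ∘ₗ L.rangeRestrict
  refine ⟨_, LinearMap.toMatrix' f, LinearMap.toMatrix' g, ?_, ?_⟩
  · rw [← LinearMap.toMatrix'_comp]
    have : f ∘ₗ g = L := by
      refine LinearMap.ext fun x => ?_
      change ((b.equivFun.symm (b.equivFun (L.rangeRestrict x)) : LinearMap.range L) : Fin n → K) = L x
      rw [LinearEquiv.symm_apply_apply]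
      rfl
    rw [this]
    exact LinearMap.toMatrix'_toLin' e
  · rw [← LinearMap.toMatrix'_comp]
    have : g ∘ₗ f = LinearMap.id := by
      refine LinearMap.ext fun x => ?_
      change b.equivFun (L.rangeRestrict (b.equivFun.symm x)) = x
      have h1 : L.rangeRestrict (b.equivFun.symm x : Fin n → K) = b.equivFun.symm x := by
        obtain ⟨y, hy⟩ := (b.equivFun.symm x).2
        refine Subtype.ext ?_
        change L (b.equivFun.symm x : Fin n → K) = _
        rw [← hy]
        change Matrix.toLin' e (Matrix.toLin' e y) = Matrix.toLin' e y
        rw [← LinearMap.comp_apply, ← Matrix.toLin'_mul, he]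
      rw [h1, LinearEquiv.apply_symm_apply]
    rw [this, LinearMap.toMatrix'_id]

/-- The idempotent splits as e = A·C with C·A = 1, and σ(t) = C·ρ(t)·A is ρ restricted to the image
of e. The last clause records which elements act on that image by scalars; it is used to see
kernels. -/
theorem exists_corner {T : Type*} [Group T] {n : ℕ} {K : Type*} [Field K] (ρ : T →* Matrix (Fin n) (Fin n) K)
    (e : Matrix (Fin n) (Fin n) K) (he : e * e = e) (hc : ∀ t, ρ t * e = e * ρ t) :
    ∃ (m : ℕ) (σ : T →* Matrix (Fin m) (Fin m) K), (∀ t, (σ t).trace = (ρ t * e).trace) ∧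
      ∀ (t : T) (c : K), ρ t * e = c • e → σ t = c • 1 := by
  obtain ⟨m, A, C, h1, h2⟩ := Matrix_exists_factor e he
  have hA : e * A = A := by rw [← h1, Matrix.mul_assoc, h2, Matrix.mul_one]
  refine ⟨m, ⟨⟨fun t => C * ρ t * A, ?_⟩, fun s t => ?_⟩, fun t => ?_, fun t c h => ?_⟩
  · rw [map_one, Matrix.mul_one, h2]
  · change C * ρ (s * t) * A = C * ρ s * A * (C * ρ t * A)
    calc C * ρ (s * t) * A = C * ρ s * (ρ t * (e * A)) := by rw [hA, map_mul]; simp only [Matrix.mul_assoc]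
      _ = C * ρ s * (e * ρ t) * A := by rw [← hc]; simp only [Matrix.mul_assoc]
      _ = _ := by rw [← h1]; simp only [Matrix.mul_assoc]
  · change (C * ρ t * A).trace = _
    rw [← h1, Matrix.mul_assoc, Matrix.trace_mul_comm, Matrix.mul_assoc]
  · change C * ρ t * A = _
    rw [← hA, Matrix.mul_assoc, ← Matrix.mul_assoc (ρ t), h, Matrix.smul_mul, hA, Matrix.mul_smul, h2]

theorem exists_trace_eq_natCast {n : ℕ} {K : Type*} [Field K] (e : Matrix (Fin n) (Fin n) K) (he : e * e = e) :
    ∃ m : ℕ, e.trace = m := by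
  obtain ⟨m, A, C, h1, h2⟩ := Matrix_exists_factor e he
  exact ⟨m, by rw [← h1, Matrix.trace_mul_comm, h2, Matrix.trace_one, Fintype.card_fin]⟩

theorem trace_eq_sum_char {A : Type*} [Group A] [Finite A] (hA : ∀ a b : A, a * b = b * a) {n : ℕ}
    (ρ : A →* Matrix (Fin n) (Fin n) (QBar p)) :
    ∃ m : (A →* (ZBar p)ˣ) → ℕ, ∀ a, (ρ a).trace = ∑ w, m w * chVal w a := by
  classical
  have h := fun w => exists_trace_eq_natCast (eigProj ρ w) (by rw [eigProj_mul, if_pos rfl])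
  choose m hm using h
  refine ⟨m, fun a => ?_⟩
  calc (ρ a).trace = (ρ a * ∑ w, eigProj ρ w).trace := by rw [sum_eigProj ρ hA, mul_one]
    _ = _ := by
      rw [Finset.mul_sum, Matrix.trace_sum]
      refine Finset.sum_congr rfl fun w _ => ?_
      rw [mul_eigProj, Matrix.trace_smul, hm, smul_eq_mul, mul_comm]

end Characters

/-! ### Blichfeldt's theorem: characters of finite p-groups are combinations of monomial ones. -/

section Monomial

universe u

variable {p : ℕ} [Fact p.Prime]

theorem trace_conj {T : Type*} [Group T] {n : ℕ} {K : Type*} [Field K] (ρ : T →* Matrix (Fin n) (Fin n) K)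
    (u : T) (X : Matrix (Fin n) (Fin n) K) : (ρ u * X * ρ u⁻¹).trace = X.trace := by
  rw [Matrix.trace_mul_comm, ← Matrix.mul_assoc, ← map_mul, inv_mul_cancel, map_one, Matrix.one_mul]

variable (p) in
/-- The span of the functions induced from linear characters of subgroups. -/
def monSpan (F : Type*) [Group F] : AddSubgroup (F → QBar p) :=
  AddSubgroup.closure {f | ∃ (V : Subgroup F) (φ : V →* (ZBar p)ˣ), f = indFun V.subtype (chVal φ)}

theorem indFun_congr {U V V' : Type*} [Group U] [Group V] [Group V'] (i : V →* U) (hi : Function.Injective i)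
    (i' : V' →* U) (hi' : Function.Injective i') (e : V →* V') (he : ∀ v, i' (e v) = i v)
    (h : ∀ v', i' v' ∈ i.range) (χ : V' → QBar p) (hχ : ∀ u v, χ (u * v) = χ (v * u)) :
    indFun i (χ ∘ e) = indFun i' χ :=
  funext fun u => indFun_inflate i hi i' hi' (MonoidHom.id U) Function.surjective_id e he
    (fun u ⟨v', hv⟩ => by have := h v'; rwa [hv] at this) χ hχ u

theorem monSpan_comp {F F' : Type*} [Group F] [Group F'] (f : F →* F') (hf : Function.Surjective f)
    {χ : F' → QBar p} (h : χ ∈ monSpan p F') : χ ∘ f ∈ monSpan p F := by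
  induction h using AddSubgroup.closure_induction with
  | mem x hx =>
    obtain ⟨V, φ, rfl⟩ := hx
    refine AddSubgroup.subset_closure ⟨V.comap f, φ.comp (f.subgroupComap V), ?_⟩
    funext u
    refine (indFun_inflate (V.comap f).subtype (V.comap f).subtype_injective V.subtype V.subtype_injective
      f hf (f.subgroupComap V) (fun _ => rfl) ?_ (chVal φ) (chVal_comm φ) u).symm
    rintro u ⟨v, hv⟩
    exact ⟨⟨u, show f u ∈ V from hv ▸ v.2⟩, rfl⟩
  | zero => exact zero_mem _
  | add x y _ _ hx hy => exact add_mem hx hy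
  | neg x _ hx => exact neg_mem hx

theorem monSpan_ind {F : Type*} [Group F] [Finite F] (T : Subgroup F) {χ : T → QBar p} (h : χ ∈ monSpan p T) :
    indFun T.subtype χ ∈ monSpan p F := by
  have hm : ∀ f : T → QBar p, indHom T.subtype T.subtype_injective f = indFun T.subtype f := fun _ => rfl
  rw [← hm]
  induction h using AddSubgroup.closure_induction with
  | mem x hx =>
    obtain ⟨V, φ, rfl⟩ := hx
    let e := V.equivMapOfInjective T.subtype T.subtype_injective
    refine AddSubgroup.subset_closure ⟨V.map T.subtype, φ.comp e.symm.toMonoidHom, ?_⟩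
    rw [hm, indFun_comp T.subtype T.subtype_injective V.subtype V.subtype_injective _ (chVal_comm φ)]
    rw [← indFun_congr (T.subtype.comp V.subtype) (T.subtype_injective.comp V.subtype_injective)
      (V.map T.subtype).subtype (Subgroup.subtype_injective _) e.toMonoidHom (fun _ => rfl) ?_
      (chVal (φ.comp e.symm.toMonoidHom)) (chVal_comm _)]
    · congr 1
      funext v
      change chVal φ v = chVal φ (e.symm (e v))
      rw [MulEquiv.symm_apply_apply]
    · rintro ⟨_, v, hv, rfl⟩
      exact ⟨⟨v, hv⟩, rfl⟩
  | zero => rw [map_zero]; exact zero_mem _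
  | add x y _ _ hx hy => rw [map_add]; exact add_mem hx hy
  | neg x _ hx => rw [map_neg]; exact neg_mem hx

section Conj

variable {F : Type*} [Group F] (A : Subgroup F) [A.Normal]

/-- The action of a group on the linear characters of a normal subgroup. -/
@[reducible] def charAction : MulAction F (A →* (ZBar p)ˣ) where
  smul g w := w.comp (MulAut.conjNormal g⁻¹ : MulAut A).toMonoidHom
  one_smul w := MonoidHom.ext fun a => by
    change w (MulAut.conjNormal (1 : F)⁻¹ a) = w a
    rw [inv_one, map_one]; rfl
  mul_smul g g' w := MonoidHom.ext fun a => by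
    change w (MulAut.conjNormal (g * g')⁻¹ a) = w (MulAut.conjNormal g'⁻¹ (MulAut.conjNormal g⁻¹ a))
    rw [mul_inv_rev, map_mul]; rfl

variable [Finite A] {n : ℕ} (ρ : F →* Matrix (Fin n) (Fin n) (QBar p))

theorem mul_eigProj_restrict (g : F) (w : A →* (ZBar p)ˣ) :
    letI := charAction (p := p) A
    ρ g * eigProj (ρ.comp A.subtype) w = eigProj (ρ.comp A.subtype) (g • w) * ρ g := by
  letI := charAction (p := p) A
  letI := Fintype.ofFinite A
  simp only [eigProj]
  rw [mul_smul_comm, smul_mul_assoc, Finset.mul_sum, Finset.sum_mul]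
  congr 1
  refine Eq.trans ?_ (Equiv.sum_comp (MulAut.conjNormal g : MulAut A).toEquiv _)
  refine Finset.sum_congr rfl fun a _ => ?_
  have e1 : chVal (g • w) ((MulAut.conjNormal g : MulAut A) a)⁻¹ = chVal w a⁻¹ := by
    change chVal w (MulAut.conjNormal g⁻¹ ((MulAut.conjNormal g : MulAut A) a)⁻¹) = _
    congr 1
    ext
    simp [mul_assoc]
  have e2 : ρ ((MulAut.conjNormal g : MulAut A) a : F) * ρ g = ρ g * ρ a := by
    rw [← map_mul, ← map_mul, MulAut.conjNormal_apply, inv_mul_cancel_right]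
  change ρ g * chVal w a⁻¹ • ρ a = (chVal (g • w) ((MulAut.conjNormal g : MulAut A) a)⁻¹ •
    ρ ((MulAut.conjNormal g : MulAut A) a : F)) * ρ g
  rw [e1, smul_mul_assoc, e2, mul_smul_comm]

/-- Clifford theory. ρ(g) permutes the A-eigenspaces as g permutes the characters of A. Eigenspaces
that are moved contribute nothing to the trace, and each orbit assembles into the representation
induced from a stabiliser acting on its eigenspace. -/
theorem trace_eq_sum_indFun [Finite F] (hA : ∀ a b : A, a * b = b * a) :
    letI := charAction (p := p) A
    letI := Fintype.ofFinite (MulAction.orbitRel.Quotient F (A →* (ZBar p)ˣ))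
    (fun g => (ρ g).trace) = ∑ ω : MulAction.orbitRel.Quotient F (A →* (ZBar p)ˣ),
      indFun (MulAction.stabilizer F ω.out).subtype
        (fun h => (ρ h * eigProj (ρ.comp A.subtype) ω.out).trace) := by
  classical
  letI := charAction (p := p) A
  letI := Fintype.ofFinite (MulAction.orbitRel.Quotient F (A →* (ZBar p)ˣ))
  funext g
  have hA' : ∀ a b : A, a * b = b * a := hA
  set e := eigProj (p := p) (ρ.comp A.subtype) with he
  have h0 : ∀ w : A →* (ZBar p)ˣ, g • w ≠ w → (ρ g * e w).trace = 0 := by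
    intro w hw
    have h1 : (ρ g * e w).trace = (e w * (ρ g * e w)).trace := by
      conv_rhs => rw [Matrix.trace_mul_comm, mul_assoc, he, eigProj_mul, if_pos rfl]
    rw [h1, he, mul_eigProj_restrict, ← mul_assoc, eigProj_mul, if_neg hw.symm, zero_mul, Matrix.trace_zero]
  have hc : ∀ (u : F) (w : A →* (ZBar p)ˣ), (ρ g * e (u • w)).trace = (ρ (u⁻¹ * g * u) * e w).trace := by
    intro u w
    have h2 : e (u • w) = ρ u * e w * ρ u⁻¹ := by
      rw [he, mul_eigProj_restrict, mul_assoc, ← map_mul, mul_inv_cancel, map_one, mul_one]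
    rw [h2, map_mul, map_mul, ← trace_conj ρ u (ρ u⁻¹ * ρ g * ρ u * e w)]
    have h3 : ρ u * ρ u⁻¹ = 1 := by rw [← map_mul, mul_inv_cancel, map_one]
    congr 1
    calc ρ g * (ρ u * e w * ρ u⁻¹) = 1 * (ρ g * (ρ u * e w * ρ u⁻¹)) := (one_mul _).symm
      _ = _ := by rw [← h3]; simp only [mul_assoc]
  have h4 : (ρ g).trace = ∑ w, (ρ g * e w).trace := by
    rw [← Matrix.trace_sum, ← Finset.mul_sum, he, sum_eigProj _ hA, mul_one]
  rw [h4]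
  letI : ∀ ω : MulAction.orbitRel.Quotient F (A →* (ZBar p)ˣ), Fintype (F ⧸ MulAction.stabilizer F ω.out) :=
    fun ω => Fintype.ofFinite _
  -- Characters of A correspond to an orbit together with a coset of the stabiliser of its
  -- representative.
  have hb : Function.Bijective (fun x : Σ ω : MulAction.orbitRel.Quotient F (A →* (ZBar p)ˣ),
      F ⧸ MulAction.stabilizer F ω.out => x.2.out • x.1.out) := by
    have hmk : ∀ (u : F) (ω : MulAction.orbitRel.Quotient F (A →* (ZBar p)ˣ)),
        (Quotient.mk'' (u • ω.out) : MulAction.orbitRel.Quotient F (A →* (ZBar p)ˣ)) = ω := by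
      intro u ω
      conv_rhs => rw [← Quotient.out_eq' ω]
      exact Quotient.sound' ⟨u, rfl⟩
    constructor
    · rintro ⟨ω, q⟩ ⟨ω', q'⟩ h
      have h : q.out • ω.out = q'.out • ω'.out := h
      obtain rfl : ω = ω' := by rw [← hmk q.out ω, h, hmk]
      congr 1
      refine eq_of_out_inv_mul_mem ?_
      rw [MulAction.mem_stabilizer_iff, mul_smul, ← h, inv_smul_smul]
    · intro w
      obtain ⟨u, hu⟩ : (Quotient.mk'' w : MulAction.orbitRel.Quotient F (A →* (ZBar p)ˣ)).out ∈
          MulAction.orbit F w := MulAction.orbitRel_apply.1 (Quotient.exact' (Quotient.out_eq' _))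
      have hu : u • w = _ := hu
      refine ⟨⟨Quotient.mk'' w, ((u⁻¹ : F) : F ⧸ _)⟩, ?_⟩
      have h5 := out_inv_mul_mem (K := MulAction.stabilizer F
        (Quotient.mk'' w : MulAction.orbitRel.Quotient F (A →* (ZBar p)ˣ)).out) u⁻¹
      rw [MulAction.mem_stabilizer_iff, mul_smul, inv_smul_eq_iff] at h5
      change Quotient.out _ • _ = w
      rw [← h5, ← hu, inv_smul_smul]
  rw [← hb.sum_comp, Fintype.sum_sigma, Finset.sum_apply]
  refine Finset.sum_congr rfl fun ω _ => ?_
  have hcomm : ∀ h : MulAction.stabilizer F ω.out, ρ h * e ω.out = e ω.out * ρ h := by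
    intro h
    rw [he, mul_eigProj_restrict, MulAction.mem_stabilizer_iff.1 h.2]
  rw [indFun_eq _ (Subgroup.subtype_injective _) _ ?_ (fun q : F ⧸ MulAction.stabilizer F ω.out => q.out)
    (fun x y h => eq_of_out_inv_mul_mem (by obtain ⟨v, hv⟩ := h; rw [← hv]; exact v.2))
    (fun u => ⟨u, ⟨_, out_inv_mul_mem u⟩, rfl⟩), finsum_eq_sum_of_fintype]
  · refine Finset.sum_congr rfl fun q _ => ?_
    by_cases hq : q.out⁻¹ * g * q.out ∈ MulAction.stabilizer F ω.out
    · have h6 := (Subgroup.subtype_injective (MulAction.stabilizer F ω.out)).extend_apply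
        (fun h => (ρ h * e ω.out).trace) 0 ⟨_, hq⟩
      exact (hc _ _).trans h6.symm
    · rw [Function.extend_apply']
      · refine h0 _ fun h7 => hq ?_
        rw [MulAction.mem_stabilizer_iff, mul_smul, mul_smul, h7, inv_smul_smul]
      · rintro ⟨v, hv⟩
        exact hq (hv ▸ v.2)
  · intro h h'
    change (ρ (h * h' : F) * e ω.out).trace = (ρ (h' * h : F) * e ω.out).trace
    rw [map_mul, map_mul, mul_assoc, hcomm, ← mul_assoc, Matrix.trace_mul_comm, ← mul_assoc]

end Conj

/-- The centre of F/Z(F) is nontrivial because F is a p-group. A lift x of a nontrivial central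
class generates, together with Z(F), an abelian subgroup; it is normal since conjugation changes x
only by central elements, and it is not central since x is not. -/
theorem exists_normal_abelian {F : Type*} [Group F] [Finite F] (hF : IsPGroup p F)
    (h : ¬ ∀ a b : F, a * b = b * a) :
    ∃ A : Subgroup F, A.Normal ∧ (∀ a b : A, a * b = b * a) ∧ ∃ a ∈ A, ∃ g : F, g * a ≠ a * g := by
  have hn : Nontrivial (F ⧸ Subgroup.center F) := by
    by_contra hc
    rw [not_nontrivial_iff_subsingleton] at hc
    have h1 := QuotientGroup.subgroup_eq_top_of_subsingleton _ hc
    refine h fun a b => ?_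
    exact (Subgroup.mem_center_iff.1 (h1 ▸ Subgroup.mem_top a : a ∈ Subgroup.center F) b).symm
  have hz := (hF.to_quotient (Subgroup.center F)).center_nontrivial
  obtain ⟨⟨y, hy⟩, hy1⟩ := exists_ne (1 : Subgroup.center (F ⧸ Subgroup.center F))
  induction y using QuotientGroup.induction_on with | H x => ?_
  have hx : x ∉ Subgroup.center F := fun hx => hy1 (Subtype.ext ((QuotientGroup.eq_one_iff x).2 hx))
  have hcomm : ∀ g, ∃ z ∈ Subgroup.center F, g * x * g⁻¹ = x * z := by
    intro g
    have h1 := Subgroup.mem_center_iff.1 hy (g : F ⧸ Subgroup.center F)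
    have h2 : (QuotientGroup.mk x : F ⧸ Subgroup.center F) = QuotientGroup.mk (g * x * g⁻¹) := by
      rw [QuotientGroup.mk_mul, QuotientGroup.mk_mul, h1, QuotientGroup.mk_inv, mul_inv_cancel_right]
    exact ⟨x⁻¹ * (g * x * g⁻¹), QuotientGroup.eq.1 h2, by group⟩
  refine ⟨Subgroup.zpowers x ⊔ Subgroup.center F, ⟨?_⟩, ?_, x, Subgroup.mem_sup_left (Subgroup.mem_zpowers x), ?_⟩
  · intro a ha g
    obtain ⟨y, hy, z, hz, rfl⟩ := Subgroup.mem_sup_of_normal_right.1 ha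
    obtain ⟨k, rfl⟩ := Subgroup.mem_zpowers_iff.1 hy
    obtain ⟨z', hz', e⟩ := hcomm g
    have e2 : g * (x ^ k * z) * g⁻¹ = (g * x * g⁻¹) ^ k * (g * z * g⁻¹) := by
      rw [conj_zpow]; group
    rw [e2, e]
    refine mul_mem (zpow_mem (mul_mem (Subgroup.mem_sup_left (Subgroup.mem_zpowers x))
      (Subgroup.mem_sup_right hz')) _) (Subgroup.mem_sup_right ?_)
    exact (inferInstance : (Subgroup.center F).Normal).conj_mem z hz g
  · rintro ⟨a, ha⟩ ⟨b, hb⟩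
    obtain ⟨y, hy, z, hz, rfl⟩ := Subgroup.mem_sup_of_normal_right.1 ha
    obtain ⟨k, rfl⟩ := Subgroup.mem_zpowers_iff.1 hy
    obtain ⟨y', hy', z', hz', rfl⟩ := Subgroup.mem_sup_of_normal_right.1 hb
    obtain ⟨k', rfl⟩ := Subgroup.mem_zpowers_iff.1 hy'
    refine Subtype.ext ?_
    have c1 : ∀ u, Commute u z := fun u => Subgroup.mem_center_iff.1 hz u
    have c2 : ∀ u, Commute u z' := fun u => Subgroup.mem_center_iff.1 hz' u
    have c3 : Commute (x ^ k) (x ^ k') := (Commute.refl x).zpow_zpow k k'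
    exact ((c3.mul_right (c2 _)).mul_left ((c1 _).symm.mul_right (c2 z)) : Commute _ _)
  · by_contra! hc
    exact hx (Subgroup.mem_center_iff.2 hc)

theorem chVal_mem_monSpan {F : Type*} [Group F] [Finite F] (w : F →* (ZBar p)ˣ) : chVal w ∈ monSpan p F := by
  have h1 := indFun_congr (MonoidHom.id F) Function.injective_id (⊤ : Subgroup F).subtype
    (Subgroup.subtype_injective _) (Subgroup.topEquiv.symm.toMonoidHom) (fun _ => rfl)
    (fun v => ⟨v, rfl⟩) (chVal (w.comp (⊤ : Subgroup F).subtype)) (chVal_comm _)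
  have h3 : chVal w = indFun (⊤ : Subgroup F).subtype (chVal (w.comp (⊤ : Subgroup F).subtype)) := by
    rw [← h1]
    funext g
    have h2 := indFun_eq (MonoidHom.id F) Function.injective_id (chVal w) (chVal_comm w)
      (fun _ : Unit => (1 : F)) (fun _ _ _ => rfl) (fun u => ⟨(), u, by simp⟩) g
    rw [finsum_eq_sum_of_fintype, Finset.univ_unique, Finset.sum_singleton, inv_one, one_mul, mul_one] at h2
    refine Eq.trans ?_ h2.symm
    have h4 : Function.Injective (MonoidHom.id F) := Function.injective_id
    exact (h4.extend_apply (chVal w) 0 g).symm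
  rw [h3]
  exact AddSubgroup.subset_closure ⟨⊤, _, rfl⟩

theorem exists_kerLift {T M : Type*} [Group T] [MulOneClass M] (σ : T →* M) :
    ∃ τ : T ⧸ σ.ker →* M, ∀ t : T, τ t = σ t := by
  have h : ∀ a b : T, QuotientGroup.leftRel σ.ker a b → σ a = σ b := by
    intro a b hab
    have h1 : a⁻¹ * b ∈ σ.ker := QuotientGroup.leftRel_apply.1 hab
    obtain ⟨k, hk, rfl⟩ : ∃ k, σ k = 1 ∧ b = a * k := ⟨_, MonoidHom.mem_ker.1 h1, by group⟩
    rw [map_mul, hk, mul_one]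
  refine ⟨⟨⟨Quotient.lift σ h, map_one σ⟩, fun x y => ?_⟩, fun t => rfl⟩
  induction x using QuotientGroup.induction_on with | H x => ?_
  induction y using QuotientGroup.induction_on with | H y => ?_
  exact map_mul σ x y

/-- A representation that is not faithful factors through a proper quotient, to which the induction
hypothesis applies. -/
theorem trace_mem_of_ker_ne_bot {T : Type u} [Group T] [Finite T] (hT : IsPGroup p T)
    (ih : ∀ (F : Type u) [Group F] [Finite F], IsPGroup p F → Nat.card F < Nat.card T →
      ∀ (n : ℕ) (ρ : F →* Matrix (Fin n) (Fin n) (QBar p)), (fun g => (ρ g).trace) ∈ monSpan p F)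
    {m : ℕ} (σ : T →* Matrix (Fin m) (Fin m) (QBar p)) (hker : σ.ker ≠ ⊥) :
    (fun g => (σ g).trace) ∈ monSpan p T := by
  have h2 : 1 < Nat.card σ.ker := (Subgroup.one_lt_card_iff_ne_bot σ.ker).2 hker
  have h3 : 0 < Nat.card (T ⧸ σ.ker) := Nat.card_pos
  have h4 := Subgroup.card_eq_card_quotient_mul_card_subgroup σ.ker
  have h5 : Nat.card (T ⧸ σ.ker) < Nat.card T := (lt_mul_of_one_lt_right h3 h2).trans_eq h4.symm
  obtain ⟨τ, hτ⟩ := exists_kerLift σ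
  have h6 := monSpan_comp (QuotientGroup.mk' σ.ker) (QuotientGroup.mk'_surjective _)
    (ih (T ⧸ σ.ker) (hT.to_quotient _) h5 m τ)
  have e : (fun g => (σ g).trace) = (fun g => (τ g).trace) ∘ QuotientGroup.mk' σ.ker :=
    funext fun g => congrArg Matrix.trace (hτ g).symm
  rw [e]
  exact h6

/-- Induction on the order. In the abelian case the character is a sum of linear ones. Otherwise
Clifford theory for a noncentral abelian normal subgroup A leaves the stabilisers T of characters w.
Either T is a smaller group, or w is invariant under F; then A acts on the w-eigenspace by scalars
that conjugation does not change, and the action on it is not faithful. -/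
theorem trace_mem_monSpan (N : ℕ) : ∀ (F : Type u) [Group F] [Finite F], IsPGroup p F → Nat.card F < N →
    ∀ (n : ℕ) (ρ : F →* Matrix (Fin n) (Fin n) (QBar p)), (fun g => (ρ g).trace) ∈ monSpan p F := by
  induction N with
  | zero => intro F _ _ _ h; exact (Nat.not_lt_zero _ h).elim
  | succ N ih =>
    intro F _ _ hF hN n ρ
    by_cases hab : ∀ a b : F, a * b = b * a
    · obtain ⟨m, hm⟩ := trace_eq_sum_char hab ρ
      have e : (fun g => (ρ g).trace) = ∑ w : F →* (ZBar p)ˣ, m w • chVal w := by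
        funext g
        rw [hm, Finset.sum_apply]
        exact Finset.sum_congr rfl fun w _ => (nsmul_eq_mul _ _).symm
      rw [e]
      exact sum_mem fun w _ => nsmul_mem (chVal_mem_monSpan w) _
    · obtain ⟨A, hn, hA, a, ha, g, hg⟩ := exists_normal_abelian hF hab
      letI := charAction (p := p) A
      rw [trace_eq_sum_indFun A ρ hA]
      refine sum_mem fun ω _ => monSpan_ind _ ?_
      generalize ω.out = w
      have hcomm : ∀ h : MulAction.stabilizer F w, (ρ.comp (MulAction.stabilizer F w).subtype) h *
          eigProj (ρ.comp A.subtype) w = eigProj (ρ.comp A.subtype) w *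
            (ρ.comp (MulAction.stabilizer F w).subtype) h := by
        intro h
        have := mul_eigProj_restrict A ρ h w
        rwa [MulAction.mem_stabilizer_iff.1 h.2] at this
      obtain ⟨m, σ, hσ, hσ'⟩ := exists_corner _ _ (by classical rw [eigProj_mul, if_pos rfl]) hcomm
      have e : (fun h : MulAction.stabilizer F w => (ρ h * eigProj (ρ.comp A.subtype) w).trace) =
        fun h => (σ h).trace := funext fun h => (hσ h).symm
      rw [e]
      have hle := Subgroup.card_le_card_group (MulAction.stabilizer F w)
      by_cases hT : MulAction.stabilizer F w = ⊤
      · refine trace_mem_of_ker_ne_bot (hF.to_subgroup _) (fun F' _ _ hF' hc => ih F' hF' (by omega)) σ ?_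
        intro hker
        have hg' : ∀ u, u ∈ MulAction.stabilizer F w := fun u => hT ▸ Subgroup.mem_top u
        have h1 : ∀ a : A, σ ⟨a, hg' a⟩ = chVal w a • 1 := fun a => hσ' _ _ (mul_eigProj _ _ a)
        -- Both sides are the same scalar by invariance of w, so faithfulness would make g and a
        -- commute.
        have h2 : σ ⟨g * a * g⁻¹, hg' _⟩ = σ ⟨a, hg' a⟩ := by
          have h3 := h1 ⟨g * a * g⁻¹, hn.conj_mem a ha g⟩
          have h4 := h1 ⟨a, ha⟩
          refine h3.trans (Eq.trans ?_ h4.symm)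
          congr 1
          have h5 : g⁻¹ • w = w := hg' g⁻¹
          have h6 : chVal (g⁻¹ • w) ⟨a, ha⟩ = chVal w ⟨g * a * g⁻¹, hn.conj_mem a ha g⟩ := by
            change chVal w (MulAut.conjNormal g⁻¹⁻¹ _) = _
            congr 1
            ext
            simp
          rw [← h6, h5]
        have h3 := (MonoidHom.ker_eq_bot_iff σ).1 hker h2
        have h4 : g * a * g⁻¹ = a := congrArg Subtype.val h3
        exact hg (mul_inv_eq_iff_eq_mul.1 h4)
      · refine ih _ (hF.to_subgroup _) ?_ m σ
        have h3 : Nat.card (MulAction.stabilizer F w) ≠ Nat.card F := fun h =>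
          hT (Subgroup.eq_top_of_card_eq _ h)
        omega

end Monomial

/-! ### Virtual characters are stable under Adams operations and contain the induced linear
characters. -/

section VirtualCharacters

variable {p : ℕ} [Fact p.Prime]

section Power

variable {n : Type*} [Fintype n] [DecidableEq n] {K : Type*} [CommRing K]

/-- The entries of M^m are sums over paths of length m. The weight f on the two endpoints is later
taken to be one more matrix entry, which closes the path into a cycle. -/
theorem sum_path (M : Matrix n n K) (m : ℕ) (f : n → n → K) :
    ∑ a : Fin (m + 1) → n, (∏ i : Fin m, M (a i.castSucc) (a i.succ)) * f (a 0) (a (Fin.last m)) =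
      ∑ x, ∑ y, (M ^ m) x y * f x y := by
  induction m generalizing f with
  | zero =>
    rw [← (Equiv.funUnique (Fin 1) n).symm.sum_comp]
    refine Finset.sum_congr rfl fun x _ => ?_
    rw [Finset.sum_eq_single x]
    · simp
    · intro y _ hy
      simp [Matrix.one_apply_ne hy.symm]
    · exact fun h => (h (Finset.mem_univ _)).elim
  | succ m ih =>
    rw [← (Fin.snocEquiv fun _ => n).sum_comp, Fintype.sum_prod_type, Finset.sum_comm]
    have h := ih (fun x z => ∑ y, M z y * f x y)
    rw [← Equiv.sum_comp (Equiv.refl _)]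
    calc _ = ∑ a : Fin (m + 1) → n, (∏ i : Fin m, M (a i.castSucc) (a i.succ)) *
          ∑ y, M (a (Fin.last m)) y * f (a 0) y := by
          refine Finset.sum_congr rfl fun a _ => ?_
          rw [Finset.mul_sum]
          refine Finset.sum_congr rfl fun y _ => ?_
          have h1 : ∀ i : Fin (m + 1), (Fin.snocEquiv fun _ => n) (y, a) i.castSucc = a i := fun i => by
            simp [Fin.snocEquiv]
          have h2 : (Fin.snocEquiv fun _ => n) (y, a) (Fin.last (m + 1)) = y := by simp [Fin.snocEquiv]
          have h3 : (Fin.snocEquiv fun _ => n) (y, a) 0 = a 0 := h1 0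
          rw [Fin.prod_univ_castSucc]
          have h4 : ∀ i : Fin m, (Fin.snocEquiv fun _ => n) (y, a) i.castSucc.succ = a i.succ := fun i => by
            rw [← Fin.castSucc_succ, h1]
          have h5 : (Fin.snocEquiv fun _ => n) (y, a) (Fin.last m).succ = y := h2
          simp only [Equiv.refl_apply, h1, h4, h5, h2, h3, mul_assoc]
      _ = _ := by
          rw [h]
          refine Finset.sum_congr rfl fun x _ => ?_
          simp only [pow_succ, Matrix.mul_apply, Finset.mul_sum, Finset.sum_mul]
          rw [Finset.sum_comm]
          simp only [mul_assoc]

theorem trace_pow_eq_sum (M : Matrix n n K) (m : ℕ) :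
    (M ^ (m + 1)).trace = ∑ a : Fin (m + 1) → n, ∏ i, M (a i) (a (i + 1)) := by
  have h := sum_path M m (fun x y => M y x)
  have e : (M ^ (m + 1)).trace = ∑ x, ∑ y, (M ^ m) x y * M y x := by
    rw [pow_succ, Matrix.trace]
    simp only [Matrix.diag_apply, Matrix.mul_apply]
  rw [e, ← h]
  refine Finset.sum_congr rfl fun a _ => ?_
  rw [Fin.prod_univ_castSucc]
  simp [Fin.coeSucc_eq_succ]

theorem trace_pow_eq_sum_zmod (M : Matrix n n K) (q : ℕ) [NeZero q] :
    (M ^ q).trace = ∑ a : ZMod q → n, ∏ i, M (a i) (a (i + 1)) := by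
  cases q with
  | zero => exact (NeZero.ne 0 rfl).elim
  | succ m => exact trace_pow_eq_sum M m

/-- The tensor power of a matrix. -/
def tensorPow (ι : Type*) [Fintype ι] (M : Matrix n n K) : Matrix (ι → n) (ι → n) K :=
  Matrix.of fun a b => ∏ i, M (a i) (b i)

theorem tensorPow_one (ι : Type*) [Fintype ι] [DecidableEq ι] : tensorPow ι (1 : Matrix n n K) = 1 := by
  ext a b
  rw [tensorPow, Matrix.of_apply]
  by_cases h : a = b
  · subst h
    simp
  · obtain ⟨i, hi⟩ := Function.ne_iff.1 h
    rw [Matrix.one_apply_ne h]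
    exact Finset.prod_eq_zero (Finset.mem_univ i) (Matrix.one_apply_ne hi)

theorem tensorPow_mul (ι : Type*) [Fintype ι] [DecidableEq ι] (M M' : Matrix n n K) :
    tensorPow ι (M * M') = tensorPow ι M * tensorPow ι M' := by
  ext a b
  rw [Matrix.mul_apply]
  simp only [tensorPow, Matrix.of_apply, Matrix.mul_apply, ← Finset.prod_mul_distrib]
  rw [Finset.prod_univ_sum, Fintype.piFinset_univ]

variable {ι : Type*} [AddCommGroup ι] [Fintype ι] [DecidableEq ι]

/-- The permutation matrix of a shift of the indices. -/
def shiftMat (n K : Type*) [DecidableEq n] [CommRing K] (k : ι) : Matrix (ι → n) (ι → n) K :=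
  Matrix.of fun a b => if a = fun i => b (i + k) then 1 else 0

theorem mul_shiftMat (M : Matrix (ι → n) (ι → n) K) (k : ι) (a b : ι → n) :
    (M * shiftMat n K k) a b = M a (fun i => b (i + k)) := by
  simp [Matrix.mul_apply, shiftMat]

theorem shiftMat_mul (M : Matrix (ι → n) (ι → n) K) (k : ι) (a b : ι → n) :
    (shiftMat n K k * M) a b = M (fun i => a (i - k)) b := by
  rw [Matrix.mul_apply, Finset.sum_eq_single fun i => a (i - k)]
  · simp [shiftMat]
  · intro c _ hc
    rw [shiftMat, Matrix.of_apply, if_neg, zero_mul]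
    rintro rfl
    exact hc (by simp)
  · exact fun h => (h (Finset.mem_univ _)).elim

theorem shiftMat_add (k l : ι) : shiftMat n K (k + l) = shiftMat n K k * shiftMat n K l := by
  ext a b
  rw [mul_shiftMat]
  simp [shiftMat, add_assoc]

theorem shiftMat_zero : shiftMat n K (0 : ι) = 1 := by
  ext a b
  simp [shiftMat, Matrix.one_apply]

theorem tensorPow_shiftMat (M : Matrix n n K) (k : ι) :
    tensorPow ι M * shiftMat n K k = shiftMat n K k * tensorPow ι M := by
  ext a b
  rw [mul_shiftMat, shiftMat_mul, tensorPow, Matrix.of_apply, Matrix.of_apply,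
    ← Equiv.prod_comp (Equiv.addRight k) fun i => M (a (i - k)) (b i)]
  simp

/-- For k = 0 the trace of a tensor power is a power of the trace. For k ≠ 0 the shift makes one
cycle through all indices, q being prime; renumbering the indices by multiplication with k turns it
into the standard cycle, whose sum is the trace of M^q. -/
theorem trace_tensorPow_shiftMat (q : ℕ) [Fact q.Prime] (M : Matrix n n K) (k : ZMod q) :
    (tensorPow (ZMod q) M * shiftMat n K k).trace = if k = 0 then M.trace ^ q else (M ^ q).trace := by
  have h0 : (tensorPow (ZMod q) M * shiftMat n K k).trace =
      ∑ a : ZMod q → n, ∏ i, M (a i) (a (i + k)) :=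
    Finset.sum_congr rfl fun a _ => by rw [Matrix.diag_apply, mul_shiftMat]; rfl
  rw [h0]
  split_ifs with hk
  · subst hk
    simp only [add_zero]
    rw [← Fintype.piFinset_univ, ← Finset.prod_univ_sum (fun _ => Finset.univ) fun (_ : ZMod q) x => M x x]
    simp [Matrix.trace, ZMod.card]
  · let e : ZMod q ≃ ZMod q := Equiv.mulLeft₀ k hk
    have h1 : ∑ a : ZMod q → n, ∏ i, M (a i) (a (i + k)) = ∑ a : ZMod q → n, ∏ i, M (a i) (a (i + 1)) := by
      rw [← Equiv.sum_comp (Equiv.arrowCongr e (Equiv.refl n))]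
      refine Finset.sum_congr rfl fun a _ => ?_
      rw [← Equiv.prod_comp e]
      refine Finset.prod_congr rfl fun i _ => ?_
      have h2 : e i + k = e (i + 1) := by simp [e, mul_add]
      rw [h2]
      simp
    rw [h1]
    exact (trace_pow_eq_sum_zmod M q).symm

end Power

variable {U V : Type*} [Group U] [TopologicalSpace U] [Group V] [TopologicalSpace V]

theorem virtChar_trace {n : ℕ} (ρ : U →* Matrix (Fin n) (Fin n) (QBar p)) (h : IsOpen {u | ρ u = 1}) :
    (fun u => (ρ u).trace) ∈ virtChar p U := AddSubgroup.subset_closure ⟨n, ρ, h, rfl⟩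

/-- Numbering the rows and columns of a matrix. -/
def finReindex (I K : Type*) [Fintype I] [DecidableEq I] [CommRing K] :
    Matrix I I K ≃* Matrix (Fin (Fintype.card I)) (Fin (Fintype.card I)) K :=
  (Matrix.reindexAlgEquiv K K (Fintype.equivFin I)).toMulEquiv

theorem trace_finReindex {I K : Type*} [Fintype I] [DecidableEq I] [CommRing K] (M : Matrix I I K) :
    (finReindex I K M).trace = M.trace :=
  Equiv.sum_comp (Fintype.equivFin I).symm fun i => M i i

theorem virtChar_trace' {I : Type*} [Fintype I] [DecidableEq I] (ρ : U →* Matrix I I (QBar p))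
    (h : IsOpen {u | ρ u = 1}) : (fun u => (ρ u).trace) ∈ virtChar p U := by
  have h1 : IsOpen {u | (((finReindex I (QBar p)).toMonoidHom).comp ρ) u = 1} := by
    convert h using 3 with u
    exact map_eq_one_iff (finReindex I (QBar p)) (finReindex I (QBar p)).injective
  have h2 := virtChar_trace (((finReindex I (QBar p)).toMonoidHom).comp ρ) h1
  convert h2 using 2 with u
  exact (trace_finReindex _).symm

theorem isClassFn_of_virtChar [IsTopologicalGroup U] [CompactSpace U] {χ : U → QBar p} (h : χ ∈ virtChar p U) :
    IsClassFn χ := by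
  induction h using AddSubgroup.closure_induction with
  | mem x hx =>
    obtain ⟨n, ρ, hρ, rfl⟩ := hx
    obtain ⟨τ, hτ⟩ := exists_kerLift ρ
    refine ⟨fun u v => ?_, ⟨{ toSubgroup := ρ.ker, isOpen' := hρ, isNormal' := inferInstance },
      fun x => (τ x).trace, fun u => ?_⟩⟩
    · rw [map_mul, map_mul, Matrix.trace_mul_comm]
    · exact congrArg Matrix.trace (hτ u).symm
  | zero => exact .zero
  | add x y _ _ hx hy => exact hx.add hy
  | neg x _ hx => exact hx.neg

theorem virtChar_comp (f : U →* V) (hf : Continuous f) {χ : V → QBar p} (h : χ ∈ virtChar p V) :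
    χ ∘ f ∈ virtChar p U := by
  induction h using AddSubgroup.closure_induction with
  | mem x hx =>
    obtain ⟨n, ρ, hρ, rfl⟩ := hx
    exact virtChar_trace (ρ.comp f) (hρ.preimage hf)
  | zero => exact zero_mem (virtChar p U)
  | add x y _ _ hx hy => exact add_mem hx hy
  | neg x _ hx => exact neg_mem hx

/-- The tensor power of a matrix representation. -/
def tensorRep {T n K : Type*} [Group T] [Fintype n] [DecidableEq n] [CommRing K] (ι : Type*) [Fintype ι]
    [DecidableEq ι] (ρ : T →* Matrix n n K) : T →* Matrix (ι → n) (ι → n) K where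
  toFun u := tensorPow ι (ρ u)
  map_one' := by rw [map_one, tensorPow_one]
  map_mul' u v := by rw [map_mul, tensorPow_mul]

theorem exists_tensorRep {T K : Type*} [Group T] [CommRing K] (q : ℕ) [Fact q.Prime] {n : ℕ}
    (ρ : T →* Matrix (Fin n) (Fin n) K) : ∃ (N : ℕ) (σ : T →* Matrix (Fin N) (Fin N) K)
    (C : Multiplicative (ZMod q) →* Matrix (Fin N) (Fin N) K), (∀ u, ρ u = 1 → σ u = 1) ∧
    (∀ u k, σ u * C k = C k * σ u) ∧
    ∀ u k, (σ u * C k).trace = if k = 1 then (ρ u).trace ^ q else (ρ u ^ q).trace := by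
  let e := finReindex (ZMod q → Fin n) K
  refine ⟨_, e.toMonoidHom.comp (tensorRep (ZMod q) ρ), e.toMonoidHom.comp
    ⟨⟨fun k : Multiplicative (ZMod q) => shiftMat (Fin n) K k.toAdd, shiftMat_zero⟩,
      fun k l => shiftMat_add _ _⟩, fun u h => ?_, fun u k => ?_, fun u k => ?_⟩
  · change e (tensorPow (ZMod q) (ρ u)) = 1
    rw [h, tensorPow_one, map_one]
  · change e (tensorPow (ZMod q) (ρ u)) * e (shiftMat (Fin n) K k.toAdd) =
      e (shiftMat (Fin n) K k.toAdd) * e (tensorPow (ZMod q) (ρ u))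
    rw [← map_mul, ← map_mul, tensorPow_shiftMat]
  · change (e (tensorPow (ZMod q) (ρ u)) * e (shiftMat (Fin n) K k.toAdd)).trace = _
    rw [← map_mul, trace_finReindex, trace_tensorPow_shiftMat]
    rfl

/-- With N the order of A, the trivial eigenspace has trace (a + (N-1)b)/N and any other has (a -
b)/N. The difference is b. -/
theorem trace_mul_eigProj {A T : Type*} [Group A] [Finite A] [DecidableEq A] [Group T] {n : ℕ}
    (ρ : T →* Matrix (Fin n) (Fin n) (QBar p)) (C : A →* Matrix (Fin n) (Fin n) (QBar p)) (a b : T → QBar p)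
    (h : ∀ u x, (ρ u * C x).trace = if x = 1 then a u else b u) (w : A →* (ZBar p)ˣ) (hw : w ≠ 1) (u : T) :
    (ρ u * eigProj C 1).trace - (ρ u * eigProj C w).trace = b u := by
  have := Fintype.ofFinite A
  have h1 : ∀ w : A →* (ZBar p)ˣ, (ρ u * eigProj C w).trace =
      (Nat.card A : QBar p)⁻¹ * (a u - b u + b u * ∑ x, chVal w x⁻¹) := by
    intro w
    have h2 : (ρ u * eigProj C w).trace = (Nat.card A : QBar p)⁻¹ * ∑ x, chVal w x⁻¹ * (ρ u * C x).trace := by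
      rw [eigProj, mul_smul_comm, Matrix.trace_smul, smul_eq_mul, Finset.mul_sum, Matrix.trace_sum]
      congr 1
      refine Finset.sum_congr (by congr!) fun x _ => ?_
      rw [mul_smul_comm, Matrix.trace_smul, smul_eq_mul]
    rw [h2]
    congr 1
    have h3 : ∀ x, chVal w x⁻¹ * (ρ u * C x).trace =
        (if x = 1 then a u - b u else 0) + b u * chVal w x⁻¹ := by
      intro x
      rw [h]
      split_ifs with hx
      · rw [hx, inv_one, chVal_one]
        ring
      · ring
    simp only [h3, Finset.sum_add_distrib, Finset.mul_sum]
    simp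
  have h4 : ∑ x, chVal w x⁻¹ = 0 := by
    have := sum_char_apply w 1 hw
    simpa [chVal] using this
  have h5 : ∑ x : A, chVal (1 : A →* (ZBar p)ˣ) x⁻¹ = Nat.card A := by
    simp [chVal]
  have h6 : (Nat.card A : QBar p) ≠ 0 := Nat.cast_ne_zero.2 Nat.card_pos.ne'
  rw [h1, h1, h4, h5]
  field_simp
  ring

/-- ℤ/p acts on the p-th tensor power of ρ by cyclic shifts commuting with U. The character of the
invariants minus that of a nontrivial eigenspace is u ↦ tr ρ(u)^p = tr ρ(u^p), a difference of two
genuine characters. -/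
theorem adams_mem_virtChar [IsTopologicalGroup U] {χ : U → QBar p} (h : χ ∈ virtChar p U) :
    adams χ ∈ virtChar p U := by
  classical
  induction h using AddSubgroup.closure_induction with
  | mem x hx =>
    obtain ⟨n, ρ, hρ, rfl⟩ := hx
    obtain ⟨N, T, C, hT, hTC, htr⟩ := exists_tensorRep p ρ
    have hA : ∀ a b : Multiplicative (ZMod p), a * b = b * a := mul_comm
    have : Fact (1 < p) := ⟨(Fact.out : p.Prime).one_lt⟩
    obtain ⟨w, hw⟩ := exists_char_ne_one (p := p) hA (Multiplicative.ofAdd (1 : ZMod p)) (by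
      rw [Ne, ofAdd_eq_one]; exact one_ne_zero)
    have hw' : w ≠ 1 := fun h => hw (by rw [h]; rfl)
    have hc : ∀ w u, T u * eigProj C w = eigProj C w * T u := fun w u => by
      simp only [eigProj, mul_smul_comm, smul_mul_assoc, Finset.mul_sum, Finset.sum_mul, hTC]
    have hmem : ∀ w, (fun u => (T u * eigProj C w).trace) ∈ virtChar p U := fun w => by
      obtain ⟨m, σ, h1, h2⟩ := exists_corner T (eigProj C w) (by rw [eigProj_mul, if_pos rfl]) (hc w)
      -- The kernel of ρ acts trivially on the tensor power, hence on its eigenspaces, so their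
      -- kernels are open too.
      have h3 := virtChar_trace σ (Subgroup.isOpen_mono (H₁ := ρ.ker) (H₂ := σ.ker) (fun u hu => by
        rw [MonoidHom.mem_ker] at hu ⊢
        rw [h2 u 1 (by rw [hT u hu, one_mul, one_smul]), one_smul]) hρ)
      simpa only [h1] using h3
    convert sub_mem (hmem 1) (hmem w) using 1
    funext u
    have h4 := trace_mul_eigProj T C _ _ htr w hw' u
    rw [Pi.sub_apply, h4]
    exact congrArg Matrix.trace (map_pow ρ u p)
  | zero => exact zero_mem (virtChar p U)
  | add x y _ _ hx hy => exact add_mem hx hy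
  | neg x _ hx => exact neg_mem hx

theorem isOpen_normalCore [IsTopologicalGroup U] [CompactSpace U] (K : Subgroup U) (h : IsOpen (K : Set U)) :
    IsOpen (K.normalCore : Set U) := by
  have : Finite (U ⧸ K) := Subgroup.quotient_finite_of_isOpen _ h
  have : K.FiniteIndex := Subgroup.finiteIndex_of_finite_quotient
  have hc := K.normalCore_isClosed (K.isClosed_of_isOpen h)
  exact Subgroup.isOpen_of_isClosed_of_finiteIndex _ hc

theorem extend_chVal_mul (i : V →* U) (hi : Function.Injective i) (w : V →* (ZBar p)ˣ) (x : U) (b : V) :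
    Function.extend i (chVal w) 0 (x * i b) = Function.extend i (chVal w) 0 x * chVal w b := by
  by_cases h : ∃ a, i a = x
  · obtain ⟨a, rfl⟩ := h
    rw [← map_mul, hi.extend_apply, hi.extend_apply, chVal_mul]
  · rw [Function.extend_apply' _ _ _ h, Function.extend_apply']
    · simp
    · rintro ⟨a, ha⟩
      exact h ⟨a * b⁻¹, by rw [map_mul, ha, map_inv, mul_inv_cancel_right]⟩

theorem extend_out (i : V →* U) (hi : Function.Injective i) (w : V →* (ZBar p)ˣ) [DecidableEq (U ⧸ i.range)]
    (x y : U ⧸ i.range) :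
    Function.extend i (chVal w) 0 (x.out⁻¹ * y.out) = if x = y then 1 else 0 := by
  split_ifs with h
  · rw [h, inv_mul_cancel, ← map_one i, hi.extend_apply, chVal_one]
  · rw [Function.extend_apply']
    · rfl
    · rintro ⟨a, ha⟩
      exact h (eq_of_out_inv_mul_mem ⟨a, ha⟩)

/-- The monomial representation induced from a linear character. -/
def monRep (i : V →* U) (hi : Function.Injective i) [Fintype (U ⧸ i.range)] [DecidableEq (U ⧸ i.range)]
    (w : V →* (ZBar p)ˣ) : U →* Matrix (U ⧸ i.range) (U ⧸ i.range) (QBar p) where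
  toFun u := Matrix.of fun x y => Function.extend i (chVal w) 0 (x.out⁻¹ * u * y.out)
  map_one' := by
    ext x y
    rw [Matrix.of_apply, mul_one, extend_out i hi, Matrix.one_apply]
  map_mul' u v := by
    ext x z
    rw [Matrix.mul_apply]
    simp only [Matrix.of_apply]
    obtain ⟨b, hb⟩ := out_inv_mul_mem (K := i.range) (v * z.out)
    rw [Finset.sum_eq_single ((v * z.out : U) : U ⧸ i.range)]
    · rw [mul_assoc _ v, ← hb, hi.extend_apply, ← extend_chVal_mul i hi, hb]
      congr 1
      group
    · intro y _ hy
      rw [Function.extend_apply' _ _ (y.out⁻¹ * v * z.out), Pi.zero_apply, mul_zero]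
      rintro ⟨a, ha⟩
      refine hy ?_
      rw [← QuotientGroup.out_eq' y, QuotientGroup.eq]
      exact ⟨a, by rw [ha, mul_assoc]⟩
    · exact fun h => (h (Finset.mem_univ _)).elim

theorem indFun_mem_virtChar [IsTopologicalGroup U] [CompactSpace U] (i : V →* U) (hi : Function.Injective i)
    (hi' : IsOpenMap i) (w : V →* (ZBar p)ˣ) (hw : IsOpen (w.ker : Set V)) :
    indFun i (chVal w) ∈ virtChar p U := by
  have : Finite (U ⧸ i.range) := Subgroup.quotient_finite_of_isOpen _ (by
    rw [MonoidHom.coe_range]; exact hi'.isOpen_range)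
  have := Fintype.ofFinite (U ⧸ i.range)
  classical
  have hK : IsOpen ((w.ker.map i : Subgroup U) : Set U) := hi' _ hw
  have hker : IsOpen {u | monRep i hi w u = 1} := by
    -- An element u of the normal core satisfies y⁻¹uy = i(a) with w(a) = 1 for every representative
    -- y, so its matrix is that of the identity.
    refine Subgroup.isOpen_mono (H₁ := (w.ker.map i).normalCore) (H₂ := (monRep i hi w).ker)
      (fun u hu => ?_) (isOpen_normalCore _ hK)
    rw [MonoidHom.mem_ker]
    ext x y
    obtain ⟨a, ha, hau⟩ := hu y.out⁻¹
    rw [inv_inv] at hau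
    have h1 : x.out⁻¹ * u * y.out = x.out⁻¹ * y.out * i a := by rw [hau]; group
    have h2 : chVal w a = 1 := by rw [chVal, MonoidHom.mem_ker.1 ha]; rfl
    change Function.extend i (chVal w) 0 (x.out⁻¹ * u * y.out) = _
    rw [h1, extend_chVal_mul i hi, h2, mul_one, extend_out i hi, Matrix.one_apply]
  have h := virtChar_trace' (monRep i hi w) hker
  convert h using 2 with u
  rw [indFun, finsum_eq_sum_of_fintype]
  rfl

end VirtualCharacters

/-! ### Monomial induction for subquotients: R(U) is spanned by characters induced from subquotients
V ⊆ U. -/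

section Monomial

variable {p : ℕ} [Fact p.Prime] {G : Type*} [Group G] [TopologicalSpace G] [IsTopologicalGroup G]
  [CompactSpace G] {P : OneDim p G}

theorem SubQ.hom_injective {S T : SubQ P} (hW : S.W ≤ T.W) (hC : S.C = T.C) :
    Function.Injective (SubQ.hom hW hC.le) := by
  rw [injective_iff_map_eq_one]
  intro a ha
  induction a using QuotientGroup.induction_on with | H a => ?_
  have h1 : (Subgroup.inclusion hW a : G) ∈ T.C :=
    (QuotientGroup.eq_one_iff (N := T.C.subgroupOf T.W) (Subgroup.inclusion hW a)).1 ha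
  refine (QuotientGroup.eq_one_iff _).2 ?_
  rw [Subgroup.mem_subgroupOf, hC]
  exact h1

theorem SubQ.Incl.injective {V U : SubQ P} (h : SubQ.Incl V U) : Function.Injective h.hom :=
  SubQ.hom_injective h.W h.C

theorem SubQ.isOpenMap_hom {S T : SubQ P} (hW : S.W ≤ T.W) (hC : S.C ≤ T.C) : IsOpenMap (SubQ.hom hW hC) := by
  intro s hs
  have h1 : SubQ.hom hW hC '' s = (fun w : S.W => (QuotientGroup.mk (Subgroup.inclusion hW w) : T.Grp)) ''
      ((fun w : S.W => (QuotientGroup.mk w : S.Grp)) ⁻¹' s) := by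
    ext u
    constructor
    · rintro ⟨v, hv, rfl⟩
      induction v using QuotientGroup.induction_on with | H v => ?_
      exact ⟨v, hv, rfl⟩
    · rintro ⟨v, hv, rfl⟩
      exact ⟨_, hv, rfl⟩
  rw [h1]
  exact ((QuotientGroup.isOpenMap_coe (N := T.C.subgroupOf T.W)).comp
    (S.isOpen.isOpenMap_inclusion hW)) _ (hs.preimage QuotientGroup.continuous_mk)

theorem SubQ.Incl.isOpenMap {V U : SubQ P} (h : SubQ.Incl V U) : IsOpenMap h.hom := SubQ.isOpenMap_hom _ _

instance SubQ.Incl.finite {V U : SubQ P} (h : SubQ.Incl V U) : Finite (U.Grp ⧸ h.hom.range) :=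
  Subgroup.quotient_finite_of_isOpen _ (by rw [MonoidHom.coe_range]; exact h.isOpenMap.isOpen_range)

theorem SubQ.surjective_hom {S T : SubQ P} (hW : S.W = T.W) (hC : S.C ≤ T.C) :
    Function.Surjective (SubQ.hom hW.le hC) := fun v => by
  induction v using QuotientGroup.induction_on with | H v => ?_
  exact ⟨QuotientGroup.mk ⟨v.1, hW.ge v.2⟩, rfl⟩

theorem SubQ.chrFun_comm (V : SubQ P) (φ : Chr p V.ab.Grp) (a b : V.Grp) :
    V.chrFun φ (a * b) = V.chrFun φ (b * a) := by
  simp only [SubQ.chrFun]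
  rw [map_mul, map_mul, V.ab_isAb]

theorem SubQ.Incl.indFun_mem {V U : SubQ P} (h : SubQ.Incl V U) (φ : Chr p V.ab.Grp) :
    indFun h.hom (V.chrFun φ) ∈ virtChar p U.Grp :=
  indFun_mem_virtChar h.hom h.injective h.isOpenMap
    (φ.toHom.comp (SubQ.hom (S := V) (T := V.ab) le_rfl V.le_ab))
    (φ.isOpen_ker.preimage (SubQ.continuous_hom _ _))

/-- The group generated by the functions induced from linear characters of subquotients. -/
def SubQ.indSpan (U : SubQ P) : AddSubgroup (U.Grp → QBar p) :=
  AddSubgroup.closure {f | ∃ (V : SubQ P) (h : SubQ.Incl V U) (φ : Chr p V.ab.Grp),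
    f = indFun h.hom (V.chrFun φ)}

theorem SubQ.incl_pre (U : SubQ P) (N : OpenNormalSubgroup U.Grp) (V : Subgroup (U.Grp ⧸ N.toSubgroup)) :
    SubQ.Incl (U.pre N V) U := ⟨U.pre_le N V, rfl⟩

/-- Translates monomial characters of the finite quotient (W/C)/N into characters induced from
preimages, which are subquotients of G and so are accessible to (RW4). -/
theorem SubQ.indFun_pre (U : SubQ P) (N : OpenNormalSubgroup U.Grp) (x : MPair p (U.Grp ⧸ N.toSubgroup))
    (u : U.Grp) : indFun (U.incl_pre N x.V).hom ((U.pre N x.V).chrFun (U.preChr N x)) u =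
      indFun x.V.subtype (chVal x.φ) (u : U.Grp ⧸ N.toSubgroup) := by
  let f' : (U.pre N x.V).Grp →* x.V := QuotientGroup.lift _ (U.preHom N x.V) fun c hc => Subtype.ext (by
      have h' : QuotientGroup.mk' (U.C.subgroupOf U.W) ⟨c, U.pre_le N x.V c.2⟩ = 1 :=
        (QuotientGroup.eq_one_iff _).2 hc
      change QuotientGroup.mk' N.toSubgroup (QuotientGroup.mk' (U.C.subgroupOf U.W) ⟨c, _⟩) = 1
      rw [h', map_one])
  have h1 : (U.pre N x.V).chrFun (U.preChr N x) = chVal x.φ ∘ f' := by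
    funext v
    induction v using QuotientGroup.induction_on with | H v => ?_
    rfl
  rw [h1]
  refine indFun_inflate _ (SubQ.Incl.injective _) x.V.subtype x.V.subtype_injective
    (QuotientGroup.mk' N.toSubgroup) (QuotientGroup.mk'_surjective _) f' (fun v => ?_) (fun u hu => ?_)
    _ (chVal_comm x.φ) u
  · induction v using QuotientGroup.induction_on with | H v => ?_
    rfl
  · obtain ⟨v, hv⟩ := hu
    induction u using QuotientGroup.induction_on with | H u => ?_
    have h2 : U.toQuot N u ∈ x.V := by
      rw [show U.toQuot N u = v from hv.symm]
      exact v.2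
    exact ⟨QuotientGroup.mk ⟨u.1, ⟨u, h2, rfl⟩⟩, rfl⟩

theorem SubQ.comp_mem_indSpan (U : SubQ P) (N : OpenNormalSubgroup U.Grp) {χ : U.Grp ⧸ N.toSubgroup → QBar p}
    (h : χ ∈ monSpan p (U.Grp ⧸ N.toSubgroup)) : (fun u : U.Grp => χ u) ∈ U.indSpan := by
  induction h using AddSubgroup.closure_induction with
  | mem x hx =>
    obtain ⟨V, φ, rfl⟩ := hx
    refine AddSubgroup.subset_closure ⟨U.pre N V, U.incl_pre N V, U.preChr N ⟨V, φ⟩, ?_⟩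
    funext u
    exact (U.indFun_pre N ⟨V, φ⟩ u).symm
  | zero => exact zero_mem U.indSpan
  | add x y _ _ hx hy => exact add_mem hx hy
  | neg x _ hx => exact neg_mem hx

/-- The kernel of W → (W/C)/N is open in G, so it contains an open normal subgroup of G. The orders
of elements then come from the corresponding p-group quotient of G. -/
theorem SubQ.isPGroup_quot (hG : ∀ N : OpenNormalSubgroup G, IsPGroup p (G ⧸ N.toSubgroup)) (U : SubQ P)
    (N : OpenNormalSubgroup U.Grp) : IsPGroup p (U.Grp ⧸ N.toSubgroup) := by
  let K : Subgroup G := (U.toQuot N).ker.map U.W.subtype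
  have hK : IsOpen (K : Set G) :=
    U.isOpen.isOpenMap_subtype_val _ (U.isOpen_toQuot N {1})
  let M : OpenNormalSubgroup G :=
    { toSubgroup := K.normalCore, isOpen' := isOpen_normalCore K hK, isNormal' := inferInstance }
  intro x
  obtain ⟨u, rfl⟩ := QuotientGroup.mk_surjective x
  obtain ⟨w, rfl⟩ := QuotientGroup.mk_surjective u
  obtain ⟨k, hk⟩ := hG M (w : G)
  refine ⟨k, ?_⟩
  have h1 : (w : G) ^ p ^ k ∈ K.normalCore := by
    rw [← QuotientGroup.mk_pow] at hk
    exact (QuotientGroup.eq_one_iff _).1 hk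
  obtain ⟨y, hy, hyw⟩ := K.normalCore_le h1
  have h2 : y = w ^ p ^ k := Subtype.ext hyw
  have h3 : U.toQuot N (w ^ p ^ k) = 1 := h2 ▸ hy
  rw [map_pow] at h3
  exact h3

theorem SubQ.virtChar_le_indSpan (hG : ∀ N : OpenNormalSubgroup G, IsPGroup p (G ⧸ N.toSubgroup))
    (U : SubQ P) : virtChar p U.Grp ≤ U.indSpan := by
  refine (AddSubgroup.closure_le _).2 ?_
  rintro _ ⟨n, ρ, hρ, rfl⟩
  obtain ⟨τ, hτ⟩ := exists_kerLift ρ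
  let N : OpenNormalSubgroup U.Grp := { toSubgroup := ρ.ker, isOpen' := hρ, isNormal' := inferInstance }
  have : Finite (U.Grp ⧸ N.toSubgroup) := SubQ.finite_quot U N
  have h1 := U.comp_mem_indSpan N (trace_mem_monSpan (p := p) _ (U.Grp ⧸ N.toSubgroup)
    (SubQ.isPGroup_quot hG U N) (Nat.lt_succ_self _) n τ)
  have h2 : (fun u => (ρ u).trace) = fun u : U.Grp => (τ u).trace := funext fun u => by rw [hτ]
  rw [SetLike.mem_coe, h2]
  exact h1

theorem SubQ.indSpan_le_virtChar (U : SubQ P) : U.indSpan ≤ virtChar p U.Grp := by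
  refine (AddSubgroup.closure_le _).2 ?_
  rintro _ ⟨V, h, φ, rfl⟩
  exact h.indFun_mem φ

/-- A one-dimensional character of `W/C` as a character of the abelianisation. -/
def SubQ.chrAb (U : SubQ P) (w : U.Grp →* (ZBar p)ˣ) (hw : IsOpen (w.ker : Set U.Grp)) : Chr p U.ab.Grp where
  toHom := U.liftAb (w.comp (QuotientGroup.mk' _)) fun c hc => by
    have h' : QuotientGroup.mk' (U.C.subgroupOf U.W) ⟨c, U.le hc⟩ = 1 := (QuotientGroup.eq_one_iff _).2 hc
    rw [MonoidHom.comp_apply, h', map_one]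
  isOpen_ker := by
    refine (QuotientGroup.isQuotientMap_mk _).isOpen_preimage.1 ?_
    exact hw.preimage (QuotientGroup.continuous_mk (N := U.C.subgroupOf U.W))

theorem SubQ.chrFun_chrAb (U : SubQ P) (w : U.Grp →* (ZBar p)ˣ) (hw : IsOpen (w.ker : Set U.Grp)) :
    U.chrFun (U.chrAb w hw) = chVal w := by
  funext u
  induction u using QuotientGroup.induction_on with | H u => ?_
  rfl

theorem SubQ.virtChar_le_of_isAb (U : SubQ P) (hU : U.IsAb) :
    virtChar p U.Grp ≤ AddSubgroup.closure (Set.range U.chrFun) := by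
  refine (AddSubgroup.closure_le _).2 ?_
  rintro _ ⟨n, ρ, hρ, rfl⟩
  obtain ⟨τ, hτ⟩ := exists_kerLift ρ
  let N : OpenNormalSubgroup U.Grp := { toSubgroup := ρ.ker, isOpen' := hρ, isNormal' := inferInstance }
  have : Finite (U.Grp ⧸ N.toSubgroup) := SubQ.finite_quot U N
  have hA : ∀ a b : U.Grp ⧸ N.toSubgroup, a * b = b * a := fun a b => by
    obtain ⟨a, rfl⟩ := QuotientGroup.mk_surjective a
    obtain ⟨b, rfl⟩ := QuotientGroup.mk_surjective b
    rw [← QuotientGroup.mk_mul, hU, QuotientGroup.mk_mul]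
  obtain ⟨m, hm⟩ := trace_eq_sum_char hA τ
  have h2 : (fun u => (ρ u).trace) = ∑ w : U.Grp ⧸ N.toSubgroup →* (ZBar p)ˣ,
      m w • (chVal (w.comp (QuotientGroup.mk' N.toSubgroup)) : U.Grp → QBar p) := funext fun u => by
    rw [← hτ, hm, Finset.sum_apply]
    refine Finset.sum_congr rfl fun w _ => ?_
    rw [Pi.smul_apply, nsmul_eq_mul]
    rfl
  rw [SetLike.mem_coe, h2]
  refine sum_mem fun w _ => nsmul_mem (AddSubgroup.subset_closure ?_) _
  have hw : IsOpen ((w.comp (QuotientGroup.mk' N.toSubgroup)).ker : Set U.Grp) :=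
    Subgroup.isOpen_mono (H₁ := N.toSubgroup) (fun u hu => by
      rw [MonoidHom.mem_ker, MonoidHom.comp_apply]
      have h3 : QuotientGroup.mk' N.toSubgroup u = 1 := (QuotientGroup.eq_one_iff _).2 hu
      rw [h3, map_one]) N.isOpen'
  exact ⟨_, U.chrFun_chrAb _ hw⟩

theorem SubQ.exists_sum_of_indSpan (U : SubQ P) {χ : U.Grp → QBar p} (h : χ ∈ U.indSpan) :
    ∃ (m : ℕ) (V : Fin m → SubQ P) (h : ∀ i, SubQ.Incl (V i) U) (φ : ∀ i, Chr p (V i).ab.Grp)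
      (n : Fin m → ℤ), χ = ∑ i, n i • indFun (h i).hom ((V i).chrFun (φ i)) := by
  rw [SubQ.indSpan, ← Submodule.span_int_eq_addSubgroupClosure, Submodule.mem_toAddSubgroup,
    Submodule.mem_span_set'] at h
  obtain ⟨m, n, g, rfl⟩ := h
  choose V h φ hg using fun i => (g i).2
  exact ⟨m, V, h, φ, n, Finset.sum_congr rfl fun i _ => by rw [hg]⟩

end Monomial

/-! ### Ξ_U is a homomorphism, compatible with induction and inflation. -/

section Multiplicative

variable {p : ℕ} [Fact p.Prime] {G : Type*} [Group G] [TopologicalSpace G] [IsTopologicalGroup G]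
  [CompactSpace G] {P : OneDim p G}

theorem SubQ.Incl.trans {T V U : SubQ P} (h : SubQ.Incl T V) (h' : SubQ.Incl V U) : SubQ.Incl T U :=
  ⟨h.W.trans h'.W, h.C.trans h'.C⟩

theorem SubQ.Incl.continuous {V U : SubQ P} (h : SubQ.Incl V U) : Continuous h.hom :=
  SubQ.continuous_hom _ _

theorem SubQ.Surj.continuous {V U : SubQ P} (h : SubQ.Surj V U) : Continuous h.hom :=
  SubQ.continuous_hom _ _

theorem SubQ.Incl.refl (U : SubQ P) : SubQ.Incl U U := ⟨le_rfl, rfl⟩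

theorem SubQ.Incl.indFun_indFun {T V U : SubQ P} (h : SubQ.Incl T V) (h' : SubQ.Incl V U) (f : T.Grp → QBar p)
    (hf : ∀ u v, f (u * v) = f (v * u)) : indFun h'.hom (indFun h.hom f) = indFun (h.trans h').hom f := by
  rw [indFun_comp _ h'.injective _ h.injective f hf]
  congr 1
  refine MonoidHom.ext fun x => ?_
  induction x using QuotientGroup.induction_on with | H x => ?_
  rfl

theorem SubQ.Incl.indFun_mem' (hG : ∀ N : OpenNormalSubgroup G, IsPGroup p (G ⧸ N.toSubgroup))
    {V U : SubQ P} (h : SubQ.Incl V U) {ρ : V.Grp → QBar p} (hρ : ρ ∈ virtChar p V.Grp) :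
    indFun h.hom ρ ∈ virtChar p U.Grp := by
  have h1 := V.virtChar_le_indSpan hG hρ
  change indHom h.hom h.injective ρ ∈ virtChar p U.Grp
  induction h1 using AddSubgroup.closure_induction with
  | mem x hx =>
    obtain ⟨T, hT, φ, rfl⟩ := hx
    change indFun h.hom _ ∈ _
    rw [hT.indFun_indFun h _ (T.chrFun_comm φ)]
    exact (hT.trans h).indFun_mem φ
  | zero => rw [map_zero]; exact zero_mem _
  | add x y hx' hy' hx hy =>
    rw [map_add]
    exact add_mem (hx (V.indSpan_le_virtChar hx')) (hy (V.indSpan_le_virtChar hy'))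
  | neg x hx' hx => rw [map_neg]; exact neg_mem (hx (V.indSpan_le_virtChar hx'))

variable {l : Tuple P}

/-- A monomial decomposition of ρ on V induces, by transitivity, one of Ind ρ on U with the same
data, and (RW4) attaches the same product to both. -/
theorem Tuple.MemPhi.Xi_ind (hl : l.MemPhi) (hG : ∀ N : OpenNormalSubgroup G, IsPGroup p (G ⧸ N.toSubgroup))
    {V U : SubQ P} (h : SubQ.Incl V U) {ρ : V.Grp → QBar p} (hρ : ρ ∈ virtChar p V.Grp) :
    l.Xi U (indFun h.hom ρ) = l.Xi V ρ := by
  obtain ⟨m, T, hT, φ, n, e⟩ := V.exists_sum_of_indSpan (V.virtChar_le_indSpan hG hρ)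
  rw [hl.rw4 V m T hT φ n ρ hρ e]
  refine hl.rw4 U m T (fun i => (hT i).trans h) φ n _ (h.indFun_mem' hG hρ) ?_
  change indHom h.hom h.injective ρ = _
  rw [e, map_sum]
  refine Finset.sum_congr rfl fun i _ => ?_
  rw [map_zsmul, ← (hT i).indFun_indFun h _ ((T i).chrFun_comm _)]
  rfl

/-- The preimage of a subgroup under a surjection of subquotients. -/
def SubQ.Surj.pull {U V T : SubQ P} (h : SubQ.Surj U V) (hT : SubQ.Incl T V) : SubQ P where
  W := T.W
  C := U.C
  isOpen := T.isOpen
  le := h.C.trans (hT.C.ge.trans T.le)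
  leH := U.leH
  normal := ⟨fun c hc w => U.conj_mem (h.W.ge (hT.W w.2)) hc⟩

theorem SubQ.Surj.pull_incl {U V T : SubQ P} (h : SubQ.Surj U V) (hT : SubQ.Incl T V) :
    SubQ.Incl (h.pull hT) U := ⟨hT.W.trans h.W.ge, rfl⟩

theorem SubQ.Surj.pull_surj {U V T : SubQ P} (h : SubQ.Surj U V) (hT : SubQ.Incl T V) :
    SubQ.Surj (h.pull hT) T := ⟨rfl, h.C.trans hT.C.ge⟩

theorem SubQ.Surj.ab {U V : SubQ P} (h : SubQ.Surj U V) : SubQ.Surj U.ab V.ab :=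
  ⟨h.W, SubQ.ab_le h.W.le h.C⟩

theorem SubQ.Surj.indFun_comp {U V T : SubQ P} (h : SubQ.Surj U V) (hT : SubQ.Incl T V) (φ : Chr p T.ab.Grp) :
    indFun hT.hom (T.chrFun φ) ∘ h.hom = indFun (h.pull_incl hT).hom ((h.pull hT).chrFun
      (φ.comp (h.pull_surj hT).ab.hom (h.pull_surj hT).ab.continuous)) := by
  funext u
  have h1 : (h.pull hT).chrFun (φ.comp (h.pull_surj hT).ab.hom (h.pull_surj hT).ab.continuous) =
      T.chrFun φ ∘ (h.pull_surj hT).hom := by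
    funext v
    induction v using QuotientGroup.induction_on with | H v => ?_
    rfl
  rw [h1]
  refine (indFun_inflate (h.pull_incl hT).hom (h.pull_incl hT).injective hT.hom hT.injective h.hom
    (SubQ.surjective_hom h.W h.C) _ (fun v => ?_) (fun u hu => ?_) _ (T.chrFun_comm φ) u).symm
  · induction v using QuotientGroup.induction_on with | H v => ?_
    rfl
  · obtain ⟨v, hv⟩ := hu
    induction u using QuotientGroup.induction_on with | H u => ?_
    induction v using QuotientGroup.induction_on with | H v => ?_
    have h2 : (Subgroup.inclusion hT.W v)⁻¹ * Subgroup.inclusion h.W.le u ∈ V.C.subgroupOf V.W :=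
      QuotientGroup.eq.1 hv
    have h3 : (v : G)⁻¹ * u ∈ T.C := hT.C.ge h2
    have h4 : (u : G) ∈ T.W := by
      have := mul_mem v.2 (T.le h3)
      rwa [mul_inv_cancel_left] at this
    exact ⟨QuotientGroup.mk ⟨u.1, h4⟩, rfl⟩

/-- A surjection U ↠ V induces one of abelianisations, along which λ is compatible by (RW1); Det is
natural for maps over Γ. -/
theorem Tuple.MemPhi.det_surj (hl : l.MemPhi) {U V : SubQ P} (h : SubQ.Surj U V) (φ : Chr p V.ab.Grp) :
    l.det U (φ.comp h.ab.hom h.ab.continuous) = l.det V φ := by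
  refine Units.ext ?_
  change detChr U.ab.oneDim _ (l.atAb U : B p U.ab.Grp) = detChr V.ab.oneDim φ (l.atAb V : B p V.ab.Grp)
  rw [Tuple.atAb, Tuple.atAb, ← hl.rw1_pr U.ab V.ab U.ab_isAb V.ab_isAb h.ab]
  exact (detChr_map (D := U.ab.oneDim) V.ab.oneDim h.ab.hom _ (SubQ.proj_hom _ _) φ _).symm

theorem Tuple.MemPhi.Xi_surj (hl : l.MemPhi) (hG : ∀ N : OpenNormalSubgroup G, IsPGroup p (G ⧸ N.toSubgroup))
    {U V : SubQ P} (h : SubQ.Surj U V) {ρ : V.Grp → QBar p} (hρ : ρ ∈ virtChar p V.Grp) :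
    l.Xi U (ρ ∘ h.hom) = l.Xi V ρ := by
  obtain ⟨m, T, hT, φ, n, e⟩ := V.exists_sum_of_indSpan (V.virtChar_le_indSpan hG hρ)
  rw [hl.rw4 V m T hT φ n ρ hρ e, hl.rw4 U m (fun i => h.pull (hT i)) (fun i => h.pull_incl (hT i))
    (fun i => (φ i).comp (h.pull_surj (hT i)).ab.hom (h.pull_surj (hT i)).ab.continuous) n _
    (virtChar_comp h.hom (SubQ.continuous_hom _ _) hρ) ?_]
  · exact Finset.prod_congr rfl fun i _ => by rw [hl.det_surj (h.pull_surj (hT i))]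
  · rw [e]
    funext u
    simp only [Function.comp_apply, Finset.sum_apply, Pi.smul_apply]
    exact Finset.sum_congr rfl fun i _ => congrArg (n i • ·) (congrFun (h.indFun_comp (hT i) (φ i)) u)

theorem Tuple.MemPhi.Xi_eq (hl : l.MemPhi) (U : SubQ P) {ι : Type*} [Fintype ι] (V : ι → SubQ P)
    (h : ∀ i, SubQ.Incl (V i) U) (φ : ∀ i, Chr p (V i).ab.Grp) (n : ι → ℤ) :
    l.Xi U (∑ i, n i • indFun (h i).hom ((V i).chrFun (φ i))) = ∏ i, l.det (V i) (φ i) ^ n i := by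
  let e := (Fintype.equivFin ι).symm
  rw [← e.prod_comp]
  refine hl.rw4 U _ (fun i => V (e i)) (fun i => h (e i)) (fun i => φ (e i)) (fun i => n (e i)) _
    (sum_mem fun i _ => zsmul_mem ((h i).indFun_mem (φ i)) _) ?_
  exact (e.sum_comp fun i => n i • indFun (h i).hom ((V i).chrFun (φ i))).symm

/-- Two monomial decompositions can be concatenated. (RW4) holds for any decomposition, not only the
canonical one, so the product over the concatenation is Ξ_U of the sum. -/
theorem Tuple.MemPhi.Xi_add (hl : l.MemPhi) (hG : ∀ N : OpenNormalSubgroup G, IsPGroup p (G ⧸ N.toSubgroup))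
    (U : SubQ P) {ρ ρ' : U.Grp → QBar p} (hρ : ρ ∈ virtChar p U.Grp) (hρ' : ρ' ∈ virtChar p U.Grp) :
    l.Xi U (ρ + ρ') = l.Xi U ρ * l.Xi U ρ' := by
  obtain ⟨m, V, hV, φ, n, rfl⟩ := U.exists_sum_of_indSpan (U.virtChar_le_indSpan hG hρ)
  obtain ⟨m', V', hV', φ', n', rfl⟩ := U.exists_sum_of_indSpan (U.virtChar_le_indSpan hG hρ')
  have h := hl.Xi_eq U (Sum.elim V V') (fun i => match i with | .inl i => hV i | .inr i => hV' i)
    (fun i => match i with | .inl i => φ i | .inr i => φ' i) (Sum.elim n n')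
  rw [Fintype.sum_sum_type, Fintype.prod_sum_type] at h
  rw [hl.Xi_eq U V hV φ n, hl.Xi_eq U V' hV' φ' n']
  exact h

/-- `Ξ_U` as a homomorphism. -/
def Tuple.MemPhi.XiHom (hl : l.MemPhi) (hG : ∀ N : OpenNormalSubgroup G, IsPGroup p (G ⧸ N.toSubgroup))
    (U : SubQ P) : virtChar p U.Grp →+ Additive (BZ p)ˣ :=
  AddMonoidHom.mk' (fun ρ => Additive.ofMul (l.Xi U ρ)) fun ρ ρ' =>
    congrArg Additive.ofMul (hl.Xi_add hG U ρ.2 ρ'.2)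

theorem Tuple.MemPhi.Xi_sub (hl : l.MemPhi) (hG : ∀ N : OpenNormalSubgroup G, IsPGroup p (G ⧸ N.toSubgroup))
    (U : SubQ P) {ρ ρ' : U.Grp → QBar p} (hρ : ρ ∈ virtChar p U.Grp) (hρ' : ρ' ∈ virtChar p U.Grp) :
    l.Xi U (ρ - ρ') = l.Xi U ρ / l.Xi U ρ' :=
  map_sub (hl.XiHom hG U) ⟨ρ, hρ⟩ ⟨ρ', hρ'⟩

theorem Tuple.MemPhi.Xi_zero (hl : l.MemPhi) (hG : ∀ N : OpenNormalSubgroup G, IsPGroup p (G ⧸ N.toSubgroup))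
    (U : SubQ P) : l.Xi U 0 = 1 := map_zero (hl.XiHom hG U)

end Multiplicative

end RW

noncomputable section
namespace RW

/-! ### Uniqueness of logarithms, compatibility with Ψ, and telescoping. -/

section Telescope

variable {p : ℕ} [Fact p.Prime]

theorem IsPLog'.unique {x : BZ p} {z z' : BQ p} (h : IsPLog' x z) (h' : IsPLog' x z') : z = z' := by
  rw [← sub_eq_zero]
  refine eq_zero_of_mem_pLat _ fun n => ?_
  obtain ⟨k, hk⟩ := h n
  obtain ⟨k', hk'⟩ := h' n
  have := sub_mem (hk (max k k') (le_max_left _ _)) (hk' (max k k') (le_max_right _ _))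
  rwa [sub_sub_sub_cancel_right] at this

theorem PsiQ_toBQ (x : BZ p) : PsiQ p (toBQ p x) = toBQ p (PsiZ p x) := by
  induction x using TensorProduct.induction_on with
  | zero => simp
  | tmul a b => rfl
  | add x y hx hy => rw [map_add, map_add, map_add, map_add, hx, hy]

theorem PsiQ_smul (c : QBar p) (x : BQ p) : PsiQ p (c • x) = c • PsiQ p x := by
  induction x using TensorProduct.induction_on with
  | zero => simp
  | tmul a b => rfl
  | add x y hx hy => rw [smul_add, map_add, map_add, smul_add, hx, hy]

theorem PsiQ_iterate_smul (r : ℕ) (c : QBar p) (x : BQ p) : (PsiQ p)^[r] (c • x) = c • (PsiQ p)^[r] x := by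
  induction r with
  | zero => rfl
  | succ r ih => rw [Function.iterate_succ_apply', ih, PsiQ_smul, Function.iterate_succ_apply']

theorem IsPLog'.psi {x : BZ p} {z : BQ p} (h : IsPLog' x z) : IsPLog' (PsiZ p x) (PsiQ p z) := by
  intro n
  obtain ⟨k₀, hk⟩ := h n
  refine ⟨k₀, fun k hk0 => ?_⟩
  obtain ⟨w, hw⟩ := mem_pLat.1 (hk k hk0)
  refine mem_pLat.2 ⟨PsiZ p w, ?_⟩
  have h1 := congrArg (PsiQ p) hw
  rw [map_sub, PsiQ_smul, PsiQ_toBQ, PsiQ_toBQ, map_sub, map_pow, map_one, map_mul, map_pow, map_natCast] at h1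
  exact h1

theorem IsPLog'.psi_iterate {x : BZ p} {z : BQ p} (h : IsPLog' x z) (r : ℕ) :
    IsPLog' ((PsiZ p)^[r] x) ((PsiQ p)^[r] z) := by
  induction r with
  | zero => exact h
  | succ r ih => rw [Function.iterate_succ_apply', Function.iterate_succ_apply']; exact ih.psi

theorem IsPLog'.mul {x y : (BZ p)ˣ} {z z' : BQ p} (h : IsPLog' (x : BZ p) z) (h' : IsPLog' (y : BZ p) z') :
    IsPLog' ((x * y : (BZ p)ˣ) : BZ p) (z + z') :=
  (plogSub p).mul_mem (x := (x, Multiplicative.ofAdd z)) (y := (y, Multiplicative.ofAdd z')) h h'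

theorem IsPLog'.one : IsPLog' (1 : BZ p) (0 : BQ p) := (plogSub p).one_mem

/-- If log(w_r^p / w_(r+1)) = z_r then log w_r = (z_r + log w_(r+1))/p. Unrolling until w_R = 1
gives log w₀ = ∑ z_s / p^(s+1). -/
theorem IsPLog'.telescope (R : ℕ) (w : ℕ → (BZ p)ˣ) (z : ℕ → BQ p) (hR : w R = 1)
    (h : ∀ r, IsPLog' ((w r ^ p * (w (r + 1))⁻¹ : (BZ p)ˣ) : BZ p) (z r)) :
    IsPLog' (w 0 : BZ p) (∑ s ∈ Finset.range R, ((p : QBar p) ^ (s + 1))⁻¹ • z s) := by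
  induction R generalizing w z with
  | zero => rw [hR, Finset.sum_range_zero]; exact IsPLog'.one
  | succ R ih =>
    have h1 := (h 0).mul (ih (fun r => w (r + 1)) (fun r => z (r + 1)) hR fun r => h (r + 1))
    rw [inv_mul_cancel_right, Units.val_pow_eq_pow_val] at h1
    have h2 := IsPLog'.root 1 (by rwa [pow_one])
    convert h2 using 1
    rw [Finset.sum_range_succ', smul_add, Finset.smul_sum, zero_add, add_comm]
    congr 1
    refine Finset.sum_congr rfl fun s _ => ?_
    rw [smul_smul, ← mul_inv, pow_one, ← pow_succ']

end Telescope

/-! ### Elements whose traces are the logarithms of Ξ_U, and the modified trace. -/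

section LogTrace

variable {p : ℕ} [Fact p.Prime] {G : Type*} [Group G] [TopologicalSpace G] [IsTopologicalGroup G]
  [CompactSpace G] {P : OneDim p G} {l : Tuple P}

/-- The element `Ξ(ρ)ᵖ / Ψ(Ξ(ψ_p ρ))`. -/
def Tuple.quo (l : Tuple P) (U : SubQ P) (ρ : U.Grp → QBar p) : (BZ p)ˣ :=
  l.Xi U ρ ^ p * (Units.map (PsiZ p : BZ p →* BZ p) (l.Xi U (adams ρ)))⁻¹

/-- The traces of `t` are the logarithms of `Ξ_U`. -/
structure Tuple.IsLogTrace (l : Tuple P) (U : SubQ P) (t : TBp p U.Grp) : Prop where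
  log' : ∀ ρ ∈ virtChar p U.Grp, IsPLog' (l.quo U ρ : BZ p) ((p : QBar p) • Tr U.oneDim t ρ)
  log : ∀ ρ ∈ virtChar p U.Grp, IsPLog (l.quo U ρ : BZ p) ((p : QBar p) • Tr U.oneDim t ρ)

theorem Tuple.IsLogTrace.logHom {U : SubQ P} {t : TBp p U.Grp} (h : l.IsLogTrace U t) {ρ : U.Grp → QBar p}
    (hρ : ρ ∈ virtChar p U.Grp) : Tr U.oneDim t ρ = LogHom (l.Xi U) ρ := by
  have h1 := (h.log ρ hρ).plog_eq
  change _ = (p : QBar p)⁻¹ • plog (l.quo U ρ : BZ p)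
  rw [h1, inv_smul_smul₀ (Nat.cast_ne_zero.2 (Fact.out : p.Prime).ne_zero)]

/-- As soon as one preimage exists, the default value 0 in `TrInv` is not reached. -/
theorem TrInv_spec {U : Type*} [Group U] [TopologicalSpace U] [IsTopologicalGroup U] [CompactSpace U]
    (D : OneDim p U) (f : (U → QBar p) → BQ p) (t : TBp p U) (h : ∀ χ ∈ virtChar p U, Tr D t χ = f χ) :
    ∀ χ ∈ virtChar p U, Tr D (TrInv D f) χ = f χ := by
  have hex : ∃ t, ∀ χ ∈ virtChar p U, Tr D t χ = f χ := ⟨t, h⟩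
  rw [TrInv, dif_pos hex]
  exact hex.choose_spec

theorem Tuple.IsLogTrace.t_logHom {U : SubQ P} {t : TBp p U.Grp} (h : l.IsLogTrace U t) :
    ∀ ρ ∈ virtChar p U.Grp, Tr U.oneDim (l.t U) ρ = LogHom (l.Xi U) ρ :=
  TrInv_spec U.oneDim _ t fun _ => h.logHom

theorem adams_iterate (χ : G → QBar p) (r : ℕ) (u : G) : adams^[r] χ u = χ (u ^ p ^ r) := by
  induction r generalizing χ with
  | zero => rw [pow_zero, pow_one]; rfl
  | succ r ih => rw [Function.iterate_succ_apply, ih, adams, ← pow_mul, pow_succ]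

/-- χ factors through a finite p-group, whose order p^R kills every element, so the iterate
evaluates χ at 1. -/
theorem SubQ.exists_adams_eq_zero (hG : ∀ N : OpenNormalSubgroup G, IsPGroup p (G ⧸ N.toSubgroup))
    (U : SubQ P) {χ : U.Grp → QBar p} (h : χ ∈ virtChar p U.Grp) (h1 : χ 1 = 0) :
    ∃ R, ∀ r ≥ R, adams^[r] χ = 0 := by
  obtain ⟨-, N, χ', hχ⟩ := isClassFn_of_virtChar h
  obtain ⟨R, hR⟩ := (IsPGroup.iff_card.1 (U.isPGroup_quot hG N))
  refine ⟨R, fun r hr => funext fun u => ?_⟩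
  have h2 : (u : U.Grp ⧸ N.toSubgroup) ^ p ^ r = 1 := by
    obtain ⟨s, rfl⟩ := Nat.exists_eq_add_of_le hr
    rw [pow_add, pow_mul, ← hR, pow_card_eq_one', one_pow]
  rw [adams_iterate, hχ, QuotientGroup.mk_pow, h2, ← QuotientGroup.mk_one, ← hχ, h1]
  rfl

theorem adams_iterate_mem {U : Type*} [Group U] [TopologicalSpace U] [IsTopologicalGroup U] {χ : U → QBar p}
    (h : χ ∈ virtChar p U) (r : ℕ) : adams^[r] χ ∈ virtChar p U := by
  induction r with
  | zero => exact h
  | succ r ih => rw [Function.iterate_succ_apply']; exact adams_mem_virtChar ih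

/-- Since Ξ_U(Ind χ) = Ξ_V(χ) and likewise for ψ_p χ, the quotient Ξ^p/ΨΞψ_p of V at χ equals that
of U at Ind χ times ΨΞ_U(χ''). The logarithm of this last factor is found by telescoping along
Ψ^(r+1)Ξ_U(ψ_p^r χ''), whose successive quotients have known logarithms; this yields exactly the
correction sum in Res. -/
theorem Tuple.IsLogTrace.res (hl : l.MemPhi) (hG : ∀ N : OpenNormalSubgroup G, IsPGroup p (G ⧸ N.toSubgroup))
    {U V : SubQ P} (h : SubQ.Incl V U) {t : TBp p U.Grp} (ht : l.IsLogTrace U t) {t' : TBp p V.Grp}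
    (ht' : l.IsLogTrace V t') {χ : V.Grp → QBar p} (hχ : χ ∈ virtChar p V.Grp) :
    Tr V.oneDim t' χ = resHom h.hom (Tr U.oneDim t) χ := by
  set χ'' := adams (indFun h.hom χ) - indFun h.hom (adams χ) with hχ''
  have hi : indFun h.hom χ ∈ virtChar p U.Grp := h.indFun_mem' hG hχ
  have hi' : indFun h.hom (adams χ) ∈ virtChar p U.Grp := h.indFun_mem' hG (adams_mem_virtChar hχ)
  have hm : χ'' ∈ virtChar p U.Grp := sub_mem (adams_mem_virtChar hi) hi'
  have h0 : χ'' 1 = 0 := by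
    have h2 : ∀ f : V.Grp → QBar p, indFun h.hom f 1 = ∑ᶠ q : U.Grp ⧸ h.hom.range, f 1 := fun f => by
      rw [indFun]
      refine finsum_congr fun q => ?_
      rw [mul_one, inv_mul_cancel, ← map_one h.hom, h.injective.extend_apply]
    rw [hχ'', Pi.sub_apply, adams, one_pow, h2, h2, adams, one_pow, sub_self]
  obtain ⟨R, hR⟩ := U.exists_adams_eq_zero hG hm h0
  let w : ℕ → (BZ p)ˣ := fun r => (Units.map (PsiZ p : BZ p →* BZ p))^[r + 1] (l.Xi U (adams^[r] χ''))
  have hw : ∀ r, IsPLog' ((w r ^ p * (w (r + 1))⁻¹ : (BZ p)ˣ) : BZ p)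
      ((PsiQ p)^[r + 1] ((p : QBar p) • Tr U.oneDim t (adams^[r] χ''))) := by
    intro r
    have h3 := (ht.log' _ (adams_iterate_mem hm r)).psi_iterate (r + 1)
    have h4 : ∀ x : (BZ p)ˣ, (PsiZ p)^[r + 1] (x : BZ p) =
        ((Units.map (PsiZ p : BZ p →* BZ p))^[r + 1] x : (BZ p)ˣ) := fun x =>
      ((Function.Semiconj.iterate_right (f := fun x : (BZ p)ˣ => (x : BZ p)) (fun _ => rfl) (r + 1)).eq x).symm
    rw [h4, Tuple.quo, iterate_map_mul, iterate_map_pow, iterate_map_inv, ← Function.iterate_succ_apply,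
      ← Function.iterate_succ_apply' adams] at h3
    exact h3
  -- The chain ends because ψ_p^R χ'' = 0 and Ξ_U(0) = 1.
  have h4 := IsPLog'.telescope R w _ (by
    change (Units.map (PsiZ p : BZ p →* BZ p))^[R + 1] (l.Xi U (adams^[R] χ'')) = 1
    rw [hR R le_rfl, hl.Xi_zero hG, Function.iterate_fixed (map_one _)]) hw
  have h5 := (ht.log' _ hi).mul h4
  have h6 : l.quo U (indFun h.hom χ) * w 0 = l.quo V χ := by
    have h7 : w 0 = Units.map (PsiZ p : BZ p →* BZ p) (l.Xi U χ'') := rfl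
    rw [h7, Tuple.quo, Tuple.quo, hl.Xi_ind hG h hχ, hχ'', hl.Xi_sub hG U (adams_mem_virtChar hi) hi',
      hl.Xi_ind hG h (adams_mem_virtChar hχ), map_div, div_eq_mul_inv]
    group
  rw [h6] at h5
  have h8 := (ht'.log' χ hχ).unique h5
  have hp0 : (p : QBar p) ≠ 0 := Nat.cast_ne_zero.2 (Fact.out : p.Prime).ne_zero
  refine smul_right_injective _ hp0 (h8.trans ?_)
  beta_reduce
  rw [resHom, smul_add]
  congr 1
  -- The terms with r ≥ R vanish, so the finsum is not a default value.
  rw [finsum_eq_sum_of_support_subset (s := Finset.range R), Finset.smul_sum]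
  · refine Finset.sum_congr rfl fun s _ => ?_
    rw [PsiQ_iterate_smul, smul_comm]
  · intro r hr
    rw [Finset.coe_range, Set.mem_Iio]
    by_contra hc
    refine hr ?_
    beta_reduce
    rw [← hχ'', hR r (not_lt.1 hc), Tr_zero_right, Function.iterate_fixed (map_zero _), smul_zero]

end LogTrace

end RW

noncomputable section
namespace RW

/-! ### Existence of an open central subgroup isomorphic to ℤ_p. -/

section CentralSection

variable {p : ℕ} [Fact p.Prime]

/-- The natural powers of the generator are dense in Γ and the condition on g is closed. -/
theorem pow_mem_of_isClosed (S : Subgroup (Gam p)) (hS : IsClosed (S : Set (Gam p))) (m : ℕ)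
    (h : (Multiplicative.ofAdd (1 : ℤ_[p])) ^ m ∈ S) (g : Gam p) : g ^ m ∈ S := by
  have h1 : IsClosed {x : ℤ_[p] | (Multiplicative.ofAdd x) ^ m ∈ S} :=
    hS.preimage (continuous_ofAdd.pow m)
  have h2 : ∀ x : ℤ_[p], (Multiplicative.ofAdd x) ^ m ∈ S := fun x => by
    refine PadicInt.denseRange_natCast.induction_on (p := fun x => (Multiplicative.ofAdd x) ^ m ∈ S) x h1
      fun n => ?_
    have h3 : Multiplicative.ofAdd (n : ℤ_[p]) = Multiplicative.ofAdd (1 : ℤ_[p]) ^ n := by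
      rw [← ofAdd_nsmul, nsmul_one]
    rw [h3, pow_right_comm]
    exact pow_mem h n
  exact h2 g.toAdd

variable {G : Type*} [Group G] [TopologicalSpace G] [IsTopologicalGroup G]
  [CompactSpace G] [T2Space G]

/-- The commutator with g takes values in the kernel of G → Γ, which is finite and therefore
discrete. -/
theorem isOpen_centralizer (P : OneDim p G) (g : G) : IsOpen (Subgroup.centralizer {g} : Set G) := by
  have := P.fin
  let f : G → P.proj.ker := fun x => ⟨x * g * x⁻¹ * g⁻¹, by
    rw [MonoidHom.mem_ker]; simp⟩
  have hf : Continuous f := Continuous.subtype_mk (by fun_prop) _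
  have h : (Subgroup.centralizer {g} : Set G) = f ⁻¹' {1} := by
    ext x
    rw [SetLike.mem_coe, Subgroup.mem_centralizer_singleton_iff, Set.mem_preimage, Set.mem_singleton_iff,
      Subtype.ext_iff]
    change _ ↔ x * g * x⁻¹ * g⁻¹ = 1
    rw [mul_inv_eq_one, mul_inv_eq_iff_eq_mul]
  rw [h]
  exact (isOpen_discrete _).preimage hf

/-- G is generated topologically by the finite kernel H and one lift γ of a generator of Γ. If k
commutes with H and γ, its centraliser is closed, contains H and maps onto Γ, so it is all of G. The
conditions on k are finitely many open ones. -/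
theorem isOpen_center (P : OneDim p G) (hP : Function.Surjective P.proj) :
    IsOpen (Subgroup.center G : Set G) := by
  have := P.fin
  obtain ⟨γ, hγ⟩ := hP (Multiplicative.ofAdd 1)
  have h1 : IsOpen (((⨅ h : P.proj.ker, Subgroup.centralizer {(h : G)}) ⊓ Subgroup.centralizer {γ} :
      Subgroup G) : Set G) := by
    rw [Subgroup.coe_inf, Subgroup.coe_iInf]
    exact (isOpen_iInter_of_finite fun h => isOpen_centralizer P _).inter (isOpen_centralizer P _)
  refine Subgroup.isOpen_mono (fun k hk => ?_) h1
  obtain ⟨hk1, hk2⟩ := Subgroup.mem_inf.1 hk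
  have hC : IsClosed (Subgroup.centralizer {k} : Set G) :=
    Subgroup.isClosed_of_isOpen _ (isOpen_centralizer P k)
  have hmem : ∀ x, x ∈ Subgroup.centralizer {k} ↔ k ∈ Subgroup.centralizer {x} := fun x => by
    rw [Subgroup.mem_centralizer_singleton_iff, Subgroup.mem_centralizer_singleton_iff]
    exact eq_comm
  have hS : IsClosed (((Subgroup.centralizer {k}).map P.proj : Subgroup (Gam p)) : Set (Gam p)) :=
    (hC.isCompact.image P.cont).isClosed
  refine Subgroup.mem_center_iff.2 fun x => ?_
  obtain ⟨c, hc, hcx⟩ := pow_mem_of_isClosed _ hS 1 ⟨γ, (hmem γ).2 hk2, by rw [pow_one, hγ]⟩ (P.proj x)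
  rw [pow_one] at hcx
  have h2 : x * c⁻¹ ∈ Subgroup.centralizer {k} := (hmem _).2 ((Subgroup.mem_iInf.1 hk1) ⟨x * c⁻¹, by
    rw [MonoidHom.mem_ker, map_mul, map_inv, hcx, mul_inv_cancel]⟩)
  have h3 := mul_mem h2 hc
  rw [inv_mul_cancel_right] at h3
  exact (Subgroup.mem_centralizer_singleton_iff.1 h3)

theorem exists_central_subgroup [TotallyDisconnectedSpace G] (P : OneDim p G)
    (hP : Function.Surjective P.proj) : ∃ N : Subgroup G, IsOpen (N : Set G) ∧ N ≤ Subgroup.center G ∧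
      ∀ n ∈ N, P.proj n = 1 → n = 1 := by
  have hf : ((P.proj.ker : Set G) \ {1}).Finite := by
    have := P.fin
    exact (Set.toFinite (P.proj.ker : Set G)).subset Set.diff_subset
  obtain ⟨M, hM⟩ := ProfiniteGrp.exist_openNormalSubgroup_sub_open_nhds_of_one hf.isClosed.isOpen_compl
    (by simp)
  refine ⟨Subgroup.center G ⊓ M.toSubgroup, ?_, inf_le_left, fun n hn h => ?_⟩
  · rw [Subgroup.coe_inf]
    exact (isOpen_center P hP).inter M.isOpen'
  · by_contra h1
    exact hM hn.2 ⟨h, h1⟩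

/-- The projection is injective on N and its image is closed. The image contains some γ^(p^j), hence
all of Γ^(p^j), and z(g) is the unique point of N above g^(p^j). -/
theorem exists_section (P : OneDim p G) (hP : Function.Surjective P.proj)
    (hG : ∀ N : OpenNormalSubgroup G, IsPGroup p (G ⧸ N.toSubgroup)) (N : Subgroup G)
    (hN : IsOpen (N : Set G)) (h1 : ∀ n ∈ N, P.proj n = 1 → n = 1) :
    ∃ (z : Gam p →* G) (j : ℕ), Continuous z ∧ (∀ g, z g ∈ N) ∧ (∀ g, P.proj (z g) = g ^ p ^ j) ∧
      IsOpen (Set.range z) := by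
  obtain ⟨γ, hγ⟩ := hP (Multiplicative.ofAdd 1)
  let M : OpenNormalSubgroup G :=
    { toSubgroup := N.normalCore, isOpen' := isOpen_normalCore N hN, isNormal' := inferInstance }
  obtain ⟨j, hj⟩ := hG M (γ : G)
  have hγN : γ ^ p ^ j ∈ N := by
    rw [← QuotientGroup.mk_pow] at hj
    exact N.normalCore_le ((QuotientGroup.eq_one_iff _).1 hj)
  have hc : IsClosed (N : Set G) := Subgroup.isClosed_of_isOpen _ hN
  have hS : IsClosed ((N.map P.proj : Subgroup (Gam p)) : Set (Gam p)) :=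
    (hc.isCompact.image P.cont).isClosed
  have hinj : ∀ a ∈ N, ∀ b ∈ N, P.proj a = P.proj b → a = b := fun a ha b hb hab => by
    have := h1 (a * b⁻¹) (mul_mem ha (inv_mem hb)) (by rw [map_mul, map_inv, hab, mul_inv_cancel])
    rwa [mul_inv_eq_one] at this
  choose z hz hpz using pow_mem_of_isClosed _ hS (p ^ j) ⟨_, hγN, by rw [map_pow, hγ]⟩
  refine ⟨MonoidHom.mk' z fun a b => hinj _ (hz _) _ (mul_mem (hz a) (hz b)) ?_, j, ?_, hz, hpz, ?_⟩
  · rw [map_mul, hpz, hpz, hpz, mul_pow]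
  · have : CompactSpace N := isCompact_iff_compactSpace.1 hc.isCompact
    -- N is compact, so the injective projection is an embedding; continuity of z reduces to that of
    -- g ↦ g^(p^j).
    have he : Topology.IsClosedEmbedding fun n : N => P.proj n :=
      (P.cont.comp continuous_subtype_val).isClosedEmbedding fun a b hab => Subtype.ext (hinj _ a.2 _ b.2 hab)
    have h2 : Continuous fun g => (⟨z g, hz g⟩ : N) := by
      rw [he.isInducing.continuous_iff]
      convert continuous_pow (M := Gam p) (p ^ j) using 1
      exact funext hpz
    exact continuous_subtype_val.comp h2
  · have h2 : Set.range z = (N : Set G) ∩ P.proj ⁻¹' (Set.range fun g : Gam p => g ^ p ^ j) := by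
      ext n
      constructor
      · rintro ⟨g, rfl⟩
        exact ⟨hz g, g, (hpz g).symm⟩
      · rintro ⟨hn, g, hg⟩
        exact ⟨g, hinj _ (hz g) _ hn ((hpz g).trans hg)⟩
    change IsOpen (Set.range z)
    rw [h2]
    exact hN.inter ((isOpen_powRange j).preimage P.cont)

theorem SubQ.exists_cenSec [TotallyDisconnectedSpace G] {P : OneDim p G} (hP : Function.Surjective P.proj)
    (hG : ∀ N : OpenNormalSubgroup G, IsPGroup p (G ⧸ N.toSubgroup)) (U : SubQ P) :
    Nonempty (CenSec U.oneDim) := by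
  obtain ⟨N, hN, hNc, hN1⟩ := exists_central_subgroup P hP
  obtain ⟨z, j, hz, hzN, hpz, hzo⟩ := exists_section P hP hG (N ⊓ U.W) (by
    rw [Subgroup.coe_inf]; exact hN.inter U.isOpen) fun n hn => hN1 n hn.1
  let z' : Gam p →* U.W := z.codRestrict U.W fun g => (hzN g).2
  have hz' : Continuous z' := hz.subtype_mk _
  refine ⟨⟨(QuotientGroup.mk' (U.C.subgroupOf U.W)).comp z', ?_, fun g u => ?_, ?_, j, hpz⟩⟩
  · exact QuotientGroup.continuous_mk.comp hz'
  · induction u using QuotientGroup.induction_on with | H u => ?_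
    refine congrArg QuotientGroup.mk (Subtype.ext ?_ : z' g * u = u * z' g)
    exact (Subgroup.mem_center_iff.1 (hNc (hzN g).1) u).symm
  · have h1 : Set.range ((QuotientGroup.mk' (U.C.subgroupOf U.W)).comp z') =
        (fun w : U.W => (QuotientGroup.mk w : U.Grp)) '' (Subtype.val ⁻¹' Set.range z) := by
      ext u
      constructor
      · rintro ⟨g, rfl⟩
        exact ⟨z' g, ⟨g, rfl⟩, rfl⟩
      · rintro ⟨w, ⟨g, hg⟩, rfl⟩
        exact ⟨g, congrArg QuotientGroup.mk (Subtype.ext hg : z' g = w)⟩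
    rw [h1]
    exact QuotientGroup.isOpenMap_coe _ (hzo.preimage continuous_subtype_val)

end CentralSection

/-! ### An element of TB(U)[1/p] is determined by its traces. -/

section Uniqueness

variable {p : ℕ} [Fact p.Prime]

/-- Fourier inversion on the cyclic group A = ⟨c⟩. With Y(a) the sum of y over the conjugates of a,
indexed by F, the hypothesis says ∑ w(a)Y(a) = 0 for every linear character w of A. Summing against
w(c)⁻¹ over all w isolates |A|·Y(c). -/
theorem sum_conj_eq_zero {F : Type*} [Group F] [Fintype F] (y : F → B p (Gam p))
    (h : ∀ (A : Subgroup F) (w : A →* (ZBar p)ˣ),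
      ∑ g, indFun A.subtype (chVal w) g ⊗ₜ[ℤ_[p]] y g = (0 : BQ p)) (c : F) :
    ∑ d, y (d * c * d⁻¹) = 0 := by
  classical
  let A := Subgroup.zpowers c
  have hA : ∀ a b : A, a * b = b * a := by
    rintro ⟨_, i, rfl⟩ ⟨_, j, rfl⟩
    exact Subtype.ext (zpow_mul_comm c i j)
  let Y : F → B p (Gam p) := fun a => ∑ d, y (d * a * d⁻¹)
  have h1 : ∀ w : A →* (ZBar p)ˣ, ∑ a : A, chVal w a ⊗ₜ[ℤ_[p]] Y a = (0 : BQ p) := by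
    intro w
    have h2 : ((Nat.card A : ℕ) : QBar p) • ∑ g, indFun A.subtype (chVal w) g ⊗ₜ[ℤ_[p]] y g = (0 : BQ p) := by
      rw [h, smul_zero]
    rw [Finset.smul_sum] at h2
    have h3 : ∀ g, ((Nat.card A : ℕ) : QBar p) • (indFun A.subtype (chVal w) g ⊗ₜ[ℤ_[p]] y g : BQ p) =
        ∑ u : F, Function.extend A.subtype (chVal w) 0 (u⁻¹ * g * u) ⊗ₜ[ℤ_[p]] y g := fun g => by
      rw [TensorProduct.smul_tmul', smul_eq_mul, card_smul_indFun A _ (chVal_comm w),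
        finsum_eq_sum_of_fintype, TensorProduct.sum_tmul]
    simp only [h3] at h2
    rw [Finset.sum_comm] at h2
    have h4 : ∀ u : F, ∑ g, Function.extend A.subtype (chVal w) 0 (u⁻¹ * g * u) ⊗ₜ[ℤ_[p]] y g =
        (∑ a : A, chVal w a ⊗ₜ[ℤ_[p]] y (u * a * u⁻¹) : BQ p) := by
      intro u
      rw [← Equiv.sum_comp (MulAut.conj u).toEquiv]
      have h5 : ∀ g, Function.extend A.subtype (chVal w) 0 (u⁻¹ * (MulAut.conj u).toEquiv g * u) ⊗ₜ[ℤ_[p]]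
          y ((MulAut.conj u).toEquiv g) = (Function.extend A.subtype (chVal w) 0 g ⊗ₜ[ℤ_[p]] y (u * g * u⁻¹) : BQ p) := by
        intro g
        have : u⁻¹ * (MulAut.conj u).toEquiv g * u = g := by
          change u⁻¹ * (u * g * u⁻¹) * u = g
          group
        rw [this]
        rfl
      simp only [h5]
      rw [← Finset.sum_subset (Finset.subset_univ (Finset.univ.map ⟨A.subtype, A.subtype_injective⟩)),
        Finset.sum_map]
      · refine Finset.sum_congr rfl fun a _ => ?_
        change Function.extend A.subtype (chVal w) 0 (A.subtype a) ⊗ₜ[ℤ_[p]] _ = _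
        rw [A.subtype_injective.extend_apply]
        rfl
      · intro g _ hg
        rw [Function.extend_apply', Pi.zero_apply, TensorProduct.zero_tmul]
        rintro ⟨a, ha⟩
        exact hg (Finset.mem_map.2 ⟨a, Finset.mem_univ _, ha⟩)
    simp only [h4] at h2
    rw [Finset.sum_comm] at h2
    rw [← h2]
    exact Finset.sum_congr rfl fun a _ => TensorProduct.tmul_sum _ _ _
  have h2 : ∑ w : A →* (ZBar p)ˣ, chVal w (⟨c, Subgroup.mem_zpowers c⟩ : A)⁻¹ •
      ∑ a : A, (chVal w a ⊗ₜ[ℤ_[p]] Y a : BQ p) = 0 :=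
    Finset.sum_eq_zero fun w _ => by rw [h1, smul_zero]
  have h3 : ∀ (w : A →* (ZBar p)ˣ) (a : A), chVal w (⟨c, Subgroup.mem_zpowers c⟩ : A)⁻¹ •
      (chVal w a ⊗ₜ[ℤ_[p]] Y a : BQ p) = chVal w ((⟨c, Subgroup.mem_zpowers c⟩ : A)⁻¹ * a) ⊗ₜ[ℤ_[p]] Y a :=
    fun w a => by rw [TensorProduct.smul_tmul', smul_eq_mul, chVal_mul]
  simp only [Finset.smul_sum, h3] at h2
  rw [Finset.sum_comm, Finset.sum_eq_single (⟨c, Subgroup.mem_zpowers c⟩ : A)] at h2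
  · simp only [inv_mul_cancel, chVal_one] at h2
    rw [Finset.sum_const, ← Nat.cast_smul_eq_nsmul (QBar p)] at h2
    have h4 : (((Finset.univ : Finset (A →* (ZBar p)ˣ)).card : ℕ) : QBar p) ≠ 0 :=
      Nat.cast_ne_zero.2 (Finset.card_ne_zero.2 ⟨1, Finset.mem_univ _⟩)
    have h5 : ((1 : QBar p) ⊗ₜ[ℤ_[p]] Y c : BQ p) = 0 := (smul_eq_zero_iff_right h4).1 h2
    exact includeRight_BQ_injective (h5.trans (TensorProduct.tmul_zero _ _).symm)
  · intro a _ ha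
    rw [← TensorProduct.sum_tmul, sum_char hA, TensorProduct.zero_tmul]
    rw [Ne, inv_mul_eq_one]
    exact fun h => ha h.symm
  · exact fun h => (h (Finset.mem_univ _)).elim

variable {U : Type*} [Group U] [TopologicalSpace U] [IsTopologicalGroup U] [CompactSpace U] {D : OneDim p U}

theorem trFin_eq_sum {F : Type*} [Group F] [Fintype F] (χ : F → QBar p) (y : MonoidAlgebra (B p (Gam p)) F) :
    trFin χ y = ∑ c, χ c ⊗ₜ[ℤ_[p]] y.coeff c := by
  classical
  induction y using MonoidAlgebra.induction_linear with
  | zero => simp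
  | add a b ha hb => simp only [map_add, ha, hb, MonoidAlgebra.coeff_add, Finsupp.add_apply,
      TensorProduct.tmul_add, Finset.sum_add_distrib]
  | single c r =>
    rw [trFin_single, Finset.sum_eq_single c]
    · rw [MonoidAlgebra.coeff_single_apply, if_pos rfl]
    · intro d _ hd
      rw [MonoidAlgebra.coeff_single_apply, if_neg hd.symm, TensorProduct.tmul_zero]
    · exact fun h => (h (Finset.mem_univ _)).elim

theorem coeff_conj {F R : Type*} [Group F] [CommRing R] (y : MonoidAlgebra R F) (d c : F) (r s : R)
    (h : r * s = 1) : (MonoidAlgebra.single d r * y * MonoidAlgebra.single d⁻¹ s).coeff c =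
      y.coeff (d⁻¹ * c * d) := by
  rw [MonoidAlgebra.coeff_mul_single_eq_coeff_mul (m₂ := c * d),
    MonoidAlgebra.coeff_single_mul_eq_mul_coeff (m₂ := d⁻¹ * (c * d)), mul_right_comm, h, one_mul, mul_assoc]
  · exact fun m _ => eq_inv_mul_iff_mul_eq.symm
  · exact fun m _ => mul_inv_eq_iff_eq_mul

theorem CenSec.adm_proj (Z : CenSec D) : Adm p (D.proj.comp Z.z) :=
  (D.comp Z.z Z.cont (by rw [(MonoidHom.ker_eq_bot_iff _).2 Z.injective]; infer_instance)).adm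

theorem CenSec.twist_map (Z : CenSec D) (b : B p (Gam p)) : B.twist D Z.top (B.map Z.z Z.adm b) =
    MonoidAlgebra.single 1 (B.map (D.proj.comp Z.z) Z.adm_proj b) := by
  have h : (B.twist D Z.top).comp (B.map Z.z Z.adm) =
      (MonoidAlgebra.singleOneRingHom).comp (B.map (D.proj.comp Z.z) Z.adm_proj) := by
    refine B.hom_ext (MonoidAlgebra_pSep B.eq_zero) fun x => ?_
    rw [RingHom.comp_apply, RingHom.comp_apply, B.map_of, B.map_of, B.twist_of,
      Lam.twist_map D Z.top Z.z Z.cont fun g => Z.mem_top.2 ⟨g, rfl⟩, MonoidAlgebra.mapRingHom_single]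
    rfl
  exact RingHom.congr_fun h b

/-- In coordinates the coefficient at c of the twist of ∑ z(b_c)c is b_c under γ ↦ γ^(p^j), times a
unit. That endomorphism of B(Γ) is injective. -/
theorem CenSec.twist_injective (Z : CenSec D) (x : B p U) (hx : B.twist D Z.top x = 0) : x = 0 := by
  classical
  obtain ⟨b, rfl⟩ := Z.combine_surjective x
  have h : ∀ c, b c = 0 := by
    intro c
    refine B.pow_pow_injective Z.j (D.proj.comp Z.z) Z.adm_proj Z.proj_z _ ?_
    rw [CenSec.combine_apply, map_sum] at hx
    have h1 := congrArg (fun y => y.coeff c) hx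
    simp only [map_mul, CenSec.twist_map, B.twist_grp, QuotientGroup.out_eq', MonoidAlgebra.single_mul_single,
      one_mul, MonoidAlgebra.coeff_sum, Finsupp.finset_sum_apply, MonoidAlgebra.coeff_single_apply] at h1
    rw [Finset.sum_ite_eq', if_pos (Finset.mem_univ _)] at h1
    exact (B.isUnit_grp _).mul_left_eq_zero.1 h1
  have h0 : b = 0 := funext h
  rw [h0, map_zero]

/-- Modulo commutators all conjugates of x coincide, so |F|·x is represented by the sum of its
conjugates by representatives of F. The vanishing of traces at monomial characters of F makes the
twist of this sum zero, hence the sum itself. Finally |F| is a power of p, which is invertible. -/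
theorem SubQ.Tr_eq_zero {G : Type*} [Group G] [TopologicalSpace G] [IsTopologicalGroup G]
    [CompactSpace G] {P : OneDim p G} (hG : ∀ N : OpenNormalSubgroup G, IsPGroup p (G ⧸ N.toSubgroup))
    (U : SubQ P) (Z : CenSec U.oneDim) (t : TBp p U.Grp) (h : ∀ χ ∈ virtChar p U.Grp, Tr U.oneDim t χ = 0) :
    t = 0 := by
  obtain ⟨k, x, hx⟩ := TBp.exists_of t
  refine TBp.smul_injective k ((hx.trans ?_).trans (nsmul_zero _).symm)
  have h1 : ∀ χ ∈ virtChar p U.Grp, Tr U.oneDim (TBp.of p _ x) χ = 0 := fun χ hχ => by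
    rw [← hx, ← TrHom_apply, map_nsmul, TrHom_apply, h χ hχ, smul_zero]
  let F := U.Grp ⧸ Z.top.toSubgroup
  have h2 : ∀ c : F, ∑ d : F, (B.twist U.oneDim Z.top x).coeff (d * c * d⁻¹) = 0 := by
    refine sum_conj_eq_zero _ fun A w => ?_
    have h3 : indFun A.subtype (chVal w) ∈ monSpan p F := AddSubgroup.subset_closure ⟨A, w, rfl⟩
    have h4 := U.indSpan_le_virtChar (U.comp_mem_indSpan Z.top h3)
    rw [← trFin_eq_sum, ← Tr_of U.oneDim (isClassFn_of_virtChar h4) (fun _ => rfl)]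
    exact h1 _ h4
  let x' := ∑ d : F, B.grp p d.out * x * B.grp p d.out⁻¹
  have h5 : x' = 0 := by
    refine Z.twist_injective _ (MonoidAlgebra.ext (Finsupp.ext fun c => ?_))
    rw [map_sum, MonoidAlgebra.coeff_sum, Finsupp.finset_sum_apply, MonoidAlgebra.coeff_zero,
      Finsupp.coe_zero, Pi.zero_apply, ← h2 c, ← Equiv.sum_comp (Equiv.inv F)]
    refine Finset.sum_congr rfl fun d _ => ?_
    rw [map_mul, map_mul, B.twist_grp, B.twist_grp, QuotientGroup.mk_inv, coeff_conj, QuotientGroup.out_eq']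
    · simp
    · rw [← map_mul, ← map_mul, mul_inv_cancel, map_one, map_one]
  have h6 : TBp.of p U.Grp x' = Nat.card F • TBp.of p U.Grp x := by
    rw [map_sum, Nat.card_eq_fintype_card, ← Finset.card_univ, ← Finset.sum_const]
    refine Finset.sum_congr rfl fun d _ => ?_
    rw [TBp.of_mul_comm, ← mul_assoc, ← map_mul, inv_mul_cancel, map_one, one_mul]
  obtain ⟨n, hn⟩ := IsPGroup.iff_card.1 (U.isPGroup_quot hG Z.top)
  have h7 : Nat.card F = p ^ n := hn
  refine TBp.smul_injective n (Eq.trans ?_ (nsmul_zero _).symm)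
  rw [← h7, ← h6, h5, map_zero]

end Uniqueness

end RW

noncomputable section
namespace RW

/-! ### Ψ and the p-th power map on determinants. -/

section Frobenius

variable {p : ℕ} [Fact p.Prime] {U : Type*} [Group U] [TopologicalSpace U]

/-- The projection followed by the `p`-th power map of `Γ`. -/
def OneDim.pow (D : OneDim p U) : OneDim p U where
  proj := (powMonoidHom p).comp D.proj
  cont := (continuous_powHom p).comp D.cont
  fin := by
    have := D.fin
    refine Finite.of_injective (fun x : ((powMonoidHom p : Gam p →* Gam p).comp D.proj).ker =>
      (⟨x.1, gam_torsionFree _ p (Fact.out : p.Prime).ne_zero x.2⟩ : D.proj.ker)) fun x y h => ?_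
    exact Subtype.ext (congrArg (fun z : D.proj.ker => z.1) h)

theorem Lam.twist_pow (D : OneDim p U) (N : OpenNormalSubgroup U) [Finite (U ⧸ N.toSubgroup)] (x : Lam p U) :
    Lam.twist D.pow N x = MonoidAlgebra.mapRingHom _ (Lam.map p (powMonoidHom p) (continuous_powHom p))
      (Lam.twist D N x) := by
  refine MonoidAlgebra.ext (Finsupp.ext fun c => Subtype.ext (funext fun M => ?_))
  rw [Lam.twist_spec, MonoidAlgebra.coeff_mapRingHom]
  change _ = MonoidAlgebra.mapDomainRingHom ℤ_[p] _ (((Lam.twist D N x).coeff c).1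
    (comapON (powMonoidHom p) (continuous_powHom p) M))
  rw [Lam.twist_spec, ← MonoidAlgebra.coeff_mapRingHom]
  congr 2
  have key : ∀ y : MonoidAlgebra ℤ_[p] (U ⧸ (N ⊓ comapON D.pow.proj D.pow.cont M).toSubgroup),
      MonoidAlgebra.lift ℤ_[p] _ _ (twistChar D.pow N M) y = MonoidAlgebra.mapRingHom _
        (MonoidAlgebra.mapDomainRingHom ℤ_[p] (quotMap (powMonoidHom p) _ M fun u hu =>
          (mem_comapON (powMonoidHom p) (continuous_powHom p) M u).1 hu))
        (MonoidAlgebra.lift ℤ_[p] _ _ (show U ⧸ (N ⊓ comapON D.pow.proj D.pow.cont M).toSubgroup →* _ from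
          twistChar D N (comapON (powMonoidHom p) (continuous_powHom p) M)) y) := by
    intro y
    induction y using MonoidAlgebra.induction_linear with
    | zero => simp only [map_zero]
    | add a b ha hb => simp only [map_add, ha, hb]
    | single g r =>
      induction g using QuotientGroup.induction_on with | H g => ?_
      rw [MonoidAlgebra.lift_single, MonoidAlgebra.lift_single, twistChar_mk]
      refine Eq.trans ?_ (congrArg (fun y => MonoidAlgebra.mapRingHom _ _ (r • y)) (twistChar_mk D N _ g)).symm
      simp only [MonoidAlgebra.smul_single, MonoidAlgebra.mapRingHom_single,
        MonoidAlgebra.mapDomainRingHom_apply, MonoidAlgebra.mapDomain_single, quotMap_mk]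
      rfl
  exact key _

theorem B.twist_pow (D : OneDim p U) (N : OpenNormalSubgroup U) [Finite (U ⧸ N.toSubgroup)] (x : B p U) :
    B.twist D.pow N x = MonoidAlgebra.mapRingHom _ (frobB p : B p (Gam p) →+* B p (Gam p)) (B.twist D N x) := by
  have : B.twist D.pow N =
      (MonoidAlgebra.mapRingHom _ (frobB p : B p (Gam p) →+* B p (Gam p))).comp (B.twist D N) := by
    refine B.hom_ext (MonoidAlgebra_pSep B.eq_zero) fun x => ?_
    rw [RingHom.comp_apply, B.twist_of, B.twist_of, Lam.twist_pow]
    generalize Lam.twist D N x = y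
    induction y using MonoidAlgebra.induction_linear with
    | zero => simp only [map_zero]
    | add a b ha hb => simp only [map_add, ha, hb]
    | single g r =>
      simp only [MonoidAlgebra.mapRingHom_single]
      exact congrArg _ (B.map_of _ _ _).symm
  exact RingHom.congr_fun this x

variable [IsTopologicalGroup U] [CompactSpace U]

theorem detChr_pow (D : OneDim p U) (φ : Chr p U) (x : B p U) : detChr D.pow φ x = PsiZ p (detChr D φ x) := by
  change MonoidAlgebra.liftNCRingHom _ _ (fun _ _ => Commute.all _ _) (B.twist D.pow φ.kerON x) =
    PsiZ p (MonoidAlgebra.liftNCRingHom _ _ (fun _ _ => Commute.all _ _) (B.twist D φ.kerON x))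
  rw [B.twist_pow]
  generalize B.twist D φ.kerON x = y
  induction y using MonoidAlgebra.induction_linear with
  | zero => simp only [map_zero]
  | add a b ha hb => simp only [map_add, ha, hb]
  | single c r =>
    rw [MonoidAlgebra.mapRingHom_single]
    change MonoidAlgebra.liftNC _ _ _ = PsiZ p (MonoidAlgebra.liftNC _ _ _)
    rw [MonoidAlgebra.liftNC_single, MonoidAlgebra.liftNC_single, map_mul]
    have h1 : ∀ r : B p (Gam p), PsiZ p ((1 : ZBar p) ⊗ₜ[ℤ_[p]] r) = (1 : ZBar p) ⊗ₜ[ℤ_[p]] frobB p r :=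
      fun r => Algebra.TensorProduct.map_tmul _ _ _ _
    have h2 : ∀ a : ZBar p, PsiZ p (a ⊗ₜ[ℤ_[p]] (1 : B p (Gam p))) = a ⊗ₜ[ℤ_[p]] (1 : B p (Gam p)) := fun a =>
      (Algebra.TensorProduct.map_tmul _ _ _ _).trans (by rw [map_one]; rfl)
    exact congrArg₂ (· * ·) (h1 r).symm (h2 _).symm

theorem OneDim.adm_pow (D : OneDim p U) (hU : ∀ a b : U, a * b = b * a) : Adm p (powHom hU p) where
  cont := continuous_pow p
  fin := by
    have := D.fin
    refine Finite.of_injective (fun x : (powHom hU p).ker =>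
      (⟨x.1, gam_torsionFree _ p (Fact.out : p.Prime).ne_zero (by
        rw [← map_pow, show x.1 ^ p = 1 from x.2, map_one])⟩ : D.proj.ker)) fun x y h => ?_
    exact Subtype.ext (congrArg (fun z : D.proj.ker => z.1) h)
  central _ _ _ := hU _ _

/-- Both sides send u to φ(u^p)·ū^p. So the Frobenius of B(U) becomes Ψ combined with ψ_p, which is
how ΨΞ(ψ_p χ) enters as a determinant of φ(λ). -/
theorem detChr_map_pow (D : OneDim p U) (hU : ∀ a b : U, a * b = b * a) (φ : Chr p U) (x : B p U) :
    detChr D φ (B.map (powHom hU p) (D.adm_pow hU) x) =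
      PsiZ p (detChr D (φ.comp (powHom hU p) (continuous_pow p)) x) := by
  rw [← detChr_pow]
  exact detChr_map (D := D.pow) D (powHom hU p) _ (fun u => map_pow D.proj u p) φ x

end Frobenius

/-! ### Carrying elements of B(V) to B(U) along an open inclusion. -/

section Pull

variable {p : ℕ} [Fact p.Prime] {U V : Type*} [Group U] [TopologicalSpace U] [Group V] [TopologicalSpace V]
  {D : OneDim p U}

/-- The restriction of a central section to an open subgroup that contains its image. -/
def CenSec.pull (Z : CenSec D) (E : OneDim p V) (i : V →* U) (hi : Function.Injective i) (hc : Continuous i)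
    (ho : IsOpenMap i) (hp : ∀ v, D.proj (i v) = E.proj v) (hr : ∀ g, Z.z g ∈ i.range) : CenSec E :=
  have h : ∀ g, i ((((MonoidHom.ofInjective hi).symm.toMonoidHom).comp (Z.z.codRestrict i.range hr)) g) =
      Z.z g := fun g => by
    have := MonoidHom.apply_ofInjective_symm hi ⟨Z.z g, hr g⟩
    exact this
  { z := ((MonoidHom.ofInjective hi).symm.toMonoidHom).comp (Z.z.codRestrict i.range hr)
    cont := by
      rw [(Topology.IsOpenEmbedding.of_continuous_injective_isOpenMap hc hi ho).isInducing.continuous_iff]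
      exact Z.cont.congr fun g => (h g).symm
    central := fun g v => hi (by rw [map_mul, map_mul, h, Z.central])
    isOpen_range := by
      convert Z.isOpen_range.preimage hc using 1
      ext v
      constructor
      · rintro ⟨g, rfl⟩
        exact ⟨g, (h g).symm⟩
      · rintro ⟨g, hg⟩
        exact ⟨g, hi ((h g).trans hg)⟩
    j := Z.j
    proj_z := fun g => by rw [← hp, h, Z.proj_z] }

theorem CenSec.apply_pull (Z : CenSec D) (E : OneDim p V) (i : V →* U) (hi : Function.Injective i)
    (hc : Continuous i) (ho : IsOpenMap i) (hp : ∀ v, D.proj (i v) = E.proj v) (hr : ∀ g, Z.z g ∈ i.range)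
    (g : Gam p) : i ((Z.pull E i hi hc ho hp hr).z g) = Z.z g :=
  MonoidHom.apply_ofInjective_symm hi ⟨Z.z g, hr g⟩

theorem isClassFn_translate (f : Gam p →* U) (hf : Continuous f) {χ : U → QBar p} (h : IsClassFn χ) (v : U) :
    IsClassFn fun g => χ (f g * v) := by
  obtain ⟨N, χ', hχ⟩ := h.smooth
  refine ⟨fun a b => by rw [mul_comm a b], comapON f hf N,
    fun c => χ' (quotMap f (comapON f hf N) N (fun u => (mem_comapON f hf N u).1) c * v), fun u => ?_⟩
  rw [hχ]
  rfl

theorem OneDim.ext_proj {D D' : OneDim p U} (h : D.proj = D'.proj) : D = D' := by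
  cases D
  cases D'
  subst h
  rfl

variable [IsTopologicalGroup U] [CompactSpace U] [IsTopologicalGroup V] [CompactSpace V]

/-- An inclusion need not send the centre of V into that of U, so it need not satisfy `Adm`, which
`B.map` requires. Instead x is written as ∑ z'(b_c)c and each summand is replaced by z(b_c)·i(c);
the trace of a summand depends only on the values χ(z(g)i(c)), so the traces agree. -/
theorem CenSec.exists_transport (Z : CenSec D) (E : OneDim p V) (i : V →* U) (hi : Function.Injective i)
    (hc : Continuous i) (ho : IsOpenMap i) (hp : ∀ v, D.proj (i v) = E.proj v) (hr : ∀ g, Z.z g ∈ i.range)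
    (x : B p V) : ∃ y : B p U, ∀ χ : U → QBar p, IsClassFn χ →
      Tr D (TBp.of p U y) χ = Tr E (TBp.of p V x) (χ ∘ i) := by
  set Z' := Z.pull E i hi hc ho hp hr
  obtain ⟨b, rfl⟩ := Z'.combine_surjective x
  refine ⟨∑ c, B.map Z.z Z.adm (b c) * B.grp p (i c.out), fun χ hχ => ?_⟩
  rw [Z'.combine_apply, map_sum, map_sum, ← TrHom_apply, ← TrHom_apply, map_sum, map_sum]
  refine Finset.sum_congr rfl fun c _ => ?_
  have hχi : IsClassFn (χ ∘ i) := hχ.comp i hc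
  have h1 : (fun u => (χ ∘ i) (Z'.z u * c.out)) = fun u => χ (Z.z u * i c.out) := funext fun u => by
    rw [Function.comp_apply, map_mul, Z.apply_pull]
  rw [TrHom_apply, TrHom_apply, Tr_of_map_mul_grp D Z.z Z.adm _ _ hχ (isClassFn_translate _ Z.cont hχ _),
    Tr_of_map_mul_grp E Z'.z Z'.adm _ _ hχi (isClassFn_translate _ Z'.cont hχi _), h1, hp]
  congr 2
  exact OneDim.ext_proj (MonoidHom.ext fun g => (Z.proj_z g).trans (Z'.proj_z g).symm)

end Pull

end RW

noncomputable section
namespace RW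

/-! ### Calculus of logarithms of units congruent to 1 modulo p, and the abelian case. -/

section Existence

variable {p : ℕ} [Fact p.Prime]

/-- `z` is the logarithm of the unit `x`, which is congruent to `1` modulo `p`. -/
def IsLog (x : (BZ p)ˣ) (z : BQ p) : Prop := IsPLog' (x : BZ p) z ∧ ∃ w, (x : BZ p) - 1 = p * w

theorem IsLog.mul {x y : (BZ p)ˣ} {z z' : BQ p} (h : IsLog x z) (h' : IsLog y z') : IsLog (x * y) (z + z') := by
  refine ⟨h.1.mul h'.1, ?_⟩
  obtain ⟨w, hw⟩ := h.2
  obtain ⟨w', hw'⟩ := h'.2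
  refine ⟨w * y + w', ?_⟩
  rw [Units.val_mul]
  linear_combination (y : BZ p) * hw + hw'

theorem IsLog.one : IsLog (1 : (BZ p)ˣ) (0 : BQ p) :=
  ⟨by rw [Units.val_one]; exact IsPLog'.one, 0, by rw [Units.val_one, sub_self, mul_zero]⟩

theorem IsLog.inv {x : (BZ p)ˣ} {z : BQ p} (h : IsLog x z) : IsLog x⁻¹ (-z) := by
  refine ⟨(plogSub p).inv_mem (x := (x, Multiplicative.ofAdd z)) h.1, ?_⟩
  obtain ⟨w, hw⟩ := h.2
  refine ⟨-(w * (x⁻¹ : (BZ p)ˣ)), ?_⟩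
  have h1 := x.mul_inv
  linear_combination -((x⁻¹ : (BZ p)ˣ) : BZ p) * hw + h1

theorem IsLog.pow {x : (BZ p)ˣ} {z : BQ p} (h : IsLog x z) (n : ℕ) : IsLog (x ^ n) (n • z) := by
  induction n with
  | zero => rw [pow_zero]; convert IsLog.one using 1; exact zero_nsmul z
  | succ n ih => rw [pow_succ]; convert ih.mul h using 1; exact succ_nsmul z n

/-- Modulo p one has (x - 1)^(p^k) ≡ x^(p^k) - 1 ≡ 0, so x - 1 is nilpotent modulo p. That suffices
for the series at x itself to converge. -/
theorem IsLog.isPLog_of_pow {x : (BZ p)ˣ} {z : BQ p} (k : ℕ) (h : IsLog (x ^ p ^ k) z) :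
    IsPLog' (x : BZ p) (((p : QBar p) ^ k)⁻¹ • z) ∧ IsPLog (x : BZ p) (((p : QBar p) ^ k)⁻¹ • z) := by
  obtain ⟨h1, w, hw⟩ := h
  rw [Units.val_pow_eq_pow_val] at h1 hw
  have h2 := h1.root k
  obtain ⟨r, hr⟩ := exists_add_pow_prime_pow_eq (Fact.out : p.Prime) ((x : BZ p) - 1) 1 k
  rw [sub_add_cancel, one_pow] at hr
  refine ⟨h2, h2.isPLog (p ^ k) (w - ((x : BZ p) - 1) * 1 * r) ?_⟩
  linear_combination hw - hr

variable {G : Type*} [Group G] [TopologicalSpace G] [IsTopologicalGroup G]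
  [CompactSpace G] {P : OneDim p G} {l : Tuple P}

/-- The element `Ξ(α)ᵖ / Ψ(Ξ(β))`. -/
def Tuple.quo₂ (l : Tuple P) (U : SubQ P) (α β : U.Grp → QBar p) : (BZ p)ˣ :=
  l.Xi U α ^ p * (Units.map (PsiZ p : BZ p →* BZ p) (l.Xi U β))⁻¹

theorem mul_pow_mul_inv {H : Type*} [CommGroup H] (a b c d : H) (n : ℕ) :
    (a * b) ^ n * (c * d)⁻¹ = a ^ n * c⁻¹ * (b ^ n * d⁻¹) := by
  rw [mul_pow, mul_inv, mul_mul_mul_comm]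

/-- The two arguments are kept independent because they will be a·ρ and a·ψ_p(ρ) for an averaged
function a, and the second is not ψ_p of the first. -/
theorem Tuple.MemPhi.quo₂_add (hl : l.MemPhi) (hG : ∀ N : OpenNormalSubgroup G, IsPGroup p (G ⧸ N.toSubgroup))
    (U : SubQ P) {α β α' β' : U.Grp → QBar p} (hα : α ∈ virtChar p U.Grp) (hβ : β ∈ virtChar p U.Grp)
    (hα' : α' ∈ virtChar p U.Grp) (hβ' : β' ∈ virtChar p U.Grp) :
    l.quo₂ U (α + α') (β + β') = l.quo₂ U α β * l.quo₂ U α' β' := by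
  rw [Tuple.quo₂, hl.Xi_add hG U hα hα', hl.Xi_add hG U hβ hβ', map_mul]
  exact mul_pow_mul_inv (H := (BZ p)ˣ) _ _ _ _ p

theorem Tuple.MemPhi.quo₂_zero (hl : l.MemPhi) (hG : ∀ N : OpenNormalSubgroup G, IsPGroup p (G ⧸ N.toSubgroup))
    (U : SubQ P) : l.quo₂ U 0 0 = 1 := by
  rw [Tuple.quo₂, hl.Xi_zero hG, map_one, one_pow, inv_one, mul_one]

theorem Tuple.MemPhi.quo₂_neg (hl : l.MemPhi) (hG : ∀ N : OpenNormalSubgroup G, IsPGroup p (G ⧸ N.toSubgroup))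
    (U : SubQ P) {α β : U.Grp → QBar p} (hα : α ∈ virtChar p U.Grp) (hβ : β ∈ virtChar p U.Grp) :
    l.quo₂ U (-α) (-β) = (l.quo₂ U α β)⁻¹ := by
  rw [eq_inv_iff_mul_eq_one, ← hl.quo₂_add hG U (neg_mem hα) (neg_mem hβ) hα hβ, neg_add_cancel,
    neg_add_cancel, hl.quo₂_zero hG]

theorem Tuple.MemPhi.quo₂_nsmul (hl : l.MemPhi) (hG : ∀ N : OpenNormalSubgroup G, IsPGroup p (G ⧸ N.toSubgroup))
    (U : SubQ P) {α β : U.Grp → QBar p} (hα : α ∈ virtChar p U.Grp) (hβ : β ∈ virtChar p U.Grp) (n : ℕ) :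
    l.quo₂ U (n • α) (n • β) = l.quo₂ U α β ^ n := by
  induction n with
  | zero => rw [zero_nsmul, zero_nsmul, pow_zero, hl.quo₂_zero hG]
  | succ n ih =>
    rw [succ_nsmul, succ_nsmul, hl.quo₂_add hG U (nsmul_mem hα n) (nsmul_mem hβ n) hα hβ, ih, pow_succ]

theorem SubQ.indFun_refl (U : SubQ P) {f : U.Grp → QBar p} (hf : ∀ u v, f (u * v) = f (v * u)) :
    indFun (SubQ.Incl.refl U).hom f = f := by
  have h1 : ∀ u : U.Grp, (SubQ.Incl.refl U).hom u = u := fun u => by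
    induction u using QuotientGroup.induction_on with | H u => ?_
    rfl
  funext u
  rw [indFun_eq _ (SubQ.Incl.refl U).injective _ hf (fun _ : Unit => (1 : U.Grp))
    (fun _ _ _ => rfl) (fun u => ⟨(), u, by rw [h1, inv_one, one_mul]⟩), finsum_unique, inv_one, one_mul,
    mul_one]
  conv_lhs => rw [← h1 u, (SubQ.Incl.refl U).injective.extend_apply]

theorem SubQ.chrFun_mem (U : SubQ P) (φ : Chr p U.ab.Grp) : U.chrFun φ ∈ virtChar p U.Grp := by
  rw [← U.indFun_refl (U.chrFun_comm φ)]
  exact (SubQ.Incl.refl U).indFun_mem φ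

theorem Tuple.MemPhi.Xi_chrFun (hl : l.MemPhi) (U : SubQ P) (φ : Chr p U.ab.Grp) :
    l.Xi U (U.chrFun φ) = l.det U φ := by
  have h := hl.Xi_eq U (fun _ : Unit => U) (fun _ => SubQ.Incl.refl U) (fun _ => φ) (fun _ => 1)
  rw [Fintype.sum_unique, Fintype.prod_unique, one_zsmul, zpow_one] at h
  rw [← h, U.indFun_refl (U.chrFun_comm φ)]

theorem SubQ.adams_chrFun (U : SubQ P) (φ : Chr p U.ab.Grp) : adams (U.chrFun φ) =
    U.chrFun (φ.comp (powHom U.ab_isAb p) (continuous_pow p)) := by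
  funext u
  rw [adams, SubQ.chrFun, map_pow]
  rfl

/-- For abelian E, μ = λ^p/φ(λ) is congruent to 1 modulo p by the Frobenius congruence, and Det(μ)
at a linear character is the quotient Ξ^p/ΨΞψ_p there. So c = (log μ)/p works at linear characters.
Both sides are additive, and linear characters generate R(E). -/
theorem Tuple.MemPhi.exists_log_ab (hl : l.MemPhi)
    (hG : ∀ N : OpenNormalSubgroup G, IsPGroup p (G ⧸ N.toSubgroup)) (E : SubQ P) (hE : E.IsAb) :
    ∃ c : B p E.ab.Grp, ∀ ψ : E.ab.Grp → QBar p,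
      ψ ∘ SubQ.hom (S := E) (T := E.ab) le_rfl E.le_ab ∈ virtChar p E.Grp →
      IsLog (l.quo E (ψ ∘ SubQ.hom (S := E) (T := E.ab) le_rfl E.le_ab))
        ((p : QBar p) • Tr E.ab.oneDim (TBp.of p _ c) ψ) := by
  let D := E.ab.oneDim
  let a : B p E.ab.Grp →* B p E.ab.Grp := B.map (powHom E.ab_isAb p) (D.adm_pow E.ab_isAb)
  let μ : (B p E.ab.Grp)ˣ := l.atAb E ^ p * (Units.map a (l.atAb E))⁻¹
  have hμ : (μ : B p E.ab.Grp) - 1 ∈ pId p (B p E.ab.Grp) 1 := by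
    have h1 := Ideal.mul_mem_right ((Units.map a (l.atAb E))⁻¹ : (B p E.ab.Grp)ˣ).1 _
      (B.frob E.ab_isAb (D.adm_pow E.ab_isAb) (l.atAb E : B p E.ab.Grp))
    rw [sub_mul] at h1
    exact (congrArg (· ∈ _) (congrArg₂ (· - ·) rfl (Units.mul_inv (Units.map a (l.atAb E))).symm)).mpr h1
  obtain ⟨c, hc⟩ := exists_log E.ab_isAb _ hμ
  have hquo : ∀ φ, l.quo E (E.chrFun φ) = Units.map (detChr D φ : B p E.ab.Grp →* BZ p) μ := by
    intro φ
    rw [Tuple.quo, E.adams_chrFun, hl.Xi_chrFun, hl.Xi_chrFun, map_mul, map_pow, map_inv]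
    congr 2
    exact Units.ext (detChr_map_pow D E.ab_isAb φ (l.atAb E : B p E.ab.Grp)).symm
  have hlog : ∀ φ, IsLog (l.quo E (E.chrFun φ)) ((p : QBar p) • Tr D (TBp.of p _ c) φ.toFun) := by
    intro φ
    rw [Tr_of_chr, hquo]
    refine ⟨hc (detChr D φ), ?_⟩
    obtain ⟨y, hy⟩ := mem_pId_one.1 hμ
    refine ⟨detChr D φ y, ?_⟩
    have h1 := congrArg (detChr D φ) hy
    rw [map_sub, map_one, map_mul, map_natCast] at h1
    exact h1
  set r := SubQ.hom (S := E) (T := E.ab) le_rfl E.le_ab with hr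
  have hrs : Function.Surjective r := SubQ.surjective_hom (S := E) (T := E.ab) rfl E.le_ab
  -- The abelianisation is a separate type even when E is abelian, so each χ is carried together
  -- with a class function ψ on it that inflates to χ.
  have key : ∀ χ ∈ AddSubgroup.closure (Set.range E.chrFun), χ ∈ virtChar p E.Grp ∧ ∃ ψ : E.ab.Grp → QBar p,
      IsClassFn ψ ∧ ψ ∘ r = χ ∧ IsLog (l.quo E χ) ((p : QBar p) • Tr D (TBp.of p _ c) ψ) := by
    intro χ hχ
    induction hχ using AddSubgroup.closure_induction with
    | mem x hx =>
      obtain ⟨φ, rfl⟩ := hx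
      exact ⟨E.chrFun_mem φ, φ.toFun, φ.isClassFn, rfl, hlog φ⟩
    | zero => 
      refine ⟨zero_mem _, 0, .zero, rfl, ?_⟩
      rw [Tr_zero_right, smul_zero]
      exact (congrArg (IsLog · 0) (hl.quo₂_zero hG E)).mpr IsLog.one
    | add x y _ _ hx hy =>
      obtain ⟨hx, ψ, hψ, rfl, h1⟩ := hx
      obtain ⟨hy, ψ', hψ', rfl, h2⟩ := hy
      refine ⟨add_mem hx hy, ψ + ψ', hψ.add hψ', rfl, ?_⟩
      rw [Tr_add_right D _ hψ hψ', smul_add]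
      have h3 := hl.quo₂_add hG E hx (adams_mem_virtChar hx) hy (adams_mem_virtChar hy)
      exact (congrArg (IsLog · _) h3).mpr (h1.mul h2)
    | neg x _ hx =>
      obtain ⟨hx, ψ, hψ, rfl, h1⟩ := hx
      refine ⟨neg_mem hx, -ψ, hψ.neg, rfl, ?_⟩
      rw [Tr_neg_right D _ hψ, smul_neg]
      have h3 := hl.quo₂_neg hG E hx (adams_mem_virtChar hx)
      exact (congrArg (IsLog · _) h3).mpr (h1.inv)
  refine ⟨c, fun ψ hψ => ?_⟩
  obtain ⟨-, ψ', -, h1, h2⟩ := key _ (E.virtChar_le_of_isAb hE hψ)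
  obtain rfl : ψ' = ψ := hrs.injective_comp_right h1
  exact h2

end Existence

end RW

noncomputable section
namespace RW

/-! ### Artin induction with integral coefficients. -/

section Cyclic

variable {F : Type*} [Group F]

/-- The group generated by the indicator functions of the subgroups of `F` that are contained in cyclic
subgroups. -/
def cycSpan (F : Type*) [Group F] : AddSubgroup (F → ℤ) :=
  AddSubgroup.closure {f | ∃ (V : Subgroup F) (c : F), V ≤ Subgroup.zpowers c ∧ f = (V : Set F).indicator 1}

theorem indicator_mul_mem_cycSpan (c : F) {f : F → ℤ} (hf : f ∈ cycSpan F) :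
    (Subgroup.zpowers c : Set F).indicator 1 * f ∈ cycSpan F := by
  induction hf using AddSubgroup.closure_induction with
  | mem f hf =>
    obtain ⟨V, d, hV, rfl⟩ := hf
    refine AddSubgroup.subset_closure ⟨Subgroup.zpowers c ⊓ V, c, inf_le_left, ?_⟩
    rw [Subgroup.coe_inf, Set.inter_indicator_one]
  | zero => rw [mul_zero]; exact zero_mem _
  | add f g _ _ hf hg => rw [mul_add]; exact add_mem hf hg
  | neg f _ hf => rw [mul_neg]; exact neg_mem hf

/-- The product of 1 - 1_⟨c⟩ over all c vanishes because x lies in ⟨x⟩. Expanding it expresses 1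
through products of indicators, and these are indicators of intersections of cyclic subgroups. -/
theorem one_mem_cycSpan [Finite F] : (1 : F → ℤ) ∈ cycSpan F := by
  have := Fintype.ofFinite F
  have key : ∀ s : Finset F,
      (1 : F → ℤ) - ∏ c ∈ s, (1 - (Subgroup.zpowers c : Set F).indicator 1) ∈ cycSpan F := by
    intro s
    induction s using Finset.cons_induction with
    | empty => rw [Finset.prod_empty, sub_self]; exact zero_mem _
    | cons c s hc ih =>
      rw [Finset.prod_cons]
      have h1 : (Subgroup.zpowers c : Set F).indicator (1 : F → ℤ) ∈ cycSpan F :=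
        AddSubgroup.subset_closure ⟨_, c, le_rfl, rfl⟩
      have h2 := sub_mem (add_mem ih h1) (indicator_mul_mem_cycSpan c ih)
      convert h2 using 1
      ring
  have h := key Finset.univ
  have h0 : ∏ c : F, ((1 : F → ℤ) - (Subgroup.zpowers c : Set F).indicator 1) = 0 := by
    funext x
    rw [Finset.prod_apply]
    refine Finset.prod_eq_zero (Finset.mem_univ x) ?_
    rw [Pi.sub_apply, Set.indicator_of_mem (Subgroup.mem_zpowers x)]
    rfl
  rwa [h0, sub_zero] at h

end Cyclic

/-! ### Averaging functions on a finite quotient over conjugation. -/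

section Avg

variable {p : ℕ} [Fact p.Prime] {U : Type*} [Group U] (N : Subgroup U) [N.Normal] [Finite (U ⧸ N)]

variable (p) in
/-- The sum of the conjugates of a function on a finite quotient. -/
def avg (f : U ⧸ N → ℤ) : U → QBar p := fun u => ∑ᶠ d : U ⧸ N, (f (d⁻¹ * (u : U ⧸ N) * d) : QBar p)

theorem avg_add (f g : U ⧸ N → ℤ) : avg p N (f + g) = avg p N f + avg p N g := by
  funext u
  rw [Pi.add_apply, avg, avg, avg, ← finsum_add_distrib (Set.toFinite _) (Set.toFinite _)]
  exact finsum_congr fun d => Int.cast_add _ _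

theorem avg_zero : avg p N 0 = 0 := by
  have h := avg_add (p := p) N 0 0
  rwa [add_zero, left_eq_add] at h

theorem avg_neg (f : U ⧸ N → ℤ) : avg p N (-f) = -avg p N f := by
  rw [eq_neg_iff_add_eq_zero, ← avg_add, neg_add_cancel, avg_zero]

theorem avg_one (ρ : U → QBar p) : avg p N 1 * ρ = Nat.card (U ⧸ N) • ρ := by
  have := Fintype.ofFinite (U ⧸ N)
  funext u
  rw [Pi.mul_apply, avg, finsum_eq_sum_of_fintype, Pi.smul_apply, nsmul_eq_mul, Nat.card_eq_fintype_card]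
  congr 1
  exact (Finset.sum_congr rfl fun d _ => Int.cast_one).trans (by
    rw [Finset.sum_const, Finset.card_univ, nsmul_one])

end Avg

/-! ### Existence of logarithms for general U by reduction to abelian subgroups. -/

section Existence

variable {p : ℕ} [Fact p.Prime] {G : Type*} [Group G] [TopologicalSpace G] [IsTopologicalGroup G]
  [CompactSpace G] {P : OneDim p G} {l : Tuple P}

theorem SubQ.ab_C_eq {E : SubQ P} (hE : E.IsAb) : E.ab.C = E.C := by
  refine le_antisymm (sup_le le_rfl ?_) E.le_ab
  rw [Subgroup.commutator_le]
  intro a ha b hb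
  have h := hE (QuotientGroup.mk ⟨b⁻¹, inv_mem hb⟩) (QuotientGroup.mk ⟨a⁻¹, inv_mem ha⟩)
  rw [← QuotientGroup.mk_mul, ← QuotientGroup.mk_mul, QuotientGroup.eq] at h
  have h1 : (b⁻¹ * a⁻¹)⁻¹ * (a⁻¹ * b⁻¹) ∈ E.C := h
  rwa [mul_inv_rev, inv_inv, inv_inv, ← mul_assoc] at h1

theorem Tuple.MemPhi.exists_log_incl (hl : l.MemPhi)
    (hG : ∀ N : OpenNormalSubgroup G, IsPGroup p (G ⧸ N.toSubgroup)) {E U : SubQ P} (h : SubQ.Incl E U)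
    (hE : E.IsAb) (Z : CenSec U.oneDim) (hr : ∀ g, Z.z g ∈ h.hom.range) :
    ∃ t : TBp p U.Grp, ∀ ρ ∈ virtChar p U.Grp,
      IsLog (l.quo E (ρ ∘ h.hom)) ((p : QBar p) • Tr U.oneDim t ρ) := by
  have hC : E.ab.C = U.C := (SubQ.ab_C_eq hE).trans h.C
  let i : E.ab.Grp →* U.Grp := SubQ.hom (S := E.ab) (T := U) h.W hC.le
  have hi : ∀ v, i (SubQ.hom (S := E) (T := E.ab) le_rfl E.le_ab v) = h.hom v := fun v => by
    induction v using QuotientGroup.induction_on with | H v => ?_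
    rfl
  obtain ⟨c, hc⟩ := hl.exists_log_ab hG E hE
  obtain ⟨y, hy⟩ := Z.exists_transport E.ab.oneDim i (SubQ.hom_injective (S := E.ab) (T := U) h.W hC)
    (SubQ.continuous_hom _ _) (SubQ.isOpenMap_hom _ _) (SubQ.proj_hom _ _)
    (fun g => by
      obtain ⟨v, hv⟩ := hr g
      exact ⟨_, (hi v).trans hv⟩) c
  refine ⟨TBp.of p _ y, fun ρ hρ => ?_⟩
  have h1 : (ρ ∘ i) ∘ SubQ.hom (S := E) (T := E.ab) le_rfl E.le_ab = ρ ∘ h.hom :=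
    funext fun v => congrArg ρ (hi v)
  have h2 := hc (ρ ∘ i) (by rw [h1]; exact virtChar_comp _ h.continuous hρ)
  rwa [h1, ← hy ρ (isClassFn_of_virtChar hρ)] at h2

theorem indFun_comp_hom {V U : Type*} [Group V] [Group U] (i : V →* U) (hi : Function.Injective i)
    (ρ : U → QBar p) (hρ : ∀ u v, ρ (u * v) = ρ (v * u)) : indFun i (ρ ∘ i) = indFun i 1 * ρ := by
  funext u
  rw [Pi.mul_apply, indFun, indFun, finsum_mul]
  refine finsum_congr fun q => ?_
  by_cases h : ∃ v, i v = q.out⁻¹ * u * q.out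
  · obtain ⟨v, hv⟩ := h
    rw [← hv, hi.extend_apply, hi.extend_apply, Function.comp_apply, hv, mul_assoc, hρ, mul_assoc, mul_inv_cancel,
      mul_one, Pi.one_apply, one_mul]
  · rw [Function.extend_apply' _ _ _ h, Function.extend_apply' _ _ _ h, Pi.zero_apply, zero_mul]

/-- The average of the indicator of V is |V| times the permutation character of V, and Ind(1)·ρ =
Ind(Res ρ). -/
theorem SubQ.avg_indicator_mul (U : SubQ P) (N : OpenNormalSubgroup U.Grp) (V : Subgroup (U.Grp ⧸ N.toSubgroup))
    (ρ : U.Grp → QBar p) (hρ : ∀ u v, ρ (u * v) = ρ (v * u)) :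
    avg p N.toSubgroup ((V : Set (U.Grp ⧸ N.toSubgroup)).indicator 1) * ρ =
      Nat.card V • indFun (U.incl_pre N V).hom (ρ ∘ (U.incl_pre N V).hom) := by
  rw [indFun_comp_hom _ (SubQ.Incl.injective _) ρ hρ, ← smul_mul_assoc]
  congr 1
  funext u
  have h1 : (U.pre N V).chrFun (U.preChr N ⟨V, 1⟩) = 1 := by
    funext v
    induction v using QuotientGroup.induction_on with | H v => ?_
    rfl
  have h2 := U.indFun_pre N ⟨V, 1⟩ u
  rw [h1] at h2
  have h3 := card_smul_indFun V (chVal (p := p) 1) (chVal_comm 1) (u : U.Grp ⧸ N.toSubgroup)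
  rw [Pi.smul_apply, nsmul_eq_mul]
  refine Eq.trans ?_ (h3.symm.trans (congrArg _ h2.symm))
  refine finsum_congr fun d => ?_
  by_cases hd : d⁻¹ * (u : U.Grp ⧸ N.toSubgroup) * d ∈ V
  · rw [Set.indicator_of_mem (by exact hd)]
    conv_rhs => rw [show d⁻¹ * (u : U.Grp ⧸ N.toSubgroup) * d = V.subtype ⟨_, hd⟩ from rfl, V.subtype_injective.extend_apply]
    exact Int.cast_one
  · rw [Set.indicator_of_notMem (by exact hd), Function.extend_apply', Int.cast_zero]
    · rfl
    · rintro ⟨v, hv⟩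
      exact hd (hv ▸ v.2)

/-- Modulo the central subgroup z(Γ) all elements are powers of a single γ, so every element has the
form γ^m·z(g). -/
theorem SubQ.pre_isAb (U : SubQ P) (Z : CenSec U.oneDim) (V : Subgroup (U.Grp ⧸ Z.top.toSubgroup))
    {c : U.Grp ⧸ Z.top.toSubgroup} (hV : V ≤ Subgroup.zpowers c) : (U.pre Z.top V).IsAb := by
  obtain ⟨γ, rfl⟩ := QuotientGroup.mk_surjective c
  have h1 : ∀ a : (U.pre Z.top V).Grp, ∃ (m : ℤ) (g : Gam p), (U.incl_pre Z.top V).hom a = γ ^ m * Z.z g := by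
    intro a
    have h2 : ((U.incl_pre Z.top V).hom a : U.Grp ⧸ Z.top.toSubgroup) ∈ V := by
      induction a using QuotientGroup.induction_on with | H a => ?_
      exact U.toQuot_mem Z.top V a
    obtain ⟨m, hm⟩ := hV h2
    have h3 : γ ^ m * ((γ ^ m)⁻¹ * (U.incl_pre Z.top V).hom a) = _ := mul_inv_cancel_left _ _
    have h4 : (γ ^ m)⁻¹ * (U.incl_pre Z.top V).hom a ∈ Z.top.toSubgroup := QuotientGroup.eq.1 hm
    obtain ⟨g, hg⟩ := Z.mem_top.1 h4
    exact ⟨m, g, by rw [hg, h3]⟩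
  intro a b
  refine (SubQ.Incl.injective (U.incl_pre Z.top V)) ?_
  obtain ⟨m, g, hm⟩ := h1 a
  obtain ⟨n, g', hn⟩ := h1 b
  have hc : ∀ (x : U.Grp) g, Commute (Z.z g) x := fun x g => Z.central g x
  have h5 : Commute (γ ^ m * Z.z g) (γ ^ n * Z.z g') :=
    ((Commute.refl γ).zpow_zpow m n |>.mul_right (hc _ g').symm).mul_left (hc _ g)
  rw [map_mul, map_mul, hm, hn]
  exact h5

theorem SubQ.z_mem_range (U : SubQ P) (Z : CenSec U.oneDim) (V : Subgroup (U.Grp ⧸ Z.top.toSubgroup)) (g : Gam p) :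
    Z.z g ∈ (U.incl_pre Z.top V).hom.range := by
  obtain ⟨w, hw⟩ := QuotientGroup.mk_surjective (Z.z g)
  have h1 : U.toQuot Z.top w ∈ V := by
    have h2 : U.toQuot Z.top w = 1 := by
      change (QuotientGroup.mk (QuotientGroup.mk w : U.Grp) : U.Grp ⧸ Z.top.toSubgroup) = 1
      rw [hw, QuotientGroup.eq_one_iff]
      exact Z.mem_top.2 ⟨g, rfl⟩
    rw [h2]
    exact one_mem V
  rw [← hw]
  exact ⟨QuotientGroup.mk ⟨w.1, ⟨w, h1, rfl⟩⟩, rfl⟩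

/-- For the indicator of a subgroup V of a cyclic group, Ξ_U(Ind Res ρ) equals Ξ of the abelian
preimage at Res ρ, where the logarithm is known. Both the units and their logarithms depend
additively on f, so the span follows. -/
theorem Tuple.MemPhi.exists_log_avg (hl : l.MemPhi)
    (hG : ∀ N : OpenNormalSubgroup G, IsPGroup p (G ⧸ N.toSubgroup)) (U : SubQ P) (Z : CenSec U.oneDim)
    {f : U.Grp ⧸ Z.top.toSubgroup → ℤ} (hf : f ∈ cycSpan (U.Grp ⧸ Z.top.toSubgroup)) :
    (∀ ρ ∈ virtChar p U.Grp, avg p Z.top.toSubgroup f * ρ ∈ virtChar p U.Grp) ∧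
    ∃ t : TBp p U.Grp, ∀ ρ ∈ virtChar p U.Grp,
      IsLog (l.quo₂ U (avg p Z.top.toSubgroup f * ρ) (avg p Z.top.toSubgroup f * adams ρ))
        ((p : QBar p) • Tr U.oneDim t ρ) := by
  induction hf using AddSubgroup.closure_induction with
  | mem f hf =>
    obtain ⟨V, c, hV, rfl⟩ := hf
    set h := U.incl_pre Z.top V with hh
    have h1 : ∀ ρ ∈ virtChar p U.Grp, avg p Z.top.toSubgroup
        ((V : Set (U.Grp ⧸ Z.top.toSubgroup)).indicator 1) * ρ = Nat.card V • indFun h.hom (ρ ∘ h.hom) :=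
      fun ρ hρ => U.avg_indicator_mul Z.top V ρ (isClassFn_of_virtChar hρ).conj
    have h0 : ∀ ρ ∈ virtChar p U.Grp, ρ ∘ h.hom ∈ virtChar p (U.pre Z.top V).Grp :=
      fun ρ hρ => virtChar_comp _ h.continuous hρ
    have h2 : ∀ ρ ∈ virtChar p U.Grp, indFun h.hom (ρ ∘ h.hom) ∈ virtChar p U.Grp :=
      fun ρ hρ => h.indFun_mem' hG (h0 ρ hρ)
    refine ⟨fun ρ hρ => by rw [h1 ρ hρ]; exact nsmul_mem (h2 ρ hρ) _, ?_⟩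
    obtain ⟨t, ht⟩ := hl.exists_log_incl hG h (U.pre_isAb Z V hV) Z (U.z_mem_range Z V)
    refine ⟨Nat.card V • t, fun ρ hρ => ?_⟩
    have hρ' := adams_mem_virtChar hρ
    have h3 : l.quo₂ U (indFun h.hom (ρ ∘ h.hom)) (indFun h.hom (adams ρ ∘ h.hom)) =
        l.quo (U.pre Z.top V) (ρ ∘ h.hom) := by
      have h4 : adams ρ ∘ h.hom = adams (ρ ∘ h.hom) := funext fun v => by
        rw [Function.comp_apply, adams, adams, Function.comp_apply, map_pow]
      rw [Tuple.quo₂, hl.Xi_ind hG h (h0 ρ hρ), hl.Xi_ind hG h (h0 _ hρ'), h4, Tuple.quo]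
    rw [h1 ρ hρ, h1 _ hρ', hl.quo₂_nsmul hG U (h2 ρ hρ) (h2 _ hρ'), h3]
    have h5 : (p : QBar p) • Tr U.oneDim (Nat.card V • t) ρ = Nat.card V • ((p : QBar p) • Tr U.oneDim t ρ) := by
      rw [← TrHom_apply, map_nsmul, TrHom_apply, smul_comm]
    exact h5 ▸ (ht ρ hρ).pow (Nat.card V)
  | zero =>
    refine ⟨fun ρ hρ => by rw [avg_zero, zero_mul]; exact zero_mem _, 0, fun ρ hρ => ?_⟩
    rw [avg_zero, zero_mul, zero_mul, hl.quo₂_zero hG, ← TrHom_apply, map_zero, smul_zero]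
    exact IsLog.one
  | add f g _ _ hf hg =>
    obtain ⟨h1, t, ht⟩ := hf
    obtain ⟨h2, t', ht'⟩ := hg
    refine ⟨fun ρ hρ => by rw [avg_add, add_mul]; exact add_mem (h1 ρ hρ) (h2 ρ hρ), t + t', fun ρ hρ => ?_⟩
    have hρ' := adams_mem_virtChar hρ
    rw [avg_add, add_mul, add_mul, hl.quo₂_add hG U (h1 ρ hρ) (h1 _ hρ') (h2 ρ hρ) (h2 _ hρ'), Tr_add, smul_add]
    exact (ht ρ hρ).mul (ht' ρ hρ)
  | neg f _ hf =>
    obtain ⟨h1, t, ht⟩ := hf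
    refine ⟨fun ρ hρ => by rw [avg_neg, neg_mul]; exact neg_mem (h1 ρ hρ), -t, fun ρ hρ => ?_⟩
    have hρ' := adams_mem_virtChar hρ
    rw [avg_neg, neg_mul, neg_mul, hl.quo₂_neg hG U (h1 ρ hρ) (h1 _ hρ'), ← TrHom_apply, map_neg, TrHom_apply,
      smul_neg]
    exact (ht ρ hρ).inv

/-- Taking f = 1 gives the logarithm of the |F|-th power of the wanted unit, with |F| = p^k. The
preimage is divided by p^k in TB(U)[1/p], and the unit has a convergent logarithm series because its
p^k-th power is congruent to 1 modulo p. -/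
theorem Tuple.MemPhi.exists_isLogTrace (hl : l.MemPhi)
    (hG : ∀ N : OpenNormalSubgroup G, IsPGroup p (G ⧸ N.toSubgroup)) (U : SubQ P) (Z : CenSec U.oneDim) :
    ∃ t, l.IsLogTrace U t := by
  obtain ⟨-, t₁, ht₁⟩ := hl.exists_log_avg hG U Z one_mem_cycSpan
  obtain ⟨k, hk⟩ := IsPGroup.iff_card.1 (U.isPGroup_quot hG Z.top)
  obtain ⟨t, rfl⟩ := TBp.exists_smul (p := p) k t₁
  have key : ∀ ρ ∈ virtChar p U.Grp, IsPLog' (l.quo U ρ : BZ p) ((p : QBar p) • Tr U.oneDim t ρ) ∧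
      IsPLog (l.quo U ρ : BZ p) ((p : QBar p) • Tr U.oneDim t ρ) := by
    intro ρ hρ
    have h1 := ht₁ ρ hρ
    rw [avg_one, avg_one, hk, hl.quo₂_nsmul hG U hρ (adams_mem_virtChar hρ)] at h1
    have h2 := h1.isPLog_of_pow
    have h3 : ((p : QBar p) ^ k)⁻¹ • (p : QBar p) • Tr U.oneDim (p ^ k • t) ρ = (p : QBar p) • Tr U.oneDim t ρ := by
      have hp : ((p : QBar p) ^ k) ≠ 0 := pow_ne_zero _ (Nat.cast_ne_zero.2 (Fact.out : p.Prime).ne_zero)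
      rw [smul_comm, ← TrHom_apply, map_nsmul, TrHom_apply, ← Nat.cast_smul_eq_nsmul (QBar p), Nat.cast_pow,
        inv_smul_smul₀ hp]
    rwa [h3] at h2
  exact ⟨t, fun ρ hρ => (key ρ hρ).1, fun ρ hρ => (key ρ hρ).2⟩

end Existence

/-! ### Injectivity of the trace and the comparison of logarithms under projections. -/

section Main

variable {p : ℕ} [Fact p.Prime] {G : Type*} [Group G] [TopologicalSpace G] [IsTopologicalGroup G]
  [CompactSpace G] {P : OneDim p G} {l : Tuple P}

theorem SubQ.Tr_injective (hG : ∀ N : OpenNormalSubgroup G, IsPGroup p (G ⧸ N.toSubgroup)) (U : SubQ P)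
    (Z : CenSec U.oneDim) {t t' : TBp p U.Grp}
    (h : ∀ ρ ∈ virtChar p U.Grp, Tr U.oneDim t ρ = Tr U.oneDim t' ρ) : t = t' := by
  rw [← sub_eq_zero]
  refine U.Tr_eq_zero hG Z _ fun ρ hρ => ?_
  rw [← TrHom_apply, map_sub, TrHom_apply, TrHom_apply, h ρ hρ, sub_self]

theorem Tuple.IsLogTrace.eq_t (hG : ∀ N : OpenNormalSubgroup G, IsPGroup p (G ⧸ N.toSubgroup)) {U : SubQ P}
    (Z : CenSec U.oneDim) {t : TBp p U.Grp} (h : l.IsLogTrace U t) : t = l.t U :=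
  U.Tr_injective hG Z fun ρ hρ => (h.logHom hρ).trans (h.t_logHom ρ hρ).symm

theorem Tuple.MemPhi.logHom_comp (hl : l.MemPhi)
    (hG : ∀ N : OpenNormalSubgroup G, IsPGroup p (G ⧸ N.toSubgroup)) {U V : SubQ P} (h : SubQ.Surj U V)
    {ρ : V.Grp → QBar p} (hρ : ρ ∈ virtChar p V.Grp) : LogHom (l.Xi U) (ρ ∘ h.hom) = LogHom (l.Xi V) ρ := by
  have h1 : adams (ρ ∘ h.hom) = adams ρ ∘ h.hom := funext fun v => by
    rw [Function.comp_apply, adams, adams, Function.comp_apply, map_pow]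
  rw [LogHom, LogHom, h1, hl.Xi_surj hG h hρ, hl.Xi_surj hG h (adams_mem_virtChar hρ)]

end Main

end RW
end

/-- For a tuple in `Φ̃_B`, the elements `Ξ_U` and `t_U` are compatible with inflation and with norms
(modified traces) between one-dimensional subquotients of `G`. -/
theorem mainTheorem7 (p : ℕ) [Fact p.Prime] (hp : p ≠ 2)
    {G : Type*} [Group G] [TopologicalSpace G] [IsTopologicalGroup G] [CompactSpace G] [T2Space G]
    [TotallyDisconnectedSpace G]
    (hG : ∀ N : OpenNormalSubgroup G, IsPGroup p (G ⧸ N.toSubgroup))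
    (P : RW.OneDim p G) (hP : Function.Surjective P.proj)
    (l : RW.Tuple P) (hl : l.MemPhi) :
    (∀ (U V : RW.SubQ P) (h : RW.SubQ.Surj U V), ∀ ρ ∈ RW.virtChar p V.Grp,
      l.Xi U (ρ ∘ h.hom) = l.Xi V ρ) ∧
    (∀ (U V : RW.SubQ P) (h : RW.SubQ.Incl V U), ∀ ρ ∈ RW.virtChar p V.Grp,
      l.Xi U (RW.indFun h.hom ρ) = l.Xi V ρ) ∧
    (∀ (U : RW.SubQ P) (t : RW.TBp p U.Grp),
      (∀ ρ ∈ RW.virtChar p U.Grp, RW.Tr U.oneDim t ρ = RW.LogHom (l.Xi U) ρ) ↔ t = l.t U) ∧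
    (∀ (U V : RW.SubQ P) (h : RW.SubQ.Surj U V),
      RW.TBp.map (RW.B.map h.hom (RW.SubQ.adm_of_eq h.W h.C)) (l.t U) = l.t V) ∧
    (∀ (U V : RW.SubQ P) (h : RW.SubQ.Incl V U),
      (∀ ρ ∈ RW.virtChar p V.Grp,
        RW.Tr V.oneDim (RW.modTr U.oneDim V.oneDim h.hom (l.t U)) ρ =
          RW.resHom h.hom (RW.Tr U.oneDim (l.t U)) ρ) ∧
      RW.modTr U.oneDim V.oneDim h.hom (l.t U) = l.t V) := by
  have Z : ∀ U : RW.SubQ P, RW.CenSec U.oneDim := fun U => (RW.SubQ.exists_cenSec hP hG U).some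
  -- By uniqueness the element chosen by `TrInv` is the one constructed, so it inherits the stronger
  -- statement that the logarithms converge.
  have ht : ∀ U : RW.SubQ P, l.IsLogTrace U (l.t U) := fun U => by
    obtain ⟨t, ht⟩ := hl.exists_isLogTrace hG U (Z U)
    exact ht.eq_t hG (Z U) ▸ ht
  refine ⟨fun U V h ρ hρ => hl.Xi_surj hG h hρ, fun U V h ρ hρ => hl.Xi_ind hG h hρ, fun U t => ⟨fun h => ?_, ?_⟩,
    fun U V h => ?_, fun U V h => ?_⟩
  · exact U.Tr_injective hG (Z U) fun ρ hρ => (h ρ hρ).trans ((ht U).logHom hρ).symm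
  · rintro rfl ρ hρ
    exact (ht U).logHom hρ
  · refine V.Tr_injective hG (Z V) fun ρ hρ => ?_
    exact (RW.Tr_map U.oneDim V.oneDim h.hom _ (RW.SubQ.proj_hom _ _) _ (RW.isClassFn_of_virtChar hρ)).trans
      (((ht U).logHom (RW.virtChar_comp _ (RW.SubQ.continuous_hom _ _) hρ)).trans
        ((hl.logHom_comp hG h hρ).trans ((ht V).logHom hρ).symm))
  · have h1 : ∀ ρ ∈ RW.virtChar p V.Grp,
        RW.Tr V.oneDim (l.t V) ρ = RW.resHom h.hom (RW.Tr U.oneDim (l.t U)) ρ :=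
      fun ρ hρ => RW.Tuple.IsLogTrace.res hl hG h (ht U) (ht V) hρ
    -- t_V itself witnesses that Res(Tr t_U) is a trace on R(V), so the modified trace is well
    -- defined; uniqueness then identifies it with t_V.
    have h2 := RW.TrInv_spec V.oneDim _ (l.t V) h1
    exact ⟨h2, V.Tr_injective hG (Z V) fun ρ hρ => (h2 ρ hρ).trans (h1 ρ hρ).symm⟩
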